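/- Let $D\ge 0$, $N\ge 1$, and consider continuous-time Markov chains (CTMCs) on $[0,1]$ with state space $\mathcal X$; $r_t(y,x)$ is the rate of the jump $x\to y$ at time $t$, $x^{d\leftarrow n}$ is $x$ with $d$-th entry replaced by $n$, and $\gamma:[0,1]\to\mathbb R_+$ is measurable. Write $D_f(a\|b)=a\log\frac ab-a+b\in[0,\infty]$ for the generalized KL divergence. For a reference path measure $p^r$ (rate $r$, initial law $\mu$) and a target law $\nu$, let $p^\star$ be the solution of the Schrödinger bridge problem: the minimizer of $\mathrm{KL}(\cdot\|p^r)$ over path measures with law $\mu$ at time $0$ and $\nu$ at time $1$. For a controller $\varPhi_t(x)\in\mathbb R_{\ge0}^{D\times N}$, measurable in $t$, let $p^{r\varPhi}$ be a CTMC path measure with initial law $\mu$ and rates $u_t(x^{d\leftarrow n},x)=r_t(x^{d\leftarrow n},x)\varPhi_t(x)_{d,n}$, $n\ne x^d$ (assumed locally integrable in time on $(0,1)$). Let $\overline\varPhi$ be a frozen ("stop-gradient") controller with path measure $\bar p=p^{r\overline\varPhi}$ and $p^\star\ll\bar p$ (in particular, $\overline\varPhi=\varPhi$ is allowed when $p^\star\ll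 p^{r\varPhi}$). The controller denoising-matching loss with trajectory importance reweighting, generalized KL divergence and time weight $\gamma_t/N$ is $$\mathcal L_{\mathrm{DM}}(\varPhi)=\int_0^1\frac{\gamma_t}{N}\,\mathbb E_{X\sim \bar p}\Big[\frac{dp^\star}{d\bar p}(X)\,\mathbb E_{x\sim p^r_{t|0,1}(\cdot|X_0,X_1)}\sum_{d=1}^D\sum_{n\in[N],\,n\ne x^d}D_f\Big(\frac{p^r_{1|t}(X_1|x^{d\leftarrow n})}{p^r_{1|t}(X_1|x)}\Big\|\varPhi_t(x)_{d,n}\Big)\Big]dt .$$ **(1) Uniform reference.** Let $\mathcal X=[N]^D$, $r_t(y,x)=\frac{\gamma_t}N$ if $x,y$ differ in exactly one entry, $r_t(x,x)=-\gamma_tD(1-\frac1N)$, and $r_t(y,x)=0$ otherwise, where $\int_t^1\gamma_u\,du<\infty$ for every $0<t\le1$ and $\int_0^1\gamma_u\,du=\infty$. Let $\mu,\nu$ be arbitrary probability laws on $\mathcal X$. Then there is a finite constant $C\ge0$, independent of $\overline\varPhi$ and $\varPhi$, such that for all $\overline\varPhi,\varPhi$ as above $\mathcal L_{\mathrm{DM}}(\varPhi)$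 equals the weighted denoising cross-entropy (WDCE) loss of UDNS, $$\mathcal L_{\mathrm{UDNS}}(\varPhi)=\mathbb E_{X\sim \bar p}\Big[\frac{dp^\star}{d\bar p}(X)\int_0^1\frac{\gamma_t}N\,\mathbb E_{x\sim p^\star_{t|1}(\cdot|X_1)}\sum_{d=1}^D\sum_{n\ne x^d}D_f\Big(\frac{p^\star_{t|1}(x^{d\leftarrow n}|X_1)}{p^\star_{t|1}(x|X_1)}\Big\|\varPhi_t(x)_{d,n}\Big)dt\Big],$$ and $\mathcal L_{\mathrm{UDNS}}(\varPhi)=\mathrm{KL}(p^\star\|p^{r\varPhi})+C$ (as an identity in $[0,\infty]$). **(2) Masked reference.** Let $\mathcal X=\{1,\dots,N,\mathbf M\}^D$, $r_t(x^{d\leftarrow n},x)=\frac{\gamma_t}N$ if $x^d=\mathbf M$ and $n\in[N]$, $r_t(x,x)=-\gamma_t|\{d:x^d=\mathbf M\}|$, and $r_t(y,x)=0$ otherwise, where $\int_0^t\gamma_u\,du<\infty$ and $\int_t^1\gamma_u\,du=\infty$ for every $0\le t<1$. Let $\mu$ be the point mass at $(\mathbf M,\dots,\mathbf M)$ and $\nu$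 an arbitrary probability law on $[N]^D$. Let the controllers be $\varPhi_t(x)_{d,n}=N s_t(x)_{d,n}1_{x^d=\mathbf M}+1_{x^d=n}$, where $s_t(x)_{d,\cdot}$ is a probability vector on $[N]$ whenever $x^d=\mathbf M$, measurable in $t$; the frozen controller $\overline\varPhi$ is also of this form. Then there is a finite constant $C\ge0$, independent of $\overline\varPhi$ and $s$, such that $$\mathcal L_{\mathrm{DM}}(\varPhi)=\mathbb E_{X\sim\bar p}\Big[\frac{dp^\star}{d\bar p}(X)\int_0^1\gamma_t\,\mathbb E_{x\sim p^r_{t|1}(\cdot|X_1)}\sum_{d:\,x^d=\mathbf M}-\log s_t(x)_{d,X_1^d}\,dt\Big]=\mathrm{KL}(p^\star\|p^{r\varPhi})+C .$$ If moreover $s_t=s$ does not depend on $t$, this loss equals the WDCE loss of MDNS, $$\mathbb E_{X\sim\bar p}\Big[\frac{dp^\star}{d\bar p}(X)\int_0^1\frac1\lambda\,\mathbb E_{x\sim m_\lambda(\cdot|X_1)}\sum_{d:\,x^d=\mathbf M}-\log s(x)_{d,X_1^d}\,d\lambda\Big],$$ where $m_\lambda(\cdot|x_1)$ replaces every entry of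 $x_1$ independently with $\mathbf M$ with probability $\lambda$. -/

import Mathlib

open MeasureTheory Set Filter Topology
open scoped ENNReal NNReal

noncomputable section

namespace DiscreteSampler

/-- Length-`D` sequences over an alphabet with `K` symbols. -/
abbrev State (D K : ℕ) := Fin D → Fin K

/-- Path space `𝒳^[0,1]`, with the product σ-algebra. -/
abbrev PathSpace (D K : ℕ) := Icc (0 : ℝ) 1 → State D K

/-- The coordinate process `X_t`, for `t ∈ [0,1]` (times outside `[0,1]` are never used). -/
def coord {D K : ℕ} (t : ℝ) (ω : PathSpace D K) : State D K :=
  ω (projIcc 0 1 zero_le_one t)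

/-- The σ-algebra generated by `X_r`, `0 ≤ r ≤ s`. -/
abbrev past {D K : ℕ} (s : ℝ) : MeasurableSpace (PathSpace D K) :=
  ⨆ r ∈ Icc (0 : ℝ) s, MeasurableSpace.comap (coord r) inferInstance

/-- `P` is the path measure of a continuous-time Markov chain on `[0,1]` with initial law `μ` and
transition rate `u`, where `u t y x` is the rate of the jump `x → y` at time `t`.  The rates are
locally integrable on the open interval `(0,1)` and may be singular at its ends.  The chain is
described by the Kolmogorov forward equation conditionally on the past,
`P(A, X_t = y) = P(A, X_s = y) + ∫_s^t ∑_z u_τ(y,z) P(A, X_τ = z) dτ` for all `A ∈ σ(X_r, r ≤ s)`,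
on each `[s,t] ⊆ [0,1]` over which the rates are integrable
(this contains the Markov property, since the linear equation has a unique solution),
and the path does not jump at the fixed time `1`. -/
structure IsCTMC {D K : ℕ} (u : ℝ → State D K → State D K → ℝ) (μ : Measure (State D K))
    (P : Measure (PathSpace D K)) : Prop where
  isProb : IsProbabilityMeasure P
  init : P.map (coord 0) = μ
  integrable : ∀ s t : ℝ, 0 < s → s ≤ t → t < 1 → ∀ x y,
    IntervalIntegrable (fun τ => u τ y x) volume s t
  forward : ∀ s t : ℝ, 0 ≤ s → s ≤ t → t ≤ 1 →
    (∀ x y, IntervalIntegrable (fun τ => u τ y x) volume s t) →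
    ∀ A : Set (PathSpace D K), MeasurableSet[past s] A → ∀ y,
      P.real (A ∩ {ω | coord t ω = y}) = P.real (A ∩ {ω | coord s ω = y})
        + ∫ τ in s..t, ∑ z, u τ y z * P.real (A ∩ {ω | coord τ ω = z})
  left_cont : Tendsto (fun t => P.real {ω | coord t ω ≠ coord 1 ω}) (𝓝[<] 1) (𝓝 0)

/-- The solution of the Schrödinger bridge problem with reference `Pr` and marginals `μ`, `ν`:
the minimizer of `KL(· ‖ Pr)` over the path measures with law `μ` at time `0` and `ν` at time `1`. -/
structure IsSchrodingerBridge {D K : ℕ} (Pr : Measure (PathSpace D K)) (μ ν : Measure (State D K))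
    (P : Measure (PathSpace D K)) : Prop where
  isProb : IsProbabilityMeasure P
  init : P.map (coord 0) = μ
  terminal : P.map (coord 1) = ν
  minimal : ∀ Q : Measure (PathSpace D K), IsProbabilityMeasure Q →
    Q.map (coord 0) = μ → Q.map (coord 1) = ν →
    InformationTheory.klDiv P Pr ≤ InformationTheory.klDiv Q Pr

/-- The conditional probability `p_{t|s}(y|x) = P(X_t = y | X_s = x)` (for `s < t` or `t < s`). -/
def condProb {D K : ℕ} (P : Measure (PathSpace D K)) (s t : ℝ) (y x : State D K) : ℝ :=
  P.real ({ω | coord s ω = x} ∩ {ω | coord t ω = y}) / P.real {ω | coord s ω = x}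

/-- The bridge probability `p_{t|0,1}(x|x₀,x₁)`. -/
def bridgeProb {D K : ℕ} (P : Measure (PathSpace D K)) (t : ℝ) (x x₀ x₁ : State D K) : ℝ :=
  P.real ({ω | coord 0 ω = x₀} ∩ {ω | coord t ω = x} ∩ {ω | coord 1 ω = x₁})
    / P.real ({ω | coord 0 ω = x₀} ∩ {ω | coord 1 ω = x₁})

/-- The generalized KL divergence `a log (a/b) - a + b` of `a, b ≥ 0`, with values in `[0,∞]`
(it is the Bregman divergence of `t ↦ t log t`, and it is `∞` for `a > 0 = b`). -/
def genKL (a b : ℝ) : ℝ≥0∞ :=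
  if b = 0 then (if a = 0 then 0 else ⊤) else ENNReal.ofReal (a * Real.log (a / b) - a + b)

/-- `-log p ∈ [0,∞]` for `p ∈ [0,1]`. -/
def negLog (p : ℝ) : ℝ≥0∞ :=
  if p = 0 then ⊤ else ENNReal.ofReal (-Real.log p)

/-- The uniform reference rate. -/
def uniformRate {D N : ℕ} (γ : ℝ → ℝ) (t : ℝ) (y x : State D N) : ℝ :=
  if hammingDist y x = 1 then γ t / N
  else if y = x then -(γ t * D * (1 - 1 / N))
  else 0

/-- The masked reference rate; the alphabet is `Fin (N + 1)`, whose last symbol is the mask. -/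
def maskedRate {D N : ℕ} (γ : ℝ → ℝ) (t : ℝ) (y x : State D (N + 1)) : ℝ :=
  if y = x then -(γ t * (Finset.univ.filter fun d => x d = Fin.last N).card)
  else if ∃ d, ∃ n : Fin N, x d = Fin.last N ∧ y = Function.update x d n.castSucc then γ t / N
  else 0

/-- A controller `t ↦ x ↦ Φ_t(x) ∈ ℝ^{D×N}`. The column `n` stands for the symbol `ι n`, where
`ι = id` in the uniform case and `ι = Fin.castSucc` (non-mask symbols) in the masked case. -/
abbrev Controller (D N K : ℕ) := ℝ → State D K → Fin D → Fin N → ℝ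

/-- Off-diagonal part of the controlled rate:
`u_t(x^{d←n}, x) = r_t(x^{d←n}, x) Φ_t(x)_{d,n}` for `n ≠ x^d`. -/
def controlledJump {D N K : ℕ} (ι : Fin N → Fin K) (r : ℝ → State D K → State D K → ℝ)
    (Φ : Controller D N K) (t : ℝ) (y x : State D K) : ℝ :=
  ∑ d, ∑ n with ι n ≠ x d, if y = Function.update x d (ι n) then r t y x * Φ t x d n else 0

/-- The controlled transition rate `rΦ`; its columns sum to zero. -/
def controlledRate {D N K : ℕ} (ι : Fin N → Fin K) (r : ℝ → State D K → State D K → ℝ)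
    (Φ : Controller D N K) (t : ℝ) (y x : State D K) : ℝ :=
  if y = x then -∑ z with z ≠ x, controlledJump ι r Φ t z x else controlledJump ι r Φ t y x

/-- The denoising-matching loss of the controller `Φ` with reference path measure `Pr`, time weight
`w`, divergence `Df`, `t ∼ Unif(0,1)`, and trajectory importance reweighting: trajectories are
sampled from `Pv` (the path measure of a frozen controller) and weighted by `dPstar/dPv`. -/
def dmLoss {D N K : ℕ} (ι : Fin N → Fin K) (Pr Pstar Pv : Measure (PathSpace D K))
    (w : ℝ → ℝ) (Df : ℝ → ℝ → ℝ≥0∞) (Φ : Controller D N K) : ℝ≥0∞ :=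
  ∫⁻ t in Ioo (0 : ℝ) 1, ENNReal.ofReal (w t) *
    ∫⁻ ω, (Pstar.rnDeriv Pv ω *
      ∑ x, ENNReal.ofReal (bridgeProb Pr t x (coord 0 ω) (coord 1 ω)) *
        ∑ d, ∑ n with ι n ≠ x d,
          Df (condProb Pr t 1 (coord 1 ω) (Function.update x d (ι n))
                / condProb Pr t 1 (coord 1 ω) x)
            (Φ t x d n)) ∂Pv

/-- The weighted denoising cross-entropy loss of UDNS, the uniform discrete neural sampler. -/
def udnsWDCE {D N : ℕ} (Pstar Pv : Measure (PathSpace D N)) (γ : ℝ → ℝ)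
    (Φ : Controller D N N) : ℝ≥0∞ :=
  ∫⁻ ω, (Pstar.rnDeriv Pv ω *
    ∫⁻ t in Ioo (0 : ℝ) 1, ENNReal.ofReal (γ t / N) *
      ∑ x, ENNReal.ofReal (condProb Pstar 1 t x (coord 1 ω)) *
        ∑ d, ∑ n with n ≠ x d,
          genKL (condProb Pstar 1 t (Function.update x d n) (coord 1 ω)
                / condProb Pstar 1 t x (coord 1 ω))
            (Φ t x d n)) ∂Pv

/-- `∑_{d : x^d = M} -log s(x)_{d, x₁^d}`, the cross-entropy of the denoiser output `s = s(x)` on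
the masked coordinates of `x` (an entry `d` with `x₁^d = M` contributes `0`). -/
def maskedCE {D N : ℕ} (s : Fin D → Fin N → ℝ) (x x₁ : State D (N + 1)) : ℝ≥0∞ :=
  ∑ d with x d = Fin.last N, ∑ n : Fin N, if x₁ d = n.castSucc then negLog (s d n) else 0

/-- The WDCE loss of masked discrete diffusion with noise schedule `γ`. -/
def maskedWDCE {D N : ℕ} (Pr Pstar Pv : Measure (PathSpace D (N + 1))) (γ : ℝ → ℝ)
    (s : Controller D N (N + 1)) : ℝ≥0∞ :=
  ∫⁻ ω, (Pstar.rnDeriv Pv ω *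
    ∫⁻ t in Ioo (0 : ℝ) 1, ENNReal.ofReal (γ t) *
      ∑ x, ENNReal.ofReal (condProb Pr 1 t x (coord 1 ω)) * maskedCE (s t x) x (coord 1 ω)) ∂Pv

/-- The probability that masking every entry of `x₁` independently with probability `l`
produces `x`. -/
def maskProb {D N : ℕ} (l : ℝ) (x x₁ : State D (N + 1)) : ℝ :=
  ∏ d, if x d = Fin.last N then l else if x d = x₁ d then 1 - l else 0

/-- The WDCE loss of MDNS, the masked diffusion neural sampler: a mask rate `l ∼ Unif(0,1)`
with weight `1/l`, and a denoiser `s` without time input. -/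
def mdnsWDCE {D N : ℕ} (Pstar Pv : Measure (PathSpace D (N + 1)))
    (s : State D (N + 1) → Fin D → Fin N → ℝ) : ℝ≥0∞ :=
  ∫⁻ ω, (Pstar.rnDeriv Pv ω *
    ∫⁻ l in Ioo (0 : ℝ) 1, ENNReal.ofReal (1 / l) *
      ∑ x, ENNReal.ofReal (maskProb l x (coord 1 ω)) * maskedCE (s x) x (coord 1 ω)) ∂Pv

/-- A denoiser: for every masked coordinate `d` of `x`, `s_t(x)_{d,·}` is a probability vector. -/
structure IsDenoiser {D N : ℕ} (s : Controller D N (N + 1)) : Prop where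
  measurable : ∀ x d n, Measurable fun t => s t x d n
  nonneg : ∀ t x d n, 0 ≤ s t x d n
  sum_one : ∀ t x d, x d = Fin.last N → ∑ n, s t x d n = 1

/-- The controller `Φ_t(x)_{d,n} = N s_t(x)_{d,n} 1_{x^d = M} + 1_{x^d = n}` of a denoiser. -/
def maskedController {D N : ℕ} (s : Controller D N (N + 1)) : Controller D N (N + 1) :=
  fun t x d n => (if x d = Fin.last N then N * s t x d n else 0)
    + (if x d = n.castSucc then 1 else 0)

end DiscreteSampler

end

/-! ### Masses of past events and the integrated forward equation. -/

namespace DiscreteSampler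

variable {D K N : ℕ}

/-! Fix an endpoint y and condition the reference on X_1 = y. By the Markov property the conditioned
law `condTerminal Pr y` has, on the past of t, the density k_t(X_t) = p_{1|t}(y|X_t) / p_1(y) with
respect to the reference (`IsTerminalKernel.mass_condTerminal`). It is a Doob transform: its rate of
jumping from x to z is r(z,x) k(z) / k(x). Girsanov's theorem for jump chains then says that its
relative entropy with respect to the controlled chain is the time integral of Σ_x p_t(x) Σ_z
genKL(r(z,x) k(z), k(x) u(z,x)), where p_t is the reference marginal. Since `genKL` is homogeneous,
the factor p_t(x|y) r(z,x) comes out and the divergence between the ratio p_{1|t}(y|z) /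
p_{1|t}(y|x) and the control remains (`IsTerminalKernel.klRate_controlledRate`). This is the
integrand of the denoising losses, given the endpoint y.

To average over y, note that the endpoints X_0 and X_1 of the reference are independent: the uniform
chain mixes instantly at time 0, and the masked chain starts at a deterministic state. Hence the
Schrödinger bridge only reweights the law of X_1 and is the mixture of the laws `condTerminal Pr y`
over ν (`IsSchrodingerBridge.eq_withDensity`, `IsSchrodingerBridge.cond_eq`). The chain rule
`sum_mul_klDiv_cond` gives Σ_y ν(y) KL(p^y ‖ Q) = KL(p⋆ ‖ Q) + H(ν), so the constant C is the
entropy of ν. The frozen controller disappears because at each time the reweighted integrand is a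
function of the endpoints (`lintegral_rnDeriv_mul_comp`), so that every loss equals Σ_y ν(y) ∫
`lossRate`.

Most of the work is Girsanov's theorem, `GirsanovSetting.klDiv_eq`. Paths are arbitrary elements of
a product space, with no regularity, and only the forward equation conditional on the past is
available, so stochastic integrals are avoided and both inequalities are variational. For the lower
bound, the Donsker–Varadhan inequality is tested with a time-discretized exponential martingale,
whose exponent is then optimized to the truncated logarithm of the ratio of fluxes
(`lower_bound_grid`, `lintegral_klRate_le_klDiv`). For the upper bound, it suffices to test with
positive functions of finitely many coordinates. The coordinates are integrated out from the last to
the first by an approximate backward transition operator of Q, and each removal costs at most the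
entropy rate over the time interval removed (`exists_backward_operator`,
`exists_remove_coordinate`). All discretization errors are quadratic in the increments of one
integrable function, hence vanish along fine grids.

The rates may be singular at the ends. At time 1 the absence of a jump allows X_1 to be replaced by
an earlier value. At time 0 a separate `StartCondition` is needed: it follows from mixing in the
uniform case and from integrability of the rates in the masked case.

In the masked case the controls sum to N over the symbols at each masked site, which turns the
generalized divergence into a cross-entropy. The last formula is the change of variable from t to
the masking probability exp(-∫_0^t γ), which carries γ_t dt to dλ / λ. -/

lemma measurable_coord (t : ℝ) : Measurable (coord t : PathSpace D K → State D K) :=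
  measurable_pi_apply _

lemma past_le (s : ℝ) : past s ≤ (MeasurableSpace.pi : MeasurableSpace (PathSpace D K)) :=
  iSup₂_le fun r _ => (measurable_coord r).comap_le

lemma past_mono {s t : ℝ} (h : s ≤ t) :
    (past s : MeasurableSpace (PathSpace D K)) ≤ past t :=
  iSup₂_le fun r hr => le_iSup₂_of_le r ⟨hr.1, hr.2.trans h⟩ le_rfl

lemma measurable_coord_past {r s : ℝ} (hr : 0 ≤ r) (hrs : r ≤ s) :
    Measurable[past s] (coord r : PathSpace D K → State D K) :=
  Measurable.mono (comap_measurable _)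
    (le_iSup₂_of_le (f := fun r (_ : r ∈ Icc (0 : ℝ) s) =>
      MeasurableSpace.comap (coord r : PathSpace D K → State D K) inferInstance)
      r ⟨hr, hrs⟩ le_rfl) le_rfl

lemma measurableSet_past_coord {r s : ℝ} (hr : 0 ≤ r) (hrs : r ≤ s) (y : State D K) :
    MeasurableSet[past s] {ω : PathSpace D K | coord r ω = y} :=
  measurable_coord_past hr hrs (measurableSet_singleton y)

lemma measurableSet_coord (t : ℝ) (y : State D K) :
    MeasurableSet {ω : PathSpace D K | coord t ω = y} :=
  measurable_coord t (measurableSet_singleton y)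

lemma sum_real_inter_fiber {Ω α : Type*} [MeasurableSpace Ω] [Fintype α] [MeasurableSpace α]
    [MeasurableSingletonClass α] (P : Measure Ω) [IsFiniteMeasure P] {f : Ω → α}
    (hf : Measurable f) (A : Set Ω) :
    ∑ y, P.real (A ∩ {ω | f ω = y}) = P.real A := by
  classical
  have h := sum_measureReal_preimage_singleton (μ := P.restrict A) (f := f) Finset.univ
    (fun y _ => hf (measurableSet_singleton y))
  simp only [Finset.coe_univ, preimage_univ] at h
  rw [measureReal_restrict_apply_univ] at h
  rw [← h]
  refine Finset.sum_congr rfl fun y _ => ?_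
  rw [measureReal_restrict_apply (hf (measurableSet_singleton y)), inter_comm]
  rfl

lemma integral_eq_sum_fiber {Ω α : Type*} [MeasurableSpace Ω] [Fintype α] [MeasurableSpace α]
    [MeasurableSingletonClass α] (P : Measure Ω) [IsFiniteMeasure P] {f : Ω → α}
    (hf : Measurable f) (A : Set Ω) (φ : α → ℝ) :
    ∫ ω in A, φ (f ω) ∂P = ∑ y, P.real (A ∩ {ω | f ω = y}) * φ y := by
  have h := integral_map (μ := P.restrict A) hf.aemeasurable (f := φ)
    (measurable_of_finite φ).aestronglyMeasurable
  rw [← h, integral_fintype Integrable.of_finite]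
  refine Finset.sum_congr rfl fun y _ => ?_
  rw [map_measureReal_apply hf (measurableSet_singleton y),
    measureReal_restrict_apply (hf (measurableSet_singleton y)), inter_comm, smul_eq_mul]
  rfl

/-- The mass `P(A, X_t = y)`. -/
noncomputable def mass (P : Measure (PathSpace D K)) (A : Set (PathSpace D K)) (t : ℝ)
    (y : State D K) : ℝ :=
  P.real (A ∩ {ω | coord t ω = y})

lemma mass_nonneg (P : Measure (PathSpace D K)) (A : Set (PathSpace D K)) (t : ℝ)
    (y : State D K) : 0 ≤ mass P A t y := measureReal_nonneg

lemma mass_le (P : Measure (PathSpace D K)) [IsFiniteMeasure P] (A : Set (PathSpace D K)) (t : ℝ)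
    (y : State D K) : mass P A t y ≤ P.real A := measureReal_mono inter_subset_left

lemma sum_mass (P : Measure (PathSpace D K)) [IsFiniteMeasure P] (A : Set (PathSpace D K))
    (t : ℝ) : ∑ y, mass P A t y = P.real A :=
  sum_real_inter_fiber P (measurable_coord t) A

/-- The Kolmogorov forward equation on `[a, b]`, conditionally on the past. -/
def ForwardOn (u : ℝ → State D K → State D K → ℝ) (P : Measure (PathSpace D K)) (a b : ℝ) : Prop :=
  ∀ s t : ℝ, a ≤ s → s ≤ t → t ≤ b → ∀ A : Set (PathSpace D K), MeasurableSet[past s] A → ∀ y,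
    mass P A t y = mass P A s y + ∫ τ in s..t, ∑ z, u τ y z * mass P A τ z

/-- The rates `u` are integrable on `[a, b]` and dominated by the integrable function `V`. -/
structure RateBound (u : ℝ → State D K → State D K → ℝ) (V : ℝ → ℝ) (a b : ℝ) : Prop where
  integrable : ∀ x y, IntervalIntegrable (fun τ => u τ y x) volume a b
  integrable_bound : IntervalIntegrable V volume a b
  le : ∀ τ, ∑ y, ∑ x, |u τ y x| ≤ V τ

lemma abs_intervalIntegral_le {f g : ℝ → ℝ} {a b : ℝ} (hab : a ≤ b)
    (h : ∀ τ ∈ Ioc a b, |f τ| ≤ g τ) (hg : IntervalIntegrable g volume a b) :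
    |∫ τ in a..b, f τ| ≤ ∫ τ in a..b, g τ := by
  rw [← Real.norm_eq_abs]
  exact intervalIntegral.norm_integral_le_of_norm_le hab (ae_of_all _ h) hg

lemma intervalIntegrable_sum {ι : Type*} (t : Finset ι) {f : ι → ℝ → ℝ} {a b : ℝ}
    (h : ∀ i ∈ t, IntervalIntegrable (f i) volume a b) :
    IntervalIntegrable (fun τ => ∑ i ∈ t, f i τ) volume a b := by
  simpa only [Finset.sum_fn] using IntervalIntegrable.sum t h

section Forward

variable {u : ℝ → State D K → State D K → ℝ} {V : ℝ → ℝ} {P : Measure (PathSpace D K)} {a b : ℝ}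

lemma ForwardOn.mono (h : ForwardOn u P a b) {a' b' : ℝ} (ha : a ≤ a') (hb : b' ≤ b) :
    ForwardOn u P a' b' :=
  fun s t has hst htb => h s t (ha.trans has) hst (htb.trans hb)

lemma IntervalIntegrable.sub_interval {f : ℝ → ℝ} (h : IntervalIntegrable f volume a b)
    {s t : ℝ} (has : a ≤ s) (hst : s ≤ t) (htb : t ≤ b) : IntervalIntegrable f volume s t :=
  h.mono_set (by
    rw [uIcc_of_le hst, uIcc_of_le (has.trans (hst.trans htb))]; exact Icc_subset_Icc has htb)

lemma RateBound.mono (h : RateBound u V a b) {s t : ℝ} (has : a ≤ s) (hst : s ≤ t) (htb : t ≤ b) :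
    RateBound u V s t :=
  ⟨fun x y => IntervalIntegrable.sub_interval (h.integrable x y) has hst htb,
    IntervalIntegrable.sub_interval h.integrable_bound has hst htb, h.le⟩

lemma RateBound.nonneg (h : RateBound u V a b) (τ : ℝ) : 0 ≤ V τ :=
  (Finset.sum_nonneg fun _ _ => Finset.sum_nonneg fun _ _ => abs_nonneg _).trans (h.le τ)

lemma RateBound.row_le (h : RateBound u V a b) (τ : ℝ) (y : State D K) :
    ∑ x, |u τ y x| ≤ V τ :=
  (Finset.single_le_sum (f := fun y => ∑ x, |u τ y x|)
    (fun _ _ => Finset.sum_nonneg fun _ _ => abs_nonneg _) (Finset.mem_univ y)).trans (h.le τ)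

lemma RateBound.abs_le (h : RateBound u V a b) (τ : ℝ) (y x : State D K) :
    |u τ y x| ≤ V τ :=
  (Finset.single_le_sum (f := fun x => |u τ y x|)
    (fun _ _ => abs_nonneg _) (Finset.mem_univ x)).trans (h.row_le τ y)

lemma RateBound.abs_integral_le (h : RateBound u V a b) (hab : a ≤ b) (y x : State D K) :
    |∫ τ in a..b, u τ y x| ≤ ∫ τ in a..b, V τ :=
  abs_intervalIntegral_le hab (fun τ _ => h.abs_le τ y x) h.integrable_bound

lemma RateBound.integral_nonneg (h : RateBound u V a b) (hab : a ≤ b) :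
    0 ≤ ∫ τ in a..b, V τ :=
  intervalIntegral.integral_nonneg hab fun τ _ => h.nonneg τ

lemma abs_sum_mul_le {ι : Type*} (t : Finset ι) (f g : ι → ℝ) {c : ℝ}
    (hg : ∀ i ∈ t, |g i| ≤ c) : |∑ i ∈ t, f i * g i| ≤ (∑ i ∈ t, |f i|) * c := by
  rw [Finset.sum_mul]
  refine (Finset.abs_sum_le_sum_abs _ _).trans (Finset.sum_le_sum fun i hi => ?_)
  rw [abs_mul]
  exact mul_le_mul_of_nonneg_left (hg i hi) (abs_nonneg _)

/-- The forward integrand is a row of rates paired with masses that are at most P(A). Keeping the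
factor P(A) matters later, when errors are summed over a partition into histories. -/
lemma ForwardOn.abs_sub_le [IsFiniteMeasure P] (h : ForwardOn u P a b) (hR : RateBound u V a b)
    {s t : ℝ} (has : a ≤ s) (hst : s ≤ t) (htb : t ≤ b) {A : Set (PathSpace D K)}
    (hA : MeasurableSet[past s] A) (y : State D K) :
    |mass P A t y - mass P A s y| ≤ P.real A * ∫ τ in s..t, V τ := by
  rw [h s t has hst htb A hA y, add_sub_cancel_left, ← intervalIntegral.integral_const_mul]
  refine abs_intervalIntegral_le hst (fun τ _ => ?_)
    ((hR.mono has hst htb).integrable_bound.const_mul _)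
  refine (abs_sum_mul_le Finset.univ (fun z => u τ y z) _ (c := P.real A) fun z _ => ?_).trans ?_
  · rw [abs_of_nonneg (mass_nonneg _ _ _ _)]; exact mass_le _ _ _ _
  · rw [mul_comm]; exact mul_le_mul_of_nonneg_left (hR.row_le τ y) measureReal_nonneg

/-- A function whose increments are bounded by those of an integral is continuous. -/
lemma continuousOn_of_abs_sub_le {f V : ℝ → ℝ} {c : ℝ} (hV : IntervalIntegrable V volume a b)
    (h : ∀ s t, a ≤ s → s ≤ t → t ≤ b → |f t - f s| ≤ c * ∫ τ in s..t, V τ) :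
    ContinuousOn f (Icc a b) := by
  rcases le_or_gt a b with hab | hab
  swap
  · rw [Icc_eq_empty (not_le.2 hab)]; exact continuousOn_empty _
  have hI : ContinuousOn (fun t => ∫ τ in a..t, V τ) (Icc a b) := by
    have := intervalIntegral.continuousOn_primitive_interval' hV left_mem_uIcc
    rwa [uIcc_of_le hab] at this
  intro x hx
  have hIx : Tendsto (fun t => |c| * |(∫ τ in a..t, V τ) - ∫ τ in a..x, V τ|) (𝓝[Icc a b] x)
      (𝓝 0) := by
    have h2 := ((hI x hx).tendsto.sub_const (∫ τ in a..x, V τ)).abs.const_mul |c|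
    simpa using h2
  rw [ContinuousWithinAt, tendsto_iff_norm_sub_tendsto_zero]
  refine squeeze_zero' (Eventually.of_forall fun _ => norm_nonneg _) ?_ hIx
  filter_upwards [self_mem_nhdsWithin] with t ht
  have key : ∀ s t, s ∈ Icc a b → t ∈ Icc a b → s ≤ t →
      |f t - f s| ≤ |c| * |(∫ τ in a..t, V τ) - ∫ τ in a..s, V τ| := by
    intro s t hs ht hst
    rw [intervalIntegral.integral_interval_sub_left
      (IntervalIntegrable.sub_interval hV le_rfl ht.1 ht.2)
      (IntervalIntegrable.sub_interval hV le_rfl hs.1 hs.2), ← abs_mul]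
    exact (h s t hs.1 hst ht.2).trans (le_abs_self _)
  rcases le_total x t with hxt | htx
  · exact key x t hx ht hxt
  · rw [Real.norm_eq_abs, abs_sub_comm, abs_sub_comm (∫ τ in a..t, V τ)]
    exact key t x ht hx htx

lemma ForwardOn.continuousOn [IsFiniteMeasure P] (h : ForwardOn u P a b) (hR : RateBound u V a b)
    {A : Set (PathSpace D K)} (hA : MeasurableSet[past a] A) (y : State D K) :
    ContinuousOn (fun t => mass P A t y) (Icc a b) :=
  continuousOn_of_abs_sub_le hR.integrable_bound fun _ _ has hst htb =>
    h.abs_sub_le hR has hst htb (past_mono has _ hA) y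

/-- Freezing the masses at the left endpoint costs one more increment of ∫ V, so the Euler scheme
has a quadratic error. This is the only local information about the chains that the discretizations
use. -/
lemma ForwardOn.abs_euler_le [IsFiniteMeasure P] (h : ForwardOn u P a b) (hR : RateBound u V a b)
    (hab : a ≤ b) {A : Set (PathSpace D K)} (hA : MeasurableSet[past a] A) (y : State D K) :
    |mass P A b y - mass P A a y - ∑ z, (∫ τ in a..b, u τ y z) * mass P A a z|
      ≤ P.real A * (∫ τ in a..b, V τ) ^ 2 := by
  have hint : ∀ z, IntervalIntegrable (fun τ => u τ y z * mass P A τ z) volume a b := fun z =>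
    (hR.integrable z y).mul_continuousOn (by
      rw [uIcc_of_le hab]; exact h.continuousOn hR hA z)
  have h1 : mass P A b y - mass P A a y - ∑ z, (∫ τ in a..b, u τ y z) * mass P A a z
      = ∫ τ in a..b, ∑ z, u τ y z * (mass P A τ z - mass P A a z) := by
    rw [h a b le_rfl hab le_rfl A hA y, add_sub_cancel_left]
    simp_rw [← intervalIntegral.integral_mul_const]
    rw [intervalIntegral.integral_finsetSum fun z _ => hint z,
      intervalIntegral.integral_finsetSum, ← Finset.sum_sub_distrib]
    · refine Finset.sum_congr rfl fun z _ => ?_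
      rw [← intervalIntegral.integral_sub (hint z) ((hR.integrable z y).mul_const _)]
      simp_rw [mul_sub]
    · intro z _
      simp_rw [mul_sub]
      exact (hint z).sub ((hR.integrable z y).mul_const _)
  rw [h1, pow_two, ← mul_assoc, ← intervalIntegral.integral_const_mul]
  refine abs_intervalIntegral_le hab (fun τ hτ => ?_) (hR.integrable_bound.const_mul _)
  · refine (abs_sum_mul_le Finset.univ (fun z => u τ y z) _
      (c := P.real A * ∫ τ in a..b, V τ) fun z _ => ?_).trans ?_
    · refine (h.abs_sub_le hR le_rfl hτ.1.le hτ.2 hA z).trans ?_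
      gcongr
      exact intervalIntegral.integral_mono_interval le_rfl hτ.1.le hτ.2
        (ae_of_all _ fun τ => hR.nonneg τ) hR.integrable_bound
    · rw [mul_comm]
      exact mul_le_mul_of_nonneg_left (hR.row_le τ y)
        (mul_nonneg measureReal_nonneg (hR.integral_nonneg hab))

end Forward

end DiscreteSampler

/-! ### One-step expansions for a measure tilted by a function of the current state. -/

namespace DiscreteSampler

variable {D K N : ℕ}

/-- On the past of `t ∈ [a, b]`, the measure `P` has density `k t (X_t)` with respect to `R`;
the density `k` is bounded by `κ` and its increments are bounded by those of `∫ V`. -/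
structure TiltOn (k : ℝ → State D K → ℝ) (κ : ℝ) (V : ℝ → ℝ) (R P : Measure (PathSpace D K))
    (a b : ℝ) : Prop where
  nonneg : ∀ t, a ≤ t → t ≤ b → ∀ y, 0 ≤ k t y
  le : ∀ t, a ≤ t → t ≤ b → ∀ y, k t y ≤ κ
  abs_sub_le : ∀ s t, a ≤ s → s ≤ t → t ≤ b → ∀ y, |k t y - k s y| ≤ ∫ τ in s..t, V τ
  mass_eq : ∀ t, a ≤ t → t ≤ b → ∀ A : Set (PathSpace D K), MeasurableSet[past t] A → ∀ y,
    mass P A t y = mass R A t y * k t y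

section Step

variable {r u : ℝ → State D K → State D K → ℝ} {V : ℝ → ℝ} {R P : Measure (PathSpace D K)}
  {a b κ : ℝ} {k : ℝ → State D K → ℝ}

lemma TiltOn.mono (h : TiltOn k κ V R P a b) {a' b' : ℝ} (ha : a ≤ a') (hb : b' ≤ b) :
    TiltOn k κ V R P a' b' :=
  ⟨fun t h1 h2 => h.nonneg t (ha.trans h1) (h2.trans hb),
    fun t h1 h2 => h.le t (ha.trans h1) (h2.trans hb),
    fun s t h1 h2 h3 => h.abs_sub_le s t (ha.trans h1) h2 (h3.trans hb),
    fun t h1 h2 => h.mass_eq t (ha.trans h1) (h2.trans hb)⟩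

lemma TiltOn.continuousOn (h : TiltOn k κ V R P a b) (hV : IntervalIntegrable V volume a b)
    (y : State D K) : ContinuousOn (fun t => k t y) (Icc a b) :=
  continuousOn_of_abs_sub_le (c := 1) hV fun s t has hst htb => by
    simpa using h.abs_sub_le s t has hst htb y

lemma mass_inter_self (P : Measure (PathSpace D K)) (A : Set (PathSpace D K)) (t : ℝ)
    (x y : State D K) :
    mass P (A ∩ {ω | coord t ω = x}) t y = if y = x then mass P A t x else 0 := by
  unfold mass
  split_ifs with h
  · subst h; rw [inter_assoc, inter_self]
  · have : A ∩ {ω : PathSpace D K | coord t ω = x} ∩ {ω | coord t ω = y} = ∅ := by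
      ext ω; simp only [mem_inter_iff, mem_ofPred_eq, mem_empty_iff_false, iff_false]
      rintro ⟨⟨_, h1⟩, h2⟩; exact h (h2.symm.trans h1)
    rw [this, measureReal_empty]

variable [IsFiniteMeasure R]

/-- The tilt at time b turns the P-probability of seeing x and then y into the R-probability times
k_b(y), and the Euler expansion evaluates the latter to first order. Moving the frozen times a and b
to the running time τ is again a second-order error. The result exhibits r(y,x) k(y) as the flux
density of the tilted chain. -/
lemma TiltOn.abs_jump_sub_le (hk : TiltOn k κ V R P a b) (h : ForwardOn r R a b)
    (hr : RateBound r V a b) (ha : 0 ≤ a) (hab : a ≤ b) {A : Set (PathSpace D K)}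
    (hA : MeasurableSet[past a] A) {x y : State D K} (hxy : y ≠ x) :
    |mass P (A ∩ {ω | coord a ω = x}) b y - ∫ τ in a..b, mass R A τ x * (r τ y x * k τ y)|
      ≤ (2 * κ + 1) * R.real A * (∫ τ in a..b, V τ) ^ 2 := by
  set ε := ∫ τ in a..b, V τ with hε
  have hε0 : 0 ≤ ε := hr.integral_nonneg hab
  have hA' : MeasurableSet[past a] (A ∩ {ω | coord a ω = x}) :=
    hA.inter (measurableSet_past_coord ha le_rfl x)
  have hκ0 : 0 ≤ κ := (hk.nonneg a le_rfl hab x).trans (hk.le a le_rfl hab x)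
  have h1 := h.abs_euler_le hr hab hA' y
  have h2 : ∑ z, (∫ τ in a..b, r τ y z) * mass R (A ∩ {ω | coord a ω = x}) a z
      = (∫ τ in a..b, r τ y x) * mass R A a x := by
    simp_rw [mass_inter_self]
    simp
  rw [mass_inter_self, if_neg hxy, sub_zero, h2] at h1
  have h3 : |mass R (A ∩ {ω | coord a ω = x}) b y - (∫ τ in a..b, r τ y x) * mass R A a x|
      ≤ R.real A * ε ^ 2 :=
    h1.trans (mul_le_mul_of_nonneg_right (measureReal_mono inter_subset_left) (sq_nonneg _))
  have hint : IntervalIntegrable (fun τ => mass R A τ x * (r τ y x * k τ y)) volume a b := by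
    refine (((hr.integrable x y).mul_continuousOn (g := fun τ => k τ y) ?_).continuousOn_mul ?_)
    · rw [uIcc_of_le hab]; exact hk.continuousOn hr.integrable_bound y
    · rw [uIcc_of_le hab]; exact h.continuousOn hr hA x
  have h4 : |(∫ τ in a..b, r τ y x) * mass R A a x * k b y
      - ∫ τ in a..b, mass R A τ x * (r τ y x * k τ y)| ≤ (κ + 1) * R.real A * ε ^ 2 := by
    rw [← intervalIntegral.integral_mul_const, ← intervalIntegral.integral_mul_const,
      ← intervalIntegral.integral_sub (((hr.integrable x y).mul_const _).mul_const _) hint, pow_two,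
      ← mul_assoc]
    conv_rhs => rw [hε, ← intervalIntegral.integral_const_mul]
    refine abs_intervalIntegral_le hab (fun τ hτ => ?_) (hr.integrable_bound.const_mul _)
    have hmono1 : ∫ σ in a..τ, V σ ≤ ε :=
      intervalIntegral.integral_mono_interval le_rfl hτ.1.le hτ.2
        (ae_of_all _ fun τ => hr.nonneg τ) hr.integrable_bound
    have hmono2 : ∫ σ in τ..b, V σ ≤ ε :=
      intervalIntegral.integral_mono_interval hτ.1.le hτ.2 le_rfl
        (ae_of_all _ fun τ => hr.nonneg τ) hr.integrable_bound
    have e1 : |mass R A τ x - mass R A a x| ≤ R.real A * ε :=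
      (h.abs_sub_le hr le_rfl hτ.1.le hτ.2 hA x).trans
        (mul_le_mul_of_nonneg_left hmono1 measureReal_nonneg)
    have e2 : |k b y - k τ y| ≤ ε := (hk.abs_sub_le τ b hτ.1.le hτ.2 le_rfl y).trans hmono2
    have e3 : |k b y| ≤ κ := by
      rw [abs_of_nonneg (hk.nonneg b hab le_rfl y)]; exact hk.le b hab le_rfl y
    have e4 : |mass R A τ x| ≤ R.real A := by
      rw [abs_of_nonneg (mass_nonneg _ _ _ _)]; exact mass_le _ _ _ _
    have : r τ y x * mass R A a x * k b y - mass R A τ x * (r τ y x * k τ y)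
        = (mass R A τ x * (k b y - k τ y) - (mass R A τ x - mass R A a x) * k b y) * r τ y x := by
      ring
    rw [this, abs_mul]
    refine mul_le_mul ?_ (hr.abs_le τ y x) (abs_nonneg _) ?_
    · refine (abs_sub _ _).trans ?_
      rw [abs_mul, abs_mul]
      have := mul_le_mul e4 e2 (abs_nonneg _) measureReal_nonneg
      have := mul_le_mul e1 e3 (abs_nonneg _) (mul_nonneg measureReal_nonneg hε0)
      linarith
    · exact mul_nonneg (mul_nonneg (by linarith) measureReal_nonneg) hε0
  rw [hk.mass_eq b hab le_rfl _ (past_mono hab _ hA') y]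
  have h5 : |mass R (A ∩ {ω | coord a ω = x}) b y * k b y
      - (∫ τ in a..b, r τ y x) * mass R A a x * k b y| ≤ κ * R.real A * ε ^ 2 := by
    rw [← sub_mul, abs_mul, abs_of_nonneg (hk.nonneg b hab le_rfl y)]
    refine (mul_le_mul h3 (hk.le b hab le_rfl y) (hk.nonneg b hab le_rfl y)
      (mul_nonneg measureReal_nonneg (sq_nonneg _))).trans_eq ?_
    ring
  refine (_root_.abs_sub_le _ _ _).trans ((add_le_add h5 h4).trans_eq ?_)
  ring

/-- The same freezing argument for the compensator: this is the flux that the rates u would produce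
from the tilted marginal. -/
lemma TiltOn.abs_mass_mul_integral_sub_le (hk : TiltOn k κ V R P a b) (h : ForwardOn r R a b)
    (hr : RateBound r V a b) (hu : RateBound u V a b) (hab : a ≤ b)
    {A : Set (PathSpace D K)} (hA : MeasurableSet[past a] A) (x y : State D K) :
    |mass P A a x * (∫ τ in a..b, u τ y x) - ∫ τ in a..b, mass R A τ x * (k τ x * u τ y x)|
      ≤ (κ + 1) * R.real A * (∫ τ in a..b, V τ) ^ 2 := by
  set ε := ∫ τ in a..b, V τ with hε
  have hε0 : 0 ≤ ε := hr.integral_nonneg hab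
  have hκ0 : 0 ≤ κ := (hk.nonneg a le_rfl hab x).trans (hk.le a le_rfl hab x)
  have hint : IntervalIntegrable (fun τ => mass R A τ x * (k τ x * u τ y x)) volume a b := by
    refine (((hu.integrable x y).continuousOn_mul (g := fun τ => k τ x) ?_).continuousOn_mul ?_)
    · rw [uIcc_of_le hab]; exact hk.continuousOn hr.integrable_bound x
    · rw [uIcc_of_le hab]; exact h.continuousOn hr hA x
  rw [hk.mass_eq a le_rfl hab _ hA x, ← intervalIntegral.integral_const_mul,
      ← intervalIntegral.integral_sub ((hu.integrable x y).const_mul _) hint, pow_two,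
      ← mul_assoc]
  conv_rhs => rw [hε, ← intervalIntegral.integral_const_mul]
  refine abs_intervalIntegral_le hab (fun τ hτ => ?_) (hr.integrable_bound.const_mul _)
  have hmono1 : ∫ σ in a..τ, V σ ≤ ε :=
    intervalIntegral.integral_mono_interval le_rfl hτ.1.le hτ.2
      (ae_of_all _ fun τ => hr.nonneg τ) hr.integrable_bound
  have e1 : |mass R A τ x - mass R A a x| ≤ R.real A * ε :=
    (h.abs_sub_le hr le_rfl hτ.1.le hτ.2 hA x).trans
      (mul_le_mul_of_nonneg_left hmono1 measureReal_nonneg)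
  have e2 : |k τ x - k a x| ≤ ε := (hk.abs_sub_le a τ le_rfl hτ.1.le hτ.2 x).trans hmono1
  have e3 : |k a x| ≤ κ := by
    rw [abs_of_nonneg (hk.nonneg a le_rfl hab x)]; exact hk.le a le_rfl hab x
  have e4 : |mass R A τ x| ≤ R.real A := by
    rw [abs_of_nonneg (mass_nonneg _ _ _ _)]; exact mass_le _ _ _ _
  have : mass R A a x * k a x * u τ y x - mass R A τ x * (k τ x * u τ y x)
      = (-(mass R A τ x * (k τ x - k a x)) - (mass R A τ x - mass R A a x) * k a x) * u τ y x := by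
    ring
  rw [this, abs_mul]
  refine mul_le_mul ?_ (hu.abs_le τ y x) (abs_nonneg _) ?_
  · refine (abs_sub _ _).trans ?_
    rw [abs_neg, abs_mul, abs_mul]
    have := mul_le_mul e4 e2 (abs_nonneg _) measureReal_nonneg
    have := mul_le_mul e1 e3 (abs_nonneg _) (mul_nonneg measureReal_nonneg hε0)
    linarith
  · exact mul_nonneg (mul_nonneg (by linarith) measureReal_nonneg) hε0

/-- The integrand of the Girsanov exponent for the test functions `ψ`, `φ`. -/
noncomputable def girsanovIntegrand (r u : ℝ → State D K → State D K → ℝ) (k : ℝ → State D K → ℝ)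
    (R : Measure (PathSpace D K)) (A : Set (PathSpace D K)) (ψ φ : State D K → State D K → ℝ)
    (τ : ℝ) : ℝ :=
  ∑ x, ∑ y with y ≠ x, (mass R A τ x * (r τ y x * k τ y) * ψ x y
    - mass R A τ x * (k τ x * u τ y x) * φ x y)

lemma TiltOn.intervalIntegrable_terms (hk : TiltOn k κ V R P a b) (h : ForwardOn r R a b)
    (hr : RateBound r V a b) (hu : RateBound u V a b) (hab : a ≤ b)
    {A : Set (PathSpace D K)} (hA : MeasurableSet[past a] A) (x y : State D K) :
    IntervalIntegrable (fun τ => mass R A τ x * (r τ y x * k τ y)) volume a b ∧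
    IntervalIntegrable (fun τ => mass R A τ x * (k τ x * u τ y x)) volume a b := by
  have h1 : ContinuousOn (fun τ => mass R A τ x) (uIcc a b) := by
    rw [uIcc_of_le hab]; exact h.continuousOn hr hA x
  have h2 : ∀ z, ContinuousOn (fun τ => k τ z) (uIcc a b) := by
    rw [uIcc_of_le hab]; exact fun z => hk.continuousOn hr.integrable_bound z
  exact ⟨((hr.integrable x y).mul_continuousOn (h2 y)).continuousOn_mul h1,
    ((hu.integrable x y).continuousOn_mul (h2 x)).continuousOn_mul h1⟩

/-- Jump term minus compensator over one step, for arbitrary bounded weights ψ and φ. The lower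
bound in Girsanov's theorem uses it with φ = exp ψ - 1 for a test function ψ, the upper bound with
ψ(x,y) = log (H y / H x). -/
lemma TiltOn.abs_step_sub_le (hk : TiltOn k κ V R P a b) (h : ForwardOn r R a b)
    (hr : RateBound r V a b) (hu : RateBound u V a b) (ha : 0 ≤ a) (hab : a ≤ b)
    {A : Set (PathSpace D K)} (hA : MeasurableSet[past a] A) {ψ φ : State D K → State D K → ℝ}
    {B : ℝ} (hψ : ∀ x y, |ψ x y| ≤ B) (hφ : ∀ x y, |φ x y| ≤ B) :
    |∑ x, ∑ y with y ≠ x, (mass P (A ∩ {ω | coord a ω = x}) b y * ψ x y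
        - mass P A a x * (∫ τ in a..b, u τ y x) * φ x y)
      - ∫ τ in a..b, girsanovIntegrand r u k R A ψ φ τ|
      ≤ (Fintype.card (State D K)) ^ 2 * (B * (3 * κ + 2)) * (R.real A * (∫ τ in a..b, V τ) ^ 2) := by
  have hint := hk.intervalIntegrable_terms h hr hu hab hA
  have h0 : ∀ x y, IntervalIntegrable (fun τ => mass R A τ x * (r τ y x * k τ y) * ψ x y
    - mass R A τ x * (k τ x * u τ y x) * φ x y) volume a b := fun x y =>
    ((hint x y).1.mul_const _).sub ((hint x y).2.mul_const _)
  unfold girsanovIntegrand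
  rw [intervalIntegral.integral_finsetSum fun x _ => intervalIntegrable_sum _ fun y _ => h0 x y,
    ← Finset.sum_sub_distrib]
  have hX : ∀ x : State D K, 0 ≤ B * (3 * κ + 2) * (R.real A * (∫ τ in a..b, V τ) ^ 2) := fun x => by
    have hκ0 : 0 ≤ κ := (hk.nonneg a le_rfl hab x).trans (hk.le a le_rfl hab x)
    have hB : 0 ≤ B := (abs_nonneg _).trans (hψ x x)
    positivity
  calc _ ≤ ∑ x : State D K, ∑ y : State D K,
        B * (3 * κ + 2) * (R.real A * (∫ τ in a..b, V τ) ^ 2) := ?_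
    _ = _ := by simp; ring
  refine (Finset.abs_sum_le_sum_abs _ _).trans (Finset.sum_le_sum fun x _ => ?_)
  rw [intervalIntegral.integral_finsetSum fun y _ => h0 x y, ← Finset.sum_sub_distrib]
  refine (Finset.abs_sum_le_sum_abs _ _).trans ?_
  refine (Finset.sum_le_sum fun y hy => ?_).trans
    (Finset.sum_le_sum_of_subset_of_nonneg (Finset.filter_subset _ _) fun _ _ _ => hX x)
  have hy' : y ≠ x := (Finset.mem_filter.1 hy).2
  have hB : 0 ≤ B := (abs_nonneg _).trans (hψ x x)
  have e1 := hk.abs_jump_sub_le h hr ha hab hA hy'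
  have e2 := hk.abs_mass_mul_integral_sub_le h hr hu hab hA x y
  rw [intervalIntegral.integral_sub ((hint x y).1.mul_const _) ((hint x y).2.mul_const _),
    intervalIntegral.integral_mul_const, intervalIntegral.integral_mul_const]
  have : ∀ p q p' q' s t : ℝ, p * s - q * t - (p' * s - q' * t) = (p - p') * s - (q - q') * t := by
    intros; ring
  rw [this]
  refine (abs_sub _ _).trans ?_
  rw [abs_mul, abs_mul]
  have f1 := mul_le_mul e1 (hψ x y) (abs_nonneg _) ((abs_nonneg _).trans e1)
  have f2 := mul_le_mul e2 (hφ x y) (abs_nonneg _) ((abs_nonneg _).trans e2)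
  refine (add_le_add f1 f2).trans_eq ?_
  ring

end Step

end DiscreteSampler

/-! ### Variational formulas for the relative entropy and reduction to finitely many coordinates. -/

namespace DiscreteSampler

variable {D K N : ℕ}

open InformationTheory

section KL

variable {Ω : Type*} [MeasurableSpace Ω] {P Q : Measure Ω}

/-- Young's inequality for the convex function f log f, with equality at g = f. For f > 0 it is log
(g/f) ≤ g/f - 1. -/
lemma mul_log_sub_add_one_le_klFun {f g : ℝ} (hf : 0 ≤ f) (hg : 0 < g) :
    f * Real.log g - g + 1 ≤ klFun f := by
  rw [klFun_apply]
  rcases hf.eq_or_lt with rfl | hf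
  · simp; exact hg.le
  · have h1 : Real.log (g / f) ≤ g / f - 1 := Real.log_le_sub_one_of_pos (by positivity)
    rw [Real.log_div hg.ne' hf.ne'] at h1
    have h2 := mul_le_mul_of_nonneg_left h1 hf.le
    have h3 : f * (g / f - 1) = g - f := by field_simp
    nlinarith

lemma integrable_of_bounds [IsFiniteMeasure P] {G : Ω → ℝ} (hG : Measurable G) {m M : ℝ}
    (hm : ∀ ω, m ≤ G ω) (hM : ∀ ω, G ω ≤ M) : Integrable G P :=
  Integrable.of_mem_Icc m M hG.aemeasurable (ae_of_all _ fun ω => ⟨hm ω, hM ω⟩)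

lemma integrable_log_of_bounds [IsFiniteMeasure P] {G : Ω → ℝ} (hG : Measurable G) {m M : ℝ}
    (hm0 : 0 < m) (hm : ∀ ω, m ≤ G ω) (hM : ∀ ω, G ω ≤ M) :
    Integrable (fun ω => Real.log (G ω)) P :=
  integrable_of_bounds (Real.measurable_log.comp hG) (m := Real.log m) (M := Real.log M)
    (fun ω => Real.log_le_log hm0 (hm ω)) fun ω => Real.log_le_log (hm0.trans_le (hm ω)) (hM ω)

/-- The Donsker–Varadhan bound, in its affine form. -/
lemma ofReal_integral_log_le_klDiv [IsProbabilityMeasure P] [IsProbabilityMeasure Q] {G : Ω → ℝ}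
    (hG : Measurable G) {m M : ℝ} (hm0 : 0 < m) (hm : ∀ ω, m ≤ G ω) (hM : ∀ ω, G ω ≤ M) :
    ENNReal.ofReal (∫ ω, Real.log (G ω) ∂P - ∫ ω, G ω ∂Q + 1) ≤ klDiv P Q := by
  by_cases htop : klDiv P Q = ⊤
  · rw [htop]; exact le_top
  obtain ⟨hac, hint⟩ := klDiv_ne_top_iff.1 htop
  rw [ENNReal.ofReal_le_iff_le_toReal htop, toReal_klDiv_eq_integral_klFun hac]
  have h1 : ∫ ω, Real.log (G ω) ∂P = ∫ ω, (P.rnDeriv Q ω).toReal * Real.log (G ω) ∂Q := by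
    rw [← integral_rnDeriv_smul hac]; simp
  have i1 : Integrable (fun ω => (P.rnDeriv Q ω).toReal * Real.log (G ω)) Q := by
    have := (integrable_rnDeriv_smul_iff hac (f := fun ω => Real.log (G ω))).2
      (integrable_log_of_bounds hG hm0 hm hM)
    simpa using this
  have i2 : Integrable G Q := integrable_of_bounds hG hm hM
  have h3 : ∫ ω, Real.log (G ω) ∂P - ∫ ω, G ω ∂Q + 1
      = ∫ ω, ((P.rnDeriv Q ω).toReal * Real.log (G ω) - G ω + 1) ∂Q := by
    rw [integral_add (f := fun ω => (P.rnDeriv Q ω).toReal * Real.log (G ω) - G ω)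
      (i1.sub i2) (integrable_const _), integral_sub i1 i2, h1]
    simp
  rw [h3]
  refine integral_mono ((i1.sub i2).add (integrable_const _))
    ((integrable_klFun_rnDeriv_iff hac).2 hint) fun ω => ?_
  exact mul_log_sub_add_one_le_klFun ENNReal.toReal_nonneg (hm0.trans_le (hm ω))

/-- Truncation of `f` to `[1/(n+1), n+1]`. -/
noncomputable def clip (n : ℕ) (f : ℝ) : ℝ := max (1 / ((n : ℝ) + 1)) (min f ((n : ℝ) + 1))

lemma clip_ge (n : ℕ) (f : ℝ) : 1 / ((n : ℝ) + 1) ≤ clip n f := le_max_left _ _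

lemma one_div_succ_le_one (n : ℕ) : 1 / ((n : ℝ) + 1) ≤ 1 := by
  rw [div_le_one (by positivity)]; simp

lemma clip_le (n : ℕ) (f : ℝ) : clip n f ≤ (n : ℝ) + 1 :=
  max_le ((one_div_succ_le_one n).trans (by simp)) (min_le_right _ _)

lemma clip_pos (n : ℕ) (f : ℝ) : 0 < clip n f := lt_of_lt_of_le (by positivity) (clip_ge n f)

lemma measurable_clip (n : ℕ) : Measurable (clip n) := by
  unfold clip; fun_prop

/-- Truncation moves f towards 1 without crossing it, which fixes the signs in `log_clip_nonneg`. -/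
lemma clip_between (n : ℕ) (f : ℝ) :
    (f ≤ clip n f ∧ clip n f ≤ 1) ∨ (1 ≤ clip n f ∧ clip n f ≤ f) := by
  have h1 := one_div_succ_le_one n
  have h2 : (1 : ℝ) ≤ n + 1 := by simp
  unfold clip
  rcases le_total f 1 with h | h
  · left
    rw [min_eq_left (h.trans h2)]
    exact ⟨le_max_right _ _, max_le h1 h⟩
  · right
    have h3 : 1 ≤ min f ((n : ℝ) + 1) := le_min h h2
    rw [max_eq_right (h1.trans h3)]
    exact ⟨h3, min_le_left _ _⟩

/-- With c the truncated value, f log c ≥ c log c by `clip_between`, and c log c ≥ c - 1.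
Nonnegativity of the truncated integrands is what permits Fatou's lemma. -/
lemma log_clip_nonneg (n : ℕ) (f : ℝ) :
    0 ≤ f * Real.log (clip n f) - clip n f + 1 := by
  have hc := clip_pos n f
  rcases clip_between n f with ⟨h1, h2⟩ | ⟨h1, h2⟩
  · have h3 : 1 - (clip n f)⁻¹ ≤ Real.log (clip n f) := Real.one_sub_inv_le_log_of_pos hc
    have h4 : Real.log (clip n f) ≤ 0 := Real.log_nonpos hc.le h2
    have h5 : clip n f * Real.log (clip n f) ≤ f * Real.log (clip n f) :=
      mul_le_mul_of_nonpos_right h1 h4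
    have h6 := mul_le_mul_of_nonneg_left h3 hc.le
    rw [mul_sub, mul_inv_cancel₀ hc.ne'] at h6
    linarith
  · have h3 : 1 - (clip n f)⁻¹ ≤ Real.log (clip n f) := Real.one_sub_inv_le_log_of_pos hc
    have h4 : 0 ≤ Real.log (clip n f) := Real.log_nonneg h1
    have h5 : clip n f * Real.log (clip n f) ≤ f * Real.log (clip n f) :=
      mul_le_mul_of_nonneg_right h2 h4
    have h6 := mul_le_mul_of_nonneg_left h3 hc.le
    rw [mul_sub, mul_inv_cancel₀ hc.ne'] at h6
    linarith

lemma tendsto_clip {f : ℝ} (hf : 0 ≤ f) : Tendsto (fun n => clip n f) atTop (𝓝 f) := by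
  have h1 : Tendsto (fun n : ℕ => 1 / ((n : ℝ) + 1)) atTop (𝓝 0) :=
    tendsto_one_div_add_atTop_nhds_zero_nat
  have h2 : ∀ᶠ n : ℕ in atTop, min f ((n : ℝ) + 1) = f := by
    obtain ⟨n0, hn0⟩ := exists_nat_ge f
    filter_upwards [eventually_ge_atTop n0] with n hn
    refine min_eq_left (hn0.trans ?_)
    have : (n0 : ℝ) ≤ n := by exact_mod_cast hn
    linarith
  have h3 : Tendsto (fun n : ℕ => min f ((n : ℝ) + 1)) atTop (𝓝 f) :=
    (tendsto_congr' h2).2 tendsto_const_nhds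
  have := h1.max h3
  rwa [max_eq_right hf] at this

lemma tendsto_log_clip {f : ℝ} (hf : 0 ≤ f) :
    Tendsto (fun n => f * Real.log (clip n f) - clip n f + 1) atTop (𝓝 (klFun f)) := by
  have h := tendsto_clip hf
  rw [klFun_apply]
  rcases hf.eq_or_lt with rfl | hf0
  · simpa using (h.neg).add_const 1
  · have h1 := ((h.log hf0.ne').const_mul f).sub h |>.add_const 1
    convert h1 using 2; ring

/-- The variational upper bound for the relative entropy. -/
lemma klDiv_le_of_forall [IsProbabilityMeasure P] [IsProbabilityMeasure Q] {c : ℝ} (hc : 0 ≤ c)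
    (h : ∀ (G : Ω → ℝ) (m M : ℝ), Measurable G → 0 < m → (∀ ω, m ≤ G ω) → (∀ ω, G ω ≤ M) →
      ∫ ω, Real.log (G ω) ∂P - ∫ ω, G ω ∂Q + 1 ≤ c) :
    klDiv P Q ≤ ENNReal.ofReal c := by
  have hac : P ≪ Q := by
    refine Measure.AbsolutelyContinuous.mk fun A hA hQA => ?_
    have hQA' : Q.real A = 0 := by simp [measureReal_def, hQA]
    by_contra hPA
    have hPA' : 0 < P.real A := by
      rw [measureReal_def]; exact ENNReal.toReal_pos hPA (measure_ne_top _ _)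
    -- A Q-null set of positive P-mass is tested with the value exp L on A and 1 elsewhere. The
    -- Q-integral stays 1, while the P-integral of the logarithm is L · P(A) = c + 1 > c.
    set L : ℝ := (c + 1) / P.real A
    have hL : 0 < L := by positivity
    have h1 := h (fun ω => 1 + A.indicator (fun _ => Real.exp L - 1) ω) 1 (Real.exp L)
      (by fun_prop (disch := exact hA)) one_pos ?_ ?_
    · have e1 : ∫ ω, Real.log (1 + A.indicator (fun _ => Real.exp L - 1) ω) ∂P = c + 1 := by
        have : (fun ω => Real.log (1 + A.indicator (fun _ => Real.exp L - 1) ω))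
            = A.indicator fun _ => L := by
          ext ω
          by_cases hω : ω ∈ A <;> simp [hω]
        rw [this, integral_indicator_const _ hA, smul_eq_mul]
        simp only [L]; field_simp
      have e2 : ∫ ω, (1 + A.indicator (fun _ => Real.exp L - 1) ω) ∂Q = 1 := by
        rw [integral_add (integrable_const _) ((integrable_const _).indicator hA),
          integral_indicator_const _ hA, hQA']
        simp
      rw [e1, e2] at h1
      linarith
    · intro ω
      have : 0 ≤ Real.exp L - 1 := by linarith [Real.add_one_le_exp L]
      simpa using indicator_nonneg (fun _ _ => this) ω
    · intro ω
      have : 1 ≤ Real.exp L := by linarith [Real.add_one_le_exp L]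
      by_cases hω : ω ∈ A <;> simp [hω]; linarith
  rw [klDiv_eq_lintegral_klFun_of_ac hac]
  set f : Ω → ℝ := fun ω => (P.rnDeriv Q ω).toReal
  have hf : Measurable f := (Measure.measurable_rnDeriv P Q).ennreal_toReal
  have hf0 : ∀ ω, 0 ≤ f ω := fun ω => ENNReal.toReal_nonneg
  have hmeas : ∀ n, Measurable fun ω => ENNReal.ofReal
      (f ω * Real.log (clip n (f ω)) - clip n (f ω) + 1) := fun n => by
    have h1 := (measurable_clip n).comp hf
    have h2 := Real.measurable_log.comp h1
    exact (((hf.mul h2).sub h1).add_const 1).ennreal_ofReal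
  calc ∫⁻ ω, ENNReal.ofReal (klFun (f ω)) ∂Q
      = ∫⁻ ω, liminf (fun n : ℕ => ENNReal.ofReal
          (f ω * Real.log (clip n (f ω)) - clip n (f ω) + 1)) atTop ∂Q := by
        refine lintegral_congr fun ω => ?_
        exact (((ENNReal.continuous_ofReal.tendsto _).comp
          (tendsto_log_clip (hf0 ω))).liminf_eq).symm
    _ ≤ liminf (fun n : ℕ => ∫⁻ ω, ENNReal.ofReal
          (f ω * Real.log (clip n (f ω)) - clip n (f ω) + 1) ∂Q) atTop :=
        lintegral_liminf_le hmeas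
    _ ≤ ENNReal.ofReal c := by
        refine liminf_le_of_frequently_le' (Frequently.of_forall fun n => ?_)
        have hG : Measurable fun ω => clip n (f ω) := (measurable_clip n).comp hf
        have hpos : (0 : ℝ) < 1 / ((n : ℝ) + 1) := by positivity
        have i1 : Integrable (fun ω => f ω * Real.log (clip n (f ω))) Q := by
          have := (integrable_rnDeriv_smul_iff hac (f := fun ω => Real.log (clip n (f ω)))).2
            (integrable_log_of_bounds hG hpos (fun ω => clip_ge n _) fun ω => clip_le n _)
          simpa using this
        have i2 : Integrable (fun ω => clip n (f ω)) Q :=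
          integrable_of_bounds hG (fun ω => clip_ge n _) fun ω => clip_le n _
        rw [← ofReal_integral_eq_lintegral_ofReal
          (f := fun ω => f ω * Real.log (clip n (f ω)) - clip n (f ω) + 1) ((i1.sub i2).add (integrable_const _))
          (ae_of_all _ fun ω => log_clip_nonneg n (f ω))]
        refine ENNReal.ofReal_le_ofReal ?_
        refine le_trans (le_of_eq ?_) (h _ _ _ hG hpos (fun ω => clip_ge n _) fun ω => clip_le n _)
        have h1 : ∫ ω, Real.log (clip n (f ω)) ∂P = ∫ ω, f ω * Real.log (clip n (f ω)) ∂Q := by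
          rw [← integral_rnDeriv_smul hac]; simp [f]
        rw [integral_add (f := fun ω => f ω * Real.log (clip n (f ω)) - clip n (f ω))
          (i1.sub i2) (integrable_const _), integral_sub i1 i2, h1]
        simp

end KL

lemma measurable_of_dependsOn {F : PathSpace D K → ℝ} {J : Finset (Icc (0 : ℝ) 1)}
    (hF : DependsOn F J) : Measurable F := by
  obtain ⟨g, hg⟩ := dependsOn_iff_exists_comp.1 hF
  rw [hg]
  exact (measurable_of_finite g).comp (measurable_pi_lambda _ fun i => measurable_pi_apply _)

/-- It suffices to test the variational formula with functions of finitely many coordinates. -/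
lemma klDiv_le_of_forall_dependsOn {P Q : Measure (PathSpace D K)} [IsProbabilityMeasure P]
    [IsProbabilityMeasure Q] {c : ℝ} (hc : 0 ≤ c)
    (h : ∀ (J : Finset (Icc (0 : ℝ) 1)) (G : PathSpace D K → ℝ) (m M : ℝ), DependsOn G J →
      0 < m → (∀ ω, m ≤ G ω) → (∀ ω, G ω ≤ M) →
      ∫ ω, Real.log (G ω) ∂P - ∫ ω, G ω ∂Q + 1 ≤ c) :
    klDiv P Q ≤ ENNReal.ofReal c := by
  refine klDiv_le_of_forall hc fun G m M hG hm0 hm hM => ?_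
  refine le_of_forall_pos_le_add fun η hη => ?_
  set μ : Measure (PathSpace D K) := P + Q
  have hdense : μ.MeasureDense (measurableCylinders fun _ : Icc (0 : ℝ) 1 => State D K) :=
    Measure.MeasureDense.of_generateFrom_isSetAlgebra_finite _
      isSetAlgebra_measurableCylinders generateFrom_measurableCylinders.symm
  have hGμ : MemLp G 1 μ := memLp_one_iff_integrable.2 (integrable_of_bounds hG hm hM)
  -- On [m, M] the logarithm is 1/m-Lipschitz, so an L¹ error δ under both P and Q changes the
  -- functional by at most (1/m + 1) δ = η.
  set δ : ℝ := η / (1 / m + 1)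
  have hδ : 0 < δ := by positivity
  have h0P : ∀ (a : ℝ) ⦃s : Set (PathSpace D K)⦄, MeasurableSet s → μ s < ⊤ →
      ∀ {ε : ℝ≥0∞}, ε ≠ 0 → ∃ g : PathSpace D K → ℝ,
        eLpNorm (g - s.indicator fun _ => a) 1 μ ≤ ε ∧
          ∃ J : Finset (Icc (0 : ℝ) 1), DependsOn g J := by
    intro a s hs _ ε hε
    -- The minimum with 1 keeps the tolerance finite when ε = ⊤, and the added 1 covers a = 0.
    set e : ℝ := (min ε 1).toReal / (|a| + 1)
    have hε1 : min ε 1 ≠ ⊤ := ne_top_of_le_ne_top ENNReal.one_ne_top (min_le_right _ _)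
    have he : 0 < e := div_pos (ENNReal.toReal_pos (by simpa using hε) hε1) (by positivity)
    obtain ⟨t, ht, hst⟩ := hdense.approx s hs (measure_ne_top _ _) e he
    refine ⟨t.indicator fun _ => a, ?_, ?_⟩
    · rw [← eLpNorm_neg, neg_sub, eLpNorm_one_eq_lintegral_enorm]
      calc ∫⁻ ω, ‖(s.indicator (fun _ => a) - t.indicator fun _ => a) ω‖ₑ ∂μ
          ≤ ∫⁻ ω, (symmDiff s t).indicator (fun _ => ‖a‖ₑ) ω ∂μ := by
            refine lintegral_mono fun ω => ?_
            by_cases h1 : ω ∈ s <;> by_cases h2 : ω ∈ t <;> simp [h1, h2, Set.mem_symmDiff]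
        _ = ‖a‖ₑ * μ (symmDiff s t) := by
            rw [lintegral_indicator_const (hs.symmDiff (hdense.measurable t ht))]
        _ ≤ ENNReal.ofReal (|a| + 1) * ENNReal.ofReal e := by
            gcongr
            rw [Real.enorm_eq_ofReal_abs]
            exact ENNReal.ofReal_le_ofReal (by linarith)
        _ = min ε 1 := by
            rw [← ENNReal.ofReal_mul (by positivity)]
            have : (|a| + 1) * e = (min ε 1).toReal := by simp only [e]; field_simp
            rw [this, ENNReal.ofReal_toReal hε1]
        _ ≤ ε := min_le_left _ _
    · obtain ⟨J, S, _, rfl⟩ := (mem_measurableCylinders _).1 ht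
      refine ⟨J, fun x y hxy => ?_⟩
      have : (fun i : J => x i) = fun i : J => y i := funext fun i => hxy i i.2
      have h2 : x ∈ cylinder J S ↔ y ∈ cylinder J S := by
        simp only [mem_cylinder]
        have : J.restrict x = J.restrict y := this
        rw [this]
      by_cases hx : x ∈ cylinder J S
      · rw [indicator_of_mem hx, indicator_of_mem (h2.1 hx)]
      · rw [indicator_of_notMem hx, indicator_of_notMem (mt h2.2 hx)]
  have h1P : ∀ f g : PathSpace D K → ℝ, (∃ J : Finset (Icc (0 : ℝ) 1), DependsOn f J) →
      (∃ J : Finset (Icc (0 : ℝ) 1), DependsOn g J) →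
      ∃ J : Finset (Icc (0 : ℝ) 1), DependsOn (f + g) J := by
    rintro f g ⟨J, hJ⟩ ⟨J', hJ'⟩
    classical
    refine ⟨J ∪ J', fun x y hxy => ?_⟩
    simp only [Pi.add_apply]
    rw [hJ fun i hi => hxy i (by simp at hi ⊢; exact Or.inl hi),
      hJ' fun i hi => hxy i (by simp at hi ⊢; exact Or.inr hi)]
  obtain ⟨g, hg1, J, hgJ⟩ := hGμ.induction_dense ENNReal.one_ne_top
    (fun g => ∃ J : Finset (Icc (0 : ℝ) 1), DependsOn g J) h0P h1P
    (fun f ⟨J, hJ⟩ => (measurable_of_dependsOn hJ).aestronglyMeasurable)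
    (ε := ENNReal.ofReal δ) (by simpa using hδ)
  set g' : PathSpace D K → ℝ := fun ω => max m (min (g ω) M)
  have hmM : m ≤ M := by
    obtain ⟨ω⟩ := nonempty_of_isProbabilityMeasure P
    exact (hm ω).trans (hM ω)
  have hg' : DependsOn g' J := fun x y hxy => by simp only [g', hgJ hxy]
  have key := h J g' m M hg' hm0 (fun ω => le_max_left _ _) fun ω => max_le hmM (min_le_right _ _)
  have hg'm : Measurable g' := measurable_of_dependsOn hg'
  have hle : ∀ ω, |G ω - g' ω| ≤ |G ω - g ω| := fun ω => by
    have e : G ω = max m (min (G ω) M) := by rw [min_eq_left (hM ω), max_eq_right (hm ω)]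
    conv_lhs => rw [e]
    refine (abs_max_sub_max_le_max _ _ _ _).trans (max_le (by simp) ?_)
    exact (abs_min_sub_min_le_max _ _ _ _).trans (max_le le_rfl (by simp))
  have hν : ∀ ν : Measure (PathSpace D K), IsProbabilityMeasure ν → ν ≤ μ →
      ∫ ω, |G ω - g' ω| ∂ν ≤ δ := by
    intro ν _ hνμ
    have : ∫ ω, |G ω - g' ω| ∂ν = (∫⁻ ω, ‖G ω - g' ω‖ₑ ∂ν).toReal :=
      integral_norm_eq_lintegral_enorm (hG.sub hg'm).aestronglyMeasurable
    rw [this]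
    refine ENNReal.toReal_le_of_le_ofReal hδ.le ?_
    rw [eLpNorm_one_eq_lintegral_enorm] at hg1
    refine (lintegral_mono' hνμ fun ω => ?_).trans hg1
    exact enorm_le_iff_norm_le.2 (hle ω)
  have hi : ∀ ν : Measure (PathSpace D K), IsProbabilityMeasure ν → Integrable g' ν :=
    fun ν _ => integrable_of_bounds hg'm (fun ω => le_max_left _ _)
      fun ω => max_le hmM (min_le_right _ _)
  have hi' : Integrable (fun ω => |G ω - g' ω|) P :=
    ((integrable_of_bounds hG hm hM).sub (hi P inferInstance)).abs
  have k1 : ∫ ω, Real.log (G ω) ∂P ≤ ∫ ω, (Real.log (g' ω) + 1 / m * |G ω - g' ω|) ∂P := by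
    refine integral_mono (integrable_log_of_bounds hG hm0 hm hM)
      ((integrable_log_of_bounds hg'm hm0 (fun ω => le_max_left _ _)
        fun ω => max_le hmM (min_le_right _ _)).add (hi'.const_mul _)) fun ω => ?_
    have hg0 : m ≤ g' ω := le_max_left _ _
    have hgpos : 0 < g' ω := hm0.trans_le hg0
    have h1 : Real.log (G ω / g' ω) ≤ G ω / g' ω - 1 :=
      Real.log_le_sub_one_of_pos (div_pos (hm0.trans_le (hm ω)) hgpos)
    rw [Real.log_div (hm0.trans_le (hm ω)).ne' hgpos.ne'] at h1
    have h2 : G ω / g' ω - 1 = (G ω - g' ω) / g' ω := by field_simp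
    have h3 : (G ω - g' ω) / g' ω ≤ |G ω - g' ω| / m :=
      (div_le_div_of_nonneg_right (le_abs_self _) hgpos.le).trans
        (div_le_div_of_nonneg_left (abs_nonneg _) hm0 hg0)
    have h4 : 1 / m * |G ω - g' ω| = |G ω - g' ω| / m := by ring
    simp only [h4]
    linarith
  rw [integral_add (integrable_log_of_bounds hg'm hm0 (fun ω => le_max_left _ _)
        fun ω => max_le hmM (min_le_right _ _)) (hi'.const_mul _), integral_const_mul] at k1
  have k2 : ∫ ω, g' ω ∂Q - ∫ ω, G ω ∂Q ≤ δ := by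
    rw [← integral_sub (hi Q inferInstance) (integrable_of_bounds hG hm hM)]
    refine le_trans (integral_mono ((hi Q inferInstance).sub (integrable_of_bounds hG hm hM))
      ((integrable_of_bounds hG hm hM).sub (hi Q inferInstance)).abs fun ω => ?_)
      (hν Q inferInstance (Measure.le_add_left le_rfl))
    simp only [Pi.sub_apply]
    rw [abs_sub_comm]
    exact le_abs_self _
  have k3 := hν P inferInstance (Measure.le_add_right le_rfl)
  have k4 : 1 / m * ∫ ω, |G ω - g' ω| ∂P ≤ 1 / m * δ :=
    mul_le_mul_of_nonneg_left k3 (by positivity)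
  have k5 : (1 / m + 1) * δ = η := by simp only [δ]; field_simp
  linarith

end DiscreteSampler

/-! ### Rate matrices and the one-step bound for exponential functionals. -/

namespace DiscreteSampler

open InformationTheory

variable {D K N : ℕ}

lemma setLIntegral_eq_sum_fiber {Ω α : Type*} [MeasurableSpace Ω] [Fintype α] [MeasurableSpace α]
    [MeasurableSingletonClass α] (P : Measure Ω) {f : Ω → α} (hf : Measurable f) (A : Set Ω)
    (hA : MeasurableSet A) (ψ : Ω → ℝ≥0∞) :
    ∫⁻ ω in A, ψ ω ∂P = ∑ y, ∫⁻ ω in A ∩ {ω | f ω = y}, ψ ω ∂P := by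
  have h : A = ⋃ y, A ∩ {ω | f ω = y} := by
    ext ω; simp
  conv_lhs => rw [h]
  rw [lintegral_iUnion (s := fun y => A ∩ {ω | f ω = y})
    (fun y => hA.inter (hf (measurableSet_singleton y))), tsum_fintype]
  intro y z hyz
  refine Set.disjoint_left.2 fun ω h1 h2 => hyz (h1.2.symm.trans h2.2)

/-- A rate matrix: nonnegative off-diagonal entries, columns with sum zero. -/
structure IsRate (u : ℝ → State D K → State D K → ℝ) : Prop where
  nonneg : ∀ τ y x, y ≠ x → 0 ≤ u τ y x
  sum_eq_zero : ∀ τ x, ∑ y, u τ y x = 0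

section

variable {u : ℝ → State D K → State D K → ℝ} {V : ℝ → ℝ} {Q : Measure (PathSpace D K)} {a b : ℝ}

lemma IsRate.integral_nonneg (hu : IsRate u) (hab : a ≤ b) {x y : State D K} (h : y ≠ x) :
    0 ≤ ∫ τ in a..b, u τ y x :=
  intervalIntegral.integral_nonneg hab fun τ _ => hu.nonneg τ y x h

lemma IsRate.sum_integral (hu : IsRate u) (hV : RateBound u V a b) (x : State D K) :
    ∑ y, ∫ τ in a..b, u τ y x = 0 := by
  rw [← intervalIntegral.integral_finsetSum fun y _ => hV.integrable x y]
  simp [hu.sum_eq_zero]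

lemma IsRate.integral_diag (hu : IsRate u) (hV : RateBound u V a b) (x : State D K) :
    ∫ τ in a..b, u τ x x = -∑ y with y ≠ x, ∫ τ in a..b, u τ y x := by
  have h := hu.sum_integral hV x
  rw [← Finset.sum_filter_add_sum_filter_not Finset.univ (fun y => y ≠ x)] at h
  have h2 : ∑ y with ¬ y ≠ x, ∫ τ in a..b, u τ y x = ∫ τ in a..b, u τ x x := by
    simp [Finset.filter_eq']
  linarith

/-- The Euler estimate for the event A ∩ {X_a = x}, whose mass at time a sits entirely at x, so the
error is also proportional to that mass. -/
lemma ForwardOn.mass_step_le [IsFiniteMeasure Q] (h : ForwardOn u Q a b) (hV : RateBound u V a b)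
    (ha : 0 ≤ a) (hab : a ≤ b) {A : Set (PathSpace D K)} (hA : MeasurableSet[past a] A)
    (x y : State D K) :
    mass Q (A ∩ {ω | coord a ω = x}) b y
      ≤ ((if y = x then 1 else 0) + (∫ τ in a..b, u τ y x) + (∫ τ in a..b, V τ) ^ 2)
        * mass Q A a x := by
  have hA' : MeasurableSet[past a] (A ∩ {ω | coord a ω = x}) :=
    hA.inter (measurableSet_past_coord ha le_rfl x)
  have h1 := (abs_le.1 (h.abs_euler_le hV hab hA' y)).2
  have h2 : ∑ z, (∫ τ in a..b, u τ y z) * mass Q (A ∩ {ω | coord a ω = x}) a z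
      = (∫ τ in a..b, u τ y x) * mass Q A a x := by
    simp_rw [mass_inter_self]
    simp
  rw [h2, mass_inter_self] at h1
  have h3 : Q.real (A ∩ {ω | coord a ω = x}) = mass Q A a x := rfl
  rw [h3] at h1
  split_ifs at h1 ⊢ <;> nlinarith

/-- The one-step bound for the conditional Laplace transform. -/
lemma ForwardOn.lintegral_step_le [IsFiniteMeasure Q] (h : ForwardOn u Q a b)
    (hV : RateBound u V a b) (hu : IsRate u) (ha : 0 ≤ a) (hab : a ≤ b)
    (hε : ∫ τ in a..b, V τ ≤ 1) {φ : PathSpace D K → ℝ≥0∞} (hφ : Measurable[past a] φ)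
    (w : State D K → State D K → ℝ) (hw : ∀ x y, 0 ≤ w x y) {c : ℝ}
    (hc : ∀ x, ∑ y, w x y * ((if y = x then 1 else 0) + (∫ τ in a..b, u τ y x)
      + (∫ τ in a..b, V τ) ^ 2) ≤ c) :
    ∫⁻ ω, φ ω * ENNReal.ofReal (w (coord a ω) (coord b ω)) ∂Q
      ≤ ENNReal.ofReal c * ∫⁻ ω, φ ω ∂Q := by
  set p : State D K → State D K → ℝ := fun x y => (if y = x then 1 else 0)
    + (∫ τ in a..b, u τ y x) + (∫ τ in a..b, V τ) ^ 2
  have hp : ∀ x y, 0 ≤ p x y := by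
    intro x y
    have hsq := sq_nonneg (∫ τ in a..b, V τ)
    simp only [p]
    split_ifs with hxy
    · have := (abs_le.1 (hV.abs_integral_le hab y x)).1
      linarith
    · have := hu.integral_nonneg hab hxy
      linarith
  set E : State D K → Set (PathSpace D K) := fun x => {ω | coord a ω = x}
  set F : State D K → Set (PathSpace D K) := fun y => {ω | coord b ω = y}
  have hE : ∀ x, MeasurableSet (E x) := fun x => measurableSet_coord a x
  have hF : ∀ x, MeasurableSet (F x) := fun x => measurableSet_coord b x
  have hφ' : Measurable φ := hφ.mono (past_le a) le_rfl
  have step : ∀ x y, ∫⁻ ω in E x ∩ F y, φ ω ∂Q ≤ ENNReal.ofReal (p x y) * ∫⁻ ω in E x, φ ω ∂Q := by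
    intro x y
    -- Since φ is measurable with respect to the past, it suffices to compare the two measures on
    -- past events, and only there does the forward equation give information.
    rw [← lintegral_trim (past_le a) hφ, ← lintegral_trim (past_le a) hφ,
      ← smul_eq_mul, ← lintegral_smul_measure]
    refine lintegral_mono' (Measure.le_iff.2 fun A hA => ?_) le_rfl
    have hA0 := past_le a A hA
    rw [Measure.smul_apply, trim_measurableSet_eq _ hA, trim_measurableSet_eq _ hA,
      Measure.restrict_apply hA0, Measure.restrict_apply hA0, smul_eq_mul,
      ← ofReal_measureReal, ← ofReal_measureReal, ← ENNReal.ofReal_mul (hp x y)]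
    refine ENNReal.ofReal_le_ofReal ?_
    have := h.mass_step_le hV ha hab hA x y
    unfold mass at this
    rwa [inter_assoc] at this
  calc ∫⁻ ω, φ ω * ENNReal.ofReal (w (coord a ω) (coord b ω)) ∂Q
      = ∑ x, ∑ y, ∫⁻ ω in E x ∩ F y, φ ω * ENNReal.ofReal (w (coord a ω) (coord b ω)) ∂Q := by
        rw [← setLIntegral_univ, setLIntegral_eq_sum_fiber Q (measurable_coord a) _ .univ]
        refine Finset.sum_congr rfl fun x _ => ?_
        rw [univ_inter, setLIntegral_eq_sum_fiber Q (measurable_coord b) _ (hE x)]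
    _ = ∑ x, ∑ y, ENNReal.ofReal (w x y) * ∫⁻ ω in E x ∩ F y, φ ω ∂Q := by
        refine Finset.sum_congr rfl fun x _ => Finset.sum_congr rfl fun y _ => ?_
        rw [← lintegral_const_mul _ hφ']
        refine setLIntegral_congr_fun ((hE x).inter (hF y)) fun ω hω => ?_
        have h1 : coord a ω = x := hω.1
        have h2 : coord b ω = y := hω.2
        simp only [h1, h2, mul_comm]
    _ ≤ ∑ x, ∑ y, ENNReal.ofReal (w x y) * (ENNReal.ofReal (p x y) * ∫⁻ ω in E x, φ ω ∂Q) := by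
        gcongr with x _ y _
        exact step x y
    _ = ∑ x, ENNReal.ofReal (∑ y, w x y * p x y) * ∫⁻ ω in E x, φ ω ∂Q := by
        refine Finset.sum_congr rfl fun x _ => ?_
        rw [ENNReal.ofReal_sum_of_nonneg fun y _ => mul_nonneg (hw x y) (hp x y), Finset.sum_mul]
        refine Finset.sum_congr rfl fun y _ => ?_
        rw [ENNReal.ofReal_mul (hw x y), mul_assoc]
    _ ≤ ∑ x, ENNReal.ofReal c * ∫⁻ ω in E x, φ ω ∂Q := by
        gcongr with x _
        exact hc x
    _ = ENNReal.ofReal c * ∫⁻ ω, φ ω ∂Q := by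
        rw [← Finset.mul_sum, ← setLIntegral_univ (f := φ),
          setLIntegral_eq_sum_fiber Q (measurable_coord a) _ .univ]
        simp only [univ_inter, E]

/-- With c the compensator, the expectation of exp β over one step is 1 + c up to a quadratic error,
and 1 + c ≤ exp c. Multiplying by exp (-c) leaves 1 + O(ε²). The factor exp (exp B) is a crude bound
for exp (-c), coming from -c ≤ ε ≤ 1 ≤ exp B. -/
lemma exp_weight_bound (hu : IsRate u) (hV : RateBound u V a b) (hab : a ≤ b)
    (hε : ∫ τ in a..b, V τ ≤ 1) {β : State D K → State D K → ℝ} {B : ℝ}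
    (hβ : ∀ x y, |β x y| ≤ B) (hβ0 : ∀ x, β x x = 0) (x : State D K) :
    ∑ y, Real.exp (β x y - ∑ z with z ≠ x, (∫ τ in a..b, u τ z x) * (Real.exp (β x z) - 1))
      * ((if y = x then 1 else 0) + (∫ τ in a..b, u τ y x) + (∫ τ in a..b, V τ) ^ 2)
    ≤ 1 + Fintype.card (State D K) * (Real.exp B * Real.exp (Real.exp B))
      * (∫ τ in a..b, V τ) ^ 2 := by
  set ε := ∫ τ in a..b, V τ
  set U : State D K → ℝ := fun y => ∫ τ in a..b, u τ y x
  set c := ∑ z with z ≠ x, U z * (Real.exp (β x z) - 1)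
  have hU : ∀ y, y ≠ x → 0 ≤ U y := fun y hy => hu.integral_nonneg hab hy
  have hsum : ∑ y, Real.exp (β x y) * ((if y = x then 1 else 0) + U y + ε ^ 2)
      = 1 + c + ε ^ 2 * ∑ y, Real.exp (β x y) := by
    have h1 : ∑ y, Real.exp (β x y) * (if y = x then (1 : ℝ) else 0) = 1 := by
      simp [hβ0]
    have h2 : ∑ y, Real.exp (β x y) * U y = c := by
      rw [← Finset.sum_filter_add_sum_filter_not Finset.univ (fun y => y ≠ x)]
      have h3 : ∑ y with ¬ y ≠ x, Real.exp (β x y) * U y = U x := by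
        simp [Finset.filter_eq', hβ0]
      have h4 : U x = -∑ y with y ≠ x, U y := hu.integral_diag hV x
      rw [h3, h4, ← sub_eq_add_neg, ← Finset.sum_sub_distrib]
      exact Finset.sum_congr rfl fun y _ => by ring
    simp_rw [mul_add]
    rw [Finset.sum_add_distrib, Finset.sum_add_distrib, h1, h2, ← Finset.sum_mul]
    ring
  have hc : -c ≤ Real.exp B := by
    have h1 : -c ≤ ∑ z with z ≠ x, U z := by
      rw [← Finset.sum_neg_distrib]
      refine Finset.sum_le_sum fun z hz => ?_
      have h5 := hU z (Finset.mem_filter.1 hz).2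
      nlinarith [mul_nonneg h5 (Real.exp_pos (β x z)).le]
    have h2 : ∑ z with z ≠ x, U z ≤ ε := by
      have h3 : U x = -∑ y with y ≠ x, U y := hu.integral_diag hV x
      have h4 := (abs_le.1 (hV.abs_integral_le hab x x)).1
      simp only [U] at h3 ⊢
      linarith
    have hB : 0 ≤ B := (abs_nonneg _).trans (hβ x x)
    linarith [Real.add_one_le_exp B]
  have hE : ∑ y, Real.exp (β x y) ≤ Fintype.card (State D K) * Real.exp B := by
    refine (Finset.sum_le_sum fun y _ => Real.exp_le_exp.2 (le_of_abs_le (hβ x y))).trans_eq ?_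
    simp
  calc ∑ y, Real.exp (β x y - c) * ((if y = x then 1 else 0) + U y + ε ^ 2)
      = Real.exp (-c) * (1 + c + ε ^ 2 * ∑ y, Real.exp (β x y)) := by
        rw [← hsum, Finset.mul_sum]
        refine Finset.sum_congr rfl fun y _ => ?_
        rw [sub_eq_add_neg, Real.exp_add]; ring
    _ ≤ Real.exp (-c) * (Real.exp c + ε ^ 2 * (Fintype.card (State D K) * Real.exp B)) := by
        gcongr
        linarith [Real.add_one_le_exp c]
    _ = 1 + Real.exp (-c) * (ε ^ 2 * (Fintype.card (State D K) * Real.exp B)) := by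
        rw [mul_add, ← Real.exp_add]; simp
    _ ≤ 1 + Real.exp (Real.exp B) * (ε ^ 2 * (Fintype.card (State D K) * Real.exp B)) := by
        gcongr
    _ = _ := by ring

end

end DiscreteSampler

/-! ### The discretized exponential martingale, and uniform grids. -/

namespace DiscreteSampler

open InformationTheory

variable {D K N : ℕ}

section

variable {r u : ℝ → State D K → State D K → ℝ} {V : ℝ → ℝ} {R P Q : Measure (PathSpace D K)}
  {a b κ : ℝ} {k : ℝ → State D K → ℝ}

lemma integral_pair_eq_sum [IsFiniteMeasure P] (A : Set (PathSpace D K)) (s t : ℝ)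
    (ψ : State D K → State D K → ℝ) :
    ∫ ω in A, ψ (coord s ω) (coord t ω) ∂P
      = ∑ x, ∑ y, mass P (A ∩ {ω | coord s ω = x}) t y * ψ x y := by
  have h := integral_eq_sum_fiber P (f := fun ω : PathSpace D K => (coord s ω, coord t ω))
    ((measurable_coord s).prodMk (measurable_coord t)) A (fun p => ψ p.1 p.2)
  rw [h, Fintype.sum_prod_type]
  refine Finset.sum_congr rfl fun x _ => Finset.sum_congr rfl fun y _ => ?_
  have : A ∩ {ω : PathSpace D K | (coord s ω, coord t ω) = (x, y)}
      = A ∩ {ω | coord s ω = x} ∩ {ω | coord t ω = y} := by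
    ext ω; simp [Prod.ext_iff, and_assoc]
  rw [this]; rfl

/-- The Donsker–Varadhan inequality for G = exp Σ_j (β_j(X_{τ_j}, X_{τ_{j+1}}) - c_j(X_{τ_j})),
where c_j is the compensator under the rates u. Under P the expectation of log G is the Girsanov
exponent up to quadratic errors. Under Q the product is nearly a supermartingale, so an induction
over the steps bounds its expectation by the exponential of a multiple of the sum of squares. The
bound `Real.exp B` serves for both β and exp β - 1. -/
lemma lower_bound_grid [IsProbabilityMeasure P] [IsProbabilityMeasure Q] [IsProbabilityMeasure R]
    (hk : TiltOn k κ V R P a b) (hR : ForwardOn r R a b) (hQ : ForwardOn u Q a b)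
    (hr : RateBound r V a b) (hu : RateBound u V a b) (hrate : IsRate u) (ha : 0 ≤ a)
    {τ : ℕ → ℝ} (hτ : Monotone τ) (hτab : ∀ j, τ j ∈ Icc a b)
    (hε : ∀ j, ∫ σ in τ j..τ (j + 1), V σ ≤ 1)
    {β : ℕ → State D K → State D K → ℝ} {B : ℝ} (hβ : ∀ j x y, |β j x y| ≤ B)
    (hβ0 : ∀ j x, β j x x = 0) (n : ℕ) :
    ENNReal.ofReal
      ((∑ j ∈ Finset.range n, ∫ σ in τ j..τ (j + 1),
          girsanovIntegrand r u k R univ (β j) (fun x y => Real.exp (β j x y) - 1) σ)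
        - (Fintype.card (State D K)) ^ 2 * (Real.exp B * (3 * κ + 2))
          * ∑ j ∈ Finset.range n, (∫ σ in τ j..τ (j + 1), V σ) ^ 2
        - Real.exp (Fintype.card (State D K) * (Real.exp B * Real.exp (Real.exp B))
          * ∑ j ∈ Finset.range n, (∫ σ in τ j..τ (j + 1), V σ) ^ 2) + 1) ≤ klDiv P Q := by
  set c : ℕ → State D K → ℝ := fun j x =>
    ∑ z with z ≠ x, (∫ σ in τ j..τ (j + 1), u σ z x) * (Real.exp (β j x z) - 1)
  set Y : ℕ → PathSpace D K → ℝ := fun j ω =>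
    β j (coord (τ j) ω) (coord (τ (j + 1)) ω) - c j (coord (τ j) ω)
  set G : ℕ → PathSpace D K → ℝ := fun n ω => Real.exp (∑ j ∈ Finset.range n, Y j ω)
  have hτ0 : ∀ j, 0 ≤ τ j := fun j => ha.trans (hτab j).1
  have hmono : ∀ j, τ j ≤ τ (j + 1) := fun j => hτ (Nat.le_succ j)
  have hYm : ∀ j m, j + 1 ≤ m → Measurable[past (τ m)] (Y j) := by
    intro j m hjm
    have h1 := measurable_coord_past (D := D) (K := K) (hτ0 j) (hτ (by omega : j ≤ m))
    have h2 := measurable_coord_past (D := D) (K := K) (hτ0 (j + 1)) (hτ hjm)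
    have h3 : Measurable[past (τ m)] fun ω : PathSpace D K =>
        (coord (τ j) ω, coord (τ (j + 1)) ω) := h1.prodMk h2
    exact (measurable_of_finite fun p : State D K × State D K => β j p.1 p.2 - c j p.1).comp h3
  have hGm : ∀ m, Measurable[past (τ m)] (G m) := by
    intro m
    refine Real.measurable_exp.comp (Finset.measurable_fun_sum _ fun j hj => hYm j m ?_)
    exact Finset.mem_range.1 hj
  have hGm' : Measurable (G n) := (hGm n).mono (past_le _) le_rfl
  set L : ℕ → ℝ := fun j => B + ∑ x, |c j x|
  have hYL : ∀ j ω, |Y j ω| ≤ L j := fun j ω =>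
    (abs_sub _ _).trans (add_le_add (hβ _ _ _)
      (Finset.single_le_sum (f := fun x => |c j x|) (fun _ _ => abs_nonneg _) (Finset.mem_univ _)))
  have hsumL : ∀ ω, |∑ j ∈ Finset.range n, Y j ω| ≤ ∑ j ∈ Finset.range n, L j := fun ω =>
    (Finset.abs_sum_le_sum_abs _ _).trans (Finset.sum_le_sum fun j _ => hYL j ω)
  have hDV := ofReal_integral_log_le_klDiv (P := P) (Q := Q) hGm'
    (m := Real.exp (-∑ j ∈ Finset.range n, L j)) (M := Real.exp (∑ j ∈ Finset.range n, L j))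
    (Real.exp_pos _) (fun ω => Real.exp_le_exp.2 (abs_le.1 (hsumL ω)).1)
    fun ω => Real.exp_le_exp.2 (abs_le.1 (hsumL ω)).2
  refine le_trans (ENNReal.ofReal_le_ofReal ?_) hDV
  have hYi : ∀ j, Integrable (Y j) P := fun j =>
    integrable_of_bounds ((hYm j (j + 1) le_rfl).mono (past_le _) le_rfl)
      (fun ω => (abs_le.1 (hYL j ω)).1) fun ω => (abs_le.1 (hYL j ω)).2
  -- the logarithm
  have hlog : (∑ j ∈ Finset.range n, ∫ σ in τ j..τ (j + 1),
      girsanovIntegrand r u k R univ (β j) (fun x y => Real.exp (β j x y) - 1) σ)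
      - (Fintype.card (State D K)) ^ 2 * (Real.exp B * (3 * κ + 2))
        * ∑ j ∈ Finset.range n, (∫ σ in τ j..τ (j + 1), V σ) ^ 2
      ≤ ∫ ω, Real.log (G n ω) ∂P := by
    simp only [G, Real.log_exp]
    rw [integral_finsetSum _ fun j _ => hYi j, Finset.mul_sum, ← Finset.sum_sub_distrib]
    refine Finset.sum_le_sum fun j _ => ?_
    have hst := hk.mono (hτab j).1 (hτab (j + 1)).2 |>.abs_step_sub_le
      (hR.mono (hτab j).1 (hτab (j + 1)).2) (hr.mono (hτab j).1 (hmono j) (hτab (j + 1)).2)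
      (hu.mono (hτab j).1 (hmono j) (hτab (j + 1)).2) (hτ0 j) (hmono j) (A := univ)
      MeasurableSet.univ (ψ := β j) (φ := fun x y => Real.exp (β j x y) - 1) (B := Real.exp B)
      (fun x y => (hβ j x y).trans (by linarith [Real.add_one_le_exp B])) (fun x y => by
        have h1 : Real.exp (β j x y) ≤ Real.exp B := Real.exp_le_exp.2 (le_of_abs_le (hβ j x y))
        have h2 := Real.exp_pos (β j x y)
        have hB : 0 ≤ B := (abs_nonneg _).trans (hβ j x y)
        rw [abs_le]; constructor <;> linarith [Real.add_one_le_exp B])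
    have hY : ∫ ω, Y j ω ∂P = ∑ x, ∑ y with y ≠ x,
        (mass P (univ ∩ {ω | coord (τ j) ω = x}) (τ (j + 1)) y * β j x y
        - mass P univ (τ j) x * (∫ σ in τ j..τ (j + 1), u σ y x) * (Real.exp (β j x y) - 1)) := by
      have e1 := integral_pair_eq_sum (P := P) univ (τ j) (τ (j + 1))
        (fun x y => β j x y - c j x)
      rw [setIntegral_univ] at e1
      refine e1.trans (Finset.sum_congr rfl fun x _ => ?_)
      simp_rw [mul_sub, Finset.sum_sub_distrib]
      congr 1
      -- The diagonal drops out because β vanishes there. Staying put contributes only through the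
      -- compensator.
      · refine (Finset.sum_filter_of_ne fun y _ hy => ?_).symm
        rintro rfl
        exact hy (by simp [hβ0])
      · rw [← Finset.sum_mul, sum_mass]
        simp only [c, Finset.mul_sum, mass, mul_assoc, mul_sub, Finset.sum_sub_distrib]
    have h1 := (abs_le.1 hst).1
    rw [hY]
    simp only [probReal_univ, one_mul] at h1
    linarith
  -- the expectation
  have hexp : ∀ m, ∫⁻ ω, ENNReal.ofReal (G m ω) ∂Q ≤ ENNReal.ofReal
      (Real.exp (Fintype.card (State D K) * (Real.exp B * Real.exp (Real.exp B))
          * ∑ j ∈ Finset.range m, (∫ σ in τ j..τ (j + 1), V σ) ^ 2)) := by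
    intro m
    induction m with
    | zero => simp [G]
    | succ m ih =>
      have hst := (hQ.mono (hτab m).1 (hτab (m + 1)).2).lintegral_step_le
        (hu.mono (hτab m).1 (hmono m) (hτab (m + 1)).2) hrate (hτ0 m) (hmono m) (hε m)
        (φ := fun ω => ENNReal.ofReal (G m ω)) (hGm m).ennreal_ofReal
        (fun x y => Real.exp (β m x y - c m x)) (fun _ _ => (Real.exp_pos _).le)
        (fun x => exp_weight_bound hrate (hu.mono (hτab m).1 (hmono m) (hτab (m + 1)).2)
          (hmono m) (hε m) (hβ m) (hβ0 m) x)
      have e1 : ∀ ω, ENNReal.ofReal (G (m + 1) ω) = ENNReal.ofReal (G m ω)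
          * ENNReal.ofReal (Real.exp (β m (coord (τ m) ω) (coord (τ (m + 1)) ω)
            - c m (coord (τ m) ω))) := fun ω => by
        rw [← ENNReal.ofReal_mul (Real.exp_pos _).le, ← Real.exp_add]
        simp only [G, Finset.sum_range_succ, Y]
      simp_rw [e1]
      refine hst.trans ((mul_le_mul_right ih _).trans ?_)
      rw [← ENNReal.ofReal_mul (by positivity), Finset.sum_range_succ, mul_add, Real.exp_add,
        mul_comm]
      refine ENNReal.ofReal_le_ofReal (mul_le_mul_of_nonneg_left ?_ (Real.exp_pos _).le)
      rw [add_comm]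
      exact Real.add_one_le_exp _
  have hexp' : ∫ ω, G n ω ∂Q ≤ Real.exp (Fintype.card (State D K) * (Real.exp B *
      Real.exp (Real.exp B)) * ∑ j ∈ Finset.range n, (∫ σ in τ j..τ (j + 1), V σ) ^ 2) := by
    rw [integral_eq_lintegral_of_nonneg_ae (ae_of_all _ fun ω => (Real.exp_pos _).le)
      hGm'.aestronglyMeasurable]
    exact ENNReal.toReal_le_of_le_ofReal (Real.exp_pos _).le (hexp n)
  linarith

end

/-- The uniform grid with `n` steps on `[a, b]`. -/
noncomputable def grid (a b : ℝ) (n : ℕ) (j : ℕ) : ℝ := a + (b - a) * (min j n : ℕ) / n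

section Grid

variable {a b : ℝ} {n : ℕ}

lemma grid_mono (hab : a ≤ b) : Monotone (grid a b n) := by
  intro i j hij
  unfold grid
  have : ((min i n : ℕ) : ℝ) ≤ (min j n : ℕ) := by exact_mod_cast min_le_min_right n hij
  have h0 : 0 ≤ b - a := by linarith
  gcongr

lemma grid_zero : grid a b n 0 = a := by simp [grid]

lemma grid_self (hn : 0 < n) : grid a b n n = b := by
  have : (n : ℝ) ≠ 0 := by exact_mod_cast hn.ne'
  simp only [grid, min_self]; field_simp; ring

/-- The index is capped at n in the grid, so the membership holds for every natural j and no range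
condition has to be carried along. -/
lemma grid_mem (hab : a ≤ b) (hn : 0 < n) (j : ℕ) : grid a b n j ∈ Icc a b := by
  have h1 := grid_mono (n := n) hab (Nat.zero_le j)
  rw [grid_zero] at h1
  refine ⟨h1, ?_⟩
  have h2 : grid a b n j = grid a b n (min j n) := by simp [grid]
  rw [h2]
  exact (grid_mono hab (min_le_right _ _)).trans_eq (grid_self hn)

lemma grid_step_le (hab : a ≤ b) (j : ℕ) :
    grid a b n (j + 1) - grid a b n j ≤ (b - a) / n := by
  have h0 : 0 ≤ b - a := by linarith
  have h2 : ((min (j + 1) n : ℕ) : ℝ) ≤ (min j n : ℕ) + 1 := by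
    exact_mod_cast (by omega : min (j + 1) n ≤ min j n + 1)
  unfold grid
  have : a + (b - a) * ((min (j + 1) n : ℕ) : ℝ) / n - (a + (b - a) * ((min j n : ℕ) : ℝ) / n)
    = (b - a) / n * (((min (j + 1) n : ℕ) : ℝ) - (min j n : ℕ)) := by ring
  rw [this]
  refine mul_le_of_le_one_right (div_nonneg h0 (Nat.cast_nonneg _)) (by linarith)

/-- Along the uniform grids, the increments of an integral tend to zero uniformly. -/
lemma exists_grid_integral_le {V : ℝ → ℝ} (hV : IntervalIntegrable V volume a b) (hab : a ≤ b)
    {η : ℝ} (hη : 0 < η) :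
    ∃ n0 : ℕ, ∀ n, n0 ≤ n → 0 < n → ∀ j, ∫ σ in grid a b n j..grid a b n (j + 1), V σ ≤ η := by
  have hI : ContinuousOn (fun t => ∫ τ in a..t, V τ) (Icc a b) := by
    have := intervalIntegral.continuousOn_primitive_interval' hV left_mem_uIcc
    rwa [uIcc_of_le hab] at this
  have hUC := isCompact_Icc.uniformContinuousOn_of_continuous hI
  rw [Metric.uniformContinuousOn_iff] at hUC
  obtain ⟨δ, hδ, hUC⟩ := hUC η hη
  obtain ⟨n0, hn0⟩ := exists_nat_gt ((b - a) / δ)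
  refine ⟨n0, fun n hn hn' j => ?_⟩
  have h1 := grid_mem hab hn' j
  have h2 := grid_mem hab hn' (j + 1)
  have h3 : grid a b n j ≤ grid a b n (j + 1) := grid_mono hab (Nat.le_succ j)
  have h4 : (b - a) / n < δ := by
    have hnpos : (0 : ℝ) < n := by exact_mod_cast hn'
    have : (n0 : ℝ) ≤ n := by exact_mod_cast hn
    rw [div_lt_iff₀ hδ] at hn0
    rw [div_lt_iff₀ hnpos]
    nlinarith
  have h5 := hUC _ h2 _ h1 (by
    rw [Real.dist_eq, abs_of_nonneg (by linarith)]
    exact (grid_step_le hab j).trans_lt h4)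
  rw [Real.dist_eq, intervalIntegral.integral_interval_sub_left
      (IntervalIntegrable.sub_interval hV le_rfl h2.1 h2.2)
      (IntervalIntegrable.sub_interval hV le_rfl h1.1 h1.2)] at h5
  exact (le_abs_self _).trans h5.le

lemma sum_grid_integral {f : ℝ → ℝ} (hf : IntervalIntegrable f volume a b) (hab : a ≤ b)
    (hn : 0 < n) :
    ∑ j ∈ Finset.range n, ∫ σ in grid a b n j..grid a b n (j + 1), f σ = ∫ σ in a..b, f σ := by
  rw [intervalIntegral.sum_integral_adjacent_intervals fun j _ =>
    IntervalIntegrable.sub_interval hf (grid_mem hab hn j).1 (grid_mono hab (Nat.le_succ j))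
      (grid_mem hab hn (j + 1)).2, grid_zero, grid_self hn]

/-- A sum of squares is at most the largest increment times the total ∫ V, and the largest increment
tends to zero by uniform continuity of the primitive. Every quadratic error is eliminated in this
way. -/
lemma exists_grid_sum_sq_le {V : ℝ → ℝ} (hV : IntervalIntegrable V volume a b) (hab : a ≤ b)
    (hV0 : ∀ σ, 0 ≤ V σ) {η : ℝ} (hη : 0 < η) :
    ∃ n0 : ℕ, ∀ n, n0 ≤ n → 0 < n →
      ∑ j ∈ Finset.range n, (∫ σ in grid a b n j..grid a b n (j + 1), V σ) ^ 2 ≤ η := by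
  have hI : 0 ≤ ∫ σ in a..b, V σ := intervalIntegral.integral_nonneg hab fun σ _ => hV0 σ
  obtain ⟨n0, h⟩ := exists_grid_integral_le hV hab
    (η := η / ((∫ σ in a..b, V σ) + 1)) (by positivity)
  refine ⟨n0, fun n hn hn' => ?_⟩
  calc ∑ j ∈ Finset.range n, (∫ σ in grid a b n j..grid a b n (j + 1), V σ) ^ 2
      ≤ ∑ j ∈ Finset.range n, η / ((∫ σ in a..b, V σ) + 1)
          * ∫ σ in grid a b n j..grid a b n (j + 1), V σ := by
        refine Finset.sum_le_sum fun j _ => ?_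
        rw [pow_two]
        exact mul_le_mul_of_nonneg_right (h n hn hn' j)
          (intervalIntegral.integral_nonneg (grid_mono hab (Nat.le_succ j)) fun σ _ => hV0 σ)
    _ = η / ((∫ σ in a..b, V σ) + 1) * ∫ σ in a..b, V σ := by
        rw [← Finset.mul_sum, sum_grid_integral hV hab hn']
    _ ≤ η := by
        rw [div_mul_eq_mul_div, div_le_iff₀ (by positivity)]
        nlinarith

end Grid

end DiscreteSampler

/-! ### The Girsanov exponent and the lower bound for continuous test functions. -/

namespace DiscreteSampler

open InformationTheory

variable {D K N : ℕ}

lemma abs_exp_sub_exp_le {p q B : ℝ} (hp : |p| ≤ B) (hq : |q| ≤ B) :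
    |Real.exp p - Real.exp q| ≤ Real.exp B * |p - q| := by
  wlog h : q ≤ p generalizing p q
  · rw [abs_sub_comm, abs_sub_comm p]; exact this hq hp (le_of_not_ge h)
  rw [abs_of_nonneg (sub_nonneg.2 (Real.exp_le_exp.2 h)), abs_of_nonneg (sub_nonneg.2 h)]
  have h1 := Real.add_one_le_exp (q - p)
  have h2 : Real.exp q = Real.exp p * Real.exp (q - p) := by rw [← Real.exp_add]; ring_nf
  have h3 : Real.exp p ≤ Real.exp B := Real.exp_le_exp.2 (le_of_abs_le hp)
  have h4 : Real.exp p * (p - q) ≤ Real.exp B * (p - q) :=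
    mul_le_mul_of_nonneg_right h3 (sub_nonneg.2 h)
  have h5 := mul_le_mul_of_nonneg_left h1 (Real.exp_pos p).le
  linarith

section

variable {r u : ℝ → State D K → State D K → ℝ} {V : ℝ → ℝ} {R P Q : Measure (PathSpace D K)}
  {a b κ : ℝ} {k : ℝ → State D K → ℝ}

/-- The flux `p_τ(x) r_τ(y,x) k_τ(y)` of the tilted chain through the edge `x → y`. -/
noncomputable def fluxP (r : ℝ → State D K → State D K → ℝ) (k : ℝ → State D K → ℝ)
    (R : Measure (PathSpace D K)) (τ : ℝ) (x y : State D K) : ℝ :=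
  mass R univ τ x * (r τ y x * k τ y)

/-- The flux `p_τ(x) k_τ(x) u_τ(y,x)` that the rates `u` would give to the tilted chain. -/
noncomputable def fluxQ (u : ℝ → State D K → State D K → ℝ) (k : ℝ → State D K → ℝ)
    (R : Measure (PathSpace D K)) (τ : ℝ) (x y : State D K) : ℝ :=
  mass R univ τ x * (k τ x * u τ y x)

/-- The Girsanov exponent for the time-dependent test function `β`. -/
noncomputable def girsanovExponent (r u : ℝ → State D K → State D K → ℝ) (k : ℝ → State D K → ℝ)
    (R : Measure (PathSpace D K)) (β : ℝ → State D K → State D K → ℝ) (τ : ℝ) : ℝ :=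
  girsanovIntegrand r u k R univ (β τ) (fun x y => Real.exp (β τ x y) - 1) τ

lemma girsanovExponent_eq (β : ℝ → State D K → State D K → ℝ) (τ : ℝ) :
    girsanovExponent r u k R β τ = ∑ x, ∑ y with y ≠ x,
      (fluxP r k R τ x y * β τ x y - fluxQ u k R τ x y * (Real.exp (β τ x y) - 1)) := rfl

lemma TiltOn.bound_nonneg [IsProbabilityMeasure R] (hk : TiltOn k κ V R P a b) (hab : a ≤ b) :
    0 ≤ κ := by
  obtain ⟨ω⟩ := nonempty_of_isProbabilityMeasure R
  exact (hk.nonneg a le_rfl hab (coord 0 ω)).trans (hk.le a le_rfl hab _)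

lemma TiltOn.abs_flux_le [IsProbabilityMeasure R] (hk : TiltOn k κ V R P a b)
    (hr : RateBound r V a b) (hu : RateBound u V a b) {τ : ℝ} (hτ : τ ∈ Icc a b)
    (x y : State D K) : |fluxP r k R τ x y| ≤ κ * V τ ∧ |fluxQ u k R τ x y| ≤ κ * V τ := by
  have h1 : |mass R univ τ x| ≤ 1 := by
    rw [abs_of_nonneg (mass_nonneg _ _ _ _)]
    exact (mass_le _ _ _ _).trans (by simp)
  have h2 : ∀ z, |k τ z| ≤ κ := fun z => by
    rw [abs_of_nonneg (hk.nonneg τ hτ.1 hτ.2 z)]; exact hk.le τ hτ.1 hτ.2 z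
  have hκ : 0 ≤ κ := (abs_nonneg _).trans (h2 x)
  have hV := hr.nonneg τ
  unfold fluxP fluxQ
  simp only [abs_mul]
  constructor
  · calc |mass R univ τ x| * (|r τ y x| * |k τ y|) ≤ 1 * (V τ * κ) := by
          gcongr
          · exact hr.abs_le τ y x
          · exact h2 y
      _ = κ * V τ := by ring
  · calc |mass R univ τ x| * (|k τ x| * |u τ y x|) ≤ 1 * (κ * V τ) := by
          gcongr
          · exact h2 x
          · exact hu.abs_le τ y x
      _ = κ * V τ := by ring

/-- Admissible test functions: bounded, measurable in time. -/
structure IsTest (β : ℝ → State D K → State D K → ℝ) (B a b : ℝ) : Prop where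
  meas : ∀ x y, AEStronglyMeasurable (fun τ => β τ x y) (volume.restrict (Ioc a b))
  le : ∀ τ x y, |β τ x y| ≤ B

lemma IsTest.mono {β : ℝ → State D K → State D K → ℝ} {B : ℝ} (h : IsTest β B a b) {c d : ℝ}
    (hc : a ≤ c) (hd : d ≤ b) : IsTest β B c d :=
  ⟨fun x y => (h.meas x y).mono_measure (Measure.restrict_mono (Ioc_subset_Ioc hc hd) le_rfl), h.le⟩

lemma IsTest.integrable_mul {β : ℝ → State D K → State D K → ℝ} {B : ℝ} (h : IsTest β B a b)
    (hab : a ≤ b) {f : ℝ → ℝ} (hf : IntervalIntegrable f volume a b) (x y : State D K) :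
    IntervalIntegrable (fun τ => f τ * β τ x y) volume a b ∧
    IntervalIntegrable (fun τ => f τ * (Real.exp (β τ x y) - 1)) volume a b := by
  rw [intervalIntegrable_iff_integrableOn_Ioc_of_le hab] at hf ⊢
  rw [intervalIntegrable_iff_integrableOn_Ioc_of_le hab]
  refine ⟨hf.mul_bdd (c := B) (h.meas x y) (ae_of_all _ fun τ => h.le τ x y),
    hf.mul_bdd (c := Real.exp B + 1) ?_ (ae_of_all _ fun τ => ?_)⟩
  · exact (Real.continuous_exp.comp_aestronglyMeasurable (h.meas x y)).sub
      aestronglyMeasurable_const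
  · rw [Real.norm_eq_abs, abs_le]
    have h1 := Real.exp_pos (β τ x y)
    have h2 : Real.exp (β τ x y) ≤ Real.exp B := Real.exp_le_exp.2 (le_of_abs_le (h.le τ x y))
    constructor <;> linarith

lemma TiltOn.intervalIntegrable_girsanovExponent [IsProbabilityMeasure R]
    (hk : TiltOn k κ V R P a b) (hR : ForwardOn r R a b)
    (hr : RateBound r V a b) (hu : RateBound u V a b) (hab : a ≤ b)
    {β : ℝ → State D K → State D K → ℝ} {B : ℝ} (hβ : IsTest β B a b) :
    IntervalIntegrable (girsanovExponent r u k R β) volume a b := by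
  refine intervalIntegrable_sum _ fun x _ => intervalIntegrable_sum _ fun y _ => ?_
  have := hk.intervalIntegrable_terms hR hr hu hab MeasurableSet.univ x y
  exact (hβ.integrable_mul hab this.1 x y).1.sub (hβ.integrable_mul hab this.2 x y).2

/-- Both fluxes are dominated by κ V and the exponential is Lipschitz on [-B, B], so the exponent is
Lipschitz in the test function for the L¹ norm with weight V. This serves twice: to freeze a
continuous test function at grid points, and to approximate a measurable one by continuous ones. -/
lemma TiltOn.abs_girsanovExponent_sub_le [IsProbabilityMeasure R]
    (hk : TiltOn k κ V R P a b) (hR : ForwardOn r R a b)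
    (hr : RateBound r V a b) (hu : RateBound u V a b) (hab : a ≤ b)
    {β β' : ℝ → State D K → State D K → ℝ} {B : ℝ} (hβ : IsTest β B a b) (hβ' : IsTest β' B a b) :
    |(∫ τ in a..b, girsanovExponent r u k R β τ) - ∫ τ in a..b, girsanovExponent r u k R β' τ|
      ≤ κ * (1 + Real.exp B) * ∑ x, ∑ y, ∫ τ in a..b, V τ * |β τ x y - β' τ x y| := by
  have hi : ∀ x y, IntervalIntegrable (fun τ => V τ * |β τ x y - β' τ x y|) volume a b := by
    intro x y
    have h1 := (hβ.integrable_mul hab hr.integrable_bound x y).1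
    have h2 := (hβ'.integrable_mul hab hr.integrable_bound x y).1
    refine (h1.sub h2).abs.congr (fun τ _ => ?_)
    rw [← mul_sub, abs_mul, abs_of_nonneg (hr.nonneg τ)]
  rw [← intervalIntegral.integral_sub
    (hk.intervalIntegrable_girsanovExponent hR hr hu hab hβ)
    (hk.intervalIntegrable_girsanovExponent hR hr hu hab hβ')]
  have e : ∑ x, ∑ y, ∫ τ in a..b, V τ * |β τ x y - β' τ x y|
      = ∫ τ in a..b, ∑ x, ∑ y, V τ * |β τ x y - β' τ x y| := by
    rw [intervalIntegral.integral_finsetSum fun x _ => intervalIntegrable_sum _ fun y _ => hi x y]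
    exact Finset.sum_congr rfl fun x _ =>
      (intervalIntegral.integral_finsetSum fun y _ => hi x y).symm
  rw [e, ← intervalIntegral.integral_const_mul]
  have hκ : 0 ≤ κ := hk.bound_nonneg hab
  refine abs_intervalIntegral_le hab (fun τ hτ => ?_)
    ((intervalIntegrable_sum _ fun x _ => intervalIntegrable_sum _ fun y _ => hi x y).const_mul _)
  simp only [girsanovExponent_eq]
  rw [← Finset.sum_sub_distrib, Finset.mul_sum]
  refine (Finset.abs_sum_le_sum_abs _ _).trans (Finset.sum_le_sum fun x _ => ?_)
  rw [← Finset.sum_sub_distrib, Finset.mul_sum]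
  refine (Finset.abs_sum_le_sum_abs _ _).trans ?_
  have hV := hr.nonneg τ
  refine (Finset.sum_le_sum fun y _ => ?_).trans
    (Finset.sum_le_sum_of_subset_of_nonneg (Finset.filter_subset _ _) fun _ _ _ => by positivity)
  have hf := hk.abs_flux_le hr hu ⟨hτ.1.le, hτ.2⟩ x y
  have he := abs_exp_sub_exp_le (hβ.le τ x y) (hβ'.le τ x y)
  have : fluxP r k R τ x y * β τ x y - fluxQ u k R τ x y * (Real.exp (β τ x y) - 1)
      - (fluxP r k R τ x y * β' τ x y - fluxQ u k R τ x y * (Real.exp (β' τ x y) - 1))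
      = fluxP r k R τ x y * (β τ x y - β' τ x y)
        - fluxQ u k R τ x y * (Real.exp (β τ x y) - Real.exp (β' τ x y)) := by ring
  rw [this]
  refine (abs_sub _ _).trans ?_
  rw [abs_mul, abs_mul]
  have h1 := mul_le_mul_of_nonneg_right hf.1 (abs_nonneg (β τ x y - β' τ x y))
  have h2 := mul_le_mul hf.2 he (abs_nonneg _) (by positivity)
  linarith

/-- The lower bound for continuous test functions. -/
lemma girsanovExponent_le_klDiv_of_continuous [IsProbabilityMeasure P] [IsProbabilityMeasure Q]
    [IsProbabilityMeasure R]
    (hk : TiltOn k κ V R P a b) (hR : ForwardOn r R a b) (hQ : ForwardOn u Q a b)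
    (hr : RateBound r V a b) (hu : RateBound u V a b) (hrate : IsRate u) (ha : 0 ≤ a) (hab : a ≤ b)
    {β : ℝ → State D K → State D K → ℝ} {B : ℝ} (hβc : ∀ x y, Continuous fun τ => β τ x y)
    (hβ : ∀ τ x y, |β τ x y| ≤ B) (hβ0 : ∀ τ x, β τ x x = 0) :
    ENNReal.ofReal (∫ τ in a..b, girsanovExponent r u k R β τ) ≤ klDiv P Q := by
  by_cases htop : klDiv P Q = ⊤
  · rw [htop]; exact le_top
  rw [ENNReal.ofReal_le_iff_le_toReal htop]
  refine le_of_forall_pos_le_add fun η hη => ?_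
  have hκ : 0 ≤ κ := hk.bound_nonneg hab
  have hβT : IsTest β B a b := ⟨fun x y => (hβc x y).aestronglyMeasurable, hβ⟩
  set I := ∫ τ in a..b, V τ
  have hI : 0 ≤ I := hr.integral_nonneg hab
  set S : ℝ := (Fintype.card (State D K) : ℝ)
  set C1 : ℝ := S ^ 2 * (Real.exp B * (3 * κ + 2))
  set C2 : ℝ := S * (Real.exp B * Real.exp (Real.exp B))
  set C3 : ℝ := κ * (1 + Real.exp B) * (S * (S * I))
  -- the modulus of continuity
  set ρ : ℝ := η / 4 / (C3 + 1)
  have hS : 0 ≤ S := Nat.cast_nonneg _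
  have hρ : 0 < ρ := by positivity
  have hmod : ∃ δ > 0, ∀ x y, ∀ s ∈ Icc a b, ∀ t ∈ Icc a b, |s - t| < δ →
      |β s x y - β t x y| ≤ ρ := by
    have h1 : ∀ p : State D K × State D K, ∃ δ > 0, ∀ s ∈ Icc a b, ∀ t ∈ Icc a b, |s - t| < δ →
        |β s p.1 p.2 - β t p.1 p.2| ≤ ρ := by
      intro p
      have hUC := isCompact_Icc.uniformContinuousOn_of_continuous
        ((hβc p.1 p.2).continuousOn (s := Icc a b))
      rw [Metric.uniformContinuousOn_iff] at hUC
      obtain ⟨δ, hδ, h⟩ := hUC ρ hρ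
      exact ⟨δ, hδ, fun s hs t ht hst => (h s hs t ht hst).le⟩
    choose δ hδ h using h1
    -- The extra index `none`, with the value 1, makes the minimum of the moduli well defined
    -- without asking whether there are any states.
    have hne : (Finset.univ : Finset (Option (State D K × State D K))).Nonempty :=
      ⟨none, Finset.mem_univ _⟩
    refine ⟨Finset.univ.inf' hne fun o => o.elim 1 δ, ?_, fun x y s hs t ht hst => ?_⟩
    · rw [gt_iff_lt, Finset.lt_inf'_iff]
      rintro (_ | p) _
      · exact one_pos
      · exact hδ p
    · refine h (x, y) s hs t ht (hst.trans_le ?_)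
      exact Finset.inf'_le (fun o : Option (State D K × State D K) => o.elim 1 δ)
        (Finset.mem_univ (some (x, y)))
  obtain ⟨δ, hδ, hmod⟩ := hmod
  obtain ⟨n1, hn1⟩ := exists_grid_integral_le hr.integrable_bound hab (η := 1) one_pos
  -- The two thresholds make the error under P and the excess over 1 of the expectation under Q at
  -- most η/4 each. Freezing β takes a further η/4.
  obtain ⟨n2, hn2⟩ := exists_grid_sum_sq_le hr.integrable_bound hab hr.nonneg
    (η := min (η / 4 / (C1 + 1)) (Real.log (1 + η / 4) / (C2 + 1)))
    (lt_min (by positivity) (div_pos (Real.log_pos (by linarith)) (by positivity)))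
  obtain ⟨n3, hn3⟩ := exists_nat_gt ((b - a) / δ)
  set n := max (max n1 n2) (max n3 1)
  have hn : 0 < n := by simp only [n]; omega
  have hnn1 : n1 ≤ n := by simp only [n]; omega
  have hnn2 : n2 ≤ n := by simp only [n]; omega
  have hnn3 : n3 ≤ n := by simp only [n]; omega
  set τ := grid a b n
  have hmem : ∀ j, τ j ∈ Icc a b := grid_mem hab hn
  have hmono : ∀ j, τ j ≤ τ (j + 1) := fun j => grid_mono hab (Nat.le_succ j)
  have hLB := lower_bound_grid hk hR hQ hr hu hrate ha (τ := τ) (grid_mono hab) hmem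
    (fun j => hn1 n hnn1 hn j) (β := fun j => β (τ j)) (fun j x y => hβ _ x y)
    (fun j x => hβ0 _ x) n
  rw [ENNReal.ofReal_le_iff_le_toReal htop] at hLB
  set W := ∑ j ∈ Finset.range n, (∫ σ in τ j..τ (j + 1), V σ) ^ 2
  have hW := hn2 n hnn2 hn
  have hW1 : C1 * W ≤ η / 4 := by
    have h1 : W ≤ η / 4 / (C1 + 1) := hW.trans (min_le_left _ _)
    have hC1 : 0 ≤ C1 := by positivity
    rw [le_div_iff₀ (by positivity)] at h1
    have : 0 ≤ W := Finset.sum_nonneg fun _ _ => sq_nonneg _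
    linarith
  have hW : Real.exp (C2 * W) ≤ 1 + η / 4 := by
    have h1 : W ≤ Real.log (1 + η / 4) / (C2 + 1) := hW.trans (min_le_right _ _)
    have hC2 : 0 ≤ C2 := by positivity
    rw [le_div_iff₀ (by positivity)] at h1
    have : 0 ≤ W := Finset.sum_nonneg fun _ _ => sq_nonneg _
    calc Real.exp (C2 * W) ≤ Real.exp (Real.log (1 + η / 4)) :=
          Real.exp_le_exp.2 (by linarith)
      _ = 1 + η / 4 := Real.exp_log (by linarith)
  have hEint := hk.intervalIntegrable_girsanovExponent hR hr hu hab hβT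
  have hsplit := sum_grid_integral hEint hab hn
  have hdiff : ∫ σ in a..b, girsanovExponent r u k R β σ ≤
      (∑ j ∈ Finset.range n, ∫ σ in τ j..τ (j + 1),
          girsanovIntegrand r u k R univ (β (τ j)) (fun x y => Real.exp (β (τ j) x y) - 1) σ)
        + C3 * ρ := by
    rw [← hsplit, ← sub_le_iff_le_add', ← Finset.sum_sub_distrib]
    have : C3 * ρ = ∑ j ∈ Finset.range n, κ * (1 + Real.exp B) * (S * (S *
        ∫ σ in τ j..τ (j + 1), V σ)) * ρ := by
      rw [← Finset.sum_mul, ← Finset.mul_sum, ← Finset.mul_sum, ← Finset.mul_sum,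
        sum_grid_integral hr.integrable_bound hab hn]
    rw [this]
    refine Finset.sum_le_sum fun j _ => ?_
    have hkj := hk.mono (hmem j).1 (hmem (j + 1)).2
    have h1 := hkj.abs_girsanovExponent_sub_le (hR.mono (hmem j).1 (hmem (j + 1)).2)
      (hr.mono (hmem j).1 (hmono j) (hmem (j + 1)).2)
      (hu.mono (hmem j).1 (hmono j) (hmem (j + 1)).2) (hmono j)
      (hβT.mono (hmem j).1 (hmem (j + 1)).2) (β' := fun _ => β (τ j))
      ⟨fun x y => aestronglyMeasurable_const, fun _ x y => hβ _ x y⟩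
    refine (le_abs_self _).trans (h1.trans ?_)
    rw [mul_assoc (κ * (1 + Real.exp B))]
    refine mul_le_mul_of_nonneg_left ?_ (by positivity)
    have h2 : ∀ x y, ∫ σ in τ j..τ (j + 1), V σ * |β σ x y - β (τ j) x y|
        ≤ (∫ σ in τ j..τ (j + 1), V σ) * ρ := by
      intro x y
      rw [← intervalIntegral.integral_mul_const]
      have hVj := (hr.mono (hmem j).1 (hmono j) (hmem (j + 1)).2).integrable_bound
      refine (le_abs_self _).trans (abs_intervalIntegral_le (hmono j) (fun σ hσ => ?_)
        (hVj.mul_const _))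
      rw [abs_mul, abs_abs, abs_of_nonneg (hr.nonneg σ)]
      refine mul_le_mul_of_nonneg_left (hmod x y σ ⟨(hmem j).1.trans hσ.1.le,
        hσ.2.trans (hmem (j + 1)).2⟩ _ (hmem j) ?_) (hr.nonneg σ)
      rw [abs_of_nonneg (by linarith [hσ.1])]
      have h3 : τ (j + 1) - τ j ≤ (b - a) / n := grid_step_le hab j
      have h4 : (b - a) / n < δ := by
        have hnpos : (0 : ℝ) < n := by exact_mod_cast hn
        have : (n3 : ℝ) ≤ n := by exact_mod_cast hnn3
        rw [div_lt_iff₀ hδ] at hn3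
        rw [div_lt_iff₀ hnpos]
        nlinarith
      linarith [hσ.2]
    refine (Finset.sum_le_sum fun x _ => Finset.sum_le_sum fun y _ => h2 x y).trans_eq ?_
    simp only [Finset.sum_const, Finset.card_univ, nsmul_eq_mul, S]
    ring
  have hC3 : C3 * ρ ≤ η / 4 := by
    have : 0 ≤ C3 := by positivity
    simp only [ρ]
    rw [mul_div_assoc', div_le_iff₀ (by positivity)]
    nlinarith
  linarith

end

end DiscreteSampler

/-! ### Optimal test functions and the lower bound in Girsanov's theorem. -/

namespace DiscreteSampler

open InformationTheory

variable {D K N : ℕ}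

/-- The optimal test ratio `f / g`, truncated. -/
noncomputable def testRatio (n : ℕ) (f g : ℝ) : ℝ :=
  if g = 0 then (if f = 0 then 1 else (n : ℝ) + 1) else clip n (f / g)

lemma testRatio_pos (n : ℕ) (f g : ℝ) : 0 < testRatio n f g := by
  unfold testRatio; split_ifs
  · exact one_pos
  · positivity
  · exact clip_pos _ _

lemma abs_log_testRatio_le (n : ℕ) (f g : ℝ) :
    |Real.log (testRatio n f g)| ≤ Real.log ((n : ℝ) + 1) := by
  have h1 : 1 / ((n : ℝ) + 1) ≤ testRatio n f g := by
    unfold testRatio; split_ifs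
    · exact one_div_succ_le_one n
    · exact (one_div_succ_le_one n).trans (by simp)
    · exact clip_ge _ _
  have h2 : testRatio n f g ≤ (n : ℝ) + 1 := by
    unfold testRatio; split_ifs
    · simp
    · exact le_rfl
    · exact clip_le _ _
  rw [abs_le]
  constructor
  · rw [← Real.log_inv, inv_eq_one_div]
    exact Real.log_le_log (by positivity) h1
  · exact Real.log_le_log (testRatio_pos n f g) h2

lemma measurable_testRatio (n : ℕ) : Measurable fun p : ℝ × ℝ => testRatio n p.1 p.2 := by
  unfold testRatio
  refine Measurable.ite (measurable_snd (measurableSet_singleton 0)) ?_ ?_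
  · exact Measurable.ite (measurable_fst (measurableSet_singleton 0)) measurable_const
      measurable_const
  · exact (measurable_clip n).comp (measurable_fst.div measurable_snd)

/-- Scaling out g reduces statements about the pair (f, g) to the facts about truncation at the
single number f / g. -/
lemma testRatio_eq_mul {f g : ℝ} (hg : g ≠ 0) (c : ℝ) :
    f * Real.log c - g * (c - 1) = g * (f / g * Real.log c - c + 1) := by
  field_simp; ring

lemma testRatio_nonneg (n : ℕ) {f g : ℝ} (hf : 0 ≤ f) (hg : 0 ≤ g) :
    0 ≤ f * Real.log (testRatio n f g) - g * (testRatio n f g - 1) := by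
  unfold testRatio
  split_ifs with h1 h2
  · simp [h2]
  · rw [h1, zero_mul, sub_zero]
    exact mul_nonneg hf (Real.log_nonneg (by simp))
  · rw [testRatio_eq_mul h1]
    exact mul_nonneg hg (log_clip_nonneg n _)

/-- For g > 0 the truncation is removed and g · klFun(f/g) appears. For g = 0 < f the test ratio n +
1 makes the value f log (n + 1) diverge, matching the value `⊤` of `genKL`: a chain that cannot make
a jump charged by P is infinitely far away. -/
lemma tendsto_testRatio {f g : ℝ} (hf : 0 ≤ f) (hg : 0 ≤ g) :
    Tendsto (fun n => ENNReal.ofReal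
      (f * Real.log (testRatio n f g) - g * (testRatio n f g - 1))) atTop (𝓝 (genKL f g)) := by
  unfold testRatio genKL
  split_ifs with h1 h2
  · simp [h2]
  · simp only [h1, zero_mul, sub_zero]
    have hf0 : 0 < f := lt_of_le_of_ne hf (Ne.symm h2)
    refine ENNReal.tendsto_ofReal_atTop.comp ?_
    refine Tendsto.const_mul_atTop hf0 (Real.tendsto_log_atTop.comp ?_)
    exact tendsto_atTop_add_const_right _ _ tendsto_natCast_atTop_atTop
  · refine (ENNReal.continuous_ofReal.tendsto _).comp ?_
    have h3 := (tendsto_log_clip (div_nonneg hf hg)).const_mul g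
    have h4 : f * Real.log (f / g) - f + g = g * klFun (f / g) := by
      rw [klFun_apply]; field_simp; ring
    rw [h4]
    exact h3.congr fun n => (testRatio_eq_mul h1 _).symm

section

variable {r u : ℝ → State D K → State D K → ℝ} {V : ℝ → ℝ} {R P Q : Measure (PathSpace D K)}
  {a b κ : ℝ} {k : ℝ → State D K → ℝ}

/-- The lower bound for measurable test functions. -/
lemma girsanovExponent_le_klDiv [IsProbabilityMeasure P] [IsProbabilityMeasure Q]
    [IsProbabilityMeasure R]
    (hk : TiltOn k κ V R P a b) (hR : ForwardOn r R a b) (hQ : ForwardOn u Q a b)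
    (hr : RateBound r V a b) (hu : RateBound u V a b) (hrate : IsRate u) (ha : 0 ≤ a) (hab : a ≤ b)
    {β : ℝ → State D K → State D K → ℝ} {B : ℝ} (hβ : IsTest β B a b)
    (hβ0 : ∀ τ x, β τ x x = 0) :
    ENNReal.ofReal (∫ τ in a..b, girsanovExponent r u k R β τ) ≤ klDiv P Q := by
  by_cases htop : klDiv P Q = ⊤
  · rw [htop]; exact le_top
  rw [ENNReal.ofReal_le_iff_le_toReal htop]
  refine le_of_forall_pos_le_add fun η hη => ?_
  have hκ : 0 ≤ κ := hk.bound_nonneg hab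
  have hB : 0 ≤ B := by
    obtain ⟨ω⟩ := nonempty_of_isProbabilityMeasure R
    exact (abs_nonneg _).trans (hβ.le 0 (coord 0 ω) (coord 0 ω))
  set S : ℝ := (Fintype.card (State D K) : ℝ)
  have hS : 0 ≤ S := Nat.cast_nonneg _
  set C : ℝ := κ * (1 + Real.exp B) * (S * S)
  have hC : 0 ≤ C := by positivity
  set δ : ℝ := η / (C + 1)
  have hδ : 0 < δ := by positivity
  have hVi : IntegrableOn V (Ioc a b) volume :=
    (intervalIntegrable_iff_integrableOn_Ioc_of_le hab).1 hr.integrable_bound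
  -- The approximation is made in L¹ of V dτ, the norm in which the exponent is Lipschitz. Clamping
  -- the continuous approximants to [-B, B] preserves the bound and does not increase the distance.
  set m : Measure ℝ := (volume.restrict (Ioc a b)).withDensity fun τ => ENNReal.ofReal (V τ)
  have : IsFiniteMeasure m := isFiniteMeasure_withDensity_ofReal hVi.2
  have hm : m ≪ volume.restrict (Ioc a b) := withDensity_absolutelyContinuous _ _
  have hmint : ∀ g : ℝ → ℝ, ∫ τ, g τ ∂m = ∫ τ in a..b, V τ * g τ := by
    intro g
    rw [integral_withDensity_eq_integral_toReal_smul₀ hVi.1.aemeasurable.ennreal_ofReal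
      (ae_of_all _ fun τ => ENNReal.ofReal_lt_top), intervalIntegral.integral_of_le hab]
    refine integral_congr_ae (ae_of_all _ fun τ => ?_)
    simp [ENNReal.toReal_ofReal (hr.nonneg τ)]
  have happ : ∀ x y, ∃ g : ℝ → ℝ, Continuous g ∧ (∀ τ, |g τ| ≤ B) ∧
      ∫ τ in a..b, V τ * |β τ x y - g τ| ≤ δ := by
    intro x y
    have hβm : AEStronglyMeasurable (fun τ => β τ x y) m := (hβ.meas x y).mono_ac hm
    have hβi : Integrable (fun τ => β τ x y) m :=
      Integrable.of_bound hβm B (ae_of_all _ fun τ => hβ.le τ x y)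
    obtain ⟨g, hg, hgi⟩ := hβi.exists_boundedContinuous_integral_sub_le hδ
    have hgc : Continuous fun τ => max (-B) (min (g τ) B) := by fun_prop
    refine ⟨fun τ => max (-B) (min (g τ) B), hgc, fun τ => ?_, ?_⟩
    · rw [abs_le]; exact ⟨le_max_left _ _, max_le (by linarith) (min_le_right _ _)⟩
    · rw [← hmint]
      refine le_trans (integral_mono_of_nonneg (ae_of_all _ fun _ => abs_nonneg _)
        (hβi.sub hgi).norm (ae_of_all _ fun τ => ?_)) hg
      simp only [Pi.sub_apply, Real.norm_eq_abs]
      have e : β τ x y = max (-B) (min (β τ x y) B) := by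
        have := abs_le.1 (hβ.le τ x y)
        rw [min_eq_left this.2, max_eq_right this.1]
      conv_lhs => rw [e]
      refine (abs_max_sub_max_le_max _ _ _ _).trans (max_le (by simp) ?_)
      exact (abs_min_sub_min_le_max _ _ _ _).trans (max_le le_rfl (by simp))
  choose g hgc hgB hgδ using happ
  set β' : ℝ → State D K → State D K → ℝ := fun τ x y => if y = x then 0 else g x y τ
  have hβ'c : ∀ x y, Continuous fun τ => β' τ x y := by
    intro x y
    by_cases h : y = x
    · simp only [β', h, if_true]; exact continuous_const
    · simp only [β', h, if_false]; exact hgc x y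
  have hβ'B : ∀ τ x y, |β' τ x y| ≤ B := by
    intro τ x y
    simp only [β']; split_ifs
    · simpa using hB
    · exact hgB x y τ
  have h1 := girsanovExponent_le_klDiv_of_continuous hk hR hQ hr hu hrate ha hab hβ'c hβ'B
    fun τ x => by simp [β']
  rw [ENNReal.ofReal_le_iff_le_toReal htop] at h1
  have h2 := hk.abs_girsanovExponent_sub_le hR hr hu hab hβ (β' := β')
    ⟨fun x y => (hβ'c x y).aestronglyMeasurable, hβ'B⟩
  have h3 : ∑ x, ∑ y, ∫ τ in a..b, V τ * |β τ x y - β' τ x y| ≤ S * (S * δ) := by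
    have : ∀ x y, ∫ τ in a..b, V τ * |β τ x y - β' τ x y| ≤ δ := by
      intro x y
      by_cases h : y = x
      · subst h
        simp only [β', if_true, hβ0, sub_zero, abs_zero, mul_zero,
          intervalIntegral.integral_zero]
        exact hδ.le
      · simp only [β', h, if_false]; exact hgδ x y
    refine (Finset.sum_le_sum fun x _ => Finset.sum_le_sum fun y _ => this x y).trans_eq ?_
    simp [S]
  have h4 := (le_abs_self _).trans h2
  have h5 : κ * (1 + Real.exp B) * ∑ x, ∑ y, ∫ τ in a..b, V τ * |β τ x y - β' τ x y| ≤ η := by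
    refine (mul_le_mul_of_nonneg_left h3 (by positivity)).trans ?_
    have : κ * (1 + Real.exp B) * (S * (S * δ)) = C * δ := by simp only [C]; ring
    rw [this]
    simp only [δ]
    rw [mul_div_assoc', div_le_iff₀ (by positivity)]
    nlinarith
  linarith

/-- The density in time of the relative entropy. -/
noncomputable def klRate (r u : ℝ → State D K → State D K → ℝ) (k : ℝ → State D K → ℝ)
    (R : Measure (PathSpace D K)) (τ : ℝ) : ℝ≥0∞ :=
  ∑ x, ∑ y with y ≠ x, genKL (fluxP r k R τ x y) (fluxQ u k R τ x y)

/-- The lower bound in Girsanov's theorem. -/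
lemma lintegral_klRate_le_klDiv [IsProbabilityMeasure P] [IsProbabilityMeasure Q]
    [IsProbabilityMeasure R]
    (hk : TiltOn k κ V R P a b) (hR : ForwardOn r R a b) (hQ : ForwardOn u Q a b)
    (hr : RateBound r V a b) (hu : RateBound u V a b) (hrr : IsRate r) (hrate : IsRate u)
    (ha : 0 ≤ a) (hab : a ≤ b) :
    ∫⁻ τ in Ioc a b, klRate r u k R τ ≤ klDiv P Q := by
  set β : ℕ → ℝ → State D K → State D K → ℝ := fun n τ x y =>
    if y = x then 0 else Real.log (testRatio n (fluxP r k R τ x y) (fluxQ u k R τ x y))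
  have hf : ∀ x y, IntegrableOn (fun τ => fluxP r k R τ x y) (Ioc a b) ∧
      IntegrableOn (fun τ => fluxQ u k R τ x y) (Ioc a b) := fun x y => by
    have := hk.intervalIntegrable_terms hR hr hu hab MeasurableSet.univ x y
    exact ⟨(intervalIntegrable_iff_integrableOn_Ioc_of_le hab).1 this.1,
      (intervalIntegrable_iff_integrableOn_Ioc_of_le hab).1 this.2⟩
  have hfP : ∀ τ ∈ Icc a b, ∀ x y, y ≠ x → 0 ≤ fluxP r k R τ x y ∧ 0 ≤ fluxQ u k R τ x y :=
    fun τ hτ x y hxy => ⟨mul_nonneg (mass_nonneg _ _ _ _)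
      (mul_nonneg (hrr.nonneg τ y x hxy) (hk.nonneg τ hτ.1 hτ.2 y)),
      mul_nonneg (mass_nonneg _ _ _ _)
      (mul_nonneg (hk.nonneg τ hτ.1 hτ.2 x) (hrate.nonneg τ y x hxy))⟩
  have hβT : ∀ n, IsTest (β n) (Real.log ((n : ℝ) + 1)) a b := by
    intro n
    refine ⟨fun x y => ?_, fun τ x y => ?_⟩
    · simp only [β]
      split_ifs with h
      · exact aestronglyMeasurable_const
      · refine (Real.measurable_log.comp_aemeasurable
          ((measurable_testRatio n).comp_aemeasurable
            (AEMeasurable.prodMk (hf x y).1.1.aemeasurable (hf x y).2.1.aemeasurable)))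
          |>.aestronglyMeasurable
    · simp only [β]
      split_ifs with h
      · simpa using Real.log_nonneg (by simp)
      · exact abs_log_testRatio_le _ _ _
  have hβ0 : ∀ n τ x, β n τ x x = 0 := fun n τ x => by simp [β]
  have hE : ∀ n τ, girsanovExponent r u k R (β n) τ = ∑ x, ∑ y with y ≠ x,
      (fluxP r k R τ x y * Real.log (testRatio n (fluxP r k R τ x y) (fluxQ u k R τ x y))
        - fluxQ u k R τ x y * (testRatio n (fluxP r k R τ x y) (fluxQ u k R τ x y) - 1)) := by
    intro n τ
    rw [girsanovExponent_eq]
    refine Finset.sum_congr rfl fun x _ => Finset.sum_congr rfl fun y hy => ?_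
    have hy' := (Finset.mem_filter.1 hy).2
    simp only [β, hy', if_false]
    rw [Real.exp_log (testRatio_pos _ _ _)]
  -- The truncated optimal integrands are nonnegative and converge to the entropy rate, so Fatou's
  -- lemma applies and no domination is needed.
  have hE0 : ∀ n, ∀ τ ∈ Icc a b, 0 ≤ girsanovExponent r u k R (β n) τ := by
    intro n τ hτ
    rw [hE]
    refine Finset.sum_nonneg fun x _ => Finset.sum_nonneg fun y hy => ?_
    have h := hfP τ hτ x y (Finset.mem_filter.1 hy).2
    exact testRatio_nonneg n h.1 h.2
  have hint : ∀ n, IntegrableOn (girsanovExponent r u k R (β n)) (Ioc a b) := fun n =>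
    (intervalIntegrable_iff_integrableOn_Ioc_of_le hab).1
      (hk.intervalIntegrable_girsanovExponent hR hr hu hab (hβT n))
  calc ∫⁻ τ in Ioc a b, klRate r u k R τ
      = ∫⁻ τ in Ioc a b, liminf (fun n : ℕ =>
          ENNReal.ofReal (girsanovExponent r u k R (β n) τ)) atTop := by
        refine setLIntegral_congr_fun measurableSet_Ioc fun τ hτ => ?_
        have hτ' : τ ∈ Icc a b := ⟨hτ.1.le, hτ.2⟩
        refine (Tendsto.liminf_eq ?_).symm
        have e : ∀ n, ENNReal.ofReal (girsanovExponent r u k R (β n) τ) = ∑ x, ∑ y with y ≠ x,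
            ENNReal.ofReal (fluxP r k R τ x y *
              Real.log (testRatio n (fluxP r k R τ x y) (fluxQ u k R τ x y))
              - fluxQ u k R τ x y *
                (testRatio n (fluxP r k R τ x y) (fluxQ u k R τ x y) - 1)) := by
          intro n
          have h0 : ∀ x, ∀ y ∈ Finset.univ.filter (fun y => y ≠ x), 0 ≤ fluxP r k R τ x y *
              Real.log (testRatio n (fluxP r k R τ x y) (fluxQ u k R τ x y))
              - fluxQ u k R τ x y *
                (testRatio n (fluxP r k R τ x y) (fluxQ u k R τ x y) - 1) := fun x y hy => by
            have h := hfP τ hτ' x y (Finset.mem_filter.1 hy).2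
            exact testRatio_nonneg n h.1 h.2
          rw [hE, ENNReal.ofReal_sum_of_nonneg fun x _ => Finset.sum_nonneg (h0 x)]
          exact Finset.sum_congr rfl fun x _ => ENNReal.ofReal_sum_of_nonneg (h0 x)
        simp_rw [e]
        refine tendsto_finsetSum _ fun x _ => tendsto_finsetSum _ fun y hy => ?_
        have h := hfP τ hτ' x y (Finset.mem_filter.1 hy).2
        exact tendsto_testRatio h.1 h.2
    _ ≤ liminf (fun n : ℕ => ∫⁻ τ in Ioc a b,
          ENNReal.ofReal (girsanovExponent r u k R (β n) τ)) atTop :=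
        lintegral_liminf_le' fun n => (hint n).1.aemeasurable.ennreal_ofReal
    _ ≤ klDiv P Q := by
        refine liminf_le_of_frequently_le' (Frequently.of_forall fun n => ?_)
        rw [← ofReal_integral_eq_lintegral_ofReal (hint n)
          ((ae_restrict_mem measurableSet_Ioc).mono fun τ hτ => hE0 n τ ⟨hτ.1.le, hτ.2⟩),
          ← intervalIntegral.integral_of_le hab]
        exact girsanovExponent_le_klDiv hk hR hQ hr hu hrate ha hab (hβT n) (hβ0 n)

end

end DiscreteSampler

/-! ### Upper bound: the backward Euler step and its entropy cost. -/

namespace DiscreteSampler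

open InformationTheory

variable {D K N : ℕ}

/-- The easy half of the dual formula that `tendsto_testRatio` realizes: `genKL f g` dominates f log
ρ - g(ρ - 1) for every ρ > 0. The upper bound uses it with ρ = H y / H x. -/
lemma ofReal_mul_log_sub_le_genKL {f g ρ : ℝ} (hf : 0 ≤ f) (hg : 0 ≤ g) (hρ : 0 < ρ) :
    ENNReal.ofReal (f * Real.log ρ - g * (ρ - 1)) ≤ genKL f g := by
  unfold genKL
  split_ifs with h1 h2
  · simp [h1, h2]
  · exact le_top
  · refine ENNReal.ofReal_le_ofReal ?_
    have h3 := mul_log_sub_add_one_le_klFun (div_nonneg hf hg) hρ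
    have h4 : f * Real.log (f / g) - f + g = g * klFun (f / g) := by
      rw [klFun_apply]; field_simp; ring
    rw [h4, testRatio_eq_mul h1]
    exact mul_le_mul_of_nonneg_left h3 hg

/-- Homogeneity lets marginal masses and rates be pulled out of the divergence. The case c = 0
relies on the convention that both sides vanish, even when `genKL f g` is infinite. -/
lemma genKL_mul {c f g : ℝ} (hc : 0 ≤ c) :
    genKL (c * f) (c * g) = ENNReal.ofReal c * genKL f g := by
  rcases hc.eq_or_lt with rfl | hc
  · simp [genKL]
  unfold genKL
  by_cases hg : g = 0
  · by_cases hf : f = 0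
    · simp [hf, hg]
    · simp [hf, hg, hc.ne', hc]
  · rw [if_neg (mul_ne_zero hc.ne' hg), if_neg hg, ← ENNReal.ofReal_mul hc.le,
      mul_div_mul_left _ _ hc.ne']
    congr 1; ring

lemma ofReal_sum_le {ι : Type*} (t : Finset ι) (f : ι → ℝ) :
    ENNReal.ofReal (∑ i ∈ t, f i) ≤ ∑ i ∈ t, ENNReal.ofReal (f i) := by
  classical
  induction t using Finset.induction_on with
  | empty => simp
  | insert i t hi ih =>
    rw [Finset.sum_insert hi, Finset.sum_insert hi]
    exact ENNReal.ofReal_add_le.trans (add_le_add le_rfl ih)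

lemma sub_two_mul_sq_le_log {z : ℝ} (hz : -(1 / 2) ≤ z) : z - 2 * z ^ 2 ≤ Real.log (1 + z) := by
  have h1 : 0 < 1 + z := by linarith
  refine le_trans ?_ (Real.one_sub_inv_le_log_of_pos h1)
  have h2 : 1 - (1 + z)⁻¹ = z / (1 + z) := by field_simp; ring
  rw [h2, le_div_iff₀ h1]
  nlinarith [mul_nonneg (sq_nonneg z) (by linarith : 0 ≤ 1 + 2 * z)]

/-- Integrability of f is not required, because the Bochner integral of a non-integrable function is
0 by convention. -/
lemma integral_le_toReal_lintegral {α : Type*} [MeasurableSpace α] {μ : Measure α} {f : α → ℝ}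
    {F : α → ℝ≥0∞} (h : ∀ᵐ x ∂μ, ENNReal.ofReal (f x) ≤ F x) (hF : ∫⁻ x, F x ∂μ ≠ ⊤) :
    ∫ x, f x ∂μ ≤ (∫⁻ x, F x ∂μ).toReal := by
  by_cases hf : Integrable f μ
  · rw [integral_eq_lintegral_pos_part_sub_lintegral_neg_part hf]
    refine (sub_le_self _ ENNReal.toReal_nonneg).trans
      (ENNReal.toReal_mono hF (lintegral_mono_ae h))
  · rw [integral_undef hf]; exact ENNReal.toReal_nonneg

section

variable {r u : ℝ → State D K → State D K → ℝ} {V : ℝ → ℝ} {R P Q : Measure (PathSpace D K)}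
  {a b κ : ℝ} {k : ℝ → State D K → ℝ}

/-- The density in time of the relative entropy, on the event `A`. -/
noncomputable def klRateOn (r u : ℝ → State D K → State D K → ℝ) (k : ℝ → State D K → ℝ)
    (R : Measure (PathSpace D K)) (A : Set (PathSpace D K)) (τ : ℝ) : ℝ≥0∞ :=
  ∑ x, ENNReal.ofReal (mass R A τ x) * ∑ y with y ≠ x, genKL (r τ y x * k τ y) (k τ x * u τ y x)

lemma klRateOn_univ (τ : ℝ) : klRateOn r u k R univ τ = klRate r u k R τ := by
  unfold klRateOn klRate fluxP fluxQ
  refine Finset.sum_congr rfl fun x _ => ?_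
  rw [Finset.mul_sum]
  exact Finset.sum_congr rfl fun y _ => (genKL_mul (mass_nonneg _ _ _ _)).symm

lemma klRateOn_mono [IsFiniteMeasure R] {A B : Set (PathSpace D K)} (h : A ⊆ B) (τ : ℝ) :
    klRateOn r u k R A τ ≤ klRateOn r u k R B τ := by
  unfold klRateOn mass
  gcongr
  exact measure_ne_top _ _

/-- The rate is linear in the mass of the event, so splitting by a discrete history costs nothing.
-/
lemma sum_klRateOn [IsFiniteMeasure R] {α : Type*} [Fintype α] [MeasurableSpace α]
    [MeasurableSingletonClass α] {π : PathSpace D K → α} (hπ : Measurable π) (τ : ℝ) :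
    ∑ h, klRateOn r u k R {ω | π ω = h} τ = klRateOn r u k R univ τ := by
  unfold klRateOn
  rw [Finset.sum_comm]
  refine Finset.sum_congr rfl fun x _ => ?_
  rw [← Finset.sum_mul, ← ENNReal.ofReal_sum_of_nonneg fun _ _ => mass_nonneg _ _ _ _]
  congr 2
  unfold mass
  rw [univ_inter, ← sum_real_inter_fiber R hπ {ω | coord τ ω = x}]
  exact Finset.sum_congr rfl fun h _ => by rw [inter_comm]

/-- The backward Euler step. -/
noncomputable def eulerStep (u : ℝ → State D K → State D K → ℝ) (a b : ℝ) (H : State D K → ℝ)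
    (x : State D K) : ℝ :=
  H x + ∑ y, (∫ τ in a..b, u τ y x) * H y

/-- As the columns of the rate sum to zero, the step adds weighted differences of H. This shows it
to be an averaging operator when the step is short. -/
lemma eulerStep_eq (hrate : IsRate u) (hu : RateBound u V a b) (H : State D K → ℝ)
    (x : State D K) :
    eulerStep u a b H x = H x + ∑ y with y ≠ x, (∫ τ in a..b, u τ y x) * (H y - H x) := by
  unfold eulerStep
  have h := hrate.sum_integral hu x
  have h2 : ∑ y with y ≠ x, (∫ τ in a..b, u τ y x) * (H y - H x)
      = ∑ y, (∫ τ in a..b, u τ y x) * (H y - H x) := by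
    refine Finset.sum_filter_of_ne fun y _ hy => ?_
    rintro rfl
    simp at hy
  rw [h2]
  simp_rw [mul_sub]
  rw [Finset.sum_sub_distrib, ← Finset.sum_mul, h]
  ring

lemma sum_offdiag_le (hrate : IsRate u) (hu : RateBound u V a b) (hab : a ≤ b) (x : State D K) :
    ∑ y with y ≠ x, (∫ τ in a..b, u τ y x) ≤ ∫ τ in a..b, V τ := by
  have h := hrate.integral_diag hu x
  have h2 := (abs_le.1 (hu.abs_integral_le hab x x)).1
  linarith

lemma eulerStep_mem (hrate : IsRate u) (hu : RateBound u V a b) (hab : a ≤ b)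
    (hε : ∫ τ in a..b, V τ ≤ 1) {H : State D K → ℝ} {m M : ℝ} (hH : ∀ x, H x ∈ Icc m M)
    (x : State D K) : eulerStep u a b H x ∈ Icc m M := by
  rw [eulerStep_eq hrate hu]
  have h1 := (sum_offdiag_le hrate hu hab x).trans hε
  have hU : ∀ y ∈ Finset.univ.filter (fun y => y ≠ x), 0 ≤ ∫ τ in a..b, u τ y x :=
    fun y hy => hrate.integral_nonneg hab (Finset.mem_filter.1 hy).2
  have h2 : ∑ y with y ≠ x, (∫ τ in a..b, u τ y x) * (H y - H x)
      ≤ ∑ y with y ≠ x, (∫ τ in a..b, u τ y x) * (M - H x) :=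
    Finset.sum_le_sum fun y hy => mul_le_mul_of_nonneg_left (by linarith [(hH y).2]) (hU y hy)
  have h3 : ∑ y with y ≠ x, (∫ τ in a..b, u τ y x) * (m - H x)
      ≤ ∑ y with y ≠ x, (∫ τ in a..b, u τ y x) * (H y - H x) :=
    Finset.sum_le_sum fun y hy => mul_le_mul_of_nonneg_left (by linarith [(hH y).1]) (hU y hy)
  rw [← Finset.sum_mul] at h2 h3
  have hx := hH x
  constructor
  · nlinarith [hx.1]
  · nlinarith [hx.2]

/-- The backward step acting on H is the adjoint of the forward Euler step acting on masses, so Q(A,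
L H) differs from Q(A, H(X_b)) only by the Euler error. -/
lemma ForwardOn.eulerStep_le [IsFiniteMeasure Q] (hQ : ForwardOn u Q a b) (hu : RateBound u V a b)
    (hab : a ≤ b) {A : Set (PathSpace D K)} (hA : MeasurableSet[past a] A)
    {H : State D K → ℝ} {M : ℝ} (hH0 : ∀ x, 0 ≤ H x) (hHM : ∀ x, H x ≤ M) :
    ∑ x, mass Q A a x * eulerStep u a b H x
      ≤ ∑ y, mass Q A b y * H y
        + Fintype.card (State D K) * M * (Q.real A * (∫ τ in a..b, V τ) ^ 2) := by
  have h1 : ∑ x, mass Q A a x * eulerStep u a b H x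
      = ∑ y, (mass Q A a y + ∑ z, (∫ τ in a..b, u τ y z) * mass Q A a z) * H y := by
    unfold eulerStep
    simp_rw [mul_add, add_mul, Finset.sum_add_distrib, Finset.mul_sum, Finset.sum_mul]
    congr 1
    rw [Finset.sum_comm]
    exact Finset.sum_congr rfl fun y _ => Finset.sum_congr rfl fun z _ => by ring
  rw [h1, ← sub_le_iff_le_add', ← Finset.sum_sub_distrib]
  calc _ ≤ ∑ y : State D K, M * (Q.real A * (∫ τ in a..b, V τ) ^ 2) := ?_
    _ = _ := by simp; ring
  refine Finset.sum_le_sum fun y _ => ?_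
  have h2 := (abs_le.1 (hQ.abs_euler_le hu hab hA y)).1
  have h3 : (mass Q A a y + ∑ z, (∫ τ in a..b, u τ y z) * mass Q A a z) - mass Q A b y
      ≤ Q.real A * (∫ τ in a..b, V τ) ^ 2 := by linarith
  rw [← sub_mul, mul_comm M]
  exact mul_le_mul h3 (hHM y) (hH0 y) (mul_nonneg measureReal_nonneg (sq_nonneg _))

lemma TiltOn.real_le [IsFiniteMeasure R] [IsFiniteMeasure P] (hk : TiltOn k κ V R P a b)
    (hab : a ≤ b) {A : Set (PathSpace D K)} (hA : MeasurableSet[past a] A) :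
    P.real A ≤ κ * R.real A := by
  rw [← sum_mass P A a, ← sum_mass R A a, Finset.mul_sum]
  refine Finset.sum_le_sum fun x _ => ?_
  rw [hk.mass_eq a le_rfl hab A hA x, mul_comm]
  exact mul_le_mul_of_nonneg_right (hk.le a le_rfl hab x) (mass_nonneg _ _ _ _)

/-- Write the Euler step as H(x)(1 + z(x)), with z the compensator of the relative jumps φ = H y / H
x - 1. The change of E log H is the sum of the jumps ψ = log (H y / H x), so after subtracting z one
has a Girsanov integrand with φ = exp ψ - 1, which is at most the entropy rate. Replacing z by log
(1 + z) costs 2 z², quadratic again. The restriction ∫ V ≤ 1/2 keeps z ≥ -1/2. -/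
lemma TiltOn.log_eulerStep_le [IsFiniteMeasure P] [IsProbabilityMeasure R]
    (hk : TiltOn k κ V R P a b) (hR : ForwardOn r R a b)
    (hr : RateBound r V a b) (hu : RateBound u V a b) (hrr : IsRate r) (hrate : IsRate u)
    (ha : 0 ≤ a) (hab : a ≤ b) (hε : ∫ τ in a..b, V τ ≤ 1 / 2)
    {A : Set (PathSpace D K)} (hA : MeasurableSet[past a] A)
    {H : State D K → ℝ} {m M : ℝ} (hm : 0 < m) (hH : ∀ x, H x ∈ Icc m M)
    (hI : ∫⁻ τ in Ioc a b, klRateOn r u k R A τ ≠ ⊤) :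
    ∑ y, mass P A b y * Real.log (H y) ≤ ∑ x, mass P A a x * Real.log (eulerStep u a b H x)
      + (∫⁻ τ in Ioc a b, klRateOn r u k R A τ).toReal
      + ((Fintype.card (State D K)) ^ 2 * (M / m * (3 * κ + 2)) + κ * (2 * (M / m) ^ 2))
        * (R.real A * (∫ τ in a..b, V τ) ^ 2) := by
  have hκ := hk.bound_nonneg hab
  have hHpos : ∀ x, 0 < H x := fun x => hm.trans_le (hH x).1
  have hratio : ∀ x y, H y / H x ≤ M / m := fun x y =>
    div_le_div₀ ((hHpos y).le.trans (hH y).2) (hH y).2 hm (hH x).1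
  have hratio0 : ∀ x y, 0 < H y / H x := fun x y => div_pos (hHpos y) (hHpos x)
  set ε := ∫ τ in a..b, V τ
  have hε0 : 0 ≤ ε := hr.integral_nonneg hab
  have hMm : ∀ _ : State D K, 1 ≤ M / m := fun x => by
    have := hratio x x
    rwa [div_self (hHpos x).ne'] at this
  set ψ : State D K → State D K → ℝ := fun x y => Real.log (H y / H x)
  set φ : State D K → State D K → ℝ := fun x y => H y / H x - 1
  have hψ : ∀ x y, |ψ x y| ≤ M / m := by
    intro x y
    have h1 : ∀ x y, Real.log (H y / H x) ≤ M / m := fun x y =>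
      (Real.log_le_sub_one_of_pos (hratio0 x y)).trans (by linarith [hratio x y])
    rw [abs_le]
    refine ⟨?_, h1 x y⟩
    have h2 := h1 y x
    have h3 : Real.log (H x / H y) = -Real.log (H y / H x) := by
      rw [← Real.log_inv, inv_div]
    rw [h3] at h2
    simp only [ψ]; linarith
  have hφ : ∀ x y, |φ x y| ≤ M / m := by
    intro x y
    rw [abs_le]
    have := hMm x
    constructor <;> simp only [φ] <;> linarith [hratio x y, hratio0 x y]
  set z : State D K → ℝ := fun x => ∑ y with y ≠ x, (∫ τ in a..b, u τ y x) * φ x y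
  have hz : ∀ x, eulerStep u a b H x = H x * (1 + z x) := by
    intro x
    rw [eulerStep_eq hrate hu, mul_add, mul_one, Finset.mul_sum]
    congr 1
    refine Finset.sum_congr rfl fun y _ => ?_
    simp only [φ]
    have := (hHpos x).ne'
    field_simp
  have hU : ∀ x, ∀ y ∈ Finset.univ.filter (fun y => y ≠ x), 0 ≤ ∫ τ in a..b, u τ y x :=
    fun x y hy => hrate.integral_nonneg hab (Finset.mem_filter.1 hy).2
  have hz1 : ∀ x, -(1 / 2) ≤ z x := by
    intro x
    have h1 := (sum_offdiag_le hrate hu hab x).trans hε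
    have h2 : -∑ y with y ≠ x, (∫ τ in a..b, u τ y x) ≤ z x := by
      rw [← Finset.sum_neg_distrib]
      refine Finset.sum_le_sum fun y hy => ?_
      have h3 : -1 ≤ φ x y := by simp only [φ]; linarith [hratio0 x y]
      nlinarith [hU x y hy]
    linarith
  have hz2 : ∀ x, z x ^ 2 ≤ (M / m) ^ 2 * ε ^ 2 := by
    intro x
    have h1 : |z x| ≤ ε * (M / m) := by
      refine (abs_sum_mul_le _ _ _ fun y _ => hφ x y).trans ?_
      refine mul_le_mul_of_nonneg_right ?_ (zero_le_one.trans (hMm x))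
      refine le_trans (Finset.sum_le_sum fun y hy => (abs_of_nonneg (hU x y hy)).le) ?_
      exact sum_offdiag_le hrate hu hab x
    rw [← sq_abs, ← mul_pow, mul_comm]
    exact pow_le_pow_left₀ (abs_nonneg _) h1 2
  -- compare with the value at `a`
  have hsplit : ∑ y, mass P A b y * Real.log (H y) - ∑ x, mass P A a x * Real.log (H x)
      = ∑ x, ∑ y with y ≠ x, mass P (A ∩ {ω | coord a ω = x}) b y * ψ x y := by
    have e1 : ∑ y, mass P A b y * Real.log (H y)
        = ∑ x, ∑ y, mass P (A ∩ {ω | coord a ω = x}) b y * Real.log (H y) := by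
      rw [Finset.sum_comm]
      refine Finset.sum_congr rfl fun y _ => ?_
      rw [← Finset.sum_mul]
      congr 1
      unfold mass
      rw [← sum_real_inter_fiber P (measurable_coord a)]
      exact Finset.sum_congr rfl fun x _ => by rw [inter_right_comm]
    have e2 : ∑ x, mass P A a x * Real.log (H x)
        = ∑ x, ∑ y, mass P (A ∩ {ω | coord a ω = x}) b y * Real.log (H x) := by
      refine Finset.sum_congr rfl fun x _ => ?_
      rw [← Finset.sum_mul, sum_mass]; rfl
    rw [e1, e2, ← Finset.sum_sub_distrib]
    refine Finset.sum_congr rfl fun x _ => ?_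
    rw [← Finset.sum_sub_distrib]
    have e3 : ∀ y, mass P (A ∩ {ω | coord a ω = x}) b y * Real.log (H y)
        - mass P (A ∩ {ω | coord a ω = x}) b y * Real.log (H x)
        = mass P (A ∩ {ω | coord a ω = x}) b y * ψ x y := fun y => by
      simp only [ψ]
      rw [Real.log_div (hHpos y).ne' (hHpos x).ne', mul_sub]
    simp_rw [e3]
    refine (Finset.sum_filter_of_ne fun y _ hy => ?_).symm
    rintro rfl
    exact hy (by simp [ψ])
  have hst := (abs_le.1 (hk.abs_step_sub_le hR hr hu ha hab hA hψ hφ)).2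
  -- Here ψ = log ρ and φ = ρ - 1 for the single positive ratio ρ = H y / H x, so the dual bound for
  -- `genKL` applies edge by edge.
  have hint : ∫ τ in a..b, girsanovIntegrand r u k R A ψ φ τ
      ≤ (∫⁻ τ in Ioc a b, klRateOn r u k R A τ).toReal := by
    rw [intervalIntegral.integral_of_le hab]
    refine integral_le_toReal_lintegral ?_ hI
    refine (ae_restrict_mem measurableSet_Ioc).mono fun τ hτ => ?_
    unfold girsanovIntegrand klRateOn
    refine (ofReal_sum_le _ _).trans (Finset.sum_le_sum fun x _ => ?_)
    rw [Finset.mul_sum]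
    refine (ofReal_sum_le _ _).trans (Finset.sum_le_sum fun y hy => ?_)
    have hy' := (Finset.mem_filter.1 hy).2
    rw [← genKL_mul (mass_nonneg _ _ _ _)]
    refine ofReal_mul_log_sub_le_genKL ?_ ?_ (hratio0 x y)
    · exact mul_nonneg (mass_nonneg _ _ _ _) (mul_nonneg (hrr.nonneg τ y x hy')
        (hk.nonneg τ hτ.1.le hτ.2 y))
    · exact mul_nonneg (mass_nonneg _ _ _ _) (mul_nonneg (hk.nonneg τ hτ.1.le hτ.2 x)
        (hrate.nonneg τ y x hy'))
  have hlog : ∑ x, mass P A a x * (Real.log (H x) + z x) - κ * (2 * (M / m) ^ 2) *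
      (R.real A * ε ^ 2) ≤ ∑ x, mass P A a x * Real.log (eulerStep u a b H x) := by
    have e1 : ∀ x, mass P A a x * (Real.log (H x) + z x) - mass P A a x *
        (2 * (M / m) ^ 2 * ε ^ 2) ≤ mass P A a x * Real.log (eulerStep u a b H x) := by
      intro x
      rw [hz, Real.log_mul (hHpos x).ne' (by linarith [hz1 x]), ← mul_sub]
      refine mul_le_mul_of_nonneg_left ?_ (mass_nonneg _ _ _ _)
      have := sub_two_mul_sq_le_log (hz1 x)
      linarith [hz2 x]
    have e2 := Finset.sum_le_sum fun x (_ : x ∈ Finset.univ) => e1 x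
    rw [Finset.sum_sub_distrib, ← Finset.sum_mul, sum_mass] at e2
    have e3 := mul_le_mul_of_nonneg_right (hk.real_le hab hA)
      (by positivity : 0 ≤ 2 * (M / m) ^ 2 * ε ^ 2)
    linarith
  have hcomb : ∑ x, mass P A a x * (Real.log (H x) + z x)
      = ∑ x, mass P A a x * Real.log (H x) + ∑ x, ∑ y with y ≠ x,
        mass P A a x * (∫ τ in a..b, u τ y x) * φ x y := by
    simp_rw [mul_add]
    rw [Finset.sum_add_distrib]
    congr 1
    refine Finset.sum_congr rfl fun x _ => ?_
    simp only [z, Finset.mul_sum, mul_assoc]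
  simp_rw [Finset.sum_sub_distrib] at hst
  linarith

end

end DiscreteSampler

/-! ### Integrating out the last coordinate. -/

namespace DiscreteSampler

open InformationTheory

variable {D K N : ℕ}

/-- `L` maps functions with values in `[m, M]` to functions with values in `[m, M]`. -/
def PreservesBounds (L : (State D K → ℝ) → State D K → ℝ) (m M : ℝ) : Prop :=
  ∀ H : State D K → ℝ, (∀ x, H x ∈ Icc m M) → ∀ x, L H x ∈ Icc m M

lemma setLIntegral_Ioc_add {f : ℝ → ℝ≥0∞} {a b c : ℝ} (hab : a ≤ b) (hbc : b ≤ c) :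
    (∫⁻ τ in Ioc a b, f τ) + ∫⁻ τ in Ioc b c, f τ = ∫⁻ τ in Ioc a c, f τ := by
  rw [← Ioc_union_Ioc_eq_Ioc hab hbc, lintegral_union measurableSet_Ioc
    (Ioc_disjoint_Ioc_of_le le_rfl)]

section

variable {r u : ℝ → State D K → State D K → ℝ} {V : ℝ → ℝ} {R P Q : Measure (PathSpace D K)}
  {a b κ : ℝ} {k : ℝ → State D K → ℝ}

/-- The approximate backward transition operator over an interval. -/
lemma exists_backward_operator [IsFiniteMeasure P] [IsFiniteMeasure Q] [IsProbabilityMeasure R]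
    (hk : TiltOn k κ V R P a b) (hR : ForwardOn r R a b) (hQ : ForwardOn u Q a b)
    (hr : RateBound r V a b) (hu : RateBound u V a b) (hrr : IsRate r) (hrate : IsRate u)
    (ha : 0 ≤ a) (hab : a ≤ b) (hI : ∫⁻ τ in Ioc a b, klRateOn r u k R univ τ ≠ ⊤)
    {m M η : ℝ} (hm : 0 < m) (hη : 0 < η) :
    ∃ L : (State D K → ℝ) → State D K → ℝ, PreservesBounds L m M ∧
      ∀ A, MeasurableSet[past a] A → ∀ H : State D K → ℝ, (∀ x, H x ∈ Icc m M) →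
        ∑ y, mass P A b y * Real.log (H y) ≤ ∑ x, mass P A a x * Real.log (L H x)
          + (∫⁻ τ in Ioc a b, klRateOn r u k R A τ).toReal + η * R.real A ∧
        ∑ x, mass Q A a x * L H x ≤ ∑ y, mass Q A b y * H y + η * Q.real A := by
  have hκ := hk.bound_nonneg hab
  by_cases hmM : m ≤ M
  swap
  · refine ⟨id, fun H hH => hH, fun A _ H hH => ?_⟩
    exfalso
    obtain ⟨ω⟩ := nonempty_of_isProbabilityMeasure R
    have := hH (coord 0 ω)
    exact hmM (this.1.trans this.2)
  set S : ℝ := (Fintype.card (State D K) : ℝ)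
  have hM : 0 < M := hm.trans_le hmM
  -- The first summand is the one-step constant for P and the second the one for Q, so one grid
  -- controls both errors.
  set C : ℝ := (S ^ 2 * (M / m * (3 * κ + 2)) + κ * (2 * (M / m) ^ 2)) + S * M
  have hC : 0 ≤ C := by positivity
  obtain ⟨n1, hn1⟩ := exists_grid_integral_le hr.integrable_bound hab (η := 1 / 2) (by norm_num)
  obtain ⟨n2, hn2⟩ := exists_grid_sum_sq_le hr.integrable_bound hab hr.nonneg
    (η := η / (C + 1)) (by positivity)
  set n := max (max n1 n2) 1
  have hn : 0 < n := by simp only [n]; omega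
  have hnn1 : n1 ≤ n := by simp only [n]; omega
  have hnn2 : n2 ≤ n := by simp only [n]; omega
  set τ := grid a b n
  have hmem : ∀ j, τ j ∈ Icc a b := grid_mem hab hn
  have hmono : ∀ j, τ j ≤ τ (j + 1) := fun j => grid_mono hab (Nat.le_succ j)
  have ha0 : τ 0 = a := grid_zero
  have hb0 : τ n = b := grid_self hn
  have key : ∀ j, ∃ L : (State D K → ℝ) → State D K → ℝ, PreservesBounds L m M ∧
      ∀ A, MeasurableSet[past a] A → ∀ H : State D K → ℝ, (∀ x, H x ∈ Icc m M) →
        ∑ y, mass P A (τ j) y * Real.log (H y) ≤ ∑ x, mass P A a x * Real.log (L H x)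
          + (∫⁻ τ in Ioc a (τ j), klRateOn r u k R A τ).toReal
          + C * (∑ i ∈ Finset.range j, (∫ σ in τ i..τ (i + 1), V σ) ^ 2) * R.real A ∧
        ∑ x, mass Q A a x * L H x ≤ ∑ y, mass Q A (τ j) y * H y
          + C * (∑ i ∈ Finset.range j, (∫ σ in τ i..τ (i + 1), V σ) ^ 2) * Q.real A := by
    intro j
    induction j with
    | zero => exact ⟨id, fun H hH => hH, fun A _ H _ => by simp [ha0]⟩
    | succ j ih =>
      obtain ⟨L, hL, hLA⟩ := ih
      have hrj := hr.mono (hmem j).1 (hmono j) (hmem (j + 1)).2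
      have huj := hu.mono (hmem j).1 (hmono j) (hmem (j + 1)).2
      have hεj := hn1 n hnn1 hn j
      have hmemE : ∀ H : State D K → ℝ, (∀ x, H x ∈ Icc m M) →
          ∀ x, eulerStep u (τ j) (τ (j + 1)) H x ∈ Icc m M := fun H hH x =>
        eulerStep_mem hrate huj (hmono j) (hεj.trans (by norm_num)) hH x
      -- Backward in time, the latest Euler step acts first. The operator does not depend on A or H,
      -- which is essential when it is applied to all histories simultaneously.
      refine ⟨fun H => L (eulerStep u (τ j) (τ (j + 1)) H), fun H hH => hL _ (hmemE H hH),
        fun A hA H hH => ?_⟩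
      have hA' := past_mono (hmem j).1 A hA
      obtain ⟨h1, h2⟩ := hLA A hA _ (hmemE H hH)
      have hIA : ∫⁻ τ in Ioc a b, klRateOn r u k R A τ ≠ ⊤ :=
        ne_top_of_le_ne_top hI (lintegral_mono fun τ => klRateOn_mono (subset_univ _) τ)
      have hIj : ∫⁻ τ in Ioc (τ j) (τ (j + 1)), klRateOn r u k R A τ ≠ ⊤ :=
        ne_top_of_le_ne_top hIA
          (lintegral_mono_set (Ioc_subset_Ioc (hmem j).1 (hmem (j + 1)).2))
      have hIj' : ∫⁻ τ in Ioc a (τ j), klRateOn r u k R A τ ≠ ⊤ :=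
        ne_top_of_le_ne_top hIA (lintegral_mono_set (Ioc_subset_Ioc le_rfl (hmem j).2))
      have h3 := (hk.mono (hmem j).1 (hmem (j + 1)).2).log_eulerStep_le
        (hR.mono (hmem j).1 (hmem (j + 1)).2) hrj huj hrr hrate (ha.trans (hmem j).1) (hmono j)
        hεj hA' hm hH hIj
      have h4 := (hQ.mono (hmem j).1 (hmem (j + 1)).2).eulerStep_le huj (hmono j) hA'
        (fun x => hm.le.trans (hH x).1) fun x => (hH x).2
      rw [← setLIntegral_Ioc_add (hmem j).1 (hmono j), ENNReal.toReal_add hIj' hIj,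
        Finset.sum_range_succ]
      have e1 : (S ^ 2 * (M / m * (3 * κ + 2)) + κ * (2 * (M / m) ^ 2)) ≤ C := by
        have : 0 ≤ S * M := by positivity
        simp only [C]; linarith
      have e2 : S * M ≤ C := by
        have : 0 ≤ (S ^ 2 * (M / m * (3 * κ + 2)) + κ * (2 * (M / m) ^ 2)) := by positivity
        simp only [C]; linarith
      have e3 := mul_le_mul_of_nonneg_right e1
        (mul_nonneg (measureReal_nonneg (μ := R) (s := A))
          (sq_nonneg (∫ σ in τ j..τ (j + 1), V σ)))
      have e4 := mul_le_mul_of_nonneg_right e2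
        (mul_nonneg (measureReal_nonneg (μ := Q) (s := A))
          (sq_nonneg (∫ σ in τ j..τ (j + 1), V σ)))
      constructor <;> linarith
  obtain ⟨L, hL, hLA⟩ := key n
  refine ⟨L, hL, fun A hA H hH => ?_⟩
  obtain ⟨h1, h2⟩ := hLA A hA H hH
  rw [hb0] at h1 h2
  have hW : C * (∑ i ∈ Finset.range n, (∫ σ in τ i..τ (i + 1), V σ) ^ 2) ≤ η := by
    have h3 := hn2 n hnn2 hn
    rw [le_div_iff₀ (by positivity)] at h3
    have : 0 ≤ ∑ i ∈ Finset.range n, (∫ σ in τ i..τ (i + 1), V σ) ^ 2 :=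
      Finset.sum_nonneg fun _ _ => sq_nonneg _
    simp only [τ] at this ⊢
    linarith
  have e3 := mul_le_mul_of_nonneg_right hW (measureReal_nonneg (μ := R) (s := A))
  have e4 := mul_le_mul_of_nonneg_right hW (measureReal_nonneg (μ := Q) (s := A))
  exact ⟨by linarith, by linarith⟩

lemma coord_coe (i : Icc (0 : ℝ) 1) (ω : PathSpace D K) : coord (i : ℝ) ω = ω i := by
  unfold coord; rw [projIcc_val]

lemma setIntegral_eq_sum_fiber {Ω α : Type*} [MeasurableSpace Ω] [Fintype α] [MeasurableSpace α]
    [MeasurableSingletonClass α] {P : Measure Ω} {f : Ω → α} (hf : Measurable f)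
    {ψ : Ω → ℝ} (hψ : Integrable ψ P) :
    ∫ ω, ψ ω ∂P = ∑ y, ∫ ω in {ω | f ω = y}, ψ ω ∂P := by
  have h : (⋃ y, {ω | f ω = y}) = univ := by ext ω; simp
  rw [← setIntegral_univ, ← h, integral_iUnion (s := fun y => {ω | f ω = y})
    (fun y => hf (measurableSet_singleton y)) ?_ ?_, tsum_fintype]
  · exact fun y z hyz => Set.disjoint_left.2 fun ω h1 h2 => hyz (h1.symm.trans h2)
  · exact hψ.integrableOn

/-- Superadditivity is enough here, and unlike additivity it needs no measurability of the
integrands. -/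
lemma sum_lintegral_le {α ι : Type*} [MeasurableSpace α] (t : Finset ι) (f : ι → α → ℝ≥0∞)
    (μ : Measure α) : ∑ i ∈ t, ∫⁻ x, f i x ∂μ ≤ ∫⁻ x, ∑ i ∈ t, f i x ∂μ := by
  classical
  induction t using Finset.induction_on with
  | empty => simp
  | insert i t hi ih =>
    simp only [Finset.sum_insert hi]
    exact (add_le_add le_rfl ih).trans (le_lintegral_add _ _)

/-- Removing the last of finitely many coordinates. -/
lemma exists_remove_coordinate [IsProbabilityMeasure P] [IsProbabilityMeasure Q]
    [IsProbabilityMeasure R] {s t : Icc (0 : ℝ) 1} (hst : s < t)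
    (hk : TiltOn k κ V R P s t) (hR : ForwardOn r R s t) (hQ : ForwardOn u Q s t)
    (hr : RateBound r V s t) (hu : RateBound u V s t) (hrr : IsRate r) (hrate : IsRate u)
    (hI : ∫⁻ τ in Ioc (s : ℝ) t, klRateOn r u k R univ τ ≠ ⊤)
    {m M η : ℝ} (hm : 0 < m) (hη : 0 < η) {J : Finset (Icc (0 : ℝ) 1)} (hs : s ∈ J)
    (hJ : ∀ j ∈ J, j ≤ s) {F : PathSpace D K → ℝ} (hF : DependsOn F (insert t J : Finset _))
    (hFm : ∀ ω, F ω ∈ Icc m M) :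
    ∃ F' : PathSpace D K → ℝ, DependsOn F' J ∧ (∀ ω, F' ω ∈ Icc m M) ∧
      ∫ ω, Real.log (F ω) ∂P ≤ ∫ ω, Real.log (F' ω) ∂P
        + (∫⁻ τ in Ioc (s : ℝ) t, klRateOn r u k R univ τ).toReal + η ∧
      ∫ ω, F' ω ∂Q ≤ ∫ ω, F ω ∂Q + η := by
  classical
  have hstR : (s : ℝ) ≤ t := hst.le
  have hs0 : (0 : ℝ) ≤ s := s.2.1
  have htJ : t ∉ J := fun h => absurd (hJ t h) (not_le.2 hst)
  obtain ⟨L, hL, hLA⟩ := exists_backward_operator hk hR hQ hr hu hrr hrate hs0 hstR hI (M := M) hm hη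
  obtain ⟨ω₀⟩ := nonempty_of_isProbabilityMeasure R
  -- With the history fixed, F is a function of X_t alone. The operator is applied to that function
  -- and the result is read off at X_s.
  set F' : PathSpace D K → ℝ := fun ω => L (fun y => F (Function.update ω t y)) (ω s)
  have hF'm : ∀ ω, F' ω ∈ Icc m M := fun ω => hL _ (fun y => hFm _) _
  have hF' : DependsOn F' J := by
    intro x y hxy
    have h1 : (fun z => F (Function.update x t z)) = fun z => F (Function.update y t z) := by
      ext z
      refine hF fun i hi => ?_
      by_cases hit : i = t
      · subst hit; simp
      · rw [Function.update_of_ne hit, Function.update_of_ne hit]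
        have : i ∈ J := by simpa [hit] using hi
        exact hxy i this
    simp only [F', h1, hxy s hs]
  have hFmeas := measurable_of_dependsOn hF
  have hF'meas := measurable_of_dependsOn hF'
  refine ⟨F', hF', hF'm, ?_⟩
  -- the partition by the history
  set π : PathSpace D K → (J → State D K) := fun ω j => ω j
  have hπ' : Measurable[past (s : ℝ)] π := by
    refine @measurable_pi_lambda _ _ _ (past (s : ℝ)) _ π fun j => ?_
    have := measurable_coord_past (D := D) (K := K) (r := (j : Icc (0 : ℝ) 1)) (s := (s : ℝ))
      j.1.2.1 (hJ j j.2)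
    have e : (coord ((j : Icc (0 : ℝ) 1) : ℝ) : PathSpace D K → State D K) = fun ω => ω j := by
      ext ω; rw [coord_coe]
    rwa [e] at this
  have hπ : Measurable π := hπ'.mono (past_le _) le_rfl
  -- An arbitrary path ω₀ fills in the times outside J. It does not influence F, which depends only
  -- on J and t, and t is overwritten.
  set ext : (J → State D K) → PathSpace D K := fun h i => if hi : i ∈ J then h ⟨i, hi⟩ else ω₀ i
  set H : (J → State D K) → State D K → ℝ := fun h y => F (Function.update (ext h) t y)
  have hH : ∀ h y, H h y ∈ Icc m M := fun h y => hFm _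
  have hA : ∀ h, MeasurableSet[past (s : ℝ)] {ω | π ω = h} := fun h =>
    hπ' (measurableSet_singleton h)
  have hFH : ∀ h ω, π ω = h → F ω = H h (coord (t : ℝ) ω) := by
    rintro h ω rfl
    refine hF fun i hi => ?_
    rw [coord_coe]
    by_cases hit : i = t
    · subst hit; simp
    · have : i ∈ J := by simpa [hit] using hi
      rw [Function.update_of_ne hit]
      simp [ext, this, π]
  have hF'H : ∀ h ω, π ω = h → F' ω = L (H h) (coord (s : ℝ) ω) := by
    rintro h ω rfl
    rw [coord_coe]
    simp only [F', H]
    congr 1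
    ext z
    refine hF fun i hi => ?_
    by_cases hit : i = t
    · subst hit; simp
    · have : i ∈ J := by simpa [hit] using hi
      rw [Function.update_of_ne hit, Function.update_of_ne hit]
      simp [ext, this, π]
  have hsum : ∀ (μ : Measure (PathSpace D K)) [IsProbabilityMeasure μ] (g : ℝ → ℝ)
      (G : PathSpace D K → ℝ) (Hh : (J → State D K) → State D K → ℝ) (τ : ℝ),
      Integrable (fun ω => g (G ω)) μ → (∀ h ω, π ω = h → G ω = Hh h (coord τ ω)) →
      ∫ ω, g (G ω) ∂μ = ∑ h, ∑ y, mass μ {ω | π ω = h} τ y * g (Hh h y) := by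
    intro μ _ g G Hh τ hi hGH
    rw [setIntegral_eq_sum_fiber hπ hi]
    refine Finset.sum_congr rfl fun h _ => ?_
    have := integral_eq_sum_fiber μ (measurable_coord τ) {ω | π ω = h} (fun y => g (Hh h y))
    unfold mass
    rw [← this]
    refine setIntegral_congr_fun (past_le _ _ (hA h)) fun ω hω => ?_
    simp only [hGH h ω hω]
  have hreal : ∀ (μ : Measure (PathSpace D K)) [IsProbabilityMeasure μ],
      ∑ h, μ.real {ω | π ω = h} = 1 := fun μ _ => by
    have := sum_real_inter_fiber μ hπ univ
    simpa using this
  have hlogF := hsum P Real.log F H t (integrable_log_of_bounds hFmeas hm (fun ω => (hFm ω).1)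
    fun ω => (hFm ω).2) hFH
  have hlogF' := hsum P Real.log F' (fun h => L (H h)) s (integrable_log_of_bounds hF'meas hm
    (fun ω => (hF'm ω).1) fun ω => (hF'm ω).2) hF'H
  have hQF := hsum Q id F H t (integrable_of_bounds hFmeas (fun ω => (hFm ω).1)
    fun ω => (hFm ω).2) hFH
  have hQF' := hsum Q id F' (fun h => L (H h)) s (integrable_of_bounds hF'meas
    (fun ω => (hF'm ω).1) fun ω => (hF'm ω).2) hF'H
  simp only [id] at hQF hQF'
  constructor
  · rw [hlogF, hlogF']
    have h1 := Finset.sum_le_sum fun h (_ : h ∈ Finset.univ) => (hLA _ (hA h) (H h) (hH h)).1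
    rw [Finset.sum_add_distrib, Finset.sum_add_distrib, ← Finset.mul_sum, hreal, mul_one] at h1
    refine h1.trans ?_
    gcongr
    -- The entropy costs of the individual histories add up to the total cost over (s, t].
    rw [← ENNReal.toReal_sum fun h _ => ?_]
    · refine ENNReal.toReal_mono hI ((sum_lintegral_le _ _ _).trans_eq ?_)
      simp_rw [sum_klRateOn hπ]
    · exact ne_top_of_le_ne_top hI (lintegral_mono fun τ => klRateOn_mono (subset_univ _) τ)
  · rw [hQF, hQF']
    have h1 := Finset.sum_le_sum fun h (_ : h ∈ Finset.univ) => (hLA _ (hA h) (H h) (hH h)).2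
    rwa [Finset.sum_add_distrib, ← Finset.mul_sum, hreal, mul_one] at h1

end

end DiscreteSampler

/-! ### Girsanov's theorem on the open unit interval, with conditions at the two ends. -/

namespace DiscreteSampler

open InformationTheory

variable {D K N : ℕ}

/-- The setting of Girsanov's theorem on `(0,1)`: `R` and `Q` satisfy the forward equations with the
rates `r` and `u`, and `P` has density `k_t(X_t)` with respect to `R` on the past of `t`. -/
structure GirsanovSetting (r u : ℝ → State D K → State D K → ℝ) (k : ℝ → State D K → ℝ) (κ : ℝ)
    (V : ℝ → ℝ) (R P Q : Measure (PathSpace D K)) : Prop where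
  tilt : ∀ a b, 0 < a → a ≤ b → b < 1 → TiltOn k κ V R P a b
  forward_ref : ∀ a b, 0 < a → a ≤ b → b < 1 → ForwardOn r R a b
  forward : ∀ a b, 0 < a → a ≤ b → b < 1 → ForwardOn u Q a b
  bound_ref : ∀ a b, 0 < a → a ≤ b → b < 1 → RateBound r V a b
  bound : ∀ a b, 0 < a → a ≤ b → b < 1 → RateBound u V a b
  rate_ref : IsRate r
  rate : IsRate u
  left_cont_tilt : Tendsto (fun t => P.real {ω | coord t ω ≠ coord 1 ω}) (𝓝[<] 1) (𝓝 0)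
  left_cont : Tendsto (fun t => Q.real {ω | coord t ω ≠ coord 1 ω}) (𝓝[<] 1) (𝓝 0)

/-- Asymptotically at time `0`, the joint laws of `(X_0, X_ε)` do not contribute to the relative
entropy (in its variational form). -/
def StartCondition (P Q : Measure (PathSpace D K)) : Prop :=
  ∀ m M δ : ℝ, 0 < m → 0 < δ → ∀ᶠ ε in 𝓝[>] (0 : ℝ), ∀ F : State D K → State D K → ℝ,
    (∀ x y, F x y ∈ Icc m M) →
    ∫ ω, Real.log (F (coord 0 ω) (coord ε ω)) ∂P - ∫ ω, F (coord 0 ω) (coord ε ω) ∂Q + 1 ≤ δ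

section

variable {r u : ℝ → State D K → State D K → ℝ} {V : ℝ → ℝ} {R P Q : Measure (PathSpace D K)}
  {κ : ℝ} {k : ℝ → State D K → ℝ}

lemma GirsanovSetting.le_klDiv [IsProbabilityMeasure P] [IsProbabilityMeasure Q]
    [IsProbabilityMeasure R] (h : GirsanovSetting r u k κ V R P Q) :
    ∫⁻ τ in Ioo (0 : ℝ) 1, klRate r u k R τ ≤ klDiv P Q := by
  -- The shift by 2 makes every interval of the exhaustion have its left end at most its right end.
  set s : ℕ → Set ℝ := fun n => Ioc (1 / ((n : ℝ) + 2)) (1 - 1 / ((n : ℝ) + 2))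
  have hs : Monotone s := by
    intro i j hij
    have : 1 / ((j : ℝ) + 2) ≤ 1 / ((i : ℝ) + 2) := by
      have : (i : ℝ) ≤ j := by exact_mod_cast hij
      gcongr
    exact Ioc_subset_Ioc this (by linarith)
  have hU : ⋃ n, s n = Ioo (0 : ℝ) 1 := by
    ext τ
    simp only [mem_iUnion, s, mem_Ioc, mem_Ioo]
    constructor
    · rintro ⟨n, h1, h2⟩
      have : 0 < 1 / ((n : ℝ) + 2) := by positivity
      constructor <;> linarith
    · rintro ⟨h1, h2⟩
      obtain ⟨n, hn⟩ := exists_nat_one_div_lt (lt_min h1 (sub_pos.2 h2))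
      have h3 : 1 / ((n : ℝ) + 2) ≤ 1 / ((n : ℝ) + 1) := by gcongr; norm_num
      have h4 := hn.trans_le (min_le_left _ _)
      have h5 := hn.trans_le (min_le_right _ _)
      exact ⟨n, by linarith, by linarith⟩
  rw [← hU, setLIntegral_iUnion_of_directed _ (directed_of_isDirected_le hs)]
  refine iSup_le fun n => ?_
  have h0 : 0 < 1 / ((n : ℝ) + 2) := by positivity
  have h1 : 1 / ((n : ℝ) + 2) ≤ 1 / 2 := by gcongr; simp
  have ha : 1 / ((n : ℝ) + 2) ≤ 1 - 1 / ((n : ℝ) + 2) := by linarith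
  have hb : 1 - 1 / ((n : ℝ) + 2) < 1 := by linarith
  exact lintegral_klRate_le_klDiv (h.tilt _ _ h0 ha hb) (h.forward_ref _ _ h0 ha hb)
    (h.forward _ _ h0 ha hb) (h.bound_ref _ _ h0 ha hb) (h.bound _ _ h0 ha hb) h.rate_ref h.rate
    h0.le ha

lemma setLIntegral_Ioc_ne_top {f : ℝ → ℝ≥0∞} (h : ∫⁻ τ in Ioo (0 : ℝ) 1, f τ ≠ ⊤) {s t : ℝ}
    (hs : 0 ≤ s) (ht : t < 1) : ∫⁻ τ in Ioc s t, f τ ≠ ⊤ :=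
  ne_top_of_le_ne_top h (lintegral_mono_set fun _ hτ => ⟨hs.trans_lt hτ.1, hτ.2.trans_lt ht⟩)

/-- Induction on the largest time. Each removal spends half of the remaining error, and the entropy
costs of adjacent intervals add up to the cost over (t₀, T]. Only the coordinates z and t₀ survive;
`GirsanovSetting.klDiv_le` uses it with z = 0, where the singularity at time 0 forbids going
further. -/
lemma GirsanovSetting.exists_remove_coordinates [IsProbabilityMeasure P] [IsProbabilityMeasure Q]
    [IsProbabilityMeasure R] (h : GirsanovSetting r u k κ V R P Q)
    (hI : ∫⁻ τ in Ioo (0 : ℝ) 1, klRate r u k R τ ≠ ⊤) {m M : ℝ} (hm : 0 < m)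
    {z t₀ : Icc (0 : ℝ) 1} (hz : z < t₀) (J : Finset (Icc (0 : ℝ) 1)) :
    (∀ j ∈ J, t₀ < j) → ∀ T : Icc (0 : ℝ) 1, (T : ℝ) < 1 → t₀ ≤ T → (∀ j ∈ J, j ≤ T) →
    ∀ (F : PathSpace D K → ℝ) (η : ℝ), 0 < η →
      DependsOn F (insert z (insert t₀ J) : Finset (Icc (0 : ℝ) 1)) → (∀ ω, F ω ∈ Icc m M) →
      ∃ F' : PathSpace D K → ℝ, DependsOn F' ({z, t₀} : Finset (Icc (0 : ℝ) 1)) ∧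
        (∀ ω, F' ω ∈ Icc m M) ∧
        ∫ ω, Real.log (F ω) ∂P ≤ ∫ ω, Real.log (F' ω) ∂P
          + (∫⁻ τ in Ioc (t₀ : ℝ) T, klRate r u k R τ).toReal + η ∧
        ∫ ω, F' ω ∂Q ≤ ∫ ω, F ω ∂Q + η := by
  have ht₀ : (0 : ℝ) < t₀ := z.2.1.trans_lt hz
  induction J using Finset.induction_on_max with
  | empty =>
    intro _ T _ _ _ F η hη hF hFm
    refine ⟨F, hF, hFm, ?_, by linarith⟩
    have : 0 ≤ (∫⁻ τ in Ioc (t₀ : ℝ) T, klRate r u k R τ).toReal := ENNReal.toReal_nonneg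
    linarith
  | insert t J htJ ih =>
    intro hJ T hT htT hJT F η hη hF hFm
    have ht : t₀ < t := hJ t (Finset.mem_insert_self _ _)
    have htT' : t ≤ T := hJT t (Finset.mem_insert_self _ _)
    have ht1 : (t : ℝ) < 1 := lt_of_le_of_lt htT' hT
    set s := (insert t₀ J).max' (Finset.insert_nonempty _ _)
    have hsm : s ∈ insert t₀ J := Finset.max'_mem _ _
    have hle : ∀ j ∈ insert t₀ J, j ≤ s := fun j hj => Finset.le_max' _ j hj
    have hst : s < t := by
      rcases Finset.mem_insert.1 hsm with h1 | h1
      · rw [h1]; exact ht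
      · exact htJ s h1
    have ht₀s : t₀ ≤ s := hle t₀ (Finset.mem_insert_self _ _)
    have hs0 : (0 : ℝ) < s := lt_of_lt_of_le ht₀ ht₀s
    have hs1 : (s : ℝ) < 1 := lt_trans hst ht1
    have hstR : (s : ℝ) ≤ t := hst.le
    have hIst : ∫⁻ τ in Ioc (s : ℝ) t, klRateOn r u k R univ τ ≠ ⊤ := by
      simp_rw [klRateOn_univ]
      exact setLIntegral_Ioc_ne_top hI hs0.le ht1
    obtain ⟨F₁, hF₁, hF₁m, h1, h2⟩ := exists_remove_coordinate hst (h.tilt _ _ hs0 hstR ht1)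
      (h.forward_ref _ _ hs0 hstR ht1) (h.forward _ _ hs0 hstR ht1) (h.bound_ref _ _ hs0 hstR ht1)
      (h.bound _ _ hs0 hstR ht1) h.rate_ref h.rate hIst hm (half_pos hη)
      (J := insert z (insert t₀ J)) (Finset.mem_insert_of_mem hsm)
      (fun j hj => by
        rcases Finset.mem_insert.1 hj with rfl | hj
        · exact hz.le.trans ht₀s
        · exact hle j hj)
      (F := F) (by
        refine hF.mono ?_
        intro i hi
        simp only [Finset.coe_insert, mem_insert_iff, Finset.mem_coe] at hi ⊢
        tauto) hFm
    obtain ⟨F', hF', hF'm, h3, h4⟩ := ih (fun j hj => hJ j (Finset.mem_insert_of_mem hj)) s hs1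
      ht₀s (fun j hj => hle j (Finset.mem_insert_of_mem hj)) F₁ (η / 2) (half_pos hη) hF₁ hF₁m
    refine ⟨F', hF', hF'm, ?_, by linarith⟩
    simp_rw [klRateOn_univ] at h1
    have h5 : (∫⁻ τ in Ioc (t₀ : ℝ) s, klRate r u k R τ).toReal
        + (∫⁻ τ in Ioc (s : ℝ) t, klRate r u k R τ).toReal
        ≤ (∫⁻ τ in Ioc (t₀ : ℝ) T, klRate r u k R τ).toReal := by
      rw [← ENNReal.toReal_add (setLIntegral_Ioc_ne_top hI ht₀.le hs1)
        (setLIntegral_Ioc_ne_top hI hs0.le ht1), setLIntegral_Ioc_add ht₀s hstR]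
      exact ENNReal.toReal_mono (setLIntegral_Ioc_ne_top hI ht₀.le hT)
        (lintegral_mono_set (Ioc_subset_Ioc le_rfl htT'))
    linarith

/-- Modifying a bounded function on an event changes its integral by little. -/
lemma abs_integral_sub_le_of_eqOn_compl {μ : Measure (PathSpace D K)} [IsProbabilityMeasure μ]
    {f g : PathSpace D K → ℝ} {l c : ℝ} {E : Set (PathSpace D K)} (hE : MeasurableSet E)
    (hf : Integrable f μ) (hg : Integrable g μ) (hfm : ∀ ω, f ω ∈ Icc l c)
    (hgm : ∀ ω, g ω ∈ Icc l c) (h : ∀ ω, ω ∉ E → f ω = g ω) :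
    |∫ ω, f ω ∂μ - ∫ ω, g ω ∂μ| ≤ (c - l) * μ.real E := by
  rw [← integral_sub hf hg, mul_comm]
  have hi : Integrable (E.indicator fun _ => c - l) μ := (integrable_const _).indicator hE
  calc |∫ ω, f ω - g ω ∂μ| ≤ ∫ ω, |f ω - g ω| ∂μ := abs_integral_le_integral_abs
    _ ≤ ∫ ω, E.indicator (fun _ => c - l) ω ∂μ := by
        refine integral_mono (hf.sub hg).abs hi fun ω => ?_
        by_cases hω : ω ∈ E
        · simp only [indicator_of_mem hω]
          rw [abs_le]
          constructor <;> linarith [(hfm ω).1, (hfm ω).2, (hgm ω).1, (hgm ω).2]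
        · simp [indicator_of_notMem hω, h ω hω]
    _ = μ.real E * (c - l) := by rw [integral_indicator_const _ hE, smul_eq_mul]

lemma measurableSet_coord_ne (s t : ℝ) :
    MeasurableSet {ω : PathSpace D K | coord s ω ≠ coord t ω} :=
  (measurableSet_eq_fun (measurable_coord s) (measurable_coord t)).compl

/-- A cylinder function is treated from right to left: X_1 is replaced by X_{t₁} with t₁ near 1 at
small cost, because there is no jump at time 1. Then the interior times are integrated out down to a
time t₀ preceding all of them, and the remaining function of (X_0, X_{t₀}) is handled by the start
condition. -/
lemma GirsanovSetting.klDiv_le [IsProbabilityMeasure P] [IsProbabilityMeasure Q]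
    [IsProbabilityMeasure R] (h : GirsanovSetting r u k κ V R P Q) (hstart : StartCondition P Q)
    (hI : ∫⁻ τ in Ioo (0 : ℝ) 1, klRate r u k R τ ≠ ⊤) :
    klDiv P Q ≤ ∫⁻ τ in Ioo (0 : ℝ) 1, klRate r u k R τ := by
  rw [← ENNReal.ofReal_toReal hI]
  refine klDiv_le_of_forall_dependsOn ENNReal.toReal_nonneg fun J G m M hG hm hGm hGM => ?_
  refine le_of_forall_pos_le_add fun η hη => ?_
  have hGmM : ∀ ω, G ω ∈ Icc m M := fun ω => ⟨hGm ω, hGM ω⟩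
  -- The two endpoints are set aside, as the forward equations are used only on compact subintervals
  -- of (0, 1).
  set J' := J.filter fun j : Icc (0 : ℝ) 1 => (0 : ℝ) < j ∧ (j : ℝ) < 1
  -- a small time
  have ev1 : ∀ᶠ t : ℝ in 𝓝[>] 0, ∀ j ∈ J', t < j :=
    (Finset.eventually_all J').2 fun j hj =>
      (eventually_lt_nhds (Finset.mem_filter.1 hj).2.1).filter_mono nhdsWithin_le_nhds
  obtain ⟨t₀, ⟨⟨h01, h02⟩, h03⟩, h04⟩ := ((ev1.and ((eventually_lt_nhds one_pos).filter_mono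
    nhdsWithin_le_nhds)).and (hstart m M (η / 4) hm (by positivity))
    |>.and self_mem_nhdsWithin).exists
  replace h04 : 0 < t₀ := h04
  -- a time close to one
  have ev2 : ∀ᶠ t : ℝ in 𝓝[<] 1, ∀ j ∈ J', (j : ℝ) < t :=
    (Finset.eventually_all J').2 fun j hj =>
      (eventually_gt_nhds (Finset.mem_filter.1 hj).2.2).filter_mono nhdsWithin_le_nhds
  have hL : Tendsto (fun t => (Real.log M - Real.log m) * P.real {ω | coord t ω ≠ coord 1 ω})
      (𝓝[<] 1) (𝓝 0) := by simpa using h.left_cont_tilt.const_mul (Real.log M - Real.log m)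
  have hL' : Tendsto (fun t => (M - m) * Q.real {ω | coord t ω ≠ coord 1 ω})
      (𝓝[<] 1) (𝓝 0) := by simpa using h.left_cont.const_mul (M - m)
  obtain ⟨t₁, ⟨⟨⟨h11, h12⟩, h13⟩, h14⟩, h15⟩ := ((ev2.and ((eventually_gt_nhds h02).filter_mono
    nhdsWithin_le_nhds)).and (hL.eventually (eventually_lt_nhds (by positivity : 0 < η / 4)))
    |>.and (hL'.eventually (eventually_lt_nhds (by positivity : 0 < η / 4)))
    |>.and self_mem_nhdsWithin).exists
  replace h15 : t₁ < 1 := h15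
  set z : Icc (0 : ℝ) 1 := ⟨0, by simp⟩
  set o : Icc (0 : ℝ) 1 := ⟨1, by simp⟩
  set s₀ : Icc (0 : ℝ) 1 := ⟨t₀, h04.le, h02.le⟩
  set s₁ : Icc (0 : ℝ) 1 := ⟨t₁, (h04.trans h12).le, h15.le⟩
  have hc0 : ∀ ω : PathSpace D K, coord 0 ω = ω z := fun ω => coord_coe z ω
  have hc1 : ∀ ω : PathSpace D K, coord 1 ω = ω o := fun ω => coord_coe o ω
  have hct₀ : ∀ ω : PathSpace D K, coord t₀ ω = ω s₀ := fun ω => coord_coe s₀ ω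
  have hct₁ : ∀ ω : PathSpace D K, coord t₁ ω = ω s₁ := fun ω => coord_coe s₁ ω
  have hs₁o : s₁ ≠ o := fun h => by
    have := congrArg Subtype.val h
    simp only [s₁, o] at this
    linarith
  -- replace the terminal value
  classical
  set F : PathSpace D K → ℝ := fun ω => G (Function.update ω o (ω s₁))
  have hF : DependsOn F (insert z (insert s₀ (insert s₁ J')) : Finset (Icc (0 : ℝ) 1)) := by
    intro x y hxy
    have hs₁ : x s₁ = y s₁ := hxy s₁ (by simp)
    refine hG fun i hi => ?_
    by_cases hio : i = o
    · subst hio; simp [hs₁]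
    · rw [Function.update_of_ne hio, Function.update_of_ne hio]
      by_cases hiz : i = z
      · rw [hiz]; exact hxy z (by simp)
      · refine hxy i ?_
        have h0 : (0 : ℝ) < i := lt_of_le_of_ne i.2.1 fun e => hiz (Subtype.ext e.symm)
        have h1 : (i : ℝ) < 1 := lt_of_le_of_ne i.2.2 fun e => hio (Subtype.ext e)
        have : i ∈ J' := Finset.mem_filter.2 ⟨hi, h0, h1⟩
        simp [this]
  have hFm : ∀ ω, F ω ∈ Icc m M := fun ω => hGmM _
  have hGmeas := measurable_of_dependsOn hG
  have hFmeas := measurable_of_dependsOn hF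
  have hFG : ∀ ω, ω ∉ {ω : PathSpace D K | coord t₁ ω ≠ coord 1 ω} → F ω = G ω := by
    intro ω hω
    simp only [mem_ofPred_eq, not_not] at hω
    simp only [F]
    rw [← hct₁ ω, hω, hc1 ω, Function.update_eq_self]
  have hlogm : ∀ x ∈ Icc m M, Real.log x ∈ Icc (Real.log m) (Real.log M) := fun x hx =>
    ⟨Real.log_le_log hm hx.1, Real.log_le_log (hm.trans_le hx.1) hx.2⟩
  have e1 := abs_le.1 (abs_integral_sub_le_of_eqOn_compl (μ := P) (measurableSet_coord_ne t₁ 1)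
    (integrable_log_of_bounds hFmeas hm (fun ω => (hFm ω).1) fun ω => (hFm ω).2)
    (integrable_log_of_bounds hGmeas hm hGm hGM) (fun ω => hlogm _ (hFm ω))
    (fun ω => hlogm _ (hGmM ω)) fun ω hω => by rw [hFG ω hω])
  have e2 := abs_le.1 (abs_integral_sub_le_of_eqOn_compl (μ := Q) (measurableSet_coord_ne t₁ 1)
    (integrable_of_bounds hFmeas (fun ω => (hFm ω).1) fun ω => (hFm ω).2)
    (integrable_of_bounds hGmeas hGm hGM) hFm hGmM hFG)
  -- remove the interior coordinates
  have hzs : z < s₀ := h04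
  obtain ⟨F', hF', hF'm, k1, k2⟩ := h.exists_remove_coordinates hI hm hzs (insert s₁ J')
    (by
      intro j hj
      rcases Finset.mem_insert.1 hj with rfl | hj
      · exact h12
      · exact h01 j hj) s₁ h15 (le_of_lt (show s₀ < s₁ from h12))
    (by
      intro j hj
      rcases Finset.mem_insert.1 hj with rfl | hj
      · exact le_rfl
      · exact (show j < s₁ from h11 j hj).le) F (η / 8) (by positivity) hF hFm
  -- the initial times
  set f : State D K → State D K → ℝ := fun x y => F' fun i => if i = z then x else y
  have hf : ∀ ω, F' ω = f (coord 0 ω) (coord t₀ ω) := by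
    intro ω
    refine hF' fun i hi => ?_
    rw [hc0, hct₀]
    by_cases hiz : i = z
    · simp [hiz]
    · have : i = s₀ := by simpa [hiz] using hi
      simp [this, hzs.ne']
  have k3 := h03 f fun x y => hF'm _
  simp_rw [← hf] at k3
  have k4 : (∫⁻ τ in Ioc (s₀ : ℝ) s₁, klRate r u k R τ).toReal
      ≤ (∫⁻ τ in Ioo (0 : ℝ) 1, klRate r u k R τ).toReal :=
    ENNReal.toReal_mono hI (lintegral_mono_set fun τ hτ => ⟨h04.trans hτ.1, hτ.2.trans_lt h15⟩)
  linarith [e1.1, e2.2]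

/-- Girsanov's theorem for the relative entropy of path measures, in `[0, ∞]`. -/
theorem GirsanovSetting.klDiv_eq [IsProbabilityMeasure P] [IsProbabilityMeasure Q]
    [IsProbabilityMeasure R] (h : GirsanovSetting r u k κ V R P Q)
    (hstart : ∫⁻ τ in Ioo (0 : ℝ) 1, klRate r u k R τ ≠ ⊤ → StartCondition P Q) :
    klDiv P Q = ∫⁻ τ in Ioo (0 : ℝ) 1, klRate r u k R τ := by
  refine le_antisymm ?_ h.le_klDiv
  by_cases hI : ∫⁻ τ in Ioo (0 : ℝ) 1, klRate r u k R τ = ⊤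
  · rw [hI]; exact le_top
  · exact h.klDiv_le (hstart hI) hI

end

end DiscreteSampler

/-! ### Transition probabilities of chains with independent coordinates. -/

namespace DiscreteSampler

open InformationTheory

variable {D K N : ℕ}

/-- A function whose increments are quadratically small in those of an integral is constant. -/
lemma eq_of_abs_sub_le_sq {f V : ℝ → ℝ} {a b C : ℝ} (hab : a ≤ b)
    (hV : IntervalIntegrable V volume a b) (hV0 : ∀ τ, 0 ≤ V τ)
    (h : ∀ s t, a ≤ s → s ≤ t → t ≤ b → |f t - f s| ≤ C * (∫ τ in s..t, V τ) ^ 2) :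
    f b = f a := by
  rw [← sub_eq_zero, ← abs_nonpos_iff]
  refine le_of_forall_pos_le_add fun η hη => ?_
  obtain ⟨n0, hn0⟩ := exists_grid_sum_sq_le hV hab hV0 (η := η / (|C| + 1)) (by positivity)
  have hn : 0 < max n0 1 := by omega
  have h1 := hn0 (max n0 1) (le_max_left _ _) hn
  set n := max n0 1
  have h2 : f b - f a = ∑ j ∈ Finset.range n, (f (grid a b n (j + 1)) - f (grid a b n j)) := by
    rw [Finset.sum_range_sub fun j => f (grid a b n j), grid_self hn, grid_zero]
  rw [h2, zero_add]
  calc |∑ j ∈ Finset.range n, (f (grid a b n (j + 1)) - f (grid a b n j))|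
      ≤ ∑ j ∈ Finset.range n, |C| * (∫ σ in grid a b n j..grid a b n (j + 1), V σ) ^ 2 := by
        refine (Finset.abs_sum_le_sum_abs _ _).trans (Finset.sum_le_sum fun j _ => ?_)
        refine (h _ _ (grid_mem hab hn j).1 (grid_mono hab (Nat.le_succ j))
          (grid_mem hab hn (j + 1)).2).trans ?_
        gcongr
        exact le_abs_self C
    _ ≤ |C| * (η / (|C| + 1)) := by rw [← Finset.mul_sum]; gcongr
    _ ≤ η := by
        rw [mul_div_assoc', div_le_iff₀ (by positivity)]
        nlinarith [abs_nonneg C]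

/-- First-order Taylor expansion for a solution of a bounded linear system. -/
lemma abs_sub_sub_mul_le {ι : Type*} [Fintype ι] {κ : ℝ → ι → ℝ} {L : ι → ι → ℝ} {B c : ℝ}
    (hκ : ∀ g x, HasDerivAt (fun g => κ g x) (∑ z, κ g z * L z x) g)
    (hB : ∀ g, 0 ≤ g → ∀ x, |κ g x| ≤ B) (hL : ∀ x, ∑ z, |L z x| ≤ c)
    {g δ : ℝ} (hg : 0 ≤ g) (hδ : 0 ≤ δ) (x : ι) :
    |κ (g + δ) x - κ g x - δ * ∑ z, κ g z * L z x| ≤ B * c ^ 2 * δ ^ 2 := by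
  have hB0 : 0 ≤ B := (abs_nonneg _).trans (hB 0 le_rfl x)
  have hc0 : 0 ≤ c := (Finset.sum_nonneg fun _ _ => abs_nonneg _).trans (hL x)
  have hsum : ∀ (w : ι → ℝ) (C : ℝ), 0 ≤ C → (∀ z, |w z| ≤ C) → ∀ x,
      |∑ z, w z * L z x| ≤ C * c := by
    intro w C hC hw x
    have := abs_sum_mul_le Finset.univ (fun z => L z x) w (c := C) fun z _ => hw z
    simp_rw [mul_comm (w _)]
    refine this.trans ?_
    rw [mul_comm]
    exact mul_le_mul_of_nonneg_left (hL x) hC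
  have hlip : ∀ h ∈ Icc g (g + δ), ∀ z, |κ h z - κ g z| ≤ B * c * δ := by
    intro h hh z
    have := (convex_Icc g (g + δ)).norm_image_sub_le_of_norm_hasDerivWithin_le
      (f := fun g => κ g z) (C := B * c) (fun y _ => (hκ y z).hasDerivWithinAt)
      (fun y hy => hsum (κ y) B hB0 (hB y (hg.trans hy.1)) z)
      (left_mem_Icc.2 (by linarith)) hh
    refine this.trans ?_
    rw [Real.norm_eq_abs, abs_of_nonneg (by linarith [hh.1])]
    gcongr
    linarith [hh.2]
  have h2 := (convex_Icc g (g + δ)).norm_image_sub_le_of_norm_hasDerivWithin_le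
    (f := fun h => κ h x - h * ∑ z, κ g z * L z x) (C := B * c * δ * c)
    (fun y _ => ((hκ y x).sub ((hasDerivAt_id y).mul_const _)).hasDerivWithinAt)
    (fun y hy => by
      rw [one_mul, ← Finset.sum_sub_distrib]
      simp_rw [← sub_mul]
      exact hsum (fun z => κ y z - κ g z) _ (by positivity) (hlip y hy) x)
    (left_mem_Icc.2 (by linarith)) (right_mem_Icc.2 (by linarith))
  rw [Real.norm_eq_abs, Real.norm_eq_abs] at h2
  calc |κ (g + δ) x - κ g x - δ * ∑ z, κ g z * L z x|
      = |κ (g + δ) x - (g + δ) * ∑ z, κ g z * L z x - (κ g x - g * ∑ z, κ g z * L z x)| := by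
        congr 1; ring
    _ ≤ B * c * δ * c * |g + δ - g| := h2
    _ = B * c ^ 2 * δ ^ 2 := by rw [add_sub_cancel_left, abs_of_nonneg hδ]; ring

/-- Duality between the forward equation with the rates `γ L` and a solution `κ` of the backward
equation. -/
lemma ForwardOn.sum_mul_mass_eq {P : Measure (PathSpace D K)} [IsFiniteMeasure P] {γ : ℝ → ℝ}
    {L : State D K → State D K → ℝ} {s t : ℝ} (h : ForwardOn (fun τ y x => γ τ * L y x) P s t)
    (hst : s ≤ t) (hγ : IntervalIntegrable γ volume s t) (hγ0 : ∀ τ, 0 ≤ γ τ)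
    {κ : ℝ → State D K → ℝ} {B : ℝ}
    (hκ : ∀ g x, HasDerivAt (fun g => κ g x) (∑ z, κ g z * L z x) g)
    (hB : ∀ g, 0 ≤ g → ∀ x, |κ g x| ≤ B) {A : Set (PathSpace D K)}
    (hA : MeasurableSet[past s] A) :
    ∑ x, κ 0 x * mass P A t x = ∑ x, κ (∫ τ in s..t, γ τ) x * mass P A s x := by
  set c : ℝ := ∑ y, ∑ x, |L y x|
  have hc0 : 0 ≤ c := Finset.sum_nonneg fun _ _ => Finset.sum_nonneg fun _ _ => abs_nonneg _
  have hLc : ∀ x, ∑ z, |L z x| ≤ c := fun x => Finset.sum_le_sum fun z _ =>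
    Finset.single_le_sum (f := fun x => |L z x|) (fun _ _ => abs_nonneg _) (Finset.mem_univ x)
  have hR : RateBound (fun τ y x => γ τ * L y x) (fun τ => γ τ * c) s t :=
    ⟨fun x y => hγ.mul_const _, hγ.mul_const _, fun τ => by
      simp_rw [abs_mul, ← Finset.mul_sum, abs_of_nonneg (hγ0 τ)]; exact le_rfl⟩
  set S : ℝ := (Fintype.card (State D K) : ℝ)
  have key := eq_of_abs_sub_le_sq (f := fun τ => ∑ x, κ (∫ σ in τ..t, γ σ) x * mass P A τ x)
    (C := 2 * (S * (B * c ^ 2 * P.real A))) hst hγ hγ0 ?_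
  · simpa using key
  intro a b ha hab hb
  have hγab := IntervalIntegrable.sub_interval hγ ha hab hb
  have hγbt := IntervalIntegrable.sub_interval hγ (ha.trans hab) hb le_rfl
  have hsplit : ∫ σ in a..t, γ σ = (∫ σ in b..t, γ σ) + ∫ σ in a..b, γ σ := by
    rw [add_comm, intervalIntegral.integral_add_adjacent_intervals hγab hγbt]
  set g := ∫ σ in b..t, γ σ
  set δ := ∫ σ in a..b, γ σ
  have hg : 0 ≤ g := intervalIntegral.integral_nonneg hb fun σ _ => hγ0 σ
  have hδ : 0 ≤ δ := intervalIntegral.integral_nonneg hab fun σ _ => hγ0 σ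
  have e1 : ∀ x, |mass P A b x - mass P A a x - ∑ z, δ * L x z * mass P A a z|
      ≤ P.real A * (c ^ 2 * δ ^ 2) := by
    intro x
    have := (h.mono ha hb).abs_euler_le (hR.mono ha hab hb) hab (past_mono ha _ hA) x
    simp only [intervalIntegral.integral_mul_const] at this
    rwa [mul_pow, mul_comm (δ ^ 2)] at this
  have e2 := fun x => abs_sub_sub_mul_le hκ hB hLc hg hδ x
  -- The generator acting on κ is the adjoint of the generator acting on masses, so the first-order
  -- terms of the two expansions cancel.
  have hswap : ∑ x, (δ * ∑ z, κ g z * L z x) * mass P A a x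
      = ∑ x, κ g x * ∑ z, δ * L x z * mass P A a z := by
    simp_rw [Finset.mul_sum, Finset.sum_mul]
    rw [Finset.sum_comm]
    exact Finset.sum_congr rfl fun x _ => Finset.sum_congr rfl fun z _ => by ring
  -- Discrete product rule: once the linear terms have cancelled, only the two second-order
  -- remainders are left, and a function with quadratically small increments is constant.
  have h3 : ∑ x, κ g x * mass P A b x - ∑ x, κ (g + δ) x * mass P A a x
      = ∑ x, κ g x * (mass P A b x - mass P A a x - ∑ z, δ * L x z * mass P A a z)
        - ∑ x, (κ (g + δ) x - κ g x - δ * ∑ z, κ g z * L z x) * mass P A a x := by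
    simp_rw [mul_sub, sub_mul, Finset.sum_sub_distrib]
    rw [hswap]; ring
  rw [hsplit, h3]
  have hS : (Finset.univ : Finset (State D K)).card = Fintype.card (State D K) := rfl
  have f1 : |∑ x, κ g x * (mass P A b x - mass P A a x - ∑ z, δ * L x z * mass P A a z)|
      ≤ S * (B * (P.real A * (c ^ 2 * δ ^ 2))) := by
    refine (Finset.abs_sum_le_sum_abs _ _).trans ?_
    rw [← nsmul_eq_mul]
    refine Finset.sum_le_card_nsmul _ _ _ fun x _ => ?_
    rw [abs_mul]
    exact mul_le_mul (hB g hg x) (e1 x) (abs_nonneg _) ((abs_nonneg _).trans (hB g hg x))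
  have f2 : |∑ x, (κ (g + δ) x - κ g x - δ * ∑ z, κ g z * L z x) * mass P A a x|
      ≤ S * ((B * c ^ 2 * δ ^ 2) * P.real A) := by
    refine (Finset.abs_sum_le_sum_abs _ _).trans ?_
    rw [← nsmul_eq_mul]
    refine Finset.sum_le_card_nsmul _ _ _ fun x _ => ?_
    rw [abs_mul, abs_of_nonneg (mass_nonneg _ _ _ _)]
    exact mul_le_mul (e2 x) (mass_le _ _ _ _) (mass_nonneg _ _ _ _)
      ((abs_nonneg _).trans (e2 x))
  refine (abs_sub _ _).trans ?_
  linarith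

/-- The generator of independent coordinates with the one-coordinate generator `ℓ`. -/
noncomputable def productRate (ℓ : Fin K → Fin K → ℝ) (y x : State D K) : ℝ :=
  ∑ d, ∑ c, if y = Function.update x d c then ℓ c (x d) else 0

/-- The transition kernel of independent coordinates. -/
noncomputable def productKernel (q : Fin K → Fin K → ℝ) (y x : State D K) : ℝ :=
  ∏ d, q (y d) (x d)

/-- `q` is the transition semigroup with generator `ℓ` on the alphabet. -/
structure IsSemigroup (ℓ : Fin K → Fin K → ℝ) (q : ℝ → Fin K → Fin K → ℝ) : Prop where
  zero : ∀ a b, q 0 a b = if a = b then 1 else 0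
  nonneg : ∀ g, 0 ≤ g → ∀ a b, 0 ≤ q g a b
  le_one : ∀ g, 0 ≤ g → ∀ a b, q g a b ≤ 1
  deriv : ∀ g a b, HasDerivAt (fun g => q g a b) (∑ c, q g a c * ℓ c b) g

lemma productKernel_nonneg {q : Fin K → Fin K → ℝ} (hq : ∀ a b, 0 ≤ q a b) (y x : State D K) :
    0 ≤ productKernel q y x := Finset.prod_nonneg fun _ _ => hq _ _

lemma productKernel_le_one {q : Fin K → Fin K → ℝ} (hq : ∀ a b, 0 ≤ q a b)
    (hq1 : ∀ a b, q a b ≤ 1) (y x : State D K) : productKernel q y x ≤ 1 :=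
  Finset.prod_le_one (fun _ _ => hq _ _) fun _ _ => hq1 _ _

lemma productKernel_one (y x : State D K) :
    productKernel (fun a b => if a = b then 1 else 0) y x = if y = x then 1 else 0 := by
  unfold productKernel
  split_ifs with h
  · simp [h]
  · obtain ⟨d, hd⟩ := Function.ne_iff.1 h
    exact Finset.prod_eq_zero (Finset.mem_univ d) (if_neg hd)

lemma productKernel_update (q : Fin K → Fin K → ℝ) (y x : State D K) (d : Fin D) (c : Fin K) :
    productKernel q y (Function.update x d c)
      = (∏ e ∈ Finset.univ.erase d, q (y e) (x e)) * q (y d) c := by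
  unfold productKernel
  rw [← Finset.prod_erase_mul _ _ (Finset.mem_univ d), Function.update_self]
  congr 1
  refine Finset.prod_congr rfl fun e he => ?_
  rw [Function.update_of_ne (Finset.ne_of_mem_erase he)]

/-- The product rule differentiates one factor at a time, and each term of the product generator
changes one coordinate. The two sums agree term by term. -/
lemma IsSemigroup.hasDerivAt_productKernel {ℓ : Fin K → Fin K → ℝ} {q : ℝ → Fin K → Fin K → ℝ}
    (hq : IsSemigroup ℓ q) (g : ℝ) (y x : State D K) :
    HasDerivAt (fun g => productKernel (q g) y x)
      (∑ z, productKernel (q g) y z * productRate ℓ z x) g := by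
  unfold productRate
  have h := HasDerivAt.fun_finsetProd (u := Finset.univ) (f := fun d g => q g (y d) (x d))
    (f' := fun d => ∑ c, q g (y d) c * ℓ c (x d)) (x := g) fun d _ => hq.deriv g (y d) (x d)
  refine h.congr_deriv ?_
  simp only [smul_eq_mul, Finset.mul_sum]
  symm
  rw [Finset.sum_comm]
  refine Finset.sum_congr rfl fun d _ => ?_
  rw [Finset.sum_comm]
  refine Finset.sum_congr rfl fun c _ => ?_
  rw [Finset.sum_eq_single (Function.update x d c)]
  · rw [if_pos rfl, productKernel_update]; ring
  · intro z _ hz; rw [if_neg hz, mul_zero]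
  · simp

/-- The transition probabilities of a chain with the rates `γ_t L` and independent coordinates. -/
lemma ForwardOn.mass_eq_sum_productKernel {P : Measure (PathSpace D K)} [IsFiniteMeasure P]
    {γ : ℝ → ℝ} {ℓ : Fin K → Fin K → ℝ} {q : ℝ → Fin K → Fin K → ℝ} (hq : IsSemigroup ℓ q)
    {s t : ℝ} (h : ForwardOn (fun τ y x => γ τ * productRate ℓ y x) P s t)
    (hst : s ≤ t) (hγ : IntervalIntegrable γ volume s t) (hγ0 : ∀ τ, 0 ≤ γ τ)
    {A : Set (PathSpace D K)} (hA : MeasurableSet[past s] A) (y : State D K) :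
    mass P A t y = ∑ x, productKernel (q (∫ τ in s..t, γ τ)) y x * mass P A s x := by
  rw [← h.sum_mul_mass_eq hst hγ hγ0 (fun g x => hq.hasDerivAt_productKernel g y x)
    (B := 1) (fun g hg x => ?_) hA]
  · have : q 0 = fun a b => if a = b then 1 else 0 := by
      ext a b; exact hq.zero a b
    simp [this, productKernel_one]
  · rw [abs_of_nonneg (productKernel_nonneg (hq.nonneg g hg) _ _)]
    exact productKernel_le_one (hq.nonneg g hg) (hq.le_one g hg) _ _

end DiscreteSampler

/-! ### Single-site jumps, and the uniform and masked generators. -/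

namespace DiscreteSampler

open InformationTheory

variable {D K N : ℕ}

lemma update_ne_self {x : State D K} {d : Fin D} {c : Fin K} (h : c ≠ x d) :
    Function.update x d c ≠ x := fun e => h (by simpa using congrFun e d)

lemma eq_of_update_eq_update {x : State D K} {d d' : Fin D} {c c' : Fin K} (h : c ≠ x d)
    (e : Function.update x d c = Function.update x d' c') : d = d' ∧ c = c' := by
  have hd : d = d' := by
    by_contra hne
    have := congrFun e d
    rw [Function.update_self, Function.update_of_ne hne] at this
    exact h this
  subst hd
  exact ⟨rfl, by simpa using congrFun e d⟩

/-- Sums over the jumps from `x`, indexed by the changed coordinate and its new symbol. -/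
lemma sum_jumps_eq {M : Type*} [AddCommMonoid M] {ι : Fin N → Fin K} (hι : Function.Injective ι)
    (x : State D K) (f : State D K → M)
    (hf : ∀ y, y ≠ x → (∀ d n, y ≠ Function.update x d (ι n)) → f y = 0) :
    ∑ y with y ≠ x, f y = ∑ d, ∑ n with ι n ≠ x d, f (Function.update x d (ι n)) := by
  classical
  rw [Finset.sum_sigma']
  set T := (Finset.univ : Finset (Fin D)).sigma fun d => Finset.univ.filter fun n => ι n ≠ x d
  have hinj : Set.InjOn (fun p : (_ : Fin D) × Fin N => Function.update x p.1 (ι p.2)) T := by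
    rintro ⟨d, n⟩ h1 ⟨d', n'⟩ h2 e
    simp only [T, Finset.coe_sigma, Finset.mem_coe, Set.mem_sigma_iff, Finset.mem_filter,
      Finset.mem_univ, true_and] at h1
    obtain ⟨rfl, e2⟩ := eq_of_update_eq_update h1 e
    rw [hι e2]
  rw [← Finset.sum_image (f := f) hinj]
  symm
  refine Finset.sum_subset ?_ ?_
  · intro y hy
    obtain ⟨⟨d, n⟩, h1, rfl⟩ := Finset.mem_image.1 hy
    simp only [T, Finset.mem_sigma, Finset.mem_filter, Finset.mem_univ, true_and] at h1
    simpa using update_ne_self h1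
  · intro y hy hyT
    have hyx : y ≠ x := by simpa using hy
    refine hf y hyx fun d n e => hyT ?_
    refine Finset.mem_image.2 ⟨⟨d, n⟩, ?_, e.symm⟩
    simp only [T, Finset.mem_sigma, Finset.mem_filter, Finset.mem_univ, true_and]
    intro h
    exact hyx (by rw [e, h, Function.update_eq_self])

section Product

variable {ℓ : Fin K → Fin K → ℝ}

lemma productRate_self (x : State D K) : productRate ℓ x x = ∑ d, ℓ (x d) (x d) := by
  unfold productRate
  refine Finset.sum_congr rfl fun d _ => ?_
  rw [Finset.sum_eq_single (x d)]
  · simp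
  · intro c _ hc
    rw [if_neg (update_ne_self hc).symm]
  · simp

lemma productRate_update {x : State D K} {d : Fin D} {c : Fin K} (h : c ≠ x d) :
    productRate ℓ (Function.update x d c) x = ℓ c (x d) := by
  unfold productRate
  rw [Finset.sum_eq_single d, Finset.sum_eq_single c, if_pos rfl]
  · intro c' _ hc
    exact if_neg fun e => hc (eq_of_update_eq_update h e).2.symm
  · simp
  · intro d' _ hd
    exact Finset.sum_eq_zero fun c' _ => if_neg fun e => hd (eq_of_update_eq_update h e).1.symm
  · simp

lemma productRate_eq_zero {x y : State D K} (h : ∀ d c, y ≠ Function.update x d c) :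
    productRate ℓ y x = 0 :=
  Finset.sum_eq_zero fun d _ => Finset.sum_eq_zero fun c _ => if_neg (h d c)

lemma sum_productRate (hℓ : ∀ b, ∑ a, ℓ a b = 0) (x : State D K) :
    ∑ y, productRate ℓ y x = 0 := by
  unfold productRate
  rw [Finset.sum_comm]
  refine Finset.sum_eq_zero fun d _ => ?_
  rw [Finset.sum_comm]
  simp [hℓ]

lemma productRate_nonneg (hℓ : ∀ a b, a ≠ b → 0 ≤ ℓ a b) {x y : State D K} (h : y ≠ x) :
    0 ≤ productRate ℓ y x := by
  unfold productRate
  refine Finset.sum_nonneg fun d _ => Finset.sum_nonneg fun c _ => ?_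
  split_ifs with e
  · refine hℓ _ _ fun hc => h ?_
    rw [e, hc, Function.update_eq_self]
  · exact le_rfl

lemma isRate_productRate {γ : ℝ → ℝ} (hγ : ∀ t, 0 ≤ γ t) (hℓ : ∀ a b, a ≠ b → 0 ≤ ℓ a b)
    (hsum : ∀ b, ∑ a, ℓ a b = 0) :
    IsRate (fun t (y x : State D K) => γ t * productRate ℓ y x) :=
  ⟨fun τ _ _ h => mul_nonneg (hγ τ) (productRate_nonneg hℓ h), fun τ x => by
    rw [← Finset.mul_sum, sum_productRate hsum, mul_zero]⟩

end Product

/-- The generator of the uniform jump chain on `N` symbols. -/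
noncomputable def uniformGenerator (a b : Fin N) : ℝ := 1 / N - if a = b then 1 else 0

/-- The transition semigroup of the uniform jump chain on `N` symbols. -/
noncomputable def uniformSemigroup (g : ℝ) (a b : Fin N) : ℝ :=
  (1 - Real.exp (-g)) / N + if a = b then Real.exp (-g) else 0

/-- The generator of the unmasking of one symbol. -/
noncomputable def maskedGenerator (a b : Fin (N + 1)) : ℝ :=
  if b = Fin.last N then (if a = Fin.last N then -1 else 1 / N) else 0

/-- The transition semigroup of the unmasking of one symbol, as a function of `e = exp (-g)`. -/
noncomputable def maskedKernel (e : ℝ) (a b : Fin (N + 1)) : ℝ :=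
  if b = Fin.last N then (if a = Fin.last N then e else (1 - e) / N) else if a = b then 1 else 0

lemma exp_neg_mem {g : ℝ} (hg : 0 ≤ g) : Real.exp (-g) ∈ Ioc (0 : ℝ) 1 :=
  ⟨Real.exp_pos _, Real.exp_le_one_iff.2 (by linarith)⟩

lemma hasDerivAt_exp_neg (g : ℝ) : HasDerivAt (fun g => Real.exp (-g)) (-Real.exp (-g)) g := by
  simpa using (hasDerivAt_neg g).exp

lemma sum_uniformGenerator (b : Fin N) : ∑ a, uniformGenerator a b = 0 := by
  have : (N : ℝ) ≠ 0 := by exact_mod_cast (Fin.pos b).ne'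
  simp [uniformGenerator, Finset.sum_sub_distrib, this]

lemma sum_maskedGenerator (hN : 0 < N) (b : Fin (N + 1)) : ∑ a, maskedGenerator a b = 0 := by
  have : (N : ℝ) ≠ 0 := by exact_mod_cast hN.ne'
  by_cases hb : b = Fin.last N
  · simp [maskedGenerator, hb, Fin.sum_univ_castSucc, this]
  · simp [maskedGenerator, hb]

lemma uniformGenerator_nonneg {a b : Fin N} (h : a ≠ b) : 0 ≤ uniformGenerator a b := by
  simp [uniformGenerator, h]

lemma maskedGenerator_nonneg {a b : Fin (N + 1)} (h : a ≠ b) : 0 ≤ maskedGenerator a b := by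
  unfold maskedGenerator
  split_ifs with h1 h2
  · exact absurd (h2.trans h1.symm) h
  · positivity
  · exact le_rfl

lemma isSemigroup_uniform : IsSemigroup (uniformGenerator (N := N)) uniformSemigroup where
  zero a b := by simp [uniformSemigroup]
  nonneg g hg a b := by
    have := exp_neg_mem hg
    have h1 : 0 ≤ 1 - Real.exp (-g) := by linarith [this.2]
    unfold uniformSemigroup
    split_ifs
    · have := this.1; positivity
    · positivity
  le_one g hg a b := by
    have hN : (1 : ℝ) ≤ N := by exact_mod_cast Fin.pos a
    have := exp_neg_mem hg
    have h1 : (1 - Real.exp (-g)) / N ≤ 1 - Real.exp (-g) :=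
      div_le_self (by linarith [this.2]) hN
    unfold uniformSemigroup
    split_ifs <;> linarith [this.1]
  deriv g a b := by
    have hN : (N : ℝ) ≠ 0 := by exact_mod_cast (Fin.pos a).ne'
    have h1 : HasDerivAt (fun g => (1 - Real.exp (-g)) / N) (Real.exp (-g) / N) g := by
      simpa using ((hasDerivAt_exp_neg g).const_sub 1).div_const (N : ℝ)
    have h2 : HasDerivAt (fun g => if a = b then Real.exp (-g) else 0)
        (if a = b then -Real.exp (-g) else 0) g := by
      split_ifs
      · exact hasDerivAt_exp_neg g
      · exact hasDerivAt_const g _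
    refine (h1.add h2).congr_deriv ?_
    simp only [uniformSemigroup, uniformGenerator, add_mul, mul_sub, Finset.sum_add_distrib,
      Finset.sum_sub_distrib, Finset.sum_const, Finset.card_univ, Fintype.card_fin, nsmul_eq_mul,
      mul_ite, mul_one, mul_zero, Finset.sum_ite_eq', Finset.mem_univ, if_true, ite_mul, zero_mul,
      Finset.sum_ite_eq]
    split_ifs <;> field_simp <;> ring

lemma isSemigroup_masked (hN : 0 < N) :
    IsSemigroup (maskedGenerator (N := N)) fun g => maskedKernel (Real.exp (-g)) where
  zero a b := by
    simp only [maskedKernel, neg_zero, Real.exp_zero, sub_self, zero_div]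
    split_ifs <;> simp_all
  nonneg g hg a b := by
    have := exp_neg_mem hg
    have h1 : 0 ≤ 1 - Real.exp (-g) := by linarith [this.2]
    unfold maskedKernel
    split_ifs
    · exact this.1.le
    · positivity
    · norm_num
    · norm_num
  le_one g hg a b := by
    have hN : (1 : ℝ) ≤ N := by exact_mod_cast hN
    have := exp_neg_mem hg
    have h1 : (1 - Real.exp (-g)) / N ≤ 1 - Real.exp (-g) :=
      div_le_self (by linarith [this.2]) hN
    unfold maskedKernel
    split_ifs <;> linarith [this.1, this.2]
  deriv g a b := by
    have hN : (N : ℝ) ≠ 0 := by exact_mod_cast hN.ne'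
    by_cases hb : b = Fin.last N
    · have h1 : HasDerivAt (fun g => (1 - Real.exp (-g)) / N) (Real.exp (-g) / N) g := by
        simpa using ((hasDerivAt_exp_neg g).const_sub 1).div_const (N : ℝ)
      simp only [maskedKernel, maskedGenerator, hb, if_true]
      by_cases ha : a = Fin.last N
      · simp only [ha, if_true]
        refine (hasDerivAt_exp_neg g).congr_deriv ?_
        simp [Fin.sum_univ_castSucc, Fin.castSucc_ne_last, (Fin.castSucc_ne_last _).symm]
      · simp only [ha, if_false]
        refine h1.congr_deriv ?_
        obtain ⟨n, rfl⟩ := Fin.exists_castSucc_eq.2 ha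
        simp [Fin.sum_univ_castSucc, Fin.castSucc_ne_last]
        field_simp
        ring
    · simp only [maskedKernel, maskedGenerator, hb, if_false, mul_zero, Finset.sum_const_zero]
      exact hasDerivAt_const g _

lemma hammingDist_eq_one_iff {x y : State D K} :
    hammingDist y x = 1 ↔ ∃ d c, c ≠ x d ∧ y = Function.update x d c := by
  unfold hammingDist
  rw [Finset.card_eq_one]
  constructor
  · rintro ⟨d, hd⟩
    have h : ∀ e, y e ≠ x e ↔ e = d := fun e => by
      have := congrArg (fun s => e ∈ s) hd
      simpa using this
    refine ⟨d, y d, (h d).2 rfl, ?_⟩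
    ext e
    by_cases he : e = d
    · subst he; simp
    · rw [Function.update_of_ne he, not_not.1 fun h' => he ((h e).1 h')]
  · rintro ⟨d, c, hc, rfl⟩
    refine ⟨d, ?_⟩
    ext e
    by_cases he : e = d
    · subst he; simpa using hc
    · simp [he]

/-- The generator resamples a site uniformly. Resampling the current symbol is no jump, and its
weight is absorbed in the diagonal value D(1/N - 1). -/
lemma uniformRate_eq (γ : ℝ → ℝ) (t : ℝ) (y x : State D N) :
    uniformRate γ t y x = γ t * productRate uniformGenerator y x := by
  unfold uniformRate
  split_ifs with h1 h2
  · obtain ⟨d, c, hc, rfl⟩ := hammingDist_eq_one_iff.1 h1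
    rw [productRate_update hc]
    simp [uniformGenerator, hc, div_eq_mul_inv]
  · subst h2
    rw [productRate_self]
    simp [uniformGenerator]
    ring
  · rw [productRate_eq_zero, mul_zero]
    intro d c e
    by_cases hc : c = x d
    · exact h2 (by rw [e, hc, Function.update_eq_self])
    · exact h1 (hammingDist_eq_one_iff.2 ⟨d, c, hc, e⟩)

lemma maskedRate_eq (γ : ℝ → ℝ) (t : ℝ) (y x : State D (N + 1)) :
    maskedRate γ t y x = γ t * productRate maskedGenerator y x := by
  unfold maskedRate
  split_ifs with h1 h2
  · subst h1
    rw [productRate_self]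
    simp only [maskedGenerator, ← Finset.sum_filter]
    rw [Finset.sum_congr rfl (g := fun _ => (-1 : ℝ)) fun d hd => if_pos (Finset.mem_filter.1 hd).2]
    simp
  · obtain ⟨d, n, hd, rfl⟩ := h2
    rw [productRate_update (by rw [hd]; exact Fin.castSucc_ne_last n)]
    simp [maskedGenerator, hd, Fin.castSucc_ne_last, div_eq_mul_inv]
  · by_cases h3 : ∃ d c, y = Function.update x d c
    · obtain ⟨d, c, rfl⟩ := h3
      have hc : c ≠ x d := fun e => h1 (by rw [e, Function.update_eq_self])
      rw [productRate_update hc]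
      by_cases hx : x d = Fin.last N
      · obtain ⟨n, rfl⟩ := Fin.exists_castSucc_eq.2 (hx ▸ hc)
        exact absurd ⟨d, n, hx, rfl⟩ h2
      · simp [maskedGenerator, hx]
    · rw [productRate_eq_zero fun d c e => h3 ⟨d, c, e⟩, mul_zero]

section Controlled

variable {ι : Fin N → Fin K} {r : ℝ → State D K → State D K → ℝ} {Φ : Controller D N K}

lemma controlledJump_update (hι : Function.Injective ι) (t : ℝ) {x : State D K} {d : Fin D}
    {n : Fin N} (h : ι n ≠ x d) :
    controlledJump ι r Φ t (Function.update x d (ι n)) x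
      = r t (Function.update x d (ι n)) x * Φ t x d n := by
  unfold controlledJump
  rw [Finset.sum_eq_single d, Finset.sum_eq_single n, if_pos rfl]
  · intro n' _ hn
    exact if_neg fun e => hn (hι (eq_of_update_eq_update h e).2).symm
  · simp [h]
  · intro d' _ hd
    exact Finset.sum_eq_zero fun c' _ => if_neg fun e => hd (eq_of_update_eq_update h e).1.symm
  · simp

lemma controlledJump_eq_zero (t : ℝ) {x y : State D K}
    (h : ∀ d n, y ≠ Function.update x d (ι n)) : controlledJump ι r Φ t y x = 0 :=
  Finset.sum_eq_zero fun d _ => Finset.sum_eq_zero fun n _ => if_neg (h d n)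

lemma controlledRate_of_ne {t : ℝ} {x y : State D K} (h : y ≠ x) :
    controlledRate ι r Φ t y x = controlledJump ι r Φ t y x := if_neg h

lemma isRate_controlledRate (hr : IsRate r) (hΦ : ∀ t x d n, 0 ≤ Φ t x d n) :
    IsRate (controlledRate ι r Φ) where
  nonneg τ y x h := by
    rw [controlledRate_of_ne h]
    refine Finset.sum_nonneg fun d _ => Finset.sum_nonneg fun n hn => ?_
    split_ifs with e
    · exact mul_nonneg (hr.nonneg τ y x h) (hΦ _ _ _ _)
    · exact le_rfl
  sum_eq_zero τ x := by
    rw [← Finset.sum_filter_add_sum_filter_not Finset.univ (fun y => y ≠ x)]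
    have h2 : ∑ y with ¬ y ≠ x, controlledRate ι r Φ τ y x = controlledRate ι r Φ τ x x := by
      simp [Finset.filter_eq']
    rw [h2, controlledRate, if_pos rfl, Finset.sum_congr rfl fun y hy =>
      controlledRate_of_ne (Finset.mem_filter.1 hy).2]
    exact add_neg_cancel _

end Controlled

end DiscreteSampler

/-! ### The chain rule for the relative entropy given a discrete variable. -/

namespace DiscreteSampler

open InformationTheory

variable {D K N : ℕ}

section Entropy

variable {Ω α : Type*} [MeasurableSpace Ω] [Fintype α] [MeasurableSpace α]
  [MeasurableSingletonClass α]

lemma klDiv_withDensity (Q : Measure Ω) [IsFiniteMeasure Q] {g : Ω → ℝ≥0∞} (hg : Measurable g)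
    (hfin : ∫⁻ ω, g ω ∂Q ≠ ⊤) :
    klDiv (Q.withDensity g) Q = ∫⁻ ω, ENNReal.ofReal (klFun (g ω).toReal) ∂Q := by
  have := isFiniteMeasure_withDensity hfin
  rw [klDiv_eq_lintegral_klFun_of_ac (withDensity_absolutelyContinuous _ _)]
  refine lintegral_congr_ae ?_
  filter_upwards [Measure.rnDeriv_withDensity Q hg] with ω hω
  rw [hω]

lemma cond_eq_withDensity {P Q : Measure Ω} [IsFiniteMeasure P] [IsFiniteMeasure Q] (h : P ≪ Q)
    {B : Set Ω} (hB : MeasurableSet B) :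
    ProbabilityTheory.cond P B
      = Q.withDensity fun ω => (P B)⁻¹ * B.indicator (P.rnDeriv Q) ω := by
  have h1 : P = Q.withDensity (P.rnDeriv Q) := (Measure.withDensity_rnDeriv_eq P Q h).symm
  have h2 := withDensity_smul (μ := Q) (P B)⁻¹ ((Measure.measurable_rnDeriv P Q).indicator hB)
  rw [ProbabilityTheory.cond]
  conv_lhs => rw [show P.restrict B = (Q.withDensity (P.rnDeriv Q)).restrict B by rw [← h1]]
  rw [restrict_withDensity hB, ← withDensity_indicator hB, ← h2]
  rfl

/-- The relative entropies of the conditional laws given a discrete variable. -/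
theorem sum_mul_klDiv_cond (P Q : Measure Ω) [IsProbabilityMeasure P] [IsProbabilityMeasure Q]
    {X : Ω → α} (hX : Measurable X) :
    ∑ x, ENNReal.ofReal (P.real {ω | X ω = x}) * klDiv (ProbabilityTheory.cond P {ω | X ω = x}) Q
      = klDiv P Q + ∑ x, ENNReal.ofReal (Real.negMulLog (P.real {ω | X ω = x})) := by
  have hB : ∀ x, MeasurableSet {ω | X ω = x} := fun x => hX (measurableSet_singleton x)
  set p : α → ℝ := fun x => P.real {ω | X ω = x}
  have hp : ∀ x, 0 ≤ p x := fun x => measureReal_nonneg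
  have hp1 : ∀ x, p x ≤ 1 := fun x => measureReal_le_one
  have hsum : ∑ x, p x = 1 := by
    have := sum_real_inter_fiber P hX univ
    simpa [p] using this
  -- If P is not absolutely continuous, some conditional law of positive weight is not either, and
  -- both sides are infinite.
  by_cases hac : P ≪ Q
  swap
  · rw [klDiv_of_not_ac hac, top_add]
    obtain ⟨x, hx⟩ : ∃ x, p x ≠ 0 ∧ ¬ ProbabilityTheory.cond P {ω | X ω = x} ≪ Q := by
      by_contra! hcon
      refine hac (Measure.AbsolutelyContinuous.mk fun A hA hQA => ?_)
      have : A = ⋃ x, {ω | X ω = x} ∩ A := by ext ω; simp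
      rw [this]
      refine measure_iUnion_null fun x => ?_
      by_cases hx : p x = 0
      · exact measure_mono_null inter_subset_left ((measureReal_eq_zero_iff).1 hx)
      · have h := hcon x hx hQA
        rw [ProbabilityTheory.cond_apply (hB x)] at h
        simpa [measure_ne_top] using h
    refine ENNReal.sum_eq_top.2 ⟨x, Finset.mem_univ _, ?_⟩
    rw [klDiv_of_not_ac hx.2, ENNReal.mul_top]
    exact (ENNReal.ofReal_pos.2 ((hp x).lt_of_ne hx.1.symm)).ne'
  set f := P.rnDeriv Q
  have hf : Measurable f := Measure.measurable_rnDeriv P Q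
  have hPf : ∀ A, MeasurableSet A → ∫⁻ ω in A, f ω ∂Q = P A := fun A hA =>
    Measure.setLIntegral_rnDeriv hac A
  have hterm : ∀ x, ENNReal.ofReal (p x) * klDiv (ProbabilityTheory.cond P {ω | X ω = x}) Q
      = ∫⁻ ω, ENNReal.ofReal (p x * klFun ((p x)⁻¹ *
        ({ω | X ω = x} : Set Ω).indicator (fun ω => (f ω).toReal) ω)) ∂Q := by
    intro x
    by_cases hx : p x = 0
    · simp [hx]
    have hPB : P {ω | X ω = x} ≠ 0 := fun h => hx (by simp [p, measureReal_def, h])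
    have hm : Measurable fun ω => (P {ω | X ω = x})⁻¹ * ({ω | X ω = x} : Set Ω).indicator f ω :=
      (hf.indicator (hB x)).const_mul _
    rw [cond_eq_withDensity hac (hB x), klDiv_withDensity Q hm, ← lintegral_const_mul]
    · refine lintegral_congr fun ω => ?_
      rw [← ENNReal.ofReal_mul (hp x), ENNReal.toReal_mul, ENNReal.toReal_inv]
      congr 4
      by_cases hω : X ω = x <;> simp [indicator, hω]
    · exact (measurable_klFun.comp hm.ennreal_toReal).ennreal_ofReal
    · rw [lintegral_const_mul _ (hf.indicator (hB x)), lintegral_indicator (hB x), hPf _ (hB x)]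
      rw [ENNReal.inv_mul_cancel hPB (measure_ne_top _ _)]
      exact ENNReal.one_ne_top
  have hmeas : ∀ x, Measurable fun ω => ENNReal.ofReal (p x * klFun ((p x)⁻¹ *
        ({ω | X ω = x} : Set Ω).indicator (fun ω => (f ω).toReal) ω)) := fun x =>
    ((measurable_klFun.comp ((hf.ennreal_toReal.indicator (hB x)).const_mul _)).const_mul
      _).ennreal_ofReal
  rw [Finset.sum_congr rfl fun x _ => hterm x, ← lintegral_finsetSum _ fun x _ => hmeas x]
  have hlog : ∀ x, 0 ≤ -Real.log (p x) := fun x => by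
    linarith [Real.log_nonpos (hp x) (hp1 x)]
  -- Where p(X) = 0 the density vanishes almost everywhere, so the values of 0⁻¹ and log 0 by
  -- convention do no harm.
  have hnull : ∀ᵐ ω ∂Q, p (X ω) = 0 → f ω = 0 := by
    have h1 : ∀ x, ∀ᵐ ω ∂Q, X ω = x → p x = 0 → f ω = 0 := by
      intro x
      by_cases hx : p x = 0
      · have h2 := hPf _ (hB x)
        rw [(measureReal_eq_zero_iff).1 hx, setLIntegral_eq_zero_iff (hB x) hf] at h2
        filter_upwards [h2] with ω hω h3 _
        exact hω h3
      · exact Eventually.of_forall fun _ _ h => absurd h hx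
    filter_upwards [ae_all_iff.2 h1] with ω hω
    exact hω _ rfl
  -- Pointwise, every x ≠ X contributes p(x) klFun(0) = p(x), a total of 1 - p(X). The remaining
  -- term is f log f - f log p(X) - f + p(X). The sum is klFun(f) plus the entropy term.
  have hpt : ∀ᵐ ω ∂Q, ∑ x, ENNReal.ofReal (p x * klFun ((p x)⁻¹ *
        ({ω | X ω = x} : Set Ω).indicator (fun ω => (f ω).toReal) ω))
      = ENNReal.ofReal (klFun (f ω).toReal)
        + f ω * ENNReal.ofReal (-Real.log (p (X ω))) := by
    filter_upwards [hnull, Measure.rnDeriv_lt_top P Q] with ω h0 htop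
    have hφ : 0 ≤ (f ω).toReal := ENNReal.toReal_nonneg
    have hnn : ∀ x, 0 ≤ p x * klFun ((p x)⁻¹ *
        ({ω | X ω = x} : Set Ω).indicator (fun ω => (f ω).toReal) ω) := fun x =>
      mul_nonneg (hp x) (klFun_nonneg (mul_nonneg (inv_nonneg.2 (hp x))
        (indicator_nonneg (fun _ _ => ENNReal.toReal_nonneg) _)))
    rw [← ENNReal.ofReal_sum_of_nonneg fun x _ => hnn x]
    have htop' : f ω ≠ ⊤ := htop.ne
    have hmul : f ω * ENNReal.ofReal (-Real.log (p (X ω)))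
        = ENNReal.ofReal ((f ω).toReal * -Real.log (p (X ω))) := by
      rw [ENNReal.ofReal_mul hφ, ENNReal.ofReal_toReal htop']
    rw [hmul, ← ENNReal.ofReal_add (klFun_nonneg hφ) (mul_nonneg hφ (hlog _))]
    congr 1
    classical
    have hrest : ∀ x, p x * klFun ((p x)⁻¹ *
        ({ω | X ω = x} : Set Ω).indicator (fun ω => (f ω).toReal) ω)
        = p x + if x = X ω then p x * klFun ((p x)⁻¹ * (f ω).toReal) - p x else 0 := by
      intro x
      by_cases hx : x = X ω
      · subst hx; simp [indicator]
      · simp [indicator, hx, Ne.symm hx, klFun_zero]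
    rw [Finset.sum_congr rfl fun x _ => hrest x, Finset.sum_add_distrib, hsum,
      Finset.sum_ite_eq' Finset.univ, if_pos (Finset.mem_univ _)]
    by_cases hpx : p (X ω) = 0
    · have hf0 : f ω = 0 := h0 hpx
      simp [hpx, hf0, klFun_zero]
    · by_cases hf0 : (f ω).toReal = 0
      · simp [hf0, klFun_zero]
      · rw [klFun_apply, klFun_apply, Real.log_mul (inv_ne_zero hpx) hf0, Real.log_inv]
        field_simp
        ring
  rw [lintegral_congr_ae hpt, lintegral_add_left
    (f := fun ω => ENNReal.ofReal (klFun (f ω).toReal))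
    (measurable_klFun.comp hf.ennreal_toReal).ennreal_ofReal,
    ← klDiv_eq_lintegral_klFun_of_ac hac]
  congr 1
  refine (lintegral_rnDeriv_mul hac (f := fun ω => ENNReal.ofReal (-Real.log (p (X ω))))
    ((measurable_of_finite fun x => ENNReal.ofReal (-Real.log (p x))).comp hX).aemeasurable).trans ?_
  rw [← setLIntegral_univ,
    setLIntegral_eq_sum_fiber P hX univ MeasurableSet.univ]
  refine Finset.sum_congr rfl fun x _ => ?_
  rw [univ_inter, setLIntegral_congr_fun (g := fun _ => ENNReal.ofReal (-Real.log (p x))) (hB x)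
    fun ω (hω : X ω = x) => by simp only [hω], setLIntegral_const, mul_comm,
    ← ofReal_measureReal, ← ENNReal.ofReal_mul (hp x), Real.negMulLog]
  congr 1
  simp only [p]
  ring

end Entropy

end DiscreteSampler

/-! ### The Schrödinger bridge as an information projection. -/

namespace DiscreteSampler

open InformationTheory

variable {D K N : ℕ}

lemma exists_abs_le {β : Type*} [Fintype β] (φ : β → ℝ) : ∃ B, ∀ x, |φ x| ≤ B :=
  ⟨∑ x, |φ x|, fun x => Finset.single_le_sum (f := fun x => |φ x|) (fun _ _ => abs_nonneg _)
    (Finset.mem_univ x)⟩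

section Projection

variable {Ω α : Type*} [MeasurableSpace Ω] [Fintype α] [MeasurableSpace α]
  [MeasurableSingletonClass α] {R P : Measure Ω} {X : Ω → α} {h : α → ℝ}

lemma integral_comp_eq_sum [IsFiniteMeasure P] (hX : Measurable X) (φ : α → ℝ) :
    ∫ ω, φ (X ω) ∂P = ∑ x, P.real {ω | X ω = x} * φ x := by
  simpa using integral_eq_sum_fiber P hX univ φ

lemma integrable_comp_mul [IsFiniteMeasure P] (hX : Measurable X) (φ : α → ℝ) {g : Ω → ℝ}
    (hg : Integrable g P) : Integrable (fun ω => φ (X ω) * g ω) P := by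
  obtain ⟨B, hB⟩ := exists_abs_le φ
  exact hg.bdd_mul ((measurable_of_finite φ).comp hX).aestronglyMeasurable
    (ae_of_all _ fun ω => hB (X ω))

lemma integral_withDensity_comp (hX : Measurable X) (hh : ∀ x, 0 ≤ h x) (g : Ω → ℝ) :
    ∫ ω, g ω ∂(R.withDensity fun ω => ENNReal.ofReal (h (X ω))) = ∫ ω, h (X ω) * g ω ∂(R) := by
  have hm : Measurable fun ω => ENNReal.ofReal (h (X ω)) :=
    ((measurable_of_finite h).comp hX).ennreal_ofReal
  rw [integral_withDensity_eq_integral_toReal_smul hm (by simp)]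
  simp [ENNReal.toReal_ofReal (hh _)]

/-- Among the laws of `ω` with a given law of `X`, the one whose density depends on `X` only
minimizes the relative entropy, and it is the unique minimizer. -/
theorem eq_withDensity_of_klDiv_le [IsProbabilityMeasure R] [IsProbabilityMeasure P]
    (hX : Measurable X) (hh : ∀ x, 0 ≤ h x)
    (hlaw : ∀ x, P.real {ω | X ω = x} = h x * R.real {ω | X ω = x})
    (hmin : klDiv P R ≤ klDiv (R.withDensity fun ω => ENNReal.ofReal (h (X ω))) R) :
    P = R.withDensity fun ω => ENNReal.ofReal (h (X ω)) := by
  have hsum : ∑ x, h x * R.real {ω | X ω = x} = 1 := by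
    simp_rw [← hlaw]
    simpa using sum_real_inter_fiber P hX univ
  have hint : ∫ ω, h (X ω) ∂(R) = 1 := by
    rw [integral_comp_eq_sum hX, ← hsum]
    exact Finset.sum_congr rfl fun x _ => mul_comm _ _
  have hi : ∀ (φ : α → ℝ) (μ : Measure Ω) [IsFiniteMeasure μ],
      Integrable (fun ω => φ (X ω)) μ := fun φ μ _ => by
    simpa using integrable_comp_mul hX φ (integrable_const (1 : ℝ))
  set Q := R.withDensity fun ω => ENNReal.ofReal (h (X ω)) with hQ
  have : IsProbabilityMeasure Q := by
    refine ⟨?_⟩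
    rw [hQ, withDensity_apply _ MeasurableSet.univ, setLIntegral_univ,
      ← ofReal_integral_eq_lintegral_ofReal (hi h R) (ae_of_all _ fun ω => hh _), hint,
      ENNReal.ofReal_one]
  set E : ℝ := ∫ ω, h (X ω) * Real.log (h (X ω)) ∂(R)
  have hiE : Integrable (fun ω => h (X ω) * Real.log (h (X ω))) R :=
    hi (fun x => h x * Real.log (h x)) R
  -- The functional tested by G is at most ∫ h log h dR, which bounds the relative entropy of the
  -- candidate Q and hence, by minimality, that of P.
  have key : ∀ (G : Ω → ℝ) (m M : ℝ), Measurable G → 0 < m → (∀ ω, m ≤ G ω) → (∀ ω, G ω ≤ M) →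
      ∫ ω, Real.log (G ω) ∂Q - ∫ ω, G ω ∂(R) + 1 ≤ E := by
    intro G m M hG hm hGm hGM
    rw [integral_withDensity_comp hX hh]
    have h1 := integrable_comp_mul hX h (integrable_log_of_bounds (P := R) hG hm hGm hGM)
    have h2 := integrable_of_bounds (P := R) hG hGm hGM
    have h3 : ∫ ω, h (X ω) * Real.log (G ω) ∂(R)
        ≤ ∫ ω, (h (X ω) * Real.log (h (X ω)) + G ω) - h (X ω) ∂(R) := by
      refine integral_mono h1 ((hiE.add h2).sub (hi h R)) fun ω => ?_
      have hGpos : 0 < G ω := hm.trans_le (hGm ω)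
      rcases (hh (X ω)).eq_or_lt with h0 | h0
      · simp only [← h0]; linarith
      · have := Real.log_le_sub_one_of_pos (div_pos hGpos h0)
        rw [Real.log_div hGpos.ne' h0.ne'] at this
        have h5 := mul_le_mul_of_nonneg_left this h0.le
        have h6 : h (X ω) * (G ω / h (X ω) - 1) = G ω - h (X ω) := by field_simp
        simp only
        nlinarith
    have h4 : Integrable (fun ω => h (X ω) * Real.log (h (X ω)) + G ω) R := hiE.add h2
    rw [integral_sub h4 (hi h R), integral_add hiE h2, hint] at h3
    linarith
  have hE : 0 ≤ E := by
    have := key (fun _ => 1) 1 1 measurable_const one_pos (fun _ => le_rfl) fun _ => le_rfl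
    simpa using this
  have hP : klDiv P R ≤ ENNReal.ofReal E := hmin.trans (klDiv_le_of_forall hE key)
  -- A Pythagorean argument: testing KL(P ‖ R) with h(X) G isolates ∫ log h(X) dP, which depends
  -- only on the law of X and so equals E. What remains says that G tests KL(P ‖ Q) nonpositively.
  have hzero : klDiv P Q ≤ ENNReal.ofReal 0 := by
    refine klDiv_le_of_forall le_rfl fun G m M hG hm hGm hGM => ?_
    refine le_of_forall_pos_le_add fun η hη => ?_
    obtain ⟨B, hB⟩ := exists_abs_le h
    set ε : ℝ := η / (|M| + 1)
    have hε : 0 < ε := by positivity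
    classical
    -- A test function has to be bounded away from zero. Raising h to ε where it vanishes is
    -- invisible to P, which gives these values of X no mass, and changes the R-integral by at most
    -- η.
    set h' : α → ℝ := fun x => if h x = 0 then ε else h x
    have hh' : ∀ x, 0 < h' x := fun x => by
      simp only [h']
      split_ifs with h0
      · exact hε
      · exact (hh x).lt_of_ne (Ne.symm h0)
    have hh'ε : ∀ x, h' x ≤ h x + ε := fun x => by
      simp only [h']
      split_ifs <;> linarith [hh x]
    have hne : Nonempty α := ⟨X (nonempty_of_isProbabilityMeasure R).some⟩
    obtain ⟨x₀, hx₀⟩ := Finite.exists_min h'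
    have hmeas : Measurable fun ω => h' (X ω) * G ω := ((measurable_of_finite h').comp hX).mul hG
    have hlow : ∀ ω, h' x₀ * m ≤ h' (X ω) * G ω := fun ω =>
      mul_le_mul (hx₀ _) (hGm ω) hm.le (hh' _).le
    have hupp : ∀ ω, h' (X ω) * G ω ≤ (B + ε) * M := fun ω =>
      mul_le_mul ((hh'ε _).trans (by linarith [(abs_le.1 (hB (X ω))).2])) (hGM ω)
        (hm.le.trans (hGm ω)) (by linarith [(abs_nonneg _).trans (hB (X ω))])
    have h1 := (ofReal_integral_log_le_klDiv (P := P) (Q := R) hmeas (mul_pos (hh' x₀) hm) hlow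
      hupp).trans hP
    rw [ENNReal.ofReal_le_ofReal_iff hE] at h1
    have h2 : ∫ ω, Real.log (h' (X ω) * G ω) ∂P = E + ∫ ω, Real.log (G ω) ∂P := by
      have : ∀ ω, Real.log (h' (X ω) * G ω) = Real.log (h' (X ω)) + Real.log (G ω) := fun ω =>
        Real.log_mul (hh' _).ne' (hm.trans_le (hGm ω)).ne'
      simp_rw [this]
      rw [integral_add (hi (fun x => Real.log (h' x)) P) (integrable_log_of_bounds hG hm hGm hGM),
        integral_comp_eq_sum hX fun x => Real.log (h' x)]
      congr 1
      simp only [E]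
      rw [integral_comp_eq_sum hX fun x => h x * Real.log (h x)]
      refine Finset.sum_congr rfl fun x _ => ?_
      rw [hlaw]
      by_cases h0 : h x = 0
      · simp [h0]
      · simp only [h', if_neg h0]; ring
    have iG := integrable_of_bounds (P := R) hG hGm hGM
    have h3 : ∫ ω, h' (X ω) * G ω ∂(R) ≤ ∫ ω, h (X ω) * G ω ∂(R) + η := by
      have : ∫ ω, h' (X ω) * G ω ∂(R) ≤ ∫ ω, h (X ω) * G ω + η ∂(R) := by
        refine integral_mono (integrable_comp_mul hX h' iG)
          ((integrable_comp_mul hX h iG).add (integrable_const η)) fun ω => ?_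
        have hGpos : 0 < G ω := hm.trans_le (hGm ω)
        have h5 := mul_le_mul_of_nonneg_right (hh'ε (X ω)) hGpos.le
        have h6 : ε * G ω ≤ η := by
          simp only [ε]
          rw [div_mul_eq_mul_div, div_le_iff₀ (by positivity)]
          exact mul_le_mul_of_nonneg_left ((hGM ω).trans ((le_abs_self M).trans (by linarith)))
            hη.le
        simp only
        linarith
      rw [integral_add (integrable_comp_mul hX h iG) (integrable_const η)] at this
      simpa using this
    rw [h2] at h1
    rw [integral_withDensity_comp hX hh]
    linarith
  rw [ENNReal.ofReal_zero, nonpos_iff_eq_zero, klDiv_eq_zero_iff] at hzero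
  exact hzero

end Projection

section Bridge

variable {Pr Pstar : Measure (PathSpace D K)} {μ ν : Measure (State D K)}

/-- The Schrödinger bridge is a mixture of the laws conditioned on the endpoint, if the endpoints
of the reference are independent. -/
theorem IsSchrodingerBridge.eq_withDensity [IsProbabilityMeasure Pr]
    (hb : IsSchrodingerBridge Pr μ ν Pstar) (h0 : Pr.map (coord 0) = μ)
    (hindep : ∀ x y, Pr.real ({ω | coord 0 ω = x} ∩ {ω | coord 1 ω = y})
      = Pr.real {ω | coord 0 ω = x} * Pr.real {ω | coord 1 ω = y})
    (hν : ∀ y, Pr.real {ω | coord 1 ω = y} = 0 → ν.real {y} = 0) :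
    Pstar = Pr.withDensity fun ω =>
      ENNReal.ofReal (ν.real {coord 1 ω} / Pr.real {ω' | coord 1 ω' = coord 1 ω}) := by
  have := hb.isProb
  have hcm : ∀ t : ℝ, Measurable (coord t : PathSpace D K → State D K) := measurable_coord
  set h : State D K → ℝ := fun y => ν.real {y} / Pr.real {ω | coord 1 ω = y}
  have hh : ∀ y, 0 ≤ h y := fun y => div_nonneg measureReal_nonneg measureReal_nonneg
  have hhp : ∀ y, h y * Pr.real {ω | coord 1 ω = y} = ν.real {y} := fun y => by
    by_cases hy : Pr.real {ω | coord 1 ω = y} = 0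
    · rw [hy, mul_zero, hν y hy]
    · exact div_mul_cancel₀ _ hy
  have hν1 : ∀ y, Pstar.real {ω | coord 1 ω = y} = ν.real {y} := fun y => by
    rw [← hb.terminal, map_measureReal_apply (hcm 1) (measurableSet_singleton y)]; rfl
  have hνprob : IsProbabilityMeasure ν := by
    rw [← hb.terminal]; exact Measure.isProbabilityMeasure_map (hcm 1).aemeasurable
  set Q := Pr.withDensity fun ω => ENNReal.ofReal (h (coord 1 ω)) with hQ
  have hQapp : ∀ A, MeasurableSet A →
      Q A = ∑ y, ENNReal.ofReal (h y * Pr.real (A ∩ {ω | coord 1 ω = y})) := fun A hA => by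
    rw [hQ, withDensity_apply _ hA, setLIntegral_eq_sum_fiber Pr (hcm 1) A hA]
    refine Finset.sum_congr rfl fun y _ => ?_
    rw [setLIntegral_congr_fun (g := fun _ => ENNReal.ofReal (h y))
      (hA.inter (measurableSet_coord 1 y)) fun ω hω => by
        have : coord 1 ω = y := hω.2
        simp only [this], setLIntegral_const, ENNReal.ofReal_mul (hh y), ofReal_measureReal]
  have hQ1 : IsProbabilityMeasure Q := by
    refine ⟨?_⟩
    rw [hQapp _ MeasurableSet.univ]
    simp_rw [univ_inter, hhp]
    rw [← ENNReal.ofReal_sum_of_nonneg fun _ _ => measureReal_nonneg]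
    have := sum_measureReal_singleton (μ := ν) Finset.univ
    rw [this, Finset.coe_univ, probReal_univ, ENNReal.ofReal_one]
  refine eq_withDensity_of_klDiv_le (hcm 1) hh (fun y => (hν1 y).trans (hhp y).symm)
    (hb.minimal Q hQ1 ?_ ?_)
  -- The reweighting involves X_1 only, so by independence of the endpoints it leaves the law of X_0
  -- unchanged.
  · rw [← h0]
    refine Measure.ext_of_singleton fun x => ?_
    rw [Measure.map_apply (hcm 0) (measurableSet_singleton x),
      Measure.map_apply (hcm 0) (measurableSet_singleton x)]
    change Q {ω | coord 0 ω = x} = Pr {ω | coord 0 ω = x}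
    rw [hQapp _ (measurableSet_coord 0 x)]
    simp_rw [hindep, mul_left_comm, hhp]
    rw [← ENNReal.ofReal_sum_of_nonneg fun _ _ => mul_nonneg measureReal_nonneg measureReal_nonneg,
      ← Finset.mul_sum, sum_measureReal_singleton, Finset.coe_univ, probReal_univ, mul_one,
      ofReal_measureReal]
  · refine Measure.ext_of_singleton fun x => ?_
    rw [Measure.map_apply (hcm 1) (measurableSet_singleton x)]
    change Q {ω | coord 1 ω = x} = ν {x}
    rw [hQapp _ (measurableSet_coord 1 x), Finset.sum_eq_single x]
    · rw [inter_self, hhp, ofReal_measureReal]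
    · intro y _ hy
      have : {ω : PathSpace D K | coord 1 ω = x} ∩ {ω | coord 1 ω = y} = ∅ := by
        ext ω
        simp only [mem_inter_iff, mem_ofPred_eq, mem_empty_iff_false, iff_false, not_and]
        intro h1 h2
        exact hy (h2.symm.trans h1)
      simp [this]
    · simp

lemma IsSchrodingerBridge.real_coord_one (hb : IsSchrodingerBridge Pr μ ν Pstar)
    (y : State D K) : Pstar.real {ω | coord 1 ω = y} = ν.real {y} := by
  rw [← hb.terminal, map_measureReal_apply (measurable_coord 1) (measurableSet_singleton y)]; rfl

/-- The Schrödinger bridge has the same bridges as the reference. -/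
theorem IsSchrodingerBridge.cond_eq [IsProbabilityMeasure Pr]
    (hb : IsSchrodingerBridge Pr μ ν Pstar) (h0 : Pr.map (coord 0) = μ)
    (hindep : ∀ x y, Pr.real ({ω | coord 0 ω = x} ∩ {ω | coord 1 ω = y})
      = Pr.real {ω | coord 0 ω = x} * Pr.real {ω | coord 1 ω = y})
    (hν : ∀ y, Pr.real {ω | coord 1 ω = y} = 0 → ν.real {y} = 0) {y : State D K}
    (hy : ν.real {y} ≠ 0) :
    ProbabilityTheory.cond Pstar {ω | coord 1 ω = y}
      = ProbabilityTheory.cond Pr {ω | coord 1 ω = y} := by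
  have hB := measurableSet_coord (D := D) (K := K) 1 y
  have hprob := hb.isProb
  have h1 := hb.real_coord_one y
  have hPr : Pr.real {ω | coord 1 ω = y} ≠ 0 := fun h => hy (hν y h)
  have hc : ENNReal.ofReal (ν.real {y} / Pr.real {ω | coord 1 ω = y}) ≠ 0 := by
    rw [Ne, ENNReal.ofReal_eq_zero, not_le]
    exact div_pos (measureReal_nonneg.lt_of_ne hy.symm) (measureReal_nonneg.lt_of_ne hPr.symm)
  have hres : Pstar.restrict {ω | coord 1 ω = y}
      = ENNReal.ofReal (ν.real {y} / Pr.real {ω | coord 1 ω = y})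
        • Pr.restrict {ω | coord 1 ω = y} := by
    rw [hb.eq_withDensity h0 hindep hν, restrict_withDensity hB, ← withDensity_const]
    refine withDensity_congr_ae ?_
    filter_upwards [ae_restrict_mem hB] with ω hω
    have : coord 1 ω = y := hω
    simp only [this]
  have hmass : Pstar {ω | coord 1 ω = y}
      = ENNReal.ofReal (ν.real {y} / Pr.real {ω | coord 1 ω = y}) * Pr {ω | coord 1 ω = y} := by
    have := congrArg (fun m : Measure (PathSpace D K) => m univ) hres
    simpa using this
  rw [ProbabilityTheory.cond, ProbabilityTheory.cond, hres, hmass, smul_smul,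
    ENNReal.mul_inv (Or.inl hc) (Or.inl ENNReal.ofReal_ne_top), mul_right_comm,
    ENNReal.inv_mul_cancel hc ENNReal.ofReal_ne_top, one_mul]

end Bridge

end DiscreteSampler

/-! ### The reference conditioned on its endpoint, as a Doob transform. -/

namespace DiscreteSampler

open InformationTheory

variable {D K N : ℕ}

section

variable {u r : ℝ → State D K → State D K → ℝ} {μ : Measure (State D K)}
  {P R Q : Measure (PathSpace D K)} {γ : ℝ → ℝ} {C : ℝ} {p : ℝ → State D K → State D K → ℝ}

lemma IsCTMC.forwardOn_of_integrable (h : IsCTMC u μ P) {a b : ℝ} (ha : 0 ≤ a) (hb : b ≤ 1)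
    (hu : ∀ x y, IntervalIntegrable (fun τ => u τ y x) volume a b) : ForwardOn u P a b :=
  fun s t has hst htb A hA y => h.forward s t (ha.trans has) hst (htb.trans hb)
    (fun x y => IntervalIntegrable.sub_interval (hu x y) has hst htb) A hA y

lemma IsCTMC.forwardOn (h : IsCTMC u μ P) {a b : ℝ} (ha : 0 < a) (hab : a ≤ b) (hb : b < 1) :
    ForwardOn u P a b :=
  h.forwardOn_of_integrable ha.le hb.le (h.integrable a b ha hab hb)

lemma intervalIntegrable_sum_abs {a b : ℝ}
    (hu : ∀ x y, IntervalIntegrable (fun τ => u τ y x) volume a b) :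
    IntervalIntegrable (fun τ => ∑ y, ∑ x, |u τ y x|) volume a b :=
  intervalIntegrable_sum _ fun y _ => intervalIntegrable_sum _ fun x _ => (hu x y).abs

/-- `p t y x` is the transition probability from `x` at time `t` to `y` at time `1`. -/
structure IsTerminalKernel (γ : ℝ → ℝ) (C : ℝ) (p : ℝ → State D K → State D K → ℝ)
    (R : Measure (PathSpace D K)) : Prop where
  nonneg : ∀ t, 0 < t → t < 1 → ∀ y x, 0 ≤ p t y x
  le_one : ∀ t, 0 < t → t < 1 → ∀ y x, p t y x ≤ 1
  const_nonneg : 0 ≤ C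
  abs_sub_le : ∀ s t, 0 < s → s ≤ t → t < 1 → ∀ y x, |p t y x - p s y x| ≤ C * ∫ τ in s..t, γ τ
  mass_eq : ∀ t, 0 < t → t < 1 → ∀ A : Set (PathSpace D K), MeasurableSet[past t] A → ∀ y,
    mass R A 1 y = ∑ x, p t y x * mass R A t x

/-- The law of the path, given its endpoint `y`. -/
noncomputable abbrev condTerminal (R : Measure (PathSpace D K)) (y : State D K) :
    Measure (PathSpace D K) :=
  ProbabilityTheory.cond R {ω | coord 1 ω = y}

lemma condTerminal_real (R : Measure (PathSpace D K)) (y : State D K) (E : Set (PathSpace D K)) :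
    (condTerminal R y).real E = R.real (E ∩ {ω | coord 1 ω = y}) / R.real {ω | coord 1 ω = y} := by
  rw [measureReal_def, ProbabilityTheory.cond_apply (measurableSet_coord 1 y), ENNReal.toReal_mul,
    ENNReal.toReal_inv, inter_comm, mul_comm, div_eq_mul_inv]
  rfl

lemma isProbabilityMeasure_condTerminal [IsFiniteMeasure R] {y : State D K}
    (hy : R.real {ω | coord 1 ω = y} ≠ 0) : IsProbabilityMeasure (condTerminal R y) :=
  ProbabilityTheory.cond_isProbabilityMeasure fun h => hy (by simp [measureReal_def, h])

/-- The Markov property, obtained by applying the kernel identity to the past event A ∩ {X_t = x}.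
-/
lemma IsTerminalKernel.real_inter_inter (hp : IsTerminalKernel γ C p R) {t : ℝ} (ht : 0 < t)
    (ht1 : t < 1) {A : Set (PathSpace D K)} (hA : MeasurableSet[past t] A) (x y : State D K) :
    R.real (A ∩ {ω | coord t ω = x} ∩ {ω | coord 1 ω = y}) = p t y x * mass R A t x := by
  have h := hp.mass_eq t ht ht1 (A ∩ {ω | coord t ω = x})
    (hA.inter (measurableSet_past_coord ht.le le_rfl x)) y
  simp_rw [mass_inter_self] at h
  simpa [mass] using h

lemma IsTerminalKernel.mass_condTerminal (hp : IsTerminalKernel γ C p R) {t : ℝ} (ht : 0 < t)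
    (ht1 : t < 1) {A : Set (PathSpace D K)} (hA : MeasurableSet[past t] A) (x y : State D K) :
    mass (condTerminal R y) A t x
      = mass R A t x * (p t y x / R.real {ω | coord 1 ω = y}) := by
  rw [mass, condTerminal_real, hp.real_inter_inter ht ht1 hA]
  ring

/-- Conditioning on an event of positive probability preserves null limits. The regularity at times
0 and 1 passes from the reference to the conditioned law through this bound. -/
lemma condTerminal_real_le [IsFiniteMeasure R] (y : State D K) (E : Set (PathSpace D K)) :
    (condTerminal R y).real E ≤ R.real E / R.real {ω | coord 1 ω = y} := by
  rw [condTerminal_real]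
  gcongr
  exact measure_ne_top _ _
  exact inter_subset_left

/-- Girsanov's theorem applies to the reference conditioned on its endpoint. -/
lemma IsTerminalKernel.girsanovSetting [IsProbabilityMeasure R] (hp : IsTerminalKernel γ C p R)
    (hR : IsCTMC r μ R) (hr : IsRate r) (hQ : IsCTMC u μ Q) (hu : IsRate u)
    (hγ : ∀ a b, 0 < a → a ≤ b → b < 1 → IntervalIntegrable γ volume a b) (hγ0 : ∀ t, 0 ≤ γ t)
    {y : State D K} (hy : R.real {ω | coord 1 ω = y} ≠ 0) :
    GirsanovSetting r u (fun t x => p t y x / R.real {ω | coord 1 ω = y})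
      (1 / R.real {ω | coord 1 ω = y})
      (fun τ => ∑ y, ∑ x, |r τ y x| + ∑ y, ∑ x, |u τ y x|
        + C / R.real {ω | coord 1 ω = y} * γ τ) R (condTerminal R y) Q := by
  set c := R.real {ω | coord 1 ω = y}
  have hc : 0 < c := measureReal_nonneg.lt_of_ne hy.symm
  have hC := hp.const_nonneg
  have h0 : ∀ (v : ℝ → State D K → State D K → ℝ) τ, 0 ≤ ∑ y, ∑ x, |v τ y x| := fun v τ =>
    Finset.sum_nonneg fun _ _ => Finset.sum_nonneg fun _ _ => abs_nonneg _
  have h1 : ∀ τ, 0 ≤ C / c * γ τ := fun τ => mul_nonneg (by positivity) (hγ0 τ)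
  -- One integrable function dominates both families of rates and the increments of the density, as
  -- the Girsanov setting demands.
  have hint : ∀ a b, 0 < a → a ≤ b → b < 1 → IntervalIntegrable (fun τ =>
      ∑ y, ∑ x, |r τ y x| + ∑ y, ∑ x, |u τ y x| + C / c * γ τ) volume a b := fun a b ha hab hb =>
    ((intervalIntegrable_sum_abs (hR.integrable a b ha hab hb)).add
      (intervalIntegrable_sum_abs (hQ.integrable a b ha hab hb))).add
      ((hγ a b ha hab hb).const_mul _)
  refine ⟨fun a b ha hab hb => ⟨?_, ?_, ?_, ?_⟩, fun a b => hR.forwardOn, fun a b => hQ.forwardOn,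
    fun a b ha hab hb => ⟨hR.integrable a b ha hab hb, hint a b ha hab hb, fun τ => ?_⟩,
    fun a b ha hab hb => ⟨hQ.integrable a b ha hab hb, hint a b ha hab hb, fun τ => ?_⟩, hr, hu, ?_,
    hQ.left_cont⟩
  · intro t hat htb x
    exact div_nonneg (hp.nonneg t (ha.trans_le hat) (htb.trans_lt hb) y x) hc.le
  · intro t hat htb x
    exact div_le_div_of_nonneg_right (hp.le_one t (ha.trans_le hat) (htb.trans_lt hb) y x) hc.le
  · intro s t has hst htb x
    rw [← sub_div, abs_div, abs_of_pos hc]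
    calc |p t y x - p s y x| / c ≤ (C * ∫ τ in s..t, γ τ) / c :=
          div_le_div_of_nonneg_right (hp.abs_sub_le s t (ha.trans_le has) hst (htb.trans_lt hb) y x)
            hc.le
      _ = ∫ τ in s..t, C / c * γ τ := by rw [intervalIntegral.integral_const_mul]; ring
      _ ≤ _ := by
          refine intervalIntegral.integral_mono_on hst
            ((hγ s t (ha.trans_le has) hst (htb.trans_lt hb)).const_mul _)
            (hint s t (ha.trans_le has) hst (htb.trans_lt hb)) fun τ _ => ?_
          linarith [h0 r τ, h0 u τ]
  · intro t hat htb A hA x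
    exact hp.mass_condTerminal (ha.trans_le hat) (htb.trans_lt hb) hA x y
  · linarith [h0 u τ, h1 τ]
  · linarith [h0 r τ, h1 τ]
  · have h2 : Tendsto (fun t => R.real {ω | coord t ω ≠ coord 1 ω} / c) (𝓝[<] 1) (𝓝 0) := by
      simpa using hR.left_cont.div_const c
    exact squeeze_zero (fun _ => measureReal_nonneg) (fun t => condTerminal_real_le y _) h2

/-- The relative entropy rate of the conditioned reference with respect to a controlled chain. -/
lemma IsTerminalKernel.klRate_controlledRate [IsFiniteMeasure R] {ι : Fin N → Fin K}
    (hι : Function.Injective ι) {Φ : Controller D N K} (hp : IsTerminalKernel γ C p R) (hr : IsRate r)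
    {τ : ℝ} (hτ : τ ∈ Ioo (0 : ℝ) 1) (y : State D K)
    (hr0 : ∀ x z, z ≠ x → (∀ d n, z ≠ Function.update x d (ι n)) → r τ z x = 0)
    (hzero : ∀ x d n, ι n ≠ x d → p τ y x = 0 →
      r τ (Function.update x d (ι n)) x * p τ y (Function.update x d (ι n)) = 0) :
    klRate r (controlledRate ι r Φ) (fun t x => p t y x / R.real {ω | coord 1 ω = y}) R τ
      = ∑ x, ENNReal.ofReal ((condTerminal R y).real {ω | coord τ ω = x}) *
        ∑ d, ∑ n with ι n ≠ x d, ENNReal.ofReal (r τ (Function.update x d (ι n)) x) *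
          genKL (p τ y (Function.update x d (ι n)) / p τ y x) (Φ τ x d n) := by
  set c := R.real {ω | coord 1 ω = y}
  have hmass : ∀ x, (condTerminal R y).real {ω | coord τ ω = x}
      = mass R univ τ x * (p τ y x / c) := fun x => by
    rw [← hp.mass_condTerminal hτ.1 hτ.2 MeasurableSet.univ]
    simp [mass]
  have hk0 : ∀ x, 0 ≤ p τ y x / c := fun x => div_nonneg (hp.nonneg τ hτ.1 hτ.2 y x) measureReal_nonneg
  unfold klRate fluxP fluxQ
  refine Finset.sum_congr rfl fun x _ => ?_
  rw [sum_jumps_eq hι x]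
  · rw [Finset.mul_sum]
    refine Finset.sum_congr rfl fun d _ => ?_
    rw [Finset.mul_sum]
    refine Finset.sum_congr rfl fun n hn => ?_
    have hn' : ι n ≠ x d := (Finset.mem_filter.1 hn).2
    set z := Function.update x d (ι n)
    have hzx : z ≠ x := update_ne_self hn'
    have hr' := hr.nonneg τ z x hzx
    rw [controlledRate_of_ne hzx, controlledJump_update hι _ hn', hmass]
    -- Such a state has no mass given the endpoint, and the assumption on zeros makes both fluxes
    -- out of it vanish. The ratio with zero denominator on the other side is multiplied by zero.
    by_cases hx : p τ y x = 0
    · have h0 := hzero x d n hn' hx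
      have e1 : mass R univ τ x * (r τ z x * (p τ y z / c)) = 0 := by
        rw [mul_div_assoc', h0, zero_div, mul_zero]
      rw [e1]
      simp [genKL, hx]
    · have e1 : mass R univ τ x * (r τ z x * (p τ y z / c))
          = (mass R univ τ x * (p τ y x / c) * r τ z x) * (p τ y z / p τ y x) := by
        field_simp
      have e2 : mass R univ τ x * (p τ y x / c * (r τ z x * Φ τ x d n))
          = (mass R univ τ x * (p τ y x / c) * r τ z x) * Φ τ x d n := by ring
      have hm := mul_nonneg (mass_nonneg R univ τ x) (hk0 x)
      rw [e1, e2, genKL_mul (mul_nonneg hm hr'), ENNReal.ofReal_mul hm, mul_assoc]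
  · intro z hz hzn
    rw [controlledRate_of_ne hz, controlledJump_eq_zero _ hzn, hr0 x z hz hzn]
    simp [genKL]

end

end DiscreteSampler

/-! ### The noise schedule, and losses as averages over the endpoint. -/

namespace DiscreteSampler

open InformationTheory

variable {D K N : ℕ}

section Schedule

variable {γ : ℝ → ℝ}

/-- The integral of `γ` over `(s, t]`. -/
noncomputable def mean (γ : ℝ → ℝ) (s t : ℝ) : ℝ := (∫⁻ τ in Ioc s t, ENNReal.ofReal (γ τ)).toReal

/-- Measurability in t comes from monotonicity of the extended integral, whether or not γ is
integrable there. This is why `mean` replaces the interval integral in the kernels. -/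
lemma measurable_mean_left (t : ℝ) : Measurable fun s => mean γ s t :=
  (Antitone.measurable fun _ _ h => lintegral_mono_set (Ioc_subset_Ioc_left h)).ennreal_toReal

lemma measurable_mean_right (s : ℝ) : Measurable fun t => mean γ s t :=
  (Monotone.measurable fun _ _ h => lintegral_mono_set (Ioc_subset_Ioc_right h)).ennreal_toReal

lemma intervalIntegral_eq_mean (hγm : Measurable γ) (hγ0 : ∀ t, 0 ≤ γ t) {s t : ℝ} (h : s ≤ t) :
    ∫ τ in s..t, γ τ = mean γ s t := by
  rw [intervalIntegral.integral_of_le h, integral_eq_lintegral_of_nonneg_ae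
    (ae_of_all _ hγ0) hγm.aestronglyMeasurable]
  rfl

/-- The primitive is nonnegative, so a zero of it is a minimum, and by Lebesgue's theorem its
derivative is γ almost everywhere. The degenerate times of the kernels are thus harmless, as they
carry no weight in the loss. -/
lemma ae_eq_zero_of_integral_left_eq_zero (hγ0 : ∀ t, 0 ≤ γ t) {a b : ℝ}
    (hγ : IntervalIntegrable γ volume a b) :
    ∀ᵐ t, t ∈ Ioo a b → ∫ τ in a..t, γ τ = 0 → γ t = 0 := by
  filter_upwards [hγ.ae_hasDerivAt_integral] with t ht hta h0
  have hab : a ≤ b := (hta.1.trans hta.2).le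
  rw [uIcc_of_le hab] at ht
  refine IsLocalMin.hasDerivAt_eq_zero (f := fun t => ∫ τ in a..t, γ τ) ?_
    (ht (Ioo_subset_Icc_self hta) a (left_mem_Icc.2 hab))
  filter_upwards [Ioi_mem_nhds hta.1] with s hs
  rw [h0]
  exact intervalIntegral.integral_nonneg (le_of_lt hs) fun τ _ => hγ0 τ

lemma ae_eq_zero_of_integral_right_eq_zero (hγ0 : ∀ t, 0 ≤ γ t) {a b : ℝ}
    (hγ : IntervalIntegrable γ volume a b) :
    ∀ᵐ t, t ∈ Ioo a b → ∫ τ in t..b, γ τ = 0 → γ t = 0 := by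
  filter_upwards [hγ.ae_hasDerivAt_integral] with t ht hta h0
  have hab : a ≤ b := (hta.1.trans hta.2).le
  rw [uIcc_of_le hab] at ht
  rw [intervalIntegral.integral_symm, neg_eq_zero] at h0
  refine IsLocalMax.hasDerivAt_eq_zero (f := fun t => ∫ τ in b..t, γ τ) ?_
    (ht (Ioo_subset_Icc_self hta) b (right_mem_Icc.2 hab))
  filter_upwards [Iio_mem_nhds hta.2] with s hs
  rw [h0, intervalIntegral.integral_symm, neg_nonpos]
  exact intervalIntegral.integral_nonneg (le_of_lt hs) fun τ _ => hγ0 τ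

/-- Where `∫_t^1 γ` vanishes, `γ` vanishes almost everywhere. -/
lemma ae_eq_zero_of_tail_eq_zero (hγ0 : ∀ t, 0 ≤ γ t)
    (hγ : ∀ t : ℝ, 0 < t → t ≤ 1 → IntervalIntegrable γ volume t 1) :
    ∀ᵐ t, t ∈ Ioo (0 : ℝ) 1 → ∫ τ in t..1, γ τ = 0 → γ t = 0 := by
  have h : ∀ n : ℕ, ∀ᵐ t, t ∈ Ioo (1 / ((n : ℝ) + 1)) 1 → ∫ τ in t..1, γ τ = 0 → γ t = 0 :=
    fun n => ae_eq_zero_of_integral_right_eq_zero hγ0 (hγ _ (by positivity) (by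
      rw [div_le_one (by positivity)]; linarith [(Nat.cast_nonneg n : (0 : ℝ) ≤ n)]))
  filter_upwards [ae_all_iff.2 h] with t ht hta
  obtain ⟨n, hn⟩ := exists_nat_one_div_lt hta.1
  exact ht n ⟨hn, hta.2⟩

/-- Where `∫_0^t γ` vanishes, `γ` vanishes almost everywhere. -/
lemma ae_eq_zero_of_head_eq_zero (hγ0 : ∀ t, 0 ≤ γ t)
    (hγ : ∀ t : ℝ, 0 ≤ t → t < 1 → IntervalIntegrable γ volume 0 t) :
    ∀ᵐ t, t ∈ Ioo (0 : ℝ) 1 → ∫ τ in 0..t, γ τ = 0 → γ t = 0 := by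
  have h : ∀ n : ℕ, ∀ᵐ t, t ∈ Ioo 0 (1 - 1 / ((n : ℝ) + 1)) → ∫ τ in 0..t, γ τ = 0 → γ t = 0 := by
    intro n
    have h1 : 1 / ((n : ℝ) + 1) ≤ 1 := by
      rw [div_le_one (by positivity)]; linarith [(Nat.cast_nonneg n : (0 : ℝ) ≤ n)]
    have h2 : 0 < 1 / ((n : ℝ) + 1) := by positivity
    exact ae_eq_zero_of_integral_left_eq_zero hγ0 (hγ _ (by linarith) (by linarith))
  filter_upwards [ae_all_iff.2 h] with t ht hta
  obtain ⟨n, hn⟩ := exists_nat_one_div_lt (sub_pos.2 hta.2)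
  exact ht n ⟨hta.1, by linarith⟩

lemma intervalIntegral_antitone_left (hγ0 : ∀ t, 0 ≤ γ t) {s s' t : ℝ} (h : s ≤ s') (h' : s' ≤ t)
    (hγ : IntervalIntegrable γ volume s t) : ∫ τ in s'..t, γ τ ≤ ∫ τ in s..t, γ τ :=
  intervalIntegral.integral_mono_interval h h' le_rfl (ae_of_all _ hγ0) hγ

lemma intervalIntegral_mono_right (hγ0 : ∀ t, 0 ≤ γ t) {s t t' : ℝ} (h : s ≤ t) (h' : t ≤ t')
    (hγ : IntervalIntegrable γ volume s t') : ∫ τ in s..t, γ τ ≤ ∫ τ in s..t', γ τ :=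
  intervalIntegral.integral_mono_interval le_rfl h h' (ae_of_all _ hγ0) hγ

/-- If `γ` is not integrable at `0`, then `∫_s^t γ → ∞` as `s → 0`. -/
lemma tendsto_integral_atTop_left (hγ0 : ∀ t, 0 ≤ γ t)
    (hγ : ∀ t : ℝ, 0 < t → t ≤ 1 → IntervalIntegrable γ volume t 1)
    (htop : ∫⁻ t in Ioo (0 : ℝ) 1, ENNReal.ofReal (γ t) = ⊤) {t : ℝ} (ht : 0 < t) (ht1 : t ≤ 1) :
    Tendsto (fun s => ∫ τ in s..t, γ τ) (𝓝[>] 0) atTop := by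
  have hst : ∀ s, 0 < s → s ≤ t → IntervalIntegrable γ volume s t := fun s hs hst =>
    IntervalIntegrable.sub_interval (hγ s hs (hst.trans ht1)) le_rfl hst ht1
  by_contra hcon
  rw [tendsto_atTop] at hcon
  push Not at hcon
  obtain ⟨b, hb⟩ := hcon
  -- If divergence fails, values below some b occur for arbitrarily small s. Monotonicity spreads
  -- the bound to all s, and γ would then be integrable down to 0.
  have hbound : ∀ s, 0 < s → s ≤ t → ∫ τ in s..t, γ τ ≤ b := by
    intro s hs hs'
    obtain ⟨s', h1, h2⟩ := (hb.and_eventually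
      (Ioo_mem_nhdsGT hs : ∀ᶠ s' in 𝓝[>] (0 : ℝ), s' ∈ Ioo 0 s)).exists
    exact (intervalIntegral_antitone_left hγ0 h2.2.le hs'
      (hst s' h2.1 (h2.2.le.trans hs'))).trans h1.le
  have hint : IntegrableOn γ (Ioc 0 t) := by
    refine integrableOn_Ioc_of_intervalIntegral_norm_bounded_left (I := b)
      (a := fun n : ℕ => t / ((n : ℝ) + 1)) (l := atTop) (fun n => ?_) ?_
      (Eventually.of_forall fun n => ?_)
    · have h1 : t / ((n : ℝ) + 1) ≤ t := div_le_self ht.le (by linarith [(Nat.cast_nonneg n : (0 : ℝ) ≤ n)])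
      exact (intervalIntegrable_iff_integrableOn_Ioc_of_le h1).1 (hst _ (by positivity) h1)
    · have := tendsto_one_div_add_atTop_nhds_zero_nat.const_mul t
      simpa [div_eq_mul_inv] using this
    · have h1 : t / ((n : ℝ) + 1) ≤ t := div_le_self ht.le (by linarith [(Nat.cast_nonneg n : (0 : ℝ) ≤ n)])
      have := hbound _ (by positivity) h1
      rw [intervalIntegral.integral_of_le h1] at this
      simpa [abs_of_nonneg (hγ0 _)] using this
  have h1 : ∫⁻ τ in Ioc 0 t, ENNReal.ofReal (γ τ) ≠ ⊤ := hint.lintegral_lt_top.ne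
  have h2 : ∫⁻ τ in Ioc t 1, ENNReal.ofReal (γ τ) ≠ ⊤ :=
    ((intervalIntegrable_iff_integrableOn_Ioc_of_le ht1).1 (hγ t ht ht1)).lintegral_lt_top.ne
  refine absurd htop (ne_top_of_le_ne_top (ENNReal.add_ne_top.2 ⟨h1, h2⟩) ?_)
  rw [setLIntegral_Ioc_add ht.le ht1]
  exact lintegral_mono_set Ioo_subset_Ioc_self

/-- If `γ` is not integrable at `1`, then `∫_s^t γ → ∞` as `t → 1`. -/
lemma tendsto_integral_atTop_right (hγ0 : ∀ t, 0 ≤ γ t)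
    (hγ : ∀ t : ℝ, 0 ≤ t → t < 1 → IntervalIntegrable γ volume 0 t) {s : ℝ} (hs : 0 ≤ s)
    (hs1 : s < 1) (htop : ∫⁻ t in Ioo s 1, ENNReal.ofReal (γ t) = ⊤) :
    Tendsto (fun t => ∫ τ in s..t, γ τ) (𝓝[<] 1) atTop := by
  have hst : ∀ t, s ≤ t → t < 1 → IntervalIntegrable γ volume s t := fun t hst ht =>
    IntervalIntegrable.sub_interval (hγ t (hs.trans hst) ht) hs hst le_rfl
  by_contra hcon
  rw [tendsto_atTop] at hcon
  push Not at hcon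
  obtain ⟨b, hb⟩ := hcon
  have hbound : ∀ t, s ≤ t → t < 1 → ∫ τ in s..t, γ τ ≤ b := by
    intro t hs' ht
    obtain ⟨t', h1, h2⟩ := (hb.and_eventually
      (Ioo_mem_nhdsLT ht : ∀ᶠ t' in 𝓝[<] (1 : ℝ), t' ∈ Ioo t 1)).exists
    exact (intervalIntegral_mono_right hγ0 hs' h2.1.le
      (hst t' (hs'.trans h2.1.le) h2.2)).trans h1.le
  have hint : IntegrableOn γ (Ioc s 1) := by
    have h0 : 0 < 1 - s := sub_pos.2 hs1
    have hle : ∀ n : ℕ, (1 - s) / ((n : ℝ) + 1) ≤ 1 - s := fun n =>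
      div_le_self h0.le (by linarith [(Nat.cast_nonneg n : (0 : ℝ) ≤ n)])
    have hpos : ∀ n : ℕ, 0 < (1 - s) / ((n : ℝ) + 1) := fun n => by positivity
    have hle' : ∀ n : ℕ, s ≤ 1 - (1 - s) / ((n : ℝ) + 1) := fun n => by linarith [hle n]
    have hlt : ∀ n : ℕ, 1 - (1 - s) / ((n : ℝ) + 1) < 1 := fun n => by linarith [hpos n]
    refine integrableOn_Ioc_of_intervalIntegral_norm_bounded_right (I := b)
      (b := fun n : ℕ => 1 - (1 - s) / ((n : ℝ) + 1)) (l := atTop) (fun n => ?_) ?_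
      (Eventually.of_forall fun n => ?_)
    · exact (intervalIntegrable_iff_integrableOn_Ioc_of_le (hle' n)).1 (hst _ (hle' n) (hlt n))
    · have := (tendsto_one_div_add_atTop_nhds_zero_nat.const_mul (1 - s)).const_sub 1
      simpa [div_eq_mul_inv] using this
    · have := hbound _ (hle' n) (hlt n)
      rw [intervalIntegral.integral_of_le (hle' n)] at this
      simpa [abs_of_nonneg (hγ0 _)] using this
  refine absurd htop (ne_top_of_le_ne_top hint.lintegral_lt_top.ne ?_)
  exact lintegral_mono_set Ioo_subset_Ioc_self

end Schedule

section Losses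

variable {ι : Fin N → Fin K} {Pr Pstar Pv : Measure (PathSpace D K)}

/-- The importance weight turns the Q-integral into a P-integral, and a function of a discrete
variable integrates to a finite sum. The sampling measure leaves no trace, which is why the losses
do not depend on the frozen controller. -/
lemma lintegral_rnDeriv_mul_comp {Ω α : Type*} [MeasurableSpace Ω] [Fintype α] [MeasurableSpace α]
    [MeasurableSingletonClass α] {P Q : Measure Ω} [IsFiniteMeasure P] [IsFiniteMeasure Q]
    (h : P ≪ Q) {X : Ω → α} (hX : Measurable X) (F : α → ℝ≥0∞) :
    ∫⁻ ω, P.rnDeriv Q ω * F (X ω) ∂Q = ∑ x, ENNReal.ofReal (P.real {ω | X ω = x}) * F x := by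
  refine (lintegral_rnDeriv_mul h (f := fun ω => F (X ω))
    ((measurable_of_finite F).comp hX).aemeasurable).trans ?_
  rw [← setLIntegral_univ, setLIntegral_eq_sum_fiber P hX univ MeasurableSet.univ]
  refine Finset.sum_congr rfl fun x _ => ?_
  have hx : MeasurableSet {ω | X ω = x} := hX (measurableSet_singleton x)
  rw [univ_inter, setLIntegral_congr_fun (g := fun _ => F x) hx
    fun ω (hω : X ω = x) => by simp only [hω], setLIntegral_const, mul_comm, ofReal_measureReal]

/-- The denoising-matching loss as an average over the endpoint. -/
lemma dmLoss_eq_sum [IsProbabilityMeasure Pstar] [IsProbabilityMeasure Pv] (h : Pstar ≪ Pv)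
    {w : ℝ → ℝ} {Df : ℝ → ℝ → ℝ≥0∞} {Φ : Controller D N K} {f : ℝ → State D K → ℝ≥0∞}
    (hf : ∀ y, Measurable fun t => f t y)
    (hfeq : ∀ᵐ t, t ∈ Ioo (0 : ℝ) 1 → ∀ x₀ y,
      Pstar.real ({ω | coord 0 ω = x₀} ∩ {ω | coord 1 ω = y}) ≠ 0 →
      ENNReal.ofReal (w t) * ∑ x, ENNReal.ofReal (bridgeProb Pr t x x₀ y) *
        ∑ d, ∑ n with ι n ≠ x d, Df (condProb Pr t 1 y (Function.update x d (ι n))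
          / condProb Pr t 1 y x) (Φ t x d n) = f t y) :
    dmLoss ι Pr Pstar Pv w Df Φ
      = ∑ y, ENNReal.ofReal (Pstar.real {ω | coord 1 ω = y}) * ∫⁻ t in Ioo (0 : ℝ) 1, f t y := by
  have hm : ∀ y, Measurable fun t => ENNReal.ofReal (Pstar.real {ω | coord 1 ω = y}) * f t y :=
    fun y => (hf y).const_mul _
  rw [Finset.sum_congr rfl fun y _ => (lintegral_const_mul _ (hf y)).symm,
    ← lintegral_finsetSum _ fun y _ => hm y]
  unfold dmLoss
  refine lintegral_congr_ae ?_
  filter_upwards [ae_restrict_mem measurableSet_Ioo, ae_restrict_of_ae hfeq] with t ht h1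
  have h2 := lintegral_rnDeriv_mul_comp h
    (X := fun ω : PathSpace D K => (coord 0 ω, coord 1 ω))
    ((measurable_coord 0).prodMk (measurable_coord 1))
    (fun q => ∑ x, ENNReal.ofReal (bridgeProb Pr t x q.1 q.2) *
        ∑ d, ∑ n with ι n ≠ x d, Df (condProb Pr t 1 q.2 (Function.update x d (ι n))
          / condProb Pr t 1 q.2 x) (Φ t x d n))
  rw [h2, Finset.mul_sum, Fintype.sum_prod_type, Finset.sum_comm]
  refine Finset.sum_congr rfl fun y _ => ?_
  rw [← sum_real_inter_fiber Pstar (measurable_coord 0) {ω | coord 1 ω = y},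
    ENNReal.ofReal_sum_of_nonneg fun _ _ => measureReal_nonneg, Finset.sum_mul]
  refine Finset.sum_congr rfl fun x₀ _ => ?_
  have hset : {ω : PathSpace D K | (coord 0 ω, coord 1 ω) = (x₀, y)}
      = {ω | coord 0 ω = x₀} ∩ {ω | coord 1 ω = y} := by ext ω; simp
  rw [hset, inter_comm {ω | coord 1 ω = y}]
  by_cases h0 : Pstar.real ({ω | coord 0 ω = x₀} ∩ {ω | coord 1 ω = y}) = 0
  · simp [h0]
  · rw [← h1 ht x₀ y h0]; ring

end Losses

end DiscreteSampler

/-! ### Two sufficient conditions at time 0. -/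

namespace DiscreteSampler

open InformationTheory

variable {D K N : ℕ}

section

variable {r u : ℝ → State D K → State D K → ℝ} {V : ℝ → ℝ} {R P Q : Measure (PathSpace D K)}
  {κ : ℝ} {k : ℝ → State D K → ℝ}

lemma tendsto_lintegral_Ioc_zero {f : ℝ → ℝ≥0∞} (hI : ∫⁻ τ in Ioo (0 : ℝ) 1, f τ ≠ ⊤) :
    Tendsto (fun ε : ℝ => (∫⁻ τ in Ioc 0 ε, f τ).toReal) (𝓝[>] 0) (𝓝 0) := by
  have h1 : Tendsto (fun ε : ℝ => ∫⁻ τ in Ioc 0 ε, f τ ∂(volume.restrict (Ioo 0 1))) (𝓝[>] 0)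
      (𝓝 0) := by
    refine tendsto_setLIntegral_zero hI ?_
    have h2 : Tendsto (fun ε : ℝ => ENNReal.ofReal ε) (𝓝[>] 0) (𝓝 0) := by
      have := (ENNReal.continuous_ofReal.tendsto 0).mono_left
        (nhdsWithin_le_nhds : 𝓝[>] (0 : ℝ) ≤ 𝓝 0)
      simpa using this
    refine tendsto_of_tendsto_of_tendsto_of_le_of_le tendsto_const_nhds h2 (fun _ => zero_le)
      fun ε => ?_
    calc (volume.restrict (Ioo (0 : ℝ) 1)) (Ioc 0 ε) ≤ volume (Ioc 0 ε) :=
          Measure.restrict_apply_le _ _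
      _ = ENNReal.ofReal ε := by simp
  have h3 := (ENNReal.tendsto_toReal ENNReal.zero_ne_top).comp h1
  refine (h3.congr' ?_)
  filter_upwards [(eventually_lt_nhds one_pos).filter_mono nhdsWithin_le_nhds] with ε hε
  simp only [Function.comp]
  rw [Measure.restrict_restrict measurableSet_Ioc, inter_eq_left.2]
  exact fun τ hτ => ⟨hτ.1, hτ.2.trans_lt hε⟩

/-- The start condition holds if the tilted chain forgets its initial value immediately. -/
lemma GirsanovSetting.startCondition_of_mixing [IsProbabilityMeasure P] [IsProbabilityMeasure Q]
    [IsProbabilityMeasure R] (h : GirsanovSetting r u k κ V R P Q)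
    (hI : ∫⁻ τ in Ioo (0 : ℝ) 1, klRate r u k R τ ≠ ⊤) {c : ℝ} (hc : 0 < c)
    (hindep : ∀ t, 0 < t → t < 1 → ∀ x y, mass P {ω | coord 0 ω = x} t y
      = P.real {ω | coord 0 ω = x} * mass P univ t y)
    (hinit : ∀ x, Q.real {ω | coord 0 ω = x} = P.real {ω | coord 0 ω = x})
    (hmix : ∀ t, 0 < t → t < 1 → ∀ x y, Tendsto (fun s => mass P {ω | coord s ω = x} t y) (𝓝[>] 0)
      (𝓝 (c * mass P univ t y))) :
    StartCondition P Q := by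
  intro m M δ hm hδ
  set S : ℝ := (Fintype.card (State D K) : ℝ)
  have hS : 0 ≤ S := Nat.cast_nonneg _
  set B : ℝ := |Real.log m| + |Real.log M|
  have hB : 0 ≤ B := by positivity
  -- Both η and the θ below are chosen so that η/c + S η and the mixing error 2 S θ B / c are at
  -- most δ/4 each. The entropy cost near time 0 gets another δ/4.
  set η : ℝ := δ / (4 * (1 / c + S))
  have hη : 0 < η := by positivity
  set θ : ℝ := δ * c / (8 * (S * B + 1))
  have hθ : 0 < θ := by positivity
  have hJ := (tendsto_lintegral_Ioc_zero hI).eventually (eventually_lt_nhds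
    (by positivity : 0 < c * δ / 4))
  filter_upwards [hJ, self_mem_nhdsWithin, (eventually_lt_nhds one_pos).filter_mono
    nhdsWithin_le_nhds] with ε hJε hε0 hε1 F hF
  replace hε0 : 0 < ε := hε0
  have hmix' : ∀ᶠ s in 𝓝[>] (0 : ℝ), ∀ x y,
      |mass P {ω | coord s ω = x} ε y - c * mass P univ ε y| < θ :=
    eventually_all.2 fun x => eventually_all.2 fun y =>
      (Metric.tendsto_nhds.1 (hmix ε hε0 hε1 x y) θ hθ)
  obtain ⟨s, hs, hs0, hsε⟩ := (hmix'.and (Ioo_mem_nhdsGT hε0 : ∀ᶠ s in 𝓝[>] (0 : ℝ),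
    s ∈ Ioo 0 ε)).exists
  have hIsε : ∫⁻ τ in Ioc s ε, klRateOn r u k R univ τ ≠ ⊤ := by
    simp_rw [klRateOn_univ]
    exact setLIntegral_Ioc_ne_top hI hs0.le hε1
  obtain ⟨L, hL, hLPQ⟩ := exists_backward_operator (h.tilt s ε hs0 hsε.le hε1)
    (h.forward_ref s ε hs0 hsε.le hε1) (h.forward s ε hs0 hsε.le hε1)
    (h.bound_ref s ε hs0 hsε.le hε1) (h.bound s ε hs0 hsε.le hε1) h.rate_ref h.rate hs0.le hsε.le
    hIsε (M := M) hm hη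
  have hlogF : ∀ z ∈ Icc m M, |Real.log z| ≤ B := by
    intro z hz
    have h1 := Real.log_le_log hm hz.1
    have h2 := Real.log_le_log (hm.trans_le hz.1) hz.2
    rw [abs_le]
    constructor
    · linarith [neg_abs_le (Real.log m), abs_nonneg (Real.log M)]
    · linarith [le_abs_self (Real.log M), abs_nonneg (Real.log m)]
  -- The expectation of log F(x₀, X_ε) under P. By independence, the initial value x₀ enters only as
  -- a parameter.
  set E : State D K → ℝ := fun x₀ => ∑ y, mass P univ ε y * Real.log (F x₀ y)
  set J : ℝ := (∫⁻ τ in Ioc 0 ε, klRate r u k R τ).toReal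
  set e : ℝ := (J + η + 2 * (S * θ * B)) / c
  have hce : c * e = J + η + 2 * (S * θ * B) := mul_div_cancel₀ _ hc.ne'
  -- Given X_s = x with s close to 0, the law of X_ε under P is nearly unconditional, so the
  -- backward function log L(F x₀) is at least E(x₀) - e at every state x. As the bound is uniform
  -- in x, it can be inserted under Q although nothing is known about the law of X_s there.
  have key : ∀ x₀ x, 1 + E x₀ - e ≤ L (F x₀) x := by
    intro x₀ x
    have hLm := hL (F x₀) (hF x₀) x
    have h1 := (hLPQ {ω | coord s ω = x} (measurableSet_past_coord hs0.le le_rfl x) (F x₀)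
      (hF x₀)).1
    have h2 : ∑ x', mass P {ω | coord s ω = x} s x' * Real.log (L (F x₀) x')
        = (∑ y, mass P {ω | coord s ω = x} ε y) * Real.log (L (F x₀) x) := by
      rw [sum_mass]
      have h3 : ∀ x', mass P {ω | coord s ω = x} s x' = if x' = x then mass P univ s x else 0 :=
        fun x' => by simpa using mass_inter_self P univ s x x'
      simp_rw [h3]
      simp [mass]
    have h4 : (∫⁻ τ in Ioc s ε, klRateOn r u k R {ω | coord s ω = x} τ).toReal ≤ J := by
      refine ENNReal.toReal_mono (setLIntegral_Ioc_ne_top hI le_rfl hε1) ?_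
      refine (lintegral_mono fun τ => klRateOn_mono (subset_univ _) τ).trans ?_
      simp_rw [klRateOn_univ]
      exact lintegral_mono_set (Ioc_subset_Ioc_left hs0.le)
    have h5 : R.real {ω | coord s ω = x} ≤ 1 := measureReal_le_one
    have h6 : ∀ (φ : State D K → ℝ), (∀ y, |φ y| ≤ B) →
        |∑ y, mass P {ω | coord s ω = x} ε y * φ y - c * ∑ y, mass P univ ε y * φ y|
          ≤ S * θ * B := by
      intro φ hφ
      rw [Finset.mul_sum, ← Finset.sum_sub_distrib, mul_assoc]
      refine (Finset.abs_sum_le_sum_abs _ _).trans ?_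
      rw [← nsmul_eq_mul]
      refine Finset.sum_le_card_nsmul _ _ _ fun y _ => ?_
      rw [← mul_assoc, ← sub_mul, abs_mul]
      exact mul_le_mul (hs x y).le (hφ y) (abs_nonneg _) hθ.le
    have h7 := (abs_le.1 (h6 (fun y => Real.log (F x₀ y)) fun y => hlogF _ (hF x₀ y))).1
    have h8 := (abs_le.1 (h6 (fun _ => Real.log (L (F x₀) x)) fun _ => hlogF _ hLm)).2
    rw [← Finset.sum_mul, ← Finset.sum_mul, sum_mass P univ, probReal_univ, one_mul] at h8
    have h9 : E x₀ - e ≤ Real.log (L (F x₀) x) := by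
      refine le_of_mul_le_mul_left ?_ hc
      rw [mul_sub, hce]
      have : η * R.real {ω | coord s ω = x} ≤ η := mul_le_of_le_one_right hη.le h5
      linarith
    have h10 := Real.log_le_sub_one_of_pos (hm.trans_le hLm.1)
    linarith
  have hP : ∫ ω, Real.log (F (coord 0 ω) (coord ε ω)) ∂P
      = ∑ x₀, P.real {ω | coord 0 ω = x₀} * E x₀ := by
    have := integral_pair_eq_sum (P := P) univ 0 ε fun x y => Real.log (F x y)
    rw [setIntegral_univ] at this
    rw [this]
    refine Finset.sum_congr rfl fun x₀ _ => ?_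
    rw [Finset.mul_sum]
    refine Finset.sum_congr rfl fun y _ => ?_
    rw [univ_inter, hindep ε hε0 hε1]; ring
  have hQ : ∑ x₀, (P.real {ω | coord 0 ω = x₀} * (1 + E x₀ - e) - η)
      ≤ ∫ ω, F (coord 0 ω) (coord ε ω) ∂Q := by
    have := integral_pair_eq_sum (P := Q) univ 0 ε fun x y => F x y
    rw [setIntegral_univ] at this
    rw [this]
    refine Finset.sum_le_sum fun x₀ _ => ?_
    rw [univ_inter, ← hinit]
    have h1 := (hLPQ {ω | coord 0 ω = x₀} (measurableSet_past_coord le_rfl hs0.le x₀) (F x₀)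
      (hF x₀)).2
    have h2 : Q.real {ω | coord 0 ω = x₀} * (1 + E x₀ - e)
        ≤ ∑ x, mass Q {ω | coord 0 ω = x₀} s x * L (F x₀) x := by
      rw [← sum_mass Q {ω | coord 0 ω = x₀} s, Finset.sum_mul]
      exact Finset.sum_le_sum fun x _ => mul_le_mul_of_nonneg_left (key x₀ x) (mass_nonneg _ _ _ _)
    have : η * Q.real {ω | coord 0 ω = x₀} ≤ η := mul_le_of_le_one_right hη.le measureReal_le_one
    linarith
  have hsum : ∑ x₀, P.real {ω | coord 0 ω = x₀} = 1 := by
    have := sum_mass P univ 0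
    simpa [mass] using this
  have hQ' : ∑ x₀, (P.real {ω | coord 0 ω = x₀} * (1 + E x₀ - e) - η)
      = 1 - e + ∑ x₀, P.real {ω | coord 0 ω = x₀} * E x₀ - S * η := by
    have h1 : ∀ x₀, P.real {ω | coord 0 ω = x₀} * (1 + E x₀ - e) - η
        = P.real {ω | coord 0 ω = x₀} * (1 - e) + P.real {ω | coord 0 ω = x₀} * E x₀ - η :=
      fun x₀ => by ring
    rw [Finset.sum_congr rfl fun x₀ _ => h1 x₀, Finset.sum_sub_distrib, Finset.sum_add_distrib,
      ← Finset.sum_mul, hsum]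
    simp [S]
  rw [hP]
  rw [hQ'] at hQ
  have b1 : η / c + S * η = δ / 4 := by
    have : 1 / c + S ≠ 0 := by positivity
    simp only [η]
    field_simp
  have b2 : 2 * (S * θ * B) / c ≤ δ / 4 := by
    rw [div_le_iff₀ hc]
    have h1 : θ * (8 * (S * B + 1)) = δ * c := div_mul_cancel₀ _ (by positivity)
    nlinarith
  have b3 : e = J / c + η / c + 2 * (S * θ * B) / c := by simp only [e]; ring
  have b4 : J / c ≤ δ / 4 := by
    rw [div_le_iff₀ hc]; linarith
  linarith

/-- The start condition holds if neither chain moves immediately. -/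
lemma startCondition_of_continuous [IsProbabilityMeasure P] [IsProbabilityMeasure Q]
    (o : State D K) (hP0 : P.real {ω | coord 0 ω ≠ o} = 0) (hQ0 : Q.real {ω | coord 0 ω ≠ o} = 0)
    (hP : Tendsto (fun t => P.real {ω | coord t ω ≠ o}) (𝓝[>] 0) (𝓝 0))
    (hQ : Tendsto (fun t => Q.real {ω | coord t ω ≠ o}) (𝓝[>] 0) (𝓝 0)) :
    StartCondition P Q := by
  intro m M δ hm hδ
  have h1 : Tendsto (fun t => (Real.log M - Real.log m) * P.real {ω | coord t ω ≠ o}) (𝓝[>] 0)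
      (𝓝 0) := by simpa using hP.const_mul (Real.log M - Real.log m)
  have h2 : Tendsto (fun t => (M - m) * Q.real {ω | coord t ω ≠ o}) (𝓝[>] 0)
      (𝓝 0) := by simpa using hQ.const_mul (M - m)
  filter_upwards [h1.eventually (eventually_lt_nhds (half_pos hδ)),
    h2.eventually (eventually_lt_nhds (half_pos hδ))] with ε hε1 hε2 F hF
  have hlogm : ∀ x ∈ Icc m M, Real.log x ∈ Icc (Real.log m) (Real.log M) := fun x hx =>
    ⟨Real.log_le_log hm hx.1, Real.log_le_log (hm.trans_le hx.1) hx.2⟩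
  have hFmeas : Measurable fun ω : PathSpace D K => F (coord 0 ω) (coord ε ω) :=
    (measurable_of_finite fun q : State D K × State D K => F q.1 q.2).comp
      ((measurable_coord 0).prodMk (measurable_coord ε))
  have hE : ∀ (μ : Measure (PathSpace D K)) [IsProbabilityMeasure μ],
      μ.real {ω | coord 0 ω ≠ o} = 0 →
      μ.real ({ω | coord 0 ω ≠ o} ∪ {ω | coord ε ω ≠ o}) ≤ μ.real {ω | coord ε ω ≠ o} := by
    intro μ _ h0
    have := measureReal_union_le (μ := μ) {ω : PathSpace D K | coord 0 ω ≠ o} {ω | coord ε ω ≠ o}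
    linarith
  have hEm : MeasurableSet ({ω : PathSpace D K | coord 0 ω ≠ o} ∪ {ω | coord ε ω ≠ o}) :=
    (measurableSet_coord 0 o).compl.union (measurableSet_coord ε o).compl
  have hFo : ∀ ω : PathSpace D K, ω ∉ {ω : PathSpace D K | coord 0 ω ≠ o} ∪ {ω | coord ε ω ≠ o} →
      F (coord 0 ω) (coord ε ω) = F o o := by
    intro ω hω
    simp only [mem_union, mem_ofPred_eq, not_or, not_not] at hω
    rw [hω.1, hω.2]
  have e1 := abs_le.1 (abs_integral_sub_le_of_eqOn_compl (μ := P) hEm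
    (f := fun ω => Real.log (F (coord 0 ω) (coord ε ω))) (g := fun _ => Real.log (F o o))
    (integrable_log_of_bounds hFmeas hm (fun ω => (hF _ _).1) fun ω => (hF _ _).2)
    (integrable_const _) (fun ω => hlogm _ (hF _ _)) (fun ω => hlogm _ (hF _ _))
    fun ω hω => by rw [hFo ω hω])
  have e2 := abs_le.1 (abs_integral_sub_le_of_eqOn_compl (μ := Q) hEm
    (f := fun ω => F (coord 0 ω) (coord ε ω)) (g := fun _ => F o o)
    (integrable_of_bounds hFmeas (fun ω => (hF _ _).1) fun ω => (hF _ _).2)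
    (integrable_const _) (fun ω => hF _ _) (fun ω => hF _ _) hFo)
  rw [integral_const, probReal_univ, one_smul] at e1 e2
  have hmM : m ≤ M := (hF o o).1.trans (hF o o).2
  have f1 := mul_le_mul_of_nonneg_left (hE P hP0)
    (sub_nonneg.2 (Real.log_le_log hm hmM))
  have f2 := mul_le_mul_of_nonneg_left (hE Q hQ0) (sub_nonneg.2 hmM)
  -- Off a small event the test function is the constant F(o, o), and for a constant the functional
  -- is log F - F + 1 ≤ 0.
  have f3 := Real.log_le_sub_one_of_pos (hm.trans_le (hF o o).1)
  linarith [e1.2, e2.1]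

end

end DiscreteSampler

/-! ### The uniform reference: instantaneous mixing and its kernel. -/

namespace DiscreteSampler

open InformationTheory

variable {D K N : ℕ}

/-- A bounded solution of a linear system is Lipschitz. -/
lemma IsSemigroup.abs_productKernel_sub_le {ℓ : Fin K → Fin K → ℝ} {q : ℝ → Fin K → Fin K → ℝ}
    (hq : IsSemigroup ℓ q) (y x : State D K) {g h : ℝ} (hg : 0 ≤ g) (hgh : g ≤ h) :
    |productKernel (q h) y x - productKernel (q g) y x|
      ≤ (∑ y : State D K, ∑ x, |productRate ℓ y x|) * (h - g) := by
  have := (convex_Icc g h).norm_image_sub_le_of_norm_hasDerivWithin_le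
    (f := fun g => productKernel (q g) y x) (C := ∑ y : State D K, ∑ x, |productRate ℓ y x|)
    (fun z _ => (hq.hasDerivAt_productKernel z y x).hasDerivWithinAt)
    (fun z hz => ?_) (left_mem_Icc.2 hgh) (right_mem_Icc.2 hgh)
  · rwa [Real.norm_eq_abs, Real.norm_eq_abs, abs_of_nonneg (sub_nonneg.2 hgh)] at this
  · have h0 : 0 ≤ z := hg.trans hz.1
    rw [Real.norm_eq_abs]
    refine (Finset.abs_sum_le_sum_abs _ _).trans (Finset.sum_le_sum fun w _ => ?_)
    rw [abs_mul, abs_of_nonneg (productKernel_nonneg (hq.nonneg z h0) _ _)]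
    refine (mul_le_of_le_one_left (abs_nonneg _)
      (productKernel_le_one (hq.nonneg z h0) (hq.le_one z h0) _ _)).trans ?_
    exact Finset.single_le_sum (f := fun x => |productRate ℓ w x|) (fun _ _ => abs_nonneg _)
      (Finset.mem_univ x)

/-- A continuous-time Markov chain with the uniform reference rate, which mixes at time `0`. -/
structure UniformReference (γ : ℝ → ℝ) (μ : Measure (State D N)) (R : Measure (PathSpace D N)) :
    Prop where
  pos : 0 < N
  measurable : Measurable γ
  nonneg : ∀ t, 0 ≤ γ t
  integrable : ∀ t : ℝ, 0 < t → t ≤ 1 → IntervalIntegrable γ volume t 1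
  diverges : ∫⁻ t in Ioo (0 : ℝ) 1, ENNReal.ofReal (γ t) = ⊤
  ctmc : IsCTMC (uniformRate γ) μ R

namespace UniformReference

variable {γ : ℝ → ℝ} {μ ν : Measure (State D N)} {R : Measure (PathSpace D N)}

lemma intervalIntegrable (h : UniformReference γ μ R) {s t : ℝ} (hs : 0 < s) (hst : s ≤ t)
    (ht : t ≤ 1) : IntervalIntegrable γ volume s t :=
  IntervalIntegrable.sub_interval (h.integrable s hs (hst.trans ht)) le_rfl hst ht

lemma rate_eq : (uniformRate γ : ℝ → State D N → State D N → ℝ)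
    = fun t y x => γ t * productRate uniformGenerator y x := by
  ext t y x; exact uniformRate_eq γ t y x

lemma isRate (h : UniformReference γ μ R) : IsRate (uniformRate γ : ℝ → State D N → State D N → ℝ) := by
  rw [rate_eq]
  exact isRate_productRate h.nonneg (fun _ _ => uniformGenerator_nonneg) sum_uniformGenerator

lemma mass_eq_sum (h : UniformReference γ μ R) {s t : ℝ} (hs : 0 < s) (hst : s ≤ t)
    (ht : t ≤ 1) {A : Set (PathSpace D N)} (hA : MeasurableSet[past s] A) (y : State D N) :
    mass R A t y
      = ∑ x, productKernel (uniformSemigroup (∫ τ in s..t, γ τ)) y x * mass R A s x := by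
  have := h.ctmc.isProb
  have hint := h.intervalIntegrable hs hst ht
  have hf : ForwardOn (fun t y x => γ t * productRate uniformGenerator y x) R s t := by
    rw [← rate_eq]
    refine h.ctmc.forwardOn_of_integrable hs.le ht fun x y => ?_
    simp_rw [uniformRate_eq]
    exact hint.mul_const _
  exact hf.mass_eq_sum_productKernel isSemigroup_uniform hst hint h.nonneg hA y

lemma tendsto_productKernel (y x : State D N) :
    Tendsto (fun g => productKernel (uniformSemigroup g) y x) atTop (𝓝 ((1 / N : ℝ) ^ D)) := by
  have h1 : Tendsto (fun g : ℝ => Real.exp (-g)) atTop (𝓝 0) := Real.tendsto_exp_neg_atTop_nhds_zero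
  have h2 : ∀ a b : Fin N, Tendsto (fun g => uniformSemigroup g a b) atTop (𝓝 (1 / N : ℝ)) := by
    intro a b
    have h3 : Tendsto (fun g : ℝ => (1 - Real.exp (-g)) / N) atTop (𝓝 (1 / N)) := by
      simpa using (h1.const_sub 1).div_const (N : ℝ)
    have h4 : Tendsto (fun g : ℝ => if a = b then Real.exp (-g) else 0) atTop (𝓝 0) := by
      split_ifs
      · exact h1
      · exact tendsto_const_nhds
    simpa [uniformSemigroup] using h3.add h4
  have := tendsto_finsetProd Finset.univ fun d (_ : d ∈ Finset.univ) => h2 (y d) (x d)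
  simpa [productKernel] using this

lemma tendsto_kernel (h : UniformReference γ μ R) {t : ℝ} (ht : 0 < t) (ht1 : t ≤ 1)
    (y x : State D N) :
    Tendsto (fun s => productKernel (uniformSemigroup (∫ τ in s..t, γ τ)) y x) (𝓝[>] 0)
      (𝓝 ((1 / N : ℝ) ^ D)) :=
  (tendsto_productKernel y x).comp
    (tendsto_integral_atTop_left h.nonneg h.integrable h.diverges ht ht1)

/-- The chain is uniformly distributed at positive times, independently of the initial value. -/
lemma mass_eq (h : UniformReference γ μ R) {t : ℝ} (ht : 0 < t) (ht1 : t ≤ 1)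
    {A : Set (PathSpace D N)} (hA : MeasurableSet[past 0] A) (y : State D N) :
    mass R A t y = (1 / N : ℝ) ^ D * R.real A := by
  have := h.ctmc.isProb
  rw [← sub_eq_zero, ← abs_nonpos_iff]
  -- The deviation from uniformity is bounded by the distance of the kernel entries from N^{-D}. It
  -- vanishes as the starting time s decreases to 0, because ∫_s^t γ diverges. Events at time 0
  -- belong to the past of every s > 0, so independence of X_0 comes for free.
  have hlim : Tendsto (fun s => ∑ x, |productKernel (uniformSemigroup (∫ τ in s..t, γ τ)) y x
      - (1 / N : ℝ) ^ D|) (𝓝[>] 0) (𝓝 0) := by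
    have := tendsto_finsetSum Finset.univ fun x (_ : x ∈ Finset.univ) =>
      ((h.tendsto_kernel ht ht1 y x).sub_const ((1 / N : ℝ) ^ D)).abs
    simpa using this
  refine ge_of_tendsto hlim ?_
  filter_upwards [(Ioo_mem_nhdsGT ht : ∀ᶠ s in 𝓝[>] (0 : ℝ), s ∈ Ioo 0 t)] with s hs
  rw [h.mass_eq_sum hs.1 hs.2.le ht1 (past_mono hs.1.le _ hA), ← sum_mass R A s, Finset.mul_sum,
    ← Finset.sum_sub_distrib]
  refine (Finset.abs_sum_le_sum_abs _ _).trans (Finset.sum_le_sum fun x _ => ?_)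
  rw [← sub_mul, abs_mul, abs_of_nonneg (mass_nonneg _ _ _ _)]
  exact mul_le_of_le_one_right (abs_nonneg _) ((mass_le _ _ _ _).trans measureReal_le_one)

lemma weight_pos (h : UniformReference γ μ R) : 0 < (1 / N : ℝ) ^ D := by
  have := h.pos
  positivity

lemma real_coord (h : UniformReference γ μ R) {t : ℝ} (ht : 0 < t) (ht1 : t ≤ 1)
    (y : State D N) : R.real {ω | coord t ω = y} = (1 / N : ℝ) ^ D := by
  have := h.ctmc.isProb
  have h1 := h.mass_eq ht ht1 MeasurableSet.univ y
  simpa [mass] using h1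

lemma mass_coord_zero (h : UniformReference γ μ R) {t : ℝ} (ht : 0 < t) (ht1 : t ≤ 1)
    (x y : State D N) :
    mass R {ω | coord 0 ω = x} t y = (1 / N : ℝ) ^ D * R.real {ω | coord 0 ω = x} :=
  h.mass_eq ht ht1 (measurableSet_past_coord le_rfl le_rfl x) y

/-- The transition probability `p_{1|t}(y|x)` of the reference. -/
noncomputable def kernel (γ : ℝ → ℝ) (t : ℝ) (y x : State D N) : ℝ :=
  productKernel (uniformSemigroup (mean γ t 1)) y x

lemma kernel_eq (h : UniformReference γ μ R) {t : ℝ} (ht : t ≤ 1) (y x : State D N) :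
    kernel γ t y x = productKernel (uniformSemigroup (∫ τ in t..1, γ τ)) y x := by
  rw [kernel, intervalIntegral_eq_mean h.measurable h.nonneg ht]

lemma kernel_nonneg (t : ℝ) (y x : State D N) : 0 ≤ kernel γ t y x :=
  productKernel_nonneg (isSemigroup_uniform.nonneg _ ENNReal.toReal_nonneg) _ _

lemma measurable_kernel (y x : State D N) : Measurable fun t => kernel γ t y x := by
  unfold kernel productKernel uniformSemigroup
  have h1 : Measurable fun t => Real.exp (-mean γ t 1) :=
    Real.measurable_exp.comp (measurable_mean_left 1).neg
  refine Finset.measurable_prod _ fun d _ => ?_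
  refine ((h1.const_sub 1).div_const _).add ?_
  split_ifs
  · exact h1
  · exact measurable_const

/-- Once some noise has accumulated after t, every symbol can become every other. Zeros of the
kernel are therefore confined to times after which γ has no mass. -/
lemma kernel_ne_zero (h : UniformReference γ μ R) {t : ℝ} (ht : mean γ t 1 ≠ 0)
    (y x : State D N) : kernel γ t y x ≠ 0 := by
  have hm : 0 < mean γ t 1 := (ENNReal.toReal_nonneg).lt_of_ne (Ne.symm ht)
  have h1 : 0 < (1 - Real.exp (-mean γ t 1)) / N := by
    have h2 : Real.exp (-mean γ t 1) < 1 :=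
      (Real.exp_lt_exp.2 (by linarith : -mean γ t 1 < 0)).trans_eq Real.exp_zero
    have h3 : (0 : ℝ) < N := by exact_mod_cast h.pos
    exact div_pos (by linarith) h3
  unfold kernel productKernel
  refine (Finset.prod_pos fun d _ => ?_).ne'
  unfold uniformSemigroup
  split_ifs
  · exact add_pos h1 (Real.exp_pos _)
  · linarith

lemma isTerminalKernel (h : UniformReference γ μ R) :
    IsTerminalKernel γ (∑ y : State D N, ∑ x, |productRate uniformGenerator y x|) (kernel γ) R where
  nonneg t _ _ y x := kernel_nonneg t y x
  le_one t _ _ y x := productKernel_le_one (isSemigroup_uniform.nonneg _ ENNReal.toReal_nonneg)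
    (isSemigroup_uniform.le_one _ ENNReal.toReal_nonneg) _ _
  const_nonneg := Finset.sum_nonneg fun _ _ => Finset.sum_nonneg fun _ _ => abs_nonneg _
  abs_sub_le s t hs hst ht y x := by
    have h1 := intervalIntegral.integral_add_adjacent_intervals
      (h.intervalIntegrable hs hst ht.le) (h.integrable t (hs.trans_le hst) ht.le)
    rw [h.kernel_eq ht.le, h.kernel_eq (hst.trans ht.le), _root_.abs_sub_comm]
    refine (isSemigroup_uniform.abs_productKernel_sub_le y x
      (intervalIntegral.integral_nonneg ht.le fun τ _ => h.nonneg τ)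
      (intervalIntegral_antitone_left h.nonneg hst ht.le
        (h.integrable s hs (hst.trans ht.le)))).trans_eq ?_
    rw [← h1, add_sub_cancel_right]
  mass_eq t ht ht1 A hA y := by
    simp_rw [h.kernel_eq ht1.le]
    exact h.mass_eq_sum ht ht1.le le_rfl hA y

lemma real_coord_one_ne_zero (h : UniformReference γ μ R) (y : State D N) :
    R.real {ω | coord 1 ω = y} ≠ 0 := by
  rw [h.real_coord one_pos le_rfl]; exact h.weight_pos.ne'

/-- The marginals at times t and 1 are both uniform, so Bayes' formula leaves the transition
probability itself. For the same reason the denoising and the bridge probabilities coincide with the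
kernel, and the two uniform losses have the same integrand. -/
lemma condTerminal_real_coord (h : UniformReference γ μ R) {t : ℝ} (ht : 0 < t) (ht1 : t < 1)
    (x y : State D N) : (condTerminal R y).real {ω | coord t ω = x} = kernel γ t y x := by
  have := h.ctmc.isProb
  have h1 := h.isTerminalKernel.mass_condTerminal ht ht1 MeasurableSet.univ x y
  rw [h.mass_eq ht ht1.le MeasurableSet.univ, h.real_coord one_pos le_rfl, probReal_univ, mul_one,
    mul_div_cancel₀ _ h.weight_pos.ne'] at h1
  simpa [mass] using h1

lemma real_coord_zero_inter_one (h : UniformReference γ μ R) (x y : State D N) :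
    R.real ({ω | coord 0 ω = x} ∩ {ω | coord 1 ω = y})
      = R.real {ω | coord 0 ω = x} * R.real {ω | coord 1 ω = y} := by
  have h1 := h.mass_coord_zero one_pos le_rfl x y
  rw [h.real_coord one_pos le_rfl, mul_comm]
  exact h1

lemma bridgeProb_eq (h : UniformReference γ μ R) {t : ℝ} (ht : 0 < t) (ht1 : t < 1)
    (x : State D N) {x₀ : State D N} (hx₀ : R.real {ω | coord 0 ω = x₀} ≠ 0) (y : State D N) :
    bridgeProb R t x x₀ y = kernel γ t y x := by
  unfold bridgeProb
  rw [h.isTerminalKernel.real_inter_inter ht ht1 (measurableSet_past_coord le_rfl ht.le x₀),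
    h.mass_coord_zero ht ht1.le, h.real_coord_zero_inter_one, h.real_coord one_pos le_rfl,
    mul_comm (R.real _), mul_div_cancel_right₀]
  exact mul_ne_zero h.weight_pos.ne' hx₀

lemma condProb_eq (h : UniformReference γ μ R) {t : ℝ} (ht : 0 < t) (ht1 : t < 1)
    (x y : State D N) : condProb R t 1 y x = kernel γ t y x := by
  have := h.ctmc.isProb
  have h1 := h.isTerminalKernel.real_inter_inter ht ht1 MeasurableSet.univ x y
  rw [h.mass_eq ht ht1.le MeasurableSet.univ, probReal_univ, mul_one, univ_inter] at h1
  unfold condProb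
  rw [h1, h.real_coord ht ht1.le, mul_div_cancel_right₀ _ h.weight_pos.ne']

lemma condTerminal_real_coord_zero (h : UniformReference γ μ R) (x y : State D N) :
    (condTerminal R y).real {ω | coord 0 ω = x} = R.real {ω | coord 0 ω = x} := by
  rw [condTerminal_real, h.real_coord_zero_inter_one,
    mul_div_cancel_right₀ _ (h.real_coord_one_ne_zero y)]

/-- The conditioned reference satisfies the start condition of Girsanov's theorem. -/
lemma klDiv_condTerminal (h : UniformReference γ μ R) {Φ : Controller D N N}
    (hΦ : ∀ t x d n, 0 ≤ Φ t x d n) {Q : Measure (PathSpace D N)}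
    (hQ : IsCTMC (controlledRate id (uniformRate γ) Φ) μ Q) (y : State D N) :
    klDiv (condTerminal R y) Q = ∫⁻ τ in Ioo (0 : ℝ) 1, klRate (uniformRate γ)
      (controlledRate id (uniformRate γ) Φ)
      (fun t x => kernel γ t y x / R.real {ω | coord 1 ω = y}) R τ := by
  have hRp := h.ctmc.isProb
  have hQp := hQ.isProb
  have hy := h.real_coord_one_ne_zero y
  have := isProbabilityMeasure_condTerminal hy
  have hG := h.isTerminalKernel.girsanovSetting h.ctmc h.isRate hQ
    (isRate_controlledRate h.isRate hΦ)
    (fun a b ha hab hb => h.intervalIntegrable ha hab hb.le) h.nonneg hy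
  have hmass0 : ∀ t, 0 < t → t < 1 → ∀ x z, mass (condTerminal R y) {ω | coord 0 ω = x} t z
      = R.real {ω | coord 0 ω = x} * kernel γ t y z := by
    intro t ht ht1 x z
    rw [h.isTerminalKernel.mass_condTerminal ht ht1 (measurableSet_past_coord le_rfl ht.le x),
      h.mass_coord_zero ht ht1.le, h.real_coord one_pos le_rfl]
    have := h.weight_pos.ne'
    field_simp
  have hmassu : ∀ t, 0 < t → t < 1 → ∀ z, mass (condTerminal R y) univ t z = kernel γ t y z := by
    intro t ht ht1 z
    rw [← h.condTerminal_real_coord ht ht1]; simp [mass]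
  refine hG.klDiv_eq fun hI => hG.startCondition_of_mixing hI h.weight_pos ?_ ?_ ?_
  · intro t ht ht1 x z
    rw [hmass0 t ht ht1, h.condTerminal_real_coord_zero, hmassu t ht ht1]
  · intro x
    rw [h.condTerminal_real_coord_zero]
    have e1 : Q.map (coord 0) = R.map (coord 0) := hQ.init.trans h.ctmc.init.symm
    have e2 := congrArg (fun m : Measure (State D N) => m.real {x}) e1
    simp only [map_measureReal_apply (measurable_coord 0) (measurableSet_singleton x)] at e2
    exact e2
  -- Given the endpoint, the joint law of (X_s, X_t) is the uniform weight times the two kernels.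
  -- The first kernel converges to N^{-D} as s → 0, giving the mixing constant.
  · intro t ht ht1 x z
    rw [hmassu t ht ht1]
    have hlim : Tendsto (fun s => productKernel (uniformSemigroup (∫ τ in s..t, γ τ)) z x
        * kernel γ t y z) (𝓝[>] 0) (𝓝 ((1 / N : ℝ) ^ D * kernel γ t y z)) :=
      (h.tendsto_kernel ht ht1.le z x).mul_const _
    refine hlim.congr' ?_
    filter_upwards [(Ioo_mem_nhdsGT ht : ∀ᶠ s in 𝓝[>] (0 : ℝ), s ∈ Ioo 0 t)] with s hs
    have hA : MeasurableSet[past s] {ω : PathSpace D N | coord s ω = x} :=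
      measurableSet_past_coord hs.1.le le_rfl x
    rw [h.isTerminalKernel.mass_condTerminal ht ht1 (past_mono hs.2.le _ hA),
      h.mass_eq_sum hs.1 hs.2.le ht1.le hA, h.real_coord one_pos le_rfl]
    have h3 : ∀ x', mass R {ω | coord s ω = x} s x' = if x' = x then mass R univ s x else 0 :=
      fun x' => by simpa using mass_inter_self R univ s x x'
    simp_rw [h3]
    simp only [mul_ite, mul_zero, Finset.sum_ite_eq', Finset.mem_univ, if_true]
    rw [h.mass_eq hs.1 (hs.2.le.trans ht1.le) MeasurableSet.univ, probReal_univ]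
    have := h.weight_pos.ne'
    field_simp

end UniformReference

end DiscreteSampler

/-! ### The uniform losses as endpoint averages. -/

namespace DiscreteSampler

open InformationTheory

variable {D K N : ℕ}

lemma measurable_genKL {a b : ℝ → ℝ} (ha : Measurable a) (hb : Measurable b) :
    Measurable fun t => genKL (a t) (b t) := by
  unfold genKL
  refine Measurable.ite (hb (measurableSet_singleton 0)) (Measurable.ite
    (ha (measurableSet_singleton 0)) measurable_const measurable_const) ?_
  exact (((ha.mul (Real.measurable_log.comp (ha.div hb))).sub ha).add hb).ennreal_ofReal

lemma condProb_one_eq (P : Measure (PathSpace D K)) (t : ℝ) (x y : State D K) :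
    condProb P 1 t x y = (condTerminal P y).real {ω | coord t ω = x} := by
  rw [condTerminal_real, condProb, inter_comm]

/-- The entropy of the law `ν`. -/
noncomputable def entropy (ν : Measure (State D K)) : ℝ≥0 :=
  (∑ y, ENNReal.ofReal (Real.negMulLog (ν.real {y}))).toNNReal

lemma coe_entropy (ν : Measure (State D K)) :
    (entropy ν : ℝ≥0∞) = ∑ y, ENNReal.ofReal (Real.negMulLog (ν.real {y})) :=
  ENNReal.coe_toNNReal (ENNReal.sum_ne_top.2 fun _ _ => ENNReal.ofReal_ne_top)

/-- The relative entropy of the Schrödinger bridge as an average over the endpoint. -/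
lemma IsSchrodingerBridge.klDiv_add_entropy {Pr Pstar Q : Measure (PathSpace D K)}
    {μ ν : Measure (State D K)} [IsProbabilityMeasure Pr] [IsProbabilityMeasure Q]
    (hb : IsSchrodingerBridge Pr μ ν Pstar) (h0 : Pr.map (coord 0) = μ)
    (hindep : ∀ x y, Pr.real ({ω | coord 0 ω = x} ∩ {ω | coord 1 ω = y})
      = Pr.real {ω | coord 0 ω = x} * Pr.real {ω | coord 1 ω = y})
    (hν : ∀ y, Pr.real {ω | coord 1 ω = y} = 0 → ν.real {y} = 0) :
    klDiv Pstar Q + entropy ν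
      = ∑ y, ENNReal.ofReal (ν.real {y}) * klDiv (condTerminal Pr y) Q := by
  have := hb.isProb
  have h := sum_mul_klDiv_cond Pstar Q (measurable_coord (D := D) (K := K) 1)
  simp_rw [hb.real_coord_one] at h
  rw [coe_entropy, ← h]
  refine Finset.sum_congr rfl fun y _ => ?_
  by_cases hy : ν.real {y} = 0
  · simp [hy]
  · rw [hb.cond_eq h0 hindep hν hy]

namespace UniformReference

variable {γ : ℝ → ℝ} {μ ν : Measure (State D N)} {R Pstar Pv : Measure (PathSpace D N)}

/-- The denoising loss at time `t`, given the endpoint `y`. -/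
noncomputable def lossRate (γ : ℝ → ℝ) (Φ : Controller D N N) (t : ℝ) (y : State D N) : ℝ≥0∞ :=
  ENNReal.ofReal (γ t / N) * ∑ x, ENNReal.ofReal (kernel γ t y x) *
    ∑ d, ∑ n with n ≠ x d,
      genKL (kernel γ t y (Function.update x d n) / kernel γ t y x) (Φ t x d n)

lemma measurable_lossRate (hγ : Measurable γ) {Φ : Controller D N N}
    (hΦ : ∀ x d n, Measurable fun t => Φ t x d n) (y : State D N) :
    Measurable fun t => lossRate γ Φ t y := by
  unfold lossRate
  refine (hγ.div_const _).ennreal_ofReal.mul (Finset.measurable_sum _ fun x _ => ?_)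
  refine (measurable_kernel y x).ennreal_ofReal.mul (Finset.measurable_sum _ fun d _ =>
    Finset.measurable_sum _ fun n _ => ?_)
  exact measurable_genKL ((measurable_kernel _ _).div (measurable_kernel _ _)) (hΦ x d n)

lemma dmLoss_eq (h : UniformReference γ μ R) (hb : IsSchrodingerBridge R μ ν Pstar)
    [IsProbabilityMeasure Pv] (hac : Pstar ≪ Pv) {Φ : Controller D N N}
    (hΦ : ∀ x d n, Measurable fun t => Φ t x d n) :
    dmLoss id R Pstar Pv (fun t => γ t / N) genKL Φ
      = ∑ y, ENNReal.ofReal (ν.real {y}) * ∫⁻ t in Ioo (0 : ℝ) 1, lossRate γ Φ t y := by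
  have := hb.isProb
  simp_rw [← hb.real_coord_one]
  refine dmLoss_eq_sum hac (measurable_lossRate h.measurable hΦ) (ae_of_all _ ?_)
  intro t ht x₀ y hxy
  have hx₀ : R.real {ω | coord 0 ω = x₀} ≠ 0 := by
    have e1 : Pstar.map (coord 0) = R.map (coord 0) := hb.init.trans h.ctmc.init.symm
    have e2 := congrArg (fun m : Measure (State D N) => m.real {x₀}) e1
    simp only [map_measureReal_apply (measurable_coord 0) (measurableSet_singleton x₀)] at e2
    have e3 : Pstar.real {ω | coord 0 ω = x₀} = R.real {ω | coord 0 ω = x₀} := e2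
    rw [← e3]
    intro h0
    exact hxy (measureReal_mono_null inter_subset_left h0)
  unfold lossRate
  simp_rw [h.bridgeProb_eq ht.1 ht.2 _ hx₀, h.condProb_eq ht.1 ht.2]
  rfl

/-- The bridge has the same conditional laws given X_1 as the reference wherever ν charges the
endpoint, so its denoising probabilities are the reference kernel. Other endpoints have weight zero.
-/
lemma udnsWDCE_eq (h : UniformReference γ μ R) (hb : IsSchrodingerBridge R μ ν Pstar)
    [IsProbabilityMeasure Pv] (hac : Pstar ≪ Pv) (Φ : Controller D N N) :
    udnsWDCE Pstar Pv γ Φ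
      = ∑ y, ENNReal.ofReal (ν.real {y}) * ∫⁻ t in Ioo (0 : ℝ) 1, lossRate γ Φ t y := by
  have := hb.isProb
  have := h.ctmc.isProb
  refine (lintegral_rnDeriv_mul_comp hac (measurable_coord 1) fun y =>
    ∫⁻ t in Ioo (0 : ℝ) 1, ENNReal.ofReal (γ t / N) *
      ∑ x, ENNReal.ofReal (condProb Pstar 1 t x y) *
        ∑ d, ∑ n with n ≠ x d,
          genKL (condProb Pstar 1 t (Function.update x d n) y / condProb Pstar 1 t x y)
            (Φ t x d n)).trans ?_
  refine Finset.sum_congr rfl fun y _ => ?_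
  rw [hb.real_coord_one]
  by_cases hy : ν.real {y} = 0
  · simp [hy]
  congr 1
  refine setLIntegral_congr_fun measurableSet_Ioo fun t ht => ?_
  have hk : ∀ x, condProb Pstar 1 t x y = kernel γ t y x := fun x => by
    rw [condProb_one_eq, condTerminal, hb.cond_eq h.ctmc.init h.real_coord_zero_inter_one
      (fun y h0 => absurd h0 (h.real_coord_one_ne_zero y)) hy, h.condTerminal_real_coord ht.1 ht.2]
  simp only [hk, lossRate]

lemma klDiv_add_entropy_eq (h : UniformReference γ μ R) (hb : IsSchrodingerBridge R μ ν Pstar)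
    {Φ : Controller D N N} (hΦ : ∀ t x d n, 0 ≤ Φ t x d n) {Q : Measure (PathSpace D N)}
    (hQ : IsCTMC (controlledRate id (uniformRate γ) Φ) μ Q) :
    klDiv Pstar Q + entropy ν
      = ∑ y, ENNReal.ofReal (ν.real {y}) * ∫⁻ t in Ioo (0 : ℝ) 1, lossRate γ Φ t y := by
  have := hQ.isProb
  have := h.ctmc.isProb
  rw [hb.klDiv_add_entropy h.ctmc.init h.real_coord_zero_inter_one
    fun y h0 => absurd h0 (h.real_coord_one_ne_zero y)]
  refine Finset.sum_congr rfl fun y _ => ?_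
  rw [h.klDiv_condTerminal hΦ hQ y]
  congr 1
  refine lintegral_congr_ae ?_
  filter_upwards [ae_restrict_mem measurableSet_Ioo,
    ae_restrict_of_ae (ae_eq_zero_of_tail_eq_zero h.nonneg h.integrable)] with t ht h0
  have hrate : ∀ (x : State D N) d n, n ≠ x d →
      uniformRate γ t (Function.update x d n) x = γ t / N := fun x d n hn =>
    if_pos (hammingDist_eq_one_iff.2 ⟨d, n, hn, rfl⟩)
  rw [h.isTerminalKernel.klRate_controlledRate Function.injective_id h.isRate ht y]
  · simp_rw [h.condTerminal_real_coord ht.1 ht.2]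
    unfold lossRate
    rw [Finset.mul_sum]
    refine Finset.sum_congr rfl fun x _ => ?_
    rw [mul_left_comm]
    congr 1
    rw [Finset.mul_sum]
    refine Finset.sum_congr rfl fun d _ => ?_
    rw [Finset.mul_sum]
    refine Finset.sum_congr rfl fun n hn => ?_
    rw [id, hrate x d n (Finset.mem_filter.1 hn).2]
  · intro x z hz hzn
    rw [uniformRate_eq, productRate_eq_zero hzn, mul_zero]
  -- A zero of the kernel forces ∫_t^1 γ = 0, and at almost every such time γ itself vanishes, so
  -- there is no jump.
  · intro x d n hn hx
    have hm : mean γ t 1 = 0 := by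
      by_contra hne
      exact h.kernel_ne_zero hne y x hx
    rw [← intervalIntegral_eq_mean h.measurable h.nonneg ht.2.le] at hm
    rw [id, hrate x d n hn, h0 ht hm, zero_div, zero_mul]

end UniformReference

end DiscreteSampler

/-! ### The masked reference: transition kernels and absorption at time 1. -/

namespace DiscreteSampler

open InformationTheory

variable {D K N : ℕ}

/-- The fully masked state. -/
def maskState (D N : ℕ) : State D (N + 1) := fun _ => Fin.last N

/-- A continuous-time Markov chain with the masked reference rate, which is absorbed at time `1`. -/
structure MaskedReference (γ : ℝ → ℝ) (R : Measure (PathSpace D (N + 1))) : Prop where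
  pos : 0 < N
  measurable : Measurable γ
  nonneg : ∀ t, 0 ≤ γ t
  integrable : ∀ t : ℝ, 0 ≤ t → t < 1 → IntervalIntegrable γ volume 0 t
  diverges : ∀ t : ℝ, 0 ≤ t → t < 1 → ∫⁻ τ in Ioo t 1, ENNReal.ofReal (γ τ) = ⊤
  ctmc : IsCTMC (maskedRate γ) (Measure.dirac (maskState D N)) R

/-- This converts the absence of a jump at the fixed time 1 into left continuity of all masses. -/
lemma abs_mass_sub_mass_le (P : Measure (PathSpace D K)) [IsFiniteMeasure P]
    (A : Set (PathSpace D K)) (s t : ℝ) (y : State D K) :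
    |mass P A s y - mass P A t y| ≤ P.real {ω | coord s ω ≠ coord t ω} := by
  have key : ∀ s t : ℝ, mass P A s y ≤ mass P A t y + P.real {ω | coord s ω ≠ coord t ω} := by
    intro s t
    refine (measureReal_mono ?_).trans (measureReal_union_le _ _)
    intro ω hω
    by_cases h : coord s ω = coord t ω
    · exact Or.inl ⟨hω.1, h.symm.trans hω.2⟩
    · exact Or.inr h
  have h1 := key s t
  have h2 := key t s
  simp_rw [ne_comm (a := coord t _)] at h2
  rw [abs_le]
  constructor <;> linarith

lemma maskedKernel_nonneg {e : ℝ} (he : 0 ≤ e) (he1 : e ≤ 1) (a b : Fin (N + 1)) :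
    0 ≤ maskedKernel e a b := by
  have : 0 ≤ 1 - e := by linarith
  unfold maskedKernel
  split_ifs <;> positivity

lemma maskedKernel_le_one (hN : 0 < N) {e : ℝ} (he : 0 ≤ e) (he1 : e ≤ 1) (a b : Fin (N + 1)) :
    maskedKernel e a b ≤ 1 := by
  have hN : (1 : ℝ) ≤ N := by exact_mod_cast hN
  have h1 : (1 - e) / N ≤ 1 - e := div_le_self (by linarith) hN
  unfold maskedKernel
  split_ifs <;> linarith

namespace MaskedReference

variable {γ : ℝ → ℝ} {R : Measure (PathSpace D (N + 1))}

lemma intervalIntegrable (h : MaskedReference γ R) {s t : ℝ} (hs : 0 ≤ s) (hst : s ≤ t)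
    (ht : t < 1) : IntervalIntegrable γ volume s t :=
  IntervalIntegrable.sub_interval (h.integrable t (hs.trans hst) ht) hs hst le_rfl

lemma rate_eq : (maskedRate γ : ℝ → State D (N + 1) → State D (N + 1) → ℝ)
    = fun t y x => γ t * productRate maskedGenerator y x := by
  ext t y x; exact maskedRate_eq γ t y x

lemma isRate (h : MaskedReference γ R) :
    IsRate (maskedRate γ : ℝ → State D (N + 1) → State D (N + 1) → ℝ) := by
  rw [rate_eq]
  exact isRate_productRate h.nonneg (fun _ _ => maskedGenerator_nonneg) (sum_maskedGenerator h.pos)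

lemma rate_update (t : ℝ) {x : State D (N + 1)} {d : Fin D} {n : Fin N} (hn : n.castSucc ≠ x d) :
    maskedRate γ t (Function.update x d n.castSucc) x
      = if x d = Fin.last N then γ t / N else 0 := by
  rw [maskedRate_eq, productRate_update hn]
  unfold maskedGenerator
  rw [if_neg (Fin.castSucc_ne_last n)]
  split_ifs <;> ring

lemma forwardOn (h : MaskedReference γ R) {s t : ℝ} (hs : 0 ≤ s) (hst : s ≤ t) (ht : t < 1) :
    ForwardOn (fun t y x => γ t * productRate maskedGenerator y x) R s t := by
  rw [← rate_eq]
  refine h.ctmc.forwardOn_of_integrable hs ht.le fun x y => ?_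
  simp_rw [maskedRate_eq]
  exact (h.intervalIntegrable hs hst ht).mul_const _

lemma mass_eq_sum (h : MaskedReference γ R) {s t : ℝ} (hs : 0 ≤ s) (hst : s ≤ t)
    (ht : t < 1) {A : Set (PathSpace D (N + 1))} (hA : MeasurableSet[past s] A)
    (y : State D (N + 1)) :
    mass R A t y
      = ∑ x, productKernel (maskedKernel (Real.exp (-∫ τ in s..t, γ τ))) y x * mass R A s x := by
  have := h.ctmc.isProb
  exact (h.forwardOn hs hst ht).mass_eq_sum_productKernel (isSemigroup_masked h.pos) hst
    (h.intervalIntegrable hs hst ht) h.nonneg hA y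

lemma continuous_productKernel (y x : State D (N + 1)) :
    Continuous fun e => productKernel (maskedKernel e) y x := by
  unfold productKernel maskedKernel
  refine continuous_finsetProd _ fun d _ => ?_
  split_ifs <;> fun_prop

/-- The transition probability `p_{1|t}(y|x)` of the masked reference. -/
noncomputable def kernel (y x : State D (N + 1)) : ℝ := productKernel (maskedKernel 0) y x

/-- The rates are not integrable up to time 1, so the forward equation cannot be used there
directly. Instead t → 1: the probability of remaining masked tends to 0, the kernel tends to its
value at e = 0, and the masses are left continuous. -/
lemma mass_one_eq_sum (h : MaskedReference γ R) {s : ℝ} (hs : 0 ≤ s) (hs1 : s < 1)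
    {A : Set (PathSpace D (N + 1))} (hA : MeasurableSet[past s] A) (y : State D (N + 1)) :
    mass R A 1 y = ∑ x, kernel y x * mass R A s x := by
  have := h.ctmc.isProb
  have h1 : Tendsto (fun t => mass R A t y) (𝓝[<] 1) (𝓝 (mass R A 1 y)) := by
    rw [tendsto_iff_norm_sub_tendsto_zero]
    exact squeeze_zero (fun _ => norm_nonneg _) (fun t => abs_mass_sub_mass_le R A t 1 y)
      h.ctmc.left_cont
  have h2 : Tendsto (fun t => Real.exp (-∫ τ in s..t, γ τ)) (𝓝[<] 1) (𝓝 0) :=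
    Real.tendsto_exp_neg_atTop_nhds_zero.comp
      (tendsto_integral_atTop_right h.nonneg h.integrable hs hs1 (h.diverges s hs hs1))
  have h3 : Tendsto (fun t => ∑ x, productKernel (maskedKernel (Real.exp (-∫ τ in s..t, γ τ))) y x
      * mass R A s x) (𝓝[<] 1) (𝓝 (∑ x, kernel y x * mass R A s x)) :=
    tendsto_finsetSum _ fun x _ =>
      (((continuous_productKernel y x).tendsto 0).comp h2).mul_const _
  refine tendsto_nhds_unique h1 (h3.congr' ?_)
  filter_upwards [(Ioo_mem_nhdsLT hs1 : ∀ᶠ t in 𝓝[<] (1 : ℝ), t ∈ Ioo s 1)] with t ht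
  exact (h.mass_eq_sum hs ht.1.le ht.2 hA y).symm

lemma kernel_nonneg (y x : State D (N + 1)) : 0 ≤ kernel y x :=
  productKernel_nonneg (maskedKernel_nonneg le_rfl zero_le_one) y x

/-- From any time before 1 every masked site ends uniformly distributed and every other site is
frozen. The kernel is constant in time, so the Lipschitz constant is 0. -/
lemma isTerminalKernel (h : MaskedReference γ R) :
    IsTerminalKernel γ 0 (fun _ => kernel) R where
  nonneg _ _ _ := kernel_nonneg
  le_one _ _ _ := productKernel_le_one (maskedKernel_nonneg le_rfl zero_le_one)
    (maskedKernel_le_one h.pos le_rfl zero_le_one)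
  const_nonneg := le_rfl
  abs_sub_le s t _ _ _ y x := by simp
  mass_eq t ht ht1 A hA y := h.mass_one_eq_sum ht.le ht1 hA y

lemma real_coord_zero_of_init {Q : Measure (PathSpace D (N + 1))} (hQ : Q.map (coord 0) = Measure.dirac (maskState D N)) :
    Q.real {ω | coord 0 ω ≠ maskState D N} = 0 := by
  have h1 : Q {ω | coord 0 ω ≠ maskState D N} = Q.map (coord 0) {maskState D N}ᶜ := by
    rw [Measure.map_apply (measurable_coord 0) (measurableSet_singleton _).compl]; rfl
  rw [measureReal_def, h1, hQ]
  simp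

end MaskedReference

end DiscreteSampler

/-! ### Conditioning the masked chain, and the cross-entropy identity for denoisers. -/

namespace DiscreteSampler

open InformationTheory

variable {D K N : ℕ}

lemma real_coord_zero_inter {P : Measure (PathSpace D K)} [IsFiniteMeasure P] {o : State D K}
    (h : P.real {ω | coord 0 ω ≠ o} = 0) (x : State D K) (E : Set (PathSpace D K)) :
    P.real ({ω | coord 0 ω = x} ∩ E) = if x = o then P.real E else 0 := by
  split_ifs with hx
  · subst hx
    refine le_antisymm (measureReal_mono inter_subset_right) ?_
    have h1 : P.real E ≤ P.real ({ω | coord 0 ω = x} ∩ E) + P.real {ω | coord 0 ω ≠ x} := by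
      refine (measureReal_mono ?_).trans (measureReal_union_le _ _)
      intro ω hω
      by_cases h2 : coord 0 ω = x
      · exact Or.inl ⟨h2, hω⟩
      · exact Or.inr h2
    linarith
  · refine measureReal_mono_null (s₂ := {ω | coord 0 ω ≠ o}) ?_ h
    rintro ω ⟨h1, _⟩ h2
    exact hx (h1.symm.trans h2)

namespace MaskedReference

variable {γ : ℝ → ℝ} {R : Measure (PathSpace D (N + 1))}

lemma real_coord_zero (h : MaskedReference γ R) :
    R.real {ω | coord 0 ω ≠ maskState D N} = 0 := real_coord_zero_of_init h.ctmc.init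

lemma mass_univ_zero (h : MaskedReference γ R) (x : State D (N + 1)) :
    mass R univ 0 x = if x = maskState D N then 1 else 0 := by
  have := h.ctmc.isProb
  have h1 := real_coord_zero_inter h.real_coord_zero x univ
  rw [mass, inter_comm, h1, probReal_univ]

/-- The probability that a symbol is still masked at time `t`. -/
noncomputable def level (γ : ℝ → ℝ) (t : ℝ) : ℝ := Real.exp (-mean γ 0 t)

lemma level_mem (γ : ℝ → ℝ) (t : ℝ) : level γ t ∈ Ioc (0 : ℝ) 1 := exp_neg_mem ENNReal.toReal_nonneg

lemma measurable_level (γ : ℝ → ℝ) : Measurable (level γ) :=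
  Real.measurable_exp.comp (measurable_mean_right 0).neg

lemma level_eq (h : MaskedReference γ R) {t : ℝ} (ht : 0 ≤ t) :
    level γ t = Real.exp (-∫ τ in 0..t, γ τ) := by
  rw [level, intervalIntegral_eq_mean h.measurable h.nonneg ht]

lemma mass_univ (h : MaskedReference γ R) {t : ℝ} (ht : 0 ≤ t) (ht1 : t < 1)
    (x : State D (N + 1)) :
    mass R univ t x = productKernel (maskedKernel (level γ t)) x (maskState D N) := by
  rw [h.mass_eq_sum le_rfl ht ht1 MeasurableSet.univ, ← h.level_eq ht]
  simp [h.mass_univ_zero]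

lemma real_coord_one (h : MaskedReference γ R) (y : State D (N + 1)) :
    R.real {ω | coord 1 ω = y} = kernel y (maskState D N) := by
  have h1 := h.mass_one_eq_sum le_rfl one_pos MeasurableSet.univ y
  simp_rw [h.mass_univ_zero] at h1
  simpa [mass] using h1

lemma kernel_maskState_ne_zero (hN : 0 < N) {y : State D (N + 1)} (hy : ∀ d, y d ≠ Fin.last N) :
    kernel y (maskState D N) ≠ 0 := by
  have : (0 : ℝ) < N := by exact_mod_cast hN
  unfold kernel productKernel
  refine Finset.prod_ne_zero_iff.2 fun d _ => ?_
  simp only [maskState, maskedKernel, if_true, if_neg (hy d)]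
  positivity

lemma real_coord_one_ne_zero (h : MaskedReference γ R) {y : State D (N + 1)}
    (hy : ∀ d, y d ≠ Fin.last N) : R.real {ω | coord 1 ω = y} ≠ 0 := by
  rw [h.real_coord_one]; exact kernel_maskState_ne_zero h.pos hy

lemma real_coord_zero_inter_one (h : MaskedReference γ R) (x y : State D (N + 1)) :
    R.real ({ω | coord 0 ω = x} ∩ {ω | coord 1 ω = y})
      = R.real {ω | coord 0 ω = x} * R.real {ω | coord 1 ω = y} := by
  have := h.ctmc.isProb
  have h1 := real_coord_zero_inter h.real_coord_zero x univ
  rw [inter_univ, probReal_univ] at h1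
  rw [real_coord_zero_inter h.real_coord_zero, h1]
  split_ifs <;> simp

/-- The conditioned reference at time `t` is obtained from the endpoint by independent masking. -/
lemma condTerminal_real_coord (h : MaskedReference γ R) {t : ℝ} (ht : 0 < t) (ht1 : t < 1)
    (x : State D (N + 1)) {y : State D (N + 1)} (hy : ∀ d, y d ≠ Fin.last N) :
    (condTerminal R y).real {ω | coord t ω = x} = maskProb (level γ t) x y := by
  have h1 := h.isTerminalKernel.mass_condTerminal ht ht1 MeasurableSet.univ x y
  rw [h.mass_univ ht.le ht1, h.real_coord_one] at h1
  have h2 : mass (condTerminal R y) univ t x = (condTerminal R y).real {ω | coord t ω = x} := by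
    simp [mass]
  rw [← h2, h1]
  unfold kernel productKernel maskProb
  rw [← Finset.prod_div_distrib, ← Finset.prod_mul_distrib]
  refine Finset.prod_congr rfl fun d _ => ?_
  have hN : (N : ℝ) ≠ 0 := by exact_mod_cast h.pos.ne'
  simp only [maskState, maskedKernel, if_true, if_neg (hy d), sub_zero]
  by_cases hx : x d = Fin.last N
  · simp [hx, hN]
  · simp only [hx, if_false]
    by_cases hxy : x d = y d
    · simp [hxy, hN]
    · simp [hxy, Ne.symm hxy]

lemma bridgeProb_eq (h : MaskedReference γ R) {t : ℝ} (ht : 0 < t) (ht1 : t < 1)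
    (x : State D (N + 1)) {y : State D (N + 1)} (hy : ∀ d, y d ≠ Fin.last N) :
    bridgeProb R t x (maskState D N) y = maskProb (level γ t) x y := by
  have := h.ctmc.isProb
  unfold bridgeProb
  rw [inter_assoc, real_coord_zero_inter h.real_coord_zero, if_pos rfl,
    real_coord_zero_inter h.real_coord_zero, if_pos rfl, ← condTerminal_real,
    h.condTerminal_real_coord ht ht1 x hy]

/-- Some noise must have acted before t for all states to be charged. Otherwise the conditional
probability at an uncharged state is 0/0, which is 0 by convention and not the kernel. -/
lemma condProb_eq (h : MaskedReference γ R) {t : ℝ} (ht : 0 < t) (ht1 : t < 1)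
    (hγ : ∫ τ in 0..t, γ τ ≠ 0) (x y : State D (N + 1)) : condProb R t 1 y x = kernel y x := by
  have h1 := h.isTerminalKernel.real_inter_inter ht ht1 MeasurableSet.univ x y
  rw [univ_inter] at h1
  have h2 : R.real {ω | coord t ω = x} = mass R univ t x := by simp [mass]
  have h3 : mass R univ t x ≠ 0 := by
    rw [h.mass_univ ht.le ht1]
    have hpos : 0 < ∫ τ in 0..t, γ τ :=
      (intervalIntegral.integral_nonneg ht.le fun τ _ => h.nonneg τ).lt_of_ne hγ.symm
    have hlt : level γ t < 1 := by
      rw [h.level_eq ht.le]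
      exact (Real.exp_lt_exp.2 (by linarith : -∫ τ in 0..t, γ τ < 0)).trans_eq Real.exp_zero
    have hN : (0 : ℝ) < N := by exact_mod_cast h.pos
    unfold productKernel
    refine Finset.prod_ne_zero_iff.2 fun d _ => ?_
    simp only [maskState, maskedKernel, if_true]
    split_ifs
    · exact (level_mem γ t).1.ne'
    · exact (div_pos (by linarith) hN).ne'
  unfold condProb
  rw [h1, h2, mul_div_cancel_right₀ _ h3]

end MaskedReference

section Denoiser

lemma genKL_zero_left {b : ℝ} : genKL 0 b = ENNReal.ofReal b := by
  unfold genKL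
  by_cases h : b = 0 <;> simp [h]

/-- The linear terms of the divergence are cancelled by the mass 1 - b that a probability vector
puts on the other symbols, leaving the pure logarithm. -/
lemma genKL_one_left_add {b : ℝ} (hb : 0 ≤ b) (hb1 : b ≤ 1) :
    genKL 1 b + ENNReal.ofReal (1 - b) = negLog b := by
  unfold genKL negLog
  by_cases h : b = 0
  · simp [h]
  · have hpos : 0 < b := hb.lt_of_ne (Ne.symm h)
    have h1 := Real.log_le_sub_one_of_pos hpos
    rw [if_neg h, if_neg h, one_div, Real.log_inv, ← ENNReal.ofReal_add (by linarith) (by linarith)]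
    congr 1; ring

/-- The generalized Kullback–Leibler divergence from a point mass to a probability vector. -/
lemma sum_genKL_single {s : Fin N → ℝ} (hs : ∀ n, 0 ≤ s n) (hs1 : ∑ n, s n = 1) (n₀ : Fin N) :
    ∑ n, genKL (if n = n₀ then 1 else 0) (s n) = negLog (s n₀) := by
  classical
  have hle : s n₀ ≤ 1 := hs1 ▸ Finset.single_le_sum (fun n _ => hs n) (Finset.mem_univ n₀)
  rw [← Finset.add_sum_erase _ _ (Finset.mem_univ n₀), if_pos rfl, ← genKL_one_left_add (hs n₀) hle]
  congr 1
  rw [Finset.sum_congr rfl fun n hn => by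
    rw [if_neg (Finset.ne_of_mem_erase hn), genKL_zero_left],
    ← ENNReal.ofReal_sum_of_nonneg fun n _ => hs n]
  congr 1
  rw [← hs1, ← Finset.add_sum_erase _ s (Finset.mem_univ n₀)]
  ring

namespace MaskedReference

variable {s : Controller D N (N + 1)}

lemma maskedController_mask {t : ℝ} {x : State D (N + 1)} {d : Fin D} (hx : x d = Fin.last N)
    (n : Fin N) : maskedController s t x d n = N * s t x d n := by
  simp [maskedController, hx, (Fin.castSucc_ne_last n).symm]

lemma maskedController_unmask {t : ℝ} {x : State D (N + 1)} {d : Fin D} (hx : x d ≠ Fin.last N)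
    {n : Fin N} (hn : n.castSucc ≠ x d) : maskedController s t x d n = 0 := by
  simp [maskedController, hx, hn.symm]

/-- Revealing the correct symbol at a masked site removes one factor 1/N from the chance of reaching
y, and a wrong symbol makes y unreachable. The ratio is N times an indicator, matching the factor N
in the controller. -/
lemma kernel_update_mask (hN : 0 < N) {x y : State D (N + 1)} (hy : ∀ d, y d ≠ Fin.last N)
    {d : Fin D} (hx : x d = Fin.last N) (n : Fin N) :
    kernel y (Function.update x d n.castSucc)
      = (if y d = n.castSucc then (N : ℝ) else 0) * kernel y x := by
  have hN : (N : ℝ) ≠ 0 := by exact_mod_cast hN.ne'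
  have h1 := productKernel_update (maskedKernel 0) y x d n.castSucc
  have h2 := productKernel_update (maskedKernel 0) y x d (x d)
  rw [Function.update_eq_self] at h2
  unfold kernel
  rw [h1, h2, hx]
  simp only [maskedKernel, if_true, if_neg (hy d), if_neg (Fin.castSucc_ne_last n), sub_zero]
  split_ifs
  · field_simp
  · simp

lemma eq_of_kernel_ne_zero {x y : State D (N + 1)} (h : kernel y x ≠ 0) {d : Fin D}
    (hx : x d ≠ Fin.last N) : y d = x d := by
  by_contra hne
  refine h (Finset.prod_eq_zero (Finset.mem_univ d) ?_)
  simp [maskedKernel, hx, hne]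

/-- Changing a revealed symbol makes y unreachable. The controller is also zero on such edges, so
they contribute genKL 0 0 = 0. -/
lemma kernel_update_unmask {x y : State D (N + 1)} (h : kernel y x ≠ 0) {d : Fin D}
    (hx : x d ≠ Fin.last N) {n : Fin N} (hn : n.castSucc ≠ x d) :
    kernel y (Function.update x d n.castSucc) = 0 := by
  refine Finset.prod_eq_zero (Finset.mem_univ d) ?_
  rw [Function.update_self, eq_of_kernel_ne_zero h hx]
  simp [maskedKernel, Fin.castSucc_ne_last, hn.symm]

/-- The generalized Kullback–Leibler loss of a denoiser is a cross-entropy. -/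
lemma sum_genKL_eq_maskedCE (hN : 0 < N) (hs : IsDenoiser s) (t : ℝ) {x y : State D (N + 1)}
    (hy : ∀ d, y d ≠ Fin.last N) (hxy : kernel y x ≠ 0) :
    ∑ d, ∑ n with Fin.castSucc n ≠ x d,
      genKL (kernel y (Function.update x d n.castSucc) / kernel y x) (maskedController s t x d n)
      = N * maskedCE (s t x) x y := by
  unfold maskedCE
  rw [Finset.sum_filter, Finset.mul_sum]
  refine Finset.sum_congr rfl fun d _ => ?_
  by_cases hx : x d = Fin.last N
  · rw [if_pos hx]
    obtain ⟨n₀, hn₀⟩ := Fin.exists_castSucc_eq.2 (hy d)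
    have h1 : (Finset.univ.filter fun n : Fin N => n.castSucc ≠ x d) = Finset.univ := by
      simp [hx, Fin.castSucc_ne_last]
    rw [h1]
    have h2 : ∀ n, genKL (kernel y (Function.update x d n.castSucc) / kernel y x)
        (maskedController s t x d n) = N * genKL (if n = n₀ then 1 else 0) (s t x d n) := by
      intro n
      rw [kernel_update_mask hN hy hx, mul_div_cancel_right₀ _ hxy, maskedController_mask hx,
        ← hn₀]
      have h3 : (if n₀.castSucc = n.castSucc then (N : ℝ) else 0)
          = N * if n = n₀ then 1 else 0 := by
        by_cases h4 : n = n₀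
        · simp [h4]
        · simp [h4, Ne.symm h4]
      rw [h3, genKL_mul (Nat.cast_nonneg N), ENNReal.ofReal_natCast]
    rw [Finset.sum_congr rfl fun n _ => h2 n, ← Finset.mul_sum,
      sum_genKL_single (hs.nonneg t x d) (hs.sum_one t x d hx)]
    congr 1
    rw [Finset.sum_eq_single n₀]
    · rw [if_pos hn₀.symm]
    · intro n _ hn
      rw [← hn₀, if_neg fun e => hn (Fin.castSucc_injective _ e).symm]
    · simp
  · rw [if_neg hx, mul_zero]
    refine Finset.sum_eq_zero fun n hn => ?_
    have hn' := (Finset.mem_filter.1 hn).2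
    rw [kernel_update_unmask hxy hx hn', maskedController_unmask hx hn', zero_div, genKL_zero_left,
      ENNReal.ofReal_zero]

end MaskedReference

end Denoiser

end DiscreteSampler

/-! ### The masked losses as endpoint averages. -/

namespace DiscreteSampler

open InformationTheory

variable {D K N : ℕ}

/-- A chain with integrable rates at time `0` does not move immediately. -/
lemma ForwardOn.tendsto_real_coord_ne {u : ℝ → State D K → State D K → ℝ} {V : ℝ → ℝ} {b : ℝ}
    {Q : Measure (PathSpace D K)} [IsProbabilityMeasure Q] (h : ForwardOn u Q 0 b)
    (hV : RateBound u V 0 b) (hb : 0 < b) {o : State D K} (h0 : Q.real {ω | coord 0 ω ≠ o} = 0) :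
    Tendsto (fun t => Q.real {ω | coord t ω ≠ o}) (𝓝[>] 0) (𝓝 0) := by
  have h1 : ∀ t : ℝ, Q.real {ω | coord t ω ≠ o} = 1 - mass Q univ t o := fun t => by
    have h5 : Q.real {ω | coord t ω ≠ o} = 1 - Q.real {ω | coord t ω = o} :=
      probReal_compl_eq_one_sub (measurableSet_coord t o)
    rw [h5]
    simp [mass]
  have h2 := (h.continuousOn hV MeasurableSet.univ o) 0 (left_mem_Icc.2 hb.le)
  have h3 : Tendsto (fun t => mass Q univ t o) (𝓝[>] 0) (𝓝 (mass Q univ 0 o)) :=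
    h2.tendsto.mono_left (nhdsWithin_le_of_mem (Icc_mem_nhdsGT hb))
  rw [h1] at h0
  simp_rw [h1]
  have h4 := h3.const_sub 1
  rwa [h0] at h4

lemma measurable_negLog {a : ℝ → ℝ} (ha : Measurable a) : Measurable fun t => negLog (a t) := by
  unfold negLog
  exact Measurable.ite (ha (measurableSet_singleton 0)) measurable_const
    (Real.measurable_log.comp ha).neg.ennreal_ofReal

lemma IsDenoiser.measurable_maskedCE {s : Controller D N (N + 1)} (hs : IsDenoiser s)
    (x y : State D (N + 1)) : Measurable fun t => maskedCE (s t x) x y := by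
  unfold maskedCE
  refine Finset.measurable_sum _ fun d _ => Finset.measurable_sum _ fun n _ => ?_
  split_ifs
  · exact measurable_negLog (hs.measurable x d n)
  · exact measurable_const

lemma IsDenoiser.measurable_maskedController {s : Controller D N (N + 1)} (hs : IsDenoiser s)
    (x : State D (N + 1)) (d : Fin D) (n : Fin N) :
    Measurable fun t => maskedController s t x d n := by
  unfold maskedController
  refine Measurable.add ?_ measurable_const
  split_ifs
  · exact (hs.measurable x d n).const_mul _
  · exact measurable_const

lemma IsDenoiser.maskedController_nonneg {s : Controller D N (N + 1)} (hs : IsDenoiser s)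
    (t : ℝ) (x : State D (N + 1)) (d : Fin D) (n : Fin N) : 0 ≤ maskedController s t x d n := by
  have := hs.nonneg t x d n
  unfold maskedController
  split_ifs <;> positivity

lemma IsDenoiser.maskedController_le {s : Controller D N (N + 1)} (hs : IsDenoiser s)
    (t : ℝ) (x : State D (N + 1)) (d : Fin D) (n : Fin N) : maskedController s t x d n ≤ N + 1 := by
  have hN : (0 : ℝ) ≤ N := Nat.cast_nonneg N
  have h1 : x d = Fin.last N → N * s t x d n ≤ N := fun hx => by
    refine mul_le_of_le_one_right hN ?_
    rw [← hs.sum_one t x d hx]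
    exact Finset.single_le_sum (fun n _ => hs.nonneg t x d n) (Finset.mem_univ n)
  unfold maskedController
  split_ifs with h2 h3 h4
  · linarith [h1 h2]
  · linarith [h1 h2]
  · linarith
  · linarith

namespace MaskedReference

variable {γ : ℝ → ℝ} {R Pstar Pv Q : Measure (PathSpace D (N + 1))} {s : Controller D N (N + 1)}
  {ν : Measure (State D (N + 1))}

/-- Denoiser outputs are probabilities, so the controller is bounded by N + 1 and the controlled
rate inherits integrability at time 0 from γ. Without such a bound the chain could move at time 0.
-/
lemma intervalIntegrable_controlledRate (h : MaskedReference γ R) (hs : IsDenoiser s) {b : ℝ}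
    (hb : 0 ≤ b) (hb1 : b < 1) (x y : State D (N + 1)) :
    IntervalIntegrable (fun τ => controlledRate Fin.castSucc (maskedRate γ) (maskedController s) τ y x)
      volume 0 b := by
  have hjump : ∀ z, IntervalIntegrable (fun τ =>
      controlledJump Fin.castSucc (maskedRate γ) (maskedController s) τ z x) volume 0 b := by
    intro z
    unfold controlledJump
    refine intervalIntegrable_sum _ fun d _ => intervalIntegrable_sum _ fun n _ => ?_
    split_ifs
    · have h1 : IntervalIntegrable (fun τ => maskedRate γ τ z x) volume 0 b := by
        simp_rw [maskedRate_eq]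
        exact (h.integrable b hb hb1).mul_const _
      have h2 : ∀ τ, ‖maskedController s τ x d n‖ ≤ N + 1 := fun τ => by
        rw [Real.norm_eq_abs, abs_of_nonneg (hs.maskedController_nonneg τ x d n)]
        exact hs.maskedController_le τ x d n
      have hm := hs.measurable_maskedController x d n
      simp_rw [mul_comm (maskedRate γ _ z x)]
      exact ⟨h1.1.bdd_mul hm.aestronglyMeasurable (ae_of_all _ h2),
        h1.2.bdd_mul hm.aestronglyMeasurable (ae_of_all _ h2)⟩
    · exact intervalIntegrable_const
  unfold controlledRate
  split_ifs
  · exact (intervalIntegrable_sum _ fun z _ => hjump z).neg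
  · exact hjump y

lemma tendsto_real_coord_ne {u : ℝ → State D (N + 1) → State D (N + 1) → ℝ}
    (hQ : IsCTMC u (Measure.dirac (maskState D N)) Q)
    (hu : ∀ x y, IntervalIntegrable (fun τ => u τ y x) volume 0 (1 / 2)) :
    Tendsto (fun t => Q.real {ω | coord t ω ≠ maskState D N}) (𝓝[>] 0) (𝓝 0) := by
  have := hQ.isProb
  exact (hQ.forwardOn_of_integrable le_rfl (by norm_num) hu).tendsto_real_coord_ne
    ⟨hu, intervalIntegrable_sum_abs hu, fun _ => le_rfl⟩ (by norm_num)
    (real_coord_zero_of_init hQ.init)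

/-- Neither chain leaves the fully masked state immediately, which gives the start condition
directly and no mixing is required. -/
lemma klDiv_condTerminal (h : MaskedReference γ R) (hs : IsDenoiser s)
    (hQ : IsCTMC (controlledRate Fin.castSucc (maskedRate γ) (maskedController s))
      (Measure.dirac (maskState D N)) Q) {y : State D (N + 1)} (hy : ∀ d, y d ≠ Fin.last N) :
    klDiv (condTerminal R y) Q = ∫⁻ τ in Ioo (0 : ℝ) 1, klRate (maskedRate γ)
      (controlledRate Fin.castSucc (maskedRate γ) (maskedController s))
      (fun _ x => kernel y x / R.real {ω | coord 1 ω = y}) R τ := by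
  have hRp := h.ctmc.isProb
  have hQp := hQ.isProb
  have hy1 := h.real_coord_one_ne_zero hy
  have := isProbabilityMeasure_condTerminal hy1
  have hG := h.isTerminalKernel.girsanovSetting h.ctmc h.isRate hQ
    (isRate_controlledRate h.isRate hs.maskedController_nonneg)
    (fun a b ha hab hb => h.intervalIntegrable ha.le hab hb) h.nonneg hy1
  have hle : ∀ t : ℝ, (condTerminal R y).real {ω | coord t ω ≠ maskState D N}
      ≤ R.real {ω | coord t ω ≠ maskState D N} / R.real {ω | coord 1 ω = y} := fun t =>
    condTerminal_real_le y _
  refine hG.klDiv_eq fun hI => startCondition_of_continuous (maskState D N) ?_ ?_ ?_ ?_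
  · refine le_antisymm ((hle 0).trans_eq ?_) measureReal_nonneg
    rw [h.real_coord_zero, zero_div]
  · exact real_coord_zero_of_init hQ.init
  · have h1 := (tendsto_real_coord_ne h.ctmc fun x z => by
      simp_rw [maskedRate_eq]
      exact (h.integrable (1 / 2) (by norm_num) (by norm_num)).mul_const _).div_const
        (R.real {ω | coord 1 ω = y})
    rw [zero_div] at h1
    exact squeeze_zero (fun _ => measureReal_nonneg) hle h1
  · exact tendsto_real_coord_ne hQ fun x z =>
      h.intervalIntegrable_controlledRate hs (by norm_num) (by norm_num) x z

/-- The weighted cross-entropy at time `t`, given the endpoint `y`. -/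
noncomputable def lossRate (γ : ℝ → ℝ) (s : Controller D N (N + 1)) (t : ℝ)
    (y : State D (N + 1)) : ℝ≥0∞ :=
  ENNReal.ofReal (γ t) * ∑ x, ENNReal.ofReal (maskProb (level γ t) x y) * maskedCE (s t x) x y

lemma measurable_maskProb {l : ℝ → ℝ} (hl : Measurable l) (x y : State D (N + 1)) :
    Measurable fun t => maskProb (l t) x y := by
  unfold maskProb
  refine Finset.measurable_prod _ fun d _ => ?_
  split_ifs
  · exact hl
  · exact hl.const_sub 1
  · exact measurable_const

lemma measurable_lossRate (hγ : Measurable γ) (hs : IsDenoiser s) (y : State D (N + 1)) :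
    Measurable fun t => lossRate γ s t y := by
  unfold lossRate
  exact hγ.ennreal_ofReal.mul (Finset.measurable_sum _ fun x _ =>
    (measurable_maskProb (measurable_level γ) x y).ennreal_ofReal.mul (hs.measurable_maskedCE x y))

lemma kernel_ne_zero_of_maskProb_ne_zero (hN : 0 < N) {l : ℝ} {x y : State D (N + 1)}
    (hy : ∀ d, y d ≠ Fin.last N) (h : maskProb l x y ≠ 0) : kernel y x ≠ 0 := by
  have hN : (N : ℝ) ≠ 0 := by exact_mod_cast hN.ne'
  unfold kernel productKernel
  refine Finset.prod_ne_zero_iff.2 fun d _ => ?_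
  have h1 := Finset.prod_ne_zero_iff.1 h d (Finset.mem_univ d)
  simp only [maskedKernel, if_neg (hy d), sub_zero]
  by_cases hx : x d = Fin.last N
  · simp [hx, hN]
  · rw [if_neg hx] at h1 ⊢
    have : x d = y d := by
      by_contra hne
      exact h1 (if_neg hne)
    simp [this]

/-- The weight γ/N and the factor N from the cross-entropy identity cancel. States that are not
maskings of y have probability zero, so their ill-defined ratios play no role. -/
lemma ofReal_div_mul_sum_eq_lossRate (hγ : ∀ t, 0 ≤ γ t) (hN : 0 < N) (hs : IsDenoiser s) (t : ℝ)
    {y : State D (N + 1)} (hy : ∀ d, y d ≠ Fin.last N) :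
    ENNReal.ofReal (γ t / N) * ∑ x, ENNReal.ofReal (maskProb (level γ t) x y) *
      ∑ d, ∑ n with Fin.castSucc n ≠ x d,
        genKL (kernel y (Function.update x d n.castSucc) / kernel y x) (maskedController s t x d n)
      = lossRate γ s t y := by
  unfold lossRate
  rw [Finset.mul_sum, Finset.mul_sum]
  refine Finset.sum_congr rfl fun x _ => ?_
  by_cases h0 : maskProb (level γ t) x y = 0
  · simp [h0]
  · rw [sum_genKL_eq_maskedCE hN hs t hy (kernel_ne_zero_of_maskProb_ne_zero hN hy h0)]
    have hN' : (N : ℝ) ≠ 0 := by exact_mod_cast hN.ne'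
    have h1 : ENNReal.ofReal (γ t / N) * N = ENNReal.ofReal (γ t) := by
      rw [← ENNReal.ofReal_natCast, ← ENNReal.ofReal_mul (div_nonneg (hγ t) (Nat.cast_nonneg N)),
        div_mul_cancel₀ _ hN']
    rw [← h1]; ring

lemma dmLoss_eq (h : MaskedReference γ R)
    (hb : IsSchrodingerBridge R (Measure.dirac (maskState D N)) ν Pstar)
    (hν : ∀ y, ν.real {y} ≠ 0 → ∀ d, y d ≠ Fin.last N)
    [IsProbabilityMeasure Pv] (hac : Pstar ≪ Pv) (hs : IsDenoiser s) :
    dmLoss Fin.castSucc R Pstar Pv (fun t => γ t / N) genKL (maskedController s)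
      = ∑ y, ENNReal.ofReal (ν.real {y}) * ∫⁻ t in Ioo (0 : ℝ) 1, lossRate γ s t y := by
  have := hb.isProb
  simp_rw [← hb.real_coord_one]
  refine dmLoss_eq_sum hac (measurable_lossRate h.measurable hs) ?_
  filter_upwards [ae_eq_zero_of_head_eq_zero h.nonneg h.integrable] with t h0 ht x₀ y hxy
  have hx₀ : x₀ = maskState D N := by
    by_contra hne
    exact hxy ((real_coord_zero_inter (real_coord_zero_of_init hb.init) x₀ _).trans (if_neg hne))
  have hy : ∀ d, y d ≠ Fin.last N := hν y fun h1 => hxy <| by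
    rw [← hb.real_coord_one] at h1
    exact measureReal_mono_null inter_subset_right h1
  -- For almost every t with γ_t > 0 the integral of γ over (0, t) is positive, so the conditional
  -- probabilities are given by the kernel. Times with γ_t = 0 contribute nothing on either side.
  by_cases hγt : γ t = 0
  · simp [hγt, lossRate]
  · subst hx₀
    have hγ' : ∫ τ in 0..t, γ τ ≠ 0 := fun h1 => hγt (h0 ht h1)
    simp_rw [h.bridgeProb_eq ht.1 ht.2 _ hy, h.condProb_eq ht.1 ht.2 hγ']
    exact ofReal_div_mul_sum_eq_lossRate h.nonneg h.pos hs t hy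

lemma maskedWDCE_eq (h : MaskedReference γ R)
    (hb : IsSchrodingerBridge R (Measure.dirac (maskState D N)) ν Pstar)
    (hν : ∀ y, ν.real {y} ≠ 0 → ∀ d, y d ≠ Fin.last N)
    [IsProbabilityMeasure Pv] (hac : Pstar ≪ Pv) (s : Controller D N (N + 1)) :
    maskedWDCE R Pstar Pv γ s
      = ∑ y, ENNReal.ofReal (ν.real {y}) * ∫⁻ t in Ioo (0 : ℝ) 1, lossRate γ s t y := by
  have := hb.isProb
  refine (lintegral_rnDeriv_mul_comp hac (measurable_coord 1) fun y =>
    ∫⁻ t in Ioo (0 : ℝ) 1, ENNReal.ofReal (γ t) *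
      ∑ x, ENNReal.ofReal (condProb R 1 t x y) * maskedCE (s t x) x y).trans ?_
  refine Finset.sum_congr rfl fun y _ => ?_
  rw [hb.real_coord_one]
  by_cases hy : ν.real {y} = 0
  · simp [hy]
  congr 1
  refine setLIntegral_congr_fun measurableSet_Ioo fun t ht => ?_
  simp only [condProb_one_eq, h.condTerminal_real_coord ht.1 ht.2 _ (hν y hy), lossRate]

lemma klDiv_add_entropy_eq (h : MaskedReference γ R)
    (hb : IsSchrodingerBridge R (Measure.dirac (maskState D N)) ν Pstar)
    (hν : ∀ y, ν.real {y} ≠ 0 → ∀ d, y d ≠ Fin.last N) (hs : IsDenoiser s)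
    (hQ : IsCTMC (controlledRate Fin.castSucc (maskedRate γ) (maskedController s))
      (Measure.dirac (maskState D N)) Q) :
    klDiv Pstar Q + entropy ν
      = ∑ y, ENNReal.ofReal (ν.real {y}) * ∫⁻ t in Ioo (0 : ℝ) 1, lossRate γ s t y := by
  have := hQ.isProb
  have := h.ctmc.isProb
  rw [hb.klDiv_add_entropy h.ctmc.init h.real_coord_zero_inter_one fun y h0 => by
    by_contra hne
    exact h.real_coord_one_ne_zero (hν y hne) h0]
  refine Finset.sum_congr rfl fun y _ => ?_
  by_cases hy0 : ν.real {y} = 0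
  · simp [hy0]
  have hy := hν y hy0
  rw [h.klDiv_condTerminal hs hQ hy]
  congr 1
  refine setLIntegral_congr_fun measurableSet_Ioo fun t ht => ?_
  rw [h.isTerminalKernel.klRate_controlledRate (Fin.castSucc_injective N) h.isRate ht y]
  · rw [← ofReal_div_mul_sum_eq_lossRate h.nonneg h.pos hs t hy, Finset.mul_sum]
    refine Finset.sum_congr rfl fun x _ => ?_
    rw [h.condTerminal_real_coord ht.1 ht.2 x hy, mul_left_comm]
    by_cases h0 : maskProb (level γ t) x y = 0
    · simp [h0]
    have hk := kernel_ne_zero_of_maskProb_ne_zero h.pos hy h0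
    congr 1
    rw [Finset.mul_sum]
    refine Finset.sum_congr rfl fun d _ => ?_
    rw [Finset.mul_sum]
    refine Finset.sum_congr rfl fun n hn => ?_
    have hn' := (Finset.mem_filter.1 hn).2
    rw [rate_update t hn']
    by_cases hx : x d = Fin.last N
    · rw [if_pos hx]
    · rw [kernel_update_unmask hk hx hn', maskedController_unmask hx hn']
      simp [genKL_zero_left]
  · intro x z hz hzn
    rw [maskedRate, if_neg hz, if_neg]
    rintro ⟨d, n, _, e⟩
    exact hzn d n e
  -- Here no exceptional times arise: if y cannot be reached from x, then after unmasking a site of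
  -- x it still cannot.
  · intro x d n hn hx
    rw [rate_update t hn]
    split_ifs with hxd
    · rw [kernel_update_mask h.pos hy hxd, hx, mul_zero, mul_zero]
    · rw [zero_mul]

end MaskedReference

end DiscreteSampler

/-! ### Change of time from the schedule to the masking probability. -/

namespace DiscreteSampler

open InformationTheory

variable {D K N : ℕ}

/-- Two measures with the same finite tails and no mass on the negative half-line are equal. -/
lemma measure_ext_of_Ici_pos {μ ν : Measure ℝ} (hμ : μ (Iic 0) = 0) (hν : ν (Iic 0) = 0)
    (h : ∀ c : ℝ, 0 < c → μ (Ici c) = ν (Ici c)) (hfin : ∀ c : ℝ, 0 < c → μ (Ici c) ≠ ⊤) :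
    μ = ν := by
  have hcover : Iic 0 ∪ ⋃ n : ℕ, Ici (1 / ((n : ℝ) + 1)) = univ := by
    refine eq_univ_of_forall fun x => ?_
    rcases le_or_gt x 0 with hx | hx
    · exact Or.inl hx
    · obtain ⟨n, hn⟩ := exists_nat_one_div_lt hx
      exact Or.inr (mem_iUnion.2 ⟨n, hn.le⟩)
  rw [← Measure.restrict_univ (μ := μ), ← Measure.restrict_univ (μ := ν), ← hcover,
    Measure.restrict_union_congr]
  refine ⟨by rw [Measure.restrict_eq_zero.2 hμ, Measure.restrict_eq_zero.2 hν],
    Measure.restrict_iUnion_congr.2 fun n => ?_⟩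
  have hpos : 0 < 1 / ((n : ℝ) + 1) := by positivity
  have : IsFiniteMeasure (μ.restrict (Ici (1 / ((n : ℝ) + 1)))) :=
    ⟨by rw [Measure.restrict_apply_univ]; exact (hfin _ hpos).lt_top⟩
  refine Measure.ext_of_Ici _ _ fun c => ?_
  rw [Measure.restrict_apply measurableSet_Ici, Measure.restrict_apply measurableSet_Ici,
    Ici_inter_Ici]
  exact h _ (hpos.trans_le le_sup_right)

lemma setLIntegral_one_div_Ici {c : ℝ} (hc : 0 < c) :
    ∫⁻ l in Ici c ∩ Ioo 0 1, ENNReal.ofReal (1 / l) = ENNReal.ofReal (-Real.log c) := by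
  rcases le_or_gt c 1 with h | h
  · have h1 : Ici c ∩ Ioo 0 1 = Ico c 1 := by
      ext l
      exact ⟨fun hl => ⟨hl.1, hl.2.2⟩, fun hl => ⟨hl.1, hc.trans_le hl.1, hl.2⟩⟩
    have h2 : IntervalIntegrable (fun l : ℝ => 1 / l) volume c 1 :=
      (intervalIntegral.intervalIntegrable_one_div
        (fun x hx => ((hc.trans_le (by simpa [h] using hx.1))).ne') continuousOn_id)
    rw [h1, setLIntegral_congr Ico_ae_eq_Ioc,
      ← ofReal_integral_eq_lintegral_ofReal
        ((intervalIntegrable_iff_integrableOn_Ioc_of_le h).1 h2)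
        ((ae_restrict_iff' measurableSet_Ioc).2 (ae_of_all _ fun l hl =>
          one_div_nonneg.2 (hc.trans hl.1).le)),
      ← intervalIntegral.integral_of_le h, integral_one_div_of_pos hc one_pos, one_div, Real.log_inv]
  · have h1 : Ici c ∩ Ioo 0 1 = ∅ :=
      eq_empty_of_forall_notMem fun l hl => (hl.2.2.trans h).not_ge hl.1
    rw [h1, ENNReal.ofReal_of_nonpos (neg_nonpos.2 (Real.log_nonneg h.le))]
    simp

namespace MaskedReference

variable {γ : ℝ → ℝ} {R Pstar Pv : Measure (PathSpace D (N + 1))} {ν : Measure (State D (N + 1))}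

/-- The times at which the integrated rate is at most `b` form an interval. -/
lemma exists_sublevel_eq (h : MaskedReference γ R) {b : ℝ} (hb : 0 ≤ b) :
    ∃ c : ℝ, 0 ≤ c ∧ c < 1 ∧ (∫ τ in 0..c, γ τ) = b ∧
      ∀ t : ℝ, 0 ≤ t → t < 1 → (∫ τ in 0..t, γ τ ≤ b ↔ t ≤ c) := by
  have htop := tendsto_integral_atTop_right h.nonneg h.integrable le_rfl one_pos
    (h.diverges 0 le_rfl one_pos)
  obtain ⟨t', h1, h2⟩ := ((htop.eventually_gt_atTop b).and
    (Ioo_mem_nhdsLT one_pos : ∀ᶠ t in 𝓝[<] (1 : ℝ), t ∈ Ioo 0 1)).exists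
  have hcont : ContinuousOn (fun t => ∫ τ in 0..t, γ τ) (Icc 0 t') := by
    have := intervalIntegral.continuousOn_primitive_interval
      ((intervalIntegrable_iff_integrableOn_Icc_of_le h2.1.le).1 (h.integrable t' h2.1.le h2.2)
        |>.mono_set (by rw [uIcc_of_le h2.1.le]))
    rwa [uIcc_of_le h2.1.le] at this
  have hmono : ∀ s t : ℝ, 0 ≤ s → s ≤ t → t < 1 → ∫ τ in 0..s, γ τ ≤ ∫ τ in 0..t, γ τ :=
    fun s t hs hst ht => intervalIntegral_mono_right h.nonneg hs hst
      (h.integrable t (hs.trans hst) ht)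
  obtain ⟨c, hc, hcb⟩ := intermediate_value_Icc h2.1.le hcont
    (show b ∈ Icc _ _ from ⟨by simpa using hb, h1.le⟩)
  have hcompact : IsCompact (Icc 0 t' ∩ (fun t => ∫ τ in 0..t, γ τ) ⁻¹' {b}) :=
    isCompact_Icc.of_isClosed_subset
      (hcont.preimage_isClosed_of_isClosed isClosed_Icc isClosed_singleton) inter_subset_left
  -- The primitive may be constant on intervals, so the largest solution has to be taken for the
  -- sublevel set to end exactly at c.
  obtain ⟨c, ⟨hc, hcb⟩, hmax⟩ := hcompact.exists_isGreatest ⟨c, hc, hcb⟩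
  have hcb : (∫ τ in 0..c, γ τ) = b := hcb
  refine ⟨c, hc.1, hc.2.trans_lt h2.2, hcb, fun t ht ht1 => ⟨fun htb => ?_, fun htc => ?_⟩⟩
  · by_contra! hct
    have htt : t ≤ t' := by
      by_contra! hlt
      exact (h1.trans_le (hmono t' t h2.1.le hlt.le ht1)).not_ge htb
    exact hct.not_ge (hmax ⟨⟨ht, htt⟩, le_antisymm htb
      (hcb.symm.trans_le (hmono c t hc.1 hct.le ht1))⟩)
  · exact (hmono t c ht htc (hc.2.trans_lt h2.2)).trans_eq hcb

/-- The masking probability is at least c exactly up to the last time a at which ∫_0^a γ = -log c.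
Comparing tails of the push-forward measure requires neither injectivity of the time change nor
regularity of γ. -/
lemma setLIntegral_level_Ici (h : MaskedReference γ R) {c : ℝ} (hc : 0 < c) :
    ∫⁻ t in level γ ⁻¹' Ici c ∩ Ioo 0 1, ENNReal.ofReal (γ t)
      = ENNReal.ofReal (-Real.log c) := by
  rcases le_or_gt c 1 with hc1 | hc1
  · obtain ⟨a, ha, ha1, hab, hle⟩ :=
      h.exists_sublevel_eq (neg_nonneg.2 (Real.log_nonpos hc.le hc1))
    have h1 : level γ ⁻¹' Ici c ∩ Ioo 0 1 = Ioc 0 a := by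
      ext t
      have key : 0 ≤ t → t < 1 → (c ≤ level γ t ↔ t ≤ a) := fun ht ht1 => by
        rw [h.level_eq ht, ← Real.log_le_iff_le_exp hc, le_neg, hle t ht ht1]
      exact ⟨fun ht => ⟨ht.2.1, (key ht.2.1.le ht.2.2).1 ht.1⟩, fun ht =>
        ⟨(key ht.1.le (ht.2.trans_lt ha1)).2 ht.2, ht.1, ht.2.trans_lt ha1⟩⟩
    rw [h1, ← ofReal_integral_eq_lintegral_ofReal
        ((intervalIntegrable_iff_integrableOn_Ioc_of_le ha).1 (h.integrable a ha ha1))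
        (ae_of_all _ h.nonneg), ← intervalIntegral.integral_of_le ha, hab]
  · have h1 : level γ ⁻¹' Ici c ∩ Ioo 0 1 = ∅ :=
      eq_empty_of_forall_notMem fun t ht => ((level_mem γ t).2.trans_lt hc1).not_ge ht.1
    rw [h1, ENNReal.ofReal_of_nonpos (neg_nonpos.2 (Real.log_nonneg hc1.le))]
    simp

/-- Under the time change `t ↦ level γ t` the measure `γ_t dt` becomes `dl / l`. -/
lemma map_level (h : MaskedReference γ R) :
    ((volume.restrict (Ioo (0 : ℝ) 1)).withDensity fun t => ENNReal.ofReal (γ t)).map (level γ)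
      = (volume.restrict (Ioo (0 : ℝ) 1)).withDensity fun l => ENNReal.ofReal (1 / l) := by
  have hl : ∀ c : ℝ, 0 < c → ((volume.restrict (Ioo (0 : ℝ) 1)).withDensity
      fun t => ENNReal.ofReal (γ t)).map (level γ) (Ici c) = ENNReal.ofReal (-Real.log c) := by
    intro c hc
    rw [Measure.map_apply (measurable_level γ) measurableSet_Ici,
      withDensity_apply _ (measurable_level γ measurableSet_Ici),
      Measure.restrict_restrict (measurable_level γ measurableSet_Ici), h.setLIntegral_level_Ici hc]
  have hr : ∀ c : ℝ, 0 < c → ((volume.restrict (Ioo (0 : ℝ) 1)).withDensity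
      fun l => ENNReal.ofReal (1 / l)) (Ici c) = ENNReal.ofReal (-Real.log c) := by
    intro c hc
    rw [withDensity_apply _ measurableSet_Ici, Measure.restrict_restrict measurableSet_Ici,
      setLIntegral_one_div_Ici hc]
  refine measure_ext_of_Ici_pos ?_ ?_ (fun c hc => (hl c hc).trans (hr c hc).symm)
    fun c hc => by rw [hl c hc]; exact ENNReal.ofReal_ne_top
  · have h1 : level γ ⁻¹' Iic 0 = ∅ :=
      eq_empty_of_forall_notMem fun t ht => (level_mem γ t).1.not_ge ht
    rw [Measure.map_apply (measurable_level γ) measurableSet_Iic, h1, measure_empty]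
  · have h1 : Iic (0 : ℝ) ∩ Ioo 0 1 = ∅ :=
      eq_empty_of_forall_notMem fun l hl => hl.2.1.not_ge hl.1
    rw [withDensity_apply _ measurableSet_Iic, Measure.restrict_restrict measurableSet_Iic, h1]
    simp

lemma lintegral_level (h : MaskedReference γ R) {g : ℝ → ℝ≥0∞} (hg : Measurable g) :
    ∫⁻ t in Ioo (0 : ℝ) 1, ENNReal.ofReal (γ t) * g (level γ t)
      = ∫⁻ l in Ioo (0 : ℝ) 1, ENNReal.ofReal (1 / l) * g l := by
  have h1 := lintegral_map (μ := (volume.restrict (Ioo (0 : ℝ) 1)).withDensity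
    fun t => ENNReal.ofReal (γ t)) hg (measurable_level γ)
  have hm : Measurable fun l : ℝ => ENNReal.ofReal (1 / l) :=
    (measurable_id.const_div 1).ennreal_ofReal
  rw [h.map_level, lintegral_withDensity_eq_lintegral_mul _ hm hg,
    ← Function.comp_def g, lintegral_withDensity_eq_lintegral_mul _ h.measurable.ennreal_ofReal
      (hg.comp (measurable_level γ))] at h1
  exact h1.symm

/-- Without explicit time dependence in the denoiser, the integrand sees t only through the masking
probability, so the push-forward identity applies. -/
lemma mdnsWDCE_eq (h : MaskedReference γ R)
    (hb : IsSchrodingerBridge R (Measure.dirac (maskState D N)) ν Pstar)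
    [IsProbabilityMeasure Pv] (hac : Pstar ≪ Pv) (s : State D (N + 1) → Fin D → Fin N → ℝ) :
    mdnsWDCE Pstar Pv s = ∑ y, ENNReal.ofReal (ν.real {y}) *
      ∫⁻ t in Ioo (0 : ℝ) 1, lossRate γ (fun _ => s) t y := by
  have := hb.isProb
  refine (lintegral_rnDeriv_mul_comp hac (measurable_coord 1) fun y =>
    ∫⁻ l in Ioo (0 : ℝ) 1, ENNReal.ofReal (1 / l) *
      ∑ x, ENNReal.ofReal (maskProb l x y) * maskedCE (s x) x y).trans ?_
  refine Finset.sum_congr rfl fun y _ => ?_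
  rw [hb.real_coord_one, ← h.lintegral_level (g := fun l => ∑ x, ENNReal.ofReal (maskProb l x y) *
    maskedCE (s x) x y) (Finset.measurable_sum _ fun x _ =>
      (measurable_maskProb measurable_id x y).ennreal_ofReal.mul_const _)]
  rfl

end MaskedReference

end DiscreteSampler

/-! ### Assembly of the two statements. -/

open DiscreteSampler InformationTheory in
theorem mainTheorem4 (D N : ℕ) (hN : 0 < N) :
    -- uniform reference
    (∀ (γ : ℝ → ℝ), Measurable γ → (∀ t, 0 ≤ γ t) →
      (∀ t : ℝ, 0 < t → t ≤ 1 → IntervalIntegrable γ volume t 1) →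
      ∫⁻ t in Ioo (0 : ℝ) 1, ENNReal.ofReal (γ t) = ⊤ →
      ∀ (μ ν : Measure (State D N)), IsProbabilityMeasure μ → IsProbabilityMeasure ν →
      ∀ (Pr Pstar : Measure (PathSpace D N)),
        IsCTMC (uniformRate γ) μ Pr → IsSchrodingerBridge Pr μ ν Pstar →
      ∃ C : ℝ≥0, ∀ (Ψ Φ : Controller D N N) (Pv Pu : Measure (PathSpace D N)),
        (∀ x d n, Measurable fun t => Ψ t x d n) → (∀ t x d n, 0 ≤ Ψ t x d n) →
        (∀ x d n, Measurable fun t => Φ t x d n) → (∀ t x d n, 0 ≤ Φ t x d n) →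
        IsCTMC (controlledRate id (uniformRate γ) Ψ) μ Pv → Pstar ≪ Pv →
        IsCTMC (controlledRate id (uniformRate γ) Φ) μ Pu →
        dmLoss id Pr Pstar Pv (fun t => γ t / N) genKL Φ = udnsWDCE Pstar Pv γ Φ ∧
        udnsWDCE Pstar Pv γ Φ = klDiv Pstar Pu + C) ∧
    -- masked reference
    (∀ (γ : ℝ → ℝ), Measurable γ → (∀ t, 0 ≤ γ t) →
      (∀ t : ℝ, 0 ≤ t → t < 1 → IntervalIntegrable γ volume 0 t) →
      (∀ t : ℝ, 0 ≤ t → t < 1 → ∫⁻ τ in Ioo t 1, ENNReal.ofReal (γ τ) = ⊤) →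
      ∀ (ν : Measure (State D N)), IsProbabilityMeasure ν →
      ∀ (Pr Pstar : Measure (PathSpace D (N + 1))),
        IsCTMC (maskedRate γ) (Measure.dirac fun _ => Fin.last N) Pr →
        IsSchrodingerBridge Pr (Measure.dirac fun _ => Fin.last N)
          (ν.map fun z d => (z d).castSucc) Pstar →
      ∃ C : ℝ≥0, ∀ (s' s : Controller D N (N + 1)) (Pv Pu : Measure (PathSpace D (N + 1))),
        IsDenoiser s' → IsDenoiser s →
        IsCTMC (controlledRate Fin.castSucc (maskedRate γ) (maskedController s'))
          (Measure.dirac fun _ => Fin.last N) Pv → Pstar ≪ Pv →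
        IsCTMC (controlledRate Fin.castSucc (maskedRate γ) (maskedController s))
          (Measure.dirac fun _ => Fin.last N) Pu →
        dmLoss Fin.castSucc Pr Pstar Pv (fun t => γ t / N) genKL (maskedController s)
            = maskedWDCE Pr Pstar Pv γ s ∧
        maskedWDCE Pr Pstar Pv γ s = klDiv Pstar Pu + C ∧
        ∀ s₀ : State D (N + 1) → Fin D → Fin N → ℝ, s = (fun _ => s₀) →
          maskedWDCE Pr Pstar Pv γ s = mdnsWDCE Pstar Pv s₀) := by
  refine ⟨?_, ?_⟩
  · intro γ hγm hγ0 hγi hγd μ ν _ _ Pr Pstar hPr hb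
    have h : UniformReference γ μ Pr := ⟨hN, hγm, hγ0, hγi, hγd, hPr⟩
    -- The constant is the entropy of the target, which depends on neither controller.
    refine ⟨entropy ν, fun Ψ Φ Pv Pu _ _ hΦm hΦ0 hPv hac hPu => ?_⟩
    have := hPv.isProb
    exact ⟨(h.dmLoss_eq hb hac hΦm).trans (h.udnsWDCE_eq hb hac Φ).symm,
      (h.udnsWDCE_eq hb hac Φ).trans (h.klDiv_add_entropy_eq hb hΦ0 hPu).symm⟩
  · intro γ hγm hγ0 hγi hγd ν _ Pr Pstar hPr hb
    have h : MaskedReference γ Pr := ⟨hN, hγm, hγ0, hγi, hγd, hPr⟩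
    -- The target lives on sequences without masks, the only endpoints for which the conditioned
    -- reference is described.
    have hν : ∀ y, (ν.map fun z d => (z d).castSucc).real {y} ≠ 0 → ∀ d, y d ≠ Fin.last N := by
      intro y hy d hd
      refine hy ?_
      have h1 : (fun (z : State D N) d => (z d).castSucc) ⁻¹' {y} = ∅ := by
        refine eq_empty_of_forall_notMem fun z hz => (z d).castSucc_ne_last ?_
        rw [← hd, ← mem_singleton_iff.1 hz]
      rw [map_measureReal_apply (measurable_of_finite _) (measurableSet_singleton y), h1,
        measureReal_empty]
    refine ⟨entropy (ν.map fun z d => (z d).castSucc),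
      fun s' s Pv Pu _ hs hPv hac hPu => ?_⟩
    have := hPv.isProb
    have hW := h.maskedWDCE_eq hb hν hac s
    refine ⟨(h.dmLoss_eq hb hν hac hs).trans hW.symm,
      hW.trans (h.klDiv_add_entropy_eq hb hν hs hPu).symm, ?_⟩
    rintro s₀ rfl
    exact hW.trans (h.mdnsWDCE_eq hb hac s₀).symm
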